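/- Let $n,m\ge 0$ be integers, let $M$ be a compact $n$-dimensional complex manifold with a Kähler form $\omega_M$, and let $L\to M$ be a negative holomorphic line bundle with $[\omega_M]=c_1(L^{-1})$ in $H^2(M,\mathbb R)$. Put $d=\int_M\omega_M^n$. Let $\pi:X=\mathbb P(\mathcal O\oplus L^{\oplus(m+1)})\to M$ be the bundle of lines in $\mathcal O\oplus L^{\oplus(m+1)}$, with divisor at infinity $D_\infty=\mathbb P(L^{\oplus(m+1)})$ and zero section $P_0=\mathbb P(\mathcal O)$, and let $\tilde\pi:\tilde X\to X$ be the blow-up of $X$ along $P_0$, with exceptional divisor $E=\tilde\pi^{-1}(P_0)$ (so that $\tilde X=X$ and $E=P_0$ if $m=0$). For $a,b>0$ put $$\alpha=\pi^*[\omega_M]+a[D_\infty],\qquad \beta=\pi^*[\omega_M]+b[D_\infty],\qquad \tilde\alpha_s=\tilde\pi^*\alpha-s[E]\quad(s\in\mathbb R),$$ $$I_{m,n,s}(x)=\int_s^x(1+t)^nt^m\,dt,\qquad \mu_s=\frac{(1+a)^na^mb+n\,I_{m,n-1,s}(a)}{I_{m,n,s}(a)}\quad(s\in[0,a)),$$ where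 the term $n\,I_{m,n-1,s}(a)$ is $0$ if $n=0$. Let $\mu=\mu_0$, and let $$\zeta_{\rm inv}=\inf\Big\{(m+n+1)\frac{\tilde\alpha_s^{m+n}\cdot\tilde\pi^*\beta}{\tilde\alpha_s^{m+n+1}}\ :\ s\in\mathbb R,\ \tilde\alpha_s\text{ is ample, i.e. contains a Kähler form}\Big\}.$$ Let $\lambda$ be the infimum of the $s\in[0,a)$ for which the problem $\psi'(x)+\psi(x)\big(\tfrac{n}{1+x}+\tfrac mx\big)=\mu_s-\tfrac{n}{1+x}$ on $(s,a)$, $\psi(s)=0$, $\psi(a)=b$, has a solution $\psi$, continuous on $[s,a]$, with $\psi>0$ on $(s,a]$. Then for every $s\in[0,a)$ $$\tilde\alpha_s^{m+n+1}=d\,(m+n+1)\binom{m+n}{n}I_{m,n,s}(a)>0,\qquad \tilde\alpha_s^{m+n}\cdot\tilde\pi^*\beta=d\binom{m+n}{n}\Big((1+a)^na^mb+n\,I_{m,n-1,s}(a)\Big),$$ and hence $$\mu_s=(m+n+1)\frac{\tilde\alpha_s^{m+n}\cdot\tilde\pi^*\beta}{\tilde\alpha_s^{m+n+1}}.$$ In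 particular: (1) $\alpha^{m+n+1}>0$ and $\mu=\mu_0=\mu(X,\alpha,\beta):=(m+n+1)\dfrac{\alpha^{m+n}\cdot\beta}{\alpha^{m+n+1}}$; (2) if $\mu\le n$, then the set of slopes defining $\zeta_{\rm inv}$ is non-empty and bounded below, $\lambda\in[0,a)$, and $\lambda$ is the unique $s\in[0,a)$ with $$\zeta_{\rm inv}=(m+n+1)\frac{\tilde\alpha_s^{m+n}\cdot\tilde\pi^*\beta}{\tilde\alpha_s^{m+n+1}};$$ moreover $\lambda=0$ if $\mu=n$. -/

import Mathlib

set_option maxSynthPendingDepth 3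
set_option linter.unusedSectionVars false
set_option linter.unusedVariables false

open Set Bundle Topology MeasureTheory
open scoped Manifold ContDiff LinearAlgebra.Projectivization

namespace KahlerProj

noncomputable section

/-! ### Differential forms, de Rham classes and intersection numbers on complex manifolds

A complex manifold is a space charted on `ι → ℂ` with `ι` a finite type, so that its complex
dimension is the cardinality of `ι`; its real tangent spaces are copies of `ι → ℂ`. -/

section Forms

variable (ι : Type*) [Fintype ι]
variable (Y : Type*) [TopologicalSpace Y] [ChartedSpace (ι → ℂ) Y]

/-- Real differential `k`-forms on `Y` (no regularity imposed): a real alternating form on each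
real tangent space `TangentSpace 𝓘(ℝ, ι → ℂ) y`, which is by definition `ι → ℂ` (tangent vectors
at `y` are written in the preferred chart `chartAt (ι → ℂ) y`). -/
abbrev RealForm (k : ℕ) : Type _ :=
  Y → (ι → ℂ) [⋀^Fin k]→L[ℝ] ℝ

variable {ι Y}

/-- The expression of a form in a chart `c`: the pullback of the form under `c⁻¹`. -/
def inChart {k : ℕ} (θ : RealForm ι Y k) (c : OpenPartialHomeomorph Y (ι → ℂ)) :
    (ι → ℂ) → (ι → ℂ) [⋀^Fin k]→L[ℝ] ℝ :=
  fun u => (θ (c.symm u)).compContinuousLinearMap (mfderiv 𝓘(ℝ, ι → ℂ) 𝓘(ℝ, ι → ℂ) c.symm u)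

/-- Smooth forms. -/
def IsSmoothForm {k : ℕ} (θ : RealForm ι Y k) : Prop :=
  ∀ c ∈ atlas (ι → ℂ) Y, ContDiffOn ℝ ∞ (inChart θ c) c.target

lemma inChart_add {k : ℕ} (θ θ' : RealForm ι Y k) (c : OpenPartialHomeomorph Y (ι → ℂ)) :
    inChart (θ + θ') c = inChart θ c + inChart θ' c := by
  ext u v; rfl

lemma inChart_smul {k : ℕ} (r : ℝ) (θ : RealForm ι Y k) (c : OpenPartialHomeomorph Y (ι → ℂ)) :
    inChart (r • θ) c = r • inChart θ c := by
  ext u v; rfl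

lemma inChart_zero {k : ℕ} (c : OpenPartialHomeomorph Y (ι → ℂ)) :
    inChart (0 : RealForm ι Y k) c = 0 := by
  ext u v; rfl

lemma IsSmoothForm.differentiableAt {k : ℕ} {θ : RealForm ι Y k} (h : IsSmoothForm θ)
    {c : OpenPartialHomeomorph Y (ι → ℂ)} (hc : c ∈ atlas (ι → ℂ) Y) {u : ι → ℂ}
    (hu : u ∈ c.target) : DifferentiableAt ℝ (inChart θ c) u :=
  ((h c hc).contDiffAt (c.open_target.mem_nhds hu)).differentiableAt (by simp)

lemma IsSmoothForm.zero {k : ℕ} : IsSmoothForm (0 : RealForm ι Y k) := by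
  intro c _; rw [inChart_zero]; exact contDiffOn_const

lemma IsSmoothForm.add {k : ℕ} {θ θ' : RealForm ι Y k} (h : IsSmoothForm θ)
    (h' : IsSmoothForm θ') : IsSmoothForm (θ + θ') := by
  intro c hc; rw [inChart_add]; exact (h c hc).add (h' c hc)

lemma IsSmoothForm.smul {k : ℕ} (r : ℝ) {θ : RealForm ι Y k} (h : IsSmoothForm θ) :
    IsSmoothForm (r • θ) := by
  intro c hc; rw [inChart_smul]; exact contDiffOn_const.smul (h c hc)

lemma extDeriv_zero_form {k : ℕ} (u : ι → ℂ) :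
    extDeriv (0 : (ι → ℂ) → (ι → ℂ) [⋀^Fin k]→L[ℝ] ℝ) u = 0 := by
  have := extDeriv_smul (x := u) (0 : ℝ) (0 : (ι → ℂ) → (ι → ℂ) [⋀^Fin k]→L[ℝ] ℝ)
  simpa using this

variable (ι Y) in
/-- Closed smooth real 2-forms. -/
def closedForms : Submodule ℝ (RealForm ι Y 2) where
  carrier := {θ | IsSmoothForm θ ∧
    ∀ c ∈ atlas (ι → ℂ) Y, ∀ u ∈ c.target, extDeriv (inChart θ c) u = 0}
  zero_mem' := ⟨.zero, fun c _ u _ => by rw [inChart_zero, extDeriv_zero_form]⟩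
  add_mem' := by
    rintro θ θ' ⟨h, hd⟩ ⟨h', hd'⟩
    refine ⟨h.add h', fun c hc u hu => ?_⟩
    rw [inChart_add, extDeriv_add (h.differentiableAt hc hu) (h'.differentiableAt hc hu),
      hd c hc u hu, hd' c hc u hu, add_zero]
  smul_mem' := by
    rintro r θ ⟨h, hd⟩
    refine ⟨h.smul r, fun c hc u hu => ?_⟩
    rw [inChart_smul, extDeriv_smul, hd c hc u hu, smul_zero]

variable (ι Y) in
/-- Exact 2-forms: those of the form `dη` with `η` a smooth real 1-form on `Y`. -/
def exactForms : Submodule ℝ (RealForm ι Y 2) where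
  carrier := {θ | ∃ η : RealForm ι Y 1, IsSmoothForm η ∧
    ∀ c ∈ atlas (ι → ℂ) Y, ∀ u ∈ c.target, inChart θ c u = extDeriv (inChart η c) u}
  zero_mem' := ⟨0, .zero, fun c _ u _ => by
    rw [inChart_zero, inChart_zero, extDeriv_zero_form]; rfl⟩
  add_mem' := by
    rintro θ θ' ⟨η, h, hd⟩ ⟨η', h', hd'⟩
    refine ⟨η + η', h.add h', fun c hc u hu => ?_⟩
    rw [inChart_add, inChart_add,
      extDeriv_add (h.differentiableAt hc hu) (h'.differentiableAt hc hu),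
      ← hd c hc u hu, ← hd' c hc u hu]; rfl
  smul_mem' := by
    rintro r θ ⟨η, h, hd⟩
    refine ⟨r • η, h.smul r, fun c hc u hu => ?_⟩
    rw [inChart_smul, inChart_smul, extDeriv_smul, ← hd c hc u hu]; rfl

variable (ι Y) in
/-- The de Rham cohomology `H²(Y, ℝ)`: closed smooth 2-forms modulo exact ones. -/
abbrev DeRham2 : Type _ :=
  (closedForms ι Y) ⧸ (exactForms ι Y).submoduleOf (closedForms ι Y)

open Classical in
/-- The de Rham class `[θ]` of a closed 2-form. -/
def deRhamClass (θ : RealForm ι Y 2) : DeRham2 ι Y :=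
  if h : θ ∈ closedForms ι Y then Submodule.Quotient.mk ⟨θ, h⟩ else 0

/-- A closed 2-form representing a given de Rham class. -/
def representative (c : DeRham2 ι Y) : RealForm ι Y 2 :=
  (Quotient.out c : closedForms ι Y).1

/-- Kähler forms: closed smooth real 2-forms which are invariant under the complex structure
and positive. -/
def IsKahlerForm (θ : RealForm ι Y 2) : Prop :=
  θ ∈ closedForms ι Y ∧
  (∀ (y : Y) (v w : ι → ℂ), θ y ![Complex.I • v, Complex.I • w] = θ y ![v, w]) ∧
  ∀ (y : Y) (v : ι → ℂ), v ≠ 0 → 0 < θ y ![v, Complex.I • v]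

/-- A real class is Kähler (the analytic notion of ampleness for real classes) when it contains a
Kähler form. -/
def IsKahlerClass (c : DeRham2 ι Y) : Prop :=
  ∃ θ : RealForm ι Y 2, IsKahlerForm θ ∧ deRhamClass θ = c

/-- `(√-1 / 2π) ∂∂̄ φ = d (-(1/4π) dφ ∘ J)` for a real function `φ` on (an open subset of) `ℂ^ι`,
where `J` is multiplication by `√-1`. -/
def ddc (φ : (ι → ℂ) → ℝ) : (ι → ℂ) → (ι → ℂ) [⋀^Fin 2]→L[ℝ] ℝ :=
  extDeriv fun u => ContinuousAlternatingMap.ofSubsingleton ℝ (ι → ℂ) ℝ (0 : Fin 1)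
    (-(1 / (4 * Real.pi)) •
      (fderiv ℝ φ u).comp (Complex.I • ContinuousLinearMap.id ℝ (ι → ℂ)))

/-- `θ = (√-1 / 2π) ∂∂̄ φ` on the open set `U ⊆ Y`. -/
def EqDdcOn (U : Set Y) (θ : RealForm ι Y 2) (φ : Y → ℝ) : Prop :=
  ∀ c ∈ atlas (ι → ℂ) Y, ∀ u ∈ c.target, c.symm u ∈ U → inChart θ c u = ddc (φ ∘ c.symm) u

/-- In the complex coordinates `z_j = x_j + √-1 y_j`, the coefficient of `⋀_j (dx_j ∧ dy_j)` in
the top degree form `⋀_j θ_j`, where `θ_j`, `j : ι`, are constant 2-forms on `ℂ^ι`: the value of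
the wedge product on the oriented real basis `e_j, √-1 e_j`. -/
def wedgeDensity [DecidableEq ι] (θ : ι → (ι → ℂ) [⋀^Fin 2]→L[ℝ] ℝ) : ℝ :=
  let e : ι × Fin 2 → (ι → ℂ) := fun p => Pi.single p.1 (if p.2 = 0 then 1 else Complex.I)
  (2 ^ Fintype.card ι : ℝ)⁻¹ * ∑ σ : Equiv.Perm (ι × Fin 2),
    ((Equiv.Perm.sign σ : ℤ) : ℝ) * ∏ j : ι, θ j ![e (σ (j, 0)), e (σ (j, 1))]

open Classical in
/-- `∫_Y ⋀_j θ_j` for smooth 2-forms `θ_j`, `j : ι`, on a compact complex manifold `Y` of dimension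
`card ι` with its complex orientation, computed with a smooth partition of unity
subordinate to the charts. -/
def integralWedge [DecidableEq ι] (θ : ι → RealForm ι Y 2) : ℝ :=
  if h : ∃ ρ : SmoothPartitionOfUnity Y 𝓘(ℝ, ι → ℂ) Y univ,
      ρ.IsSubordinate fun y => (chartAt (ι → ℂ) y).source then
    ∑ᶠ y : Y, ∫ u in (chartAt (ι → ℂ) y).target,
      h.choose y ((chartAt (ι → ℂ) y).symm u) *
        wedgeDensity fun j => inChart (θ j) (chartAt (ι → ℂ) y) u
  else 0

/-- The intersection number of `card ι = dim Y` classes. -/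
def intersectionNumber [DecidableEq ι] (c : ι → DeRham2 ι Y) : ℝ :=
  integralWedge fun j => representative (c j)

/-- The top self-intersection number `c^{dim Y}`. -/
def topSelfIntersection [DecidableEq ι] (c : DeRham2 ι Y) : ℝ :=
  intersectionNumber fun _ => c

/-- The intersection number `c^{dim Y - 1} · c'`; the factor `c'` is put at the index `i`. -/
def topIntersection [DecidableEq ι] (i : ι) (c c' : DeRham2 ι Y) : ℝ :=
  intersectionNumber (Function.update (fun _ => c) i c')

/-- `f` is a holomorphic local defining equation on the open set `U` for the smooth hypersurface
`D`, vanishing to first order along `D`. -/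
def IsLocalEquation (D U : Set Y) (f : Y → ℂ) : Prop :=
  ContMDiffOn 𝓘(ℂ, ι → ℂ) 𝓘(ℂ, ℂ) ω f U ∧ (∀ y ∈ U, f y = 0 ↔ y ∈ D) ∧
    ∀ y ∈ U ∩ D, mfderiv 𝓘(ℂ, ι → ℂ) 𝓘(ℂ, ℂ) f y ≠ 0

/-- `θ` is the first Chern form `-(√-1 / 2π) ∂∂̄ log ‖s_D‖²` of some smooth Hermitian metric on the
line bundle `𝒪(D)` of a smooth hypersurface `D`; here `σ = ‖s_D‖²` is the squared norm of the
canonical section, so that locally `σ = |f|² e^{-φ}` with `f` an equation of `D` and `φ` smooth. -/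
def IsDivisorChernForm (D : Set Y) (θ : RealForm ι Y 2) : Prop :=
  ∃ σ : Y → ℝ, ∀ p : Y, ∃ (U : Set Y) (f : Y → ℂ) (φ : Y → ℝ), IsOpen U ∧ p ∈ U ∧
    IsLocalEquation (ι := ι) D U f ∧ ContMDiffOn 𝓘(ℝ, ι → ℂ) 𝓘(ℝ, ℝ) ∞ φ U ∧
    (∀ y ∈ U, σ y = ‖f y‖ ^ 2 * Real.exp (-φ y)) ∧ EqDdcOn U θ φ

/-- The class `[D] = c₁(𝒪(D))` of a smooth hypersurface `D`. -/
def divisorClass (D : Set Y) : DeRham2 ι Y :=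
  Classical.epsilon fun c => ∃ θ, IsDivisorChernForm D θ ∧ θ ∈ closedForms ι Y ∧ deRhamClass θ = c

/-- The pullback of a form under a map. -/
def pullbackForm {κ : Type*} [Fintype κ]
    {Z : Type*} [TopologicalSpace Z] [ChartedSpace (κ → ℂ) Z]
    {k : ℕ} (f : Z → Y) (θ : RealForm ι Y k) : RealForm κ Z k :=
  fun z => (θ (f z)).compContinuousLinearMap (mfderiv 𝓘(ℝ, κ → ℂ) 𝓘(ℝ, ι → ℂ) f z)

/-- The pullback `f^*c` of a de Rham class under a smooth map. -/
def pullbackClass {κ : Type*} [Fintype κ]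
    {Z : Type*} [TopologicalSpace Z] [ChartedSpace (κ → ℂ) Z]
    (f : Z → Y) (c : DeRham2 ι Y) : DeRham2 κ Z :=
  deRhamClass (pullbackForm f (representative c))

end Forms

/-! ### Hermitian metrics and Chern classes of line bundles -/

section LineBundle

variable {ι : Type*} [Fintype ι] {M : Type*} [TopologicalSpace M] [ChartedSpace (ι → ℂ) M]
variable (L : M → Type*) [∀ x, AddCommGroup (L x)] [∀ x, Module ℂ (L x)]
  [∀ x, TopologicalSpace (L x)] [TopologicalSpace (TotalSpace ℂ L)] [FiberBundle ℂ L]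

/-- A smooth Hermitian metric on the complex line bundle `L`, given by its squared norm
`v ↦ h(v, v)`. For a trivialization `e` of `L`, `x ↦ e.symm x 1` is a holomorphic frame. -/
structure HermitianMetric where
  normSq : ∀ x, L x → ℝ
  normSq_pos : ∀ x (v : L x), v ≠ 0 → 0 < normSq x v
  normSq_smul : ∀ x (c : ℂ) (v : L x), normSq x (c • v) = ‖c‖ ^ 2 * normSq x v
  smooth : ∀ (e : Trivialization ℂ (π ℂ L)) [MemTrivializationAtlas e],
    ContMDiffOn 𝓘(ℝ, ι → ℂ) 𝓘(ℝ, ℝ) ∞ (fun x => normSq x (e.symm x 1)) e.baseSet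

variable {L}

/-- `θ` is the Chern form of `(L, h)`: `θ = -(√-1 / 2π) ∂∂̄ log h(s, s)` for each local holomorphic
frame `s` given by a trivialization of `L`. -/
def IsChernForm (h : HermitianMetric (ι := ι) L) (θ : RealForm ι M 2) : Prop :=
  ∀ (e : Trivialization ℂ (π ℂ L)) [MemTrivializationAtlas e],
    EqDdcOn e.baseSet θ fun x => -Real.log (h.normSq x (e.symm x 1))

variable (ι L)

/-- The first Chern class `c₁(L) ∈ H²(M, ℝ)`. -/
def chernClass : DeRham2 ι M :=
  Classical.epsilon fun c => ∃ (h : HermitianMetric (ι := ι) L) (θ : RealForm ι M 2),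
    IsChernForm h θ ∧ θ ∈ closedForms ι M ∧ deRhamClass θ = c

/-- `L` is negative: it has a Hermitian metric with negative definite Chern form. -/
def IsNegativeLineBundle : Prop :=
  ∃ (h : HermitianMetric (ι := ι) L) (θ : RealForm ι M 2), IsChernForm h θ ∧ IsKahlerForm (-θ)

end LineBundle

/-! ### Affine coordinates of a projective space -/

section Affine

variable {m : ℕ}

/-- The affine coordinates, on the locus `W i ≠ 0`, of the point with homogeneous coordinates
`W none, W (some 0), …, W (some m)`: for `i = none` they are `W (some k) / W none`, and for
`i = some j` they are `W (some k) / W (some j)` with the coordinate `W none / W (some j)` in place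
of the trivial one with `k = j`. -/
def affine (i : Option (Fin (m + 1))) (W : Option (Fin (m + 1)) → ℂ) : Fin (m + 1) → ℂ :=
  fun k => W (Equiv.swap none i (some k)) / W i

/-- The homogeneous coordinates, normalized by `W i = 1`, with affine coordinates `w`. -/
def homogenize (i : Option (Fin (m + 1))) (w : Fin (m + 1) → ℂ) : Option (Fin (m + 1)) → ℂ :=
  fun o => (Equiv.swap none i o).elim 1 w

@[simp] lemma homogenize_self (i : Option (Fin (m + 1))) (w : Fin (m + 1) → ℂ) :
    homogenize i w i = 1 := by
  simp [homogenize]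

lemma affine_homogenize (i : Option (Fin (m + 1))) (w : Fin (m + 1) → ℂ) :
    affine i (homogenize i w) = w := by
  ext k; simp [affine, homogenize]

lemma affine_smul (i : Option (Fin (m + 1))) {r : ℂ} (hr : r ≠ 0)
    (W : Option (Fin (m + 1)) → ℂ) : affine i (r • W) = affine i W := by
  ext k; simp [affine, mul_div_mul_left _ _ hr]

lemma homogenize_affine (i : Option (Fin (m + 1))) {W : Option (Fin (m + 1)) → ℂ}
    (hW : W i ≠ 0) : homogenize i (affine i W) = (W i)⁻¹ • W := by
  ext o
  simp only [homogenize, Pi.smul_apply, smul_eq_mul]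
  rcases h : Equiv.swap none i o with _ | k
  · have : o = i := by
      have := congrArg (Equiv.swap none i) h
      simpa using this
    subst this; simp [hW]
  · have : o = Equiv.swap none i (some k) := by rw [← h]; simp
    simp [this, affine, div_eq_inv_mul]

@[fun_prop] lemma continuous_homogenize (i o : Option (Fin (m + 1))) :
    Continuous fun w : Fin (m + 1) → ℂ => homogenize i w o := by
  unfold homogenize
  rcases Equiv.swap none i o with _ | k <;> simp <;> fun_prop

end Affine

/-! ### The projective bundle `X = ℙ(𝒪 ⊕ L^{⊕(m+1)})` and its blow-up along the zero section -/

section Bundles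

variable {n : ℕ} {M : Type*} [TopologicalSpace M] [ChartedSpace (Fin n → ℂ) M]
variable (L : M → Type*) [∀ x, AddCommGroup (L x)] [∀ x, Module ℂ (L x)]
  [∀ x, TopologicalSpace (L x)] [TopologicalSpace (TotalSpace ℂ L)] [FiberBundle ℂ L]
  [VectorBundle ℂ ℂ L]

/-- The projective bundle `X = ℙ(𝒪 ⊕ L^{⊕(m+1)})` of lines in `𝒪 ⊕ L^{⊕(m+1)}`, where `L` is a line
bundle on an `n`-dimensional complex manifold `M`. -/
structure ProjBundle (n : ℕ) {M : Type*} (L : M → Type*) [∀ x, AddCommGroup (L x)]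
    [∀ x, Module ℂ (L x)] (m : ℕ) where
  /-- The projection `X → M`. -/
  base : M
  point : ℙ ℂ (ℂ × (Fin (m + 1) → L base))

/-- The blow-up of `X = ℙ(𝒪 ⊕ L^{⊕(m+1)})` along its zero section `P₀ = {v = 0}`: the points
of the fibre product of `X` and `ℙ(L^{⊕(m+1)})` over `M` formed by a point `[t : v]` of `X` and a
line `ℓ ⊆ L_x^{⊕(m+1)}` through the origin which contains `v`. -/
structure BlowUp (n : ℕ) {M : Type*} (L : M → Type*) [∀ x, AddCommGroup (L x)]
    [∀ x, Module ℂ (L x)] (m : ℕ) where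
  base : M
  point : ℙ ℂ (ℂ × (Fin (m + 1) → L base))
  line : ℙ ℂ (Fin (m + 1) → L base)
  mem_line : ∀ w ∈ point.submodule, w.2 ∈ line.submodule

variable {L} {m : ℕ}

/-- The local holomorphic frame of `L` near `x₀`. -/
def frame (x₀ x : M) : L x := (trivializationAt ℂ L x₀).symm x 1

/-- The coordinate on `L` dual to the local frame near `x₀`. -/
def coord (x₀ x : M) : L x →ₗ[ℂ] ℂ := (trivializationAt ℂ L x₀).linearMapAt ℂ x

lemma coord_frame {x₀ x : M} (hx : x ∈ (trivializationAt ℂ L x₀).baseSet) :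
    coord x₀ x (frame (L := L) x₀ x) = 1 :=
  Trivialization.linearMapAt_symm _ hx 1

lemma coord_smul_frame {x₀ x : M} (hx : x ∈ (trivializationAt ℂ L x₀).baseSet) (v : L x) :
    coord x₀ x v • frame x₀ x = v := by
  have h := Trivialization.symmₗ_linearMapAt (R := ℂ) (trivializationAt ℂ L x₀) hx v
  rw [← mul_one ((trivializationAt ℂ L x₀).linearMapAt ℂ x v), ← smul_eq_mul, map_smul,
    Trivialization.symmₗ_apply _ hx] at h
  exact h

/-- The transition function of `L` from the frame near `x₀` to the frame near `x₁`. -/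
def transition (L : M → Type*) [∀ x, AddCommGroup (L x)] [∀ x, Module ℂ (L x)]
    [∀ x, TopologicalSpace (L x)] [TopologicalSpace (TotalSpace ℂ L)] [FiberBundle ℂ L]
    [VectorBundle ℂ ℂ L] (x₀ x₁ x : M) : ℂ :=
  coord x₁ x (frame (L := L) x₀ x)

lemma continuousOn_transition (x₀ x₁ : M) :
    ContinuousOn (transition L x₀ x₁)
      ((trivializationAt ℂ L x₀).baseSet ∩ (trivializationAt ℂ L x₁).baseSet) := by
  have h := continuousOn_coordChange ℂ (trivializationAt ℂ L x₀) (trivializationAt ℂ L x₁)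
  refine (h.clm_apply (continuousOn_const (c := (1 : ℂ)))).congr fun x hx => ?_
  change _ = Trivialization.coordChangeL ℂ _ _ x (1 : ℂ)
  rw [Trivialization.coordChangeL_apply _ _ hx]
  simp [transition, coord, frame, Trivialization.linearMapAt_apply, hx.2,
    Trivialization.mk_symm _ hx.1]

/-- The homogeneous coordinates of a vector of `𝒪 ⊕ L^{⊕(m+1)}` in the frame near `x₀`. -/
def hom (x₀ x : M) (v : ℂ × (Fin (m + 1) → L x)) : Option (Fin (m + 1)) → ℂ :=
  fun o => o.elim v.1 fun k => coord x₀ x (v.2 k)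

/-- The vector of `𝒪 ⊕ L^{⊕(m+1)}` with given coordinates in the frame near `x₀`. -/
def unhom (x₀ x : M) (W : Option (Fin (m + 1)) → ℂ) : ℂ × (Fin (m + 1) → L x) :=
  (W none, fun k => W (some k) • frame x₀ x)

/-- The action of a scalar `g` on `ℂ ⊕ ℂ^{m+1}` by `(t, v) ↦ (t, g v)`. -/
def twist (g : ℂ) (W : Option (Fin (m + 1)) → ℂ) : Option (Fin (m + 1)) → ℂ :=
  fun o => o.elim (W none) fun k => g * W (some k)

lemma hom_smul (x₀ x : M) (r : ℂ) (v : ℂ × (Fin (m + 1) → L x)) :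
    hom x₀ x (r • v) = r • hom x₀ x v := by
  ext o; rcases o with _ | k <;> simp [hom]

lemma hom_unhom (x₀ x₁ x : M) (W : Option (Fin (m + 1)) → ℂ) :
    hom x₁ x (unhom (L := L) x₀ x W) = twist (transition L x₀ x₁ x) W := by
  ext o; rcases o with _ | k <;> simp [hom, unhom, twist, transition, mul_comm]

lemma twist_self {x₀ x : M} (hx : x ∈ (trivializationAt ℂ L x₀).baseSet)
    (W : Option (Fin (m + 1)) → ℂ) : twist (transition L x₀ x₀ x) W = W := by
  ext o; rcases o with _ | k <;> simp [twist, transition, coord_frame hx]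

lemma unhom_hom {x₀ x : M} (hx : x ∈ (trivializationAt ℂ L x₀).baseSet)
    (v : ℂ × (Fin (m + 1) → L x)) : unhom x₀ x (hom x₀ x v) = v := by
  ext <;> simp [hom, unhom, coord_smul_frame hx]

lemma unhom_ne_zero {x₀ x : M} (hx : x ∈ (trivializationAt ℂ L x₀).baseSet)
    {W : Option (Fin (m + 1)) → ℂ} (hW : W ≠ 0) : unhom (L := L) x₀ x W ≠ 0 := by
  intro h
  apply hW
  rw [← twist_self hx W, ← hom_unhom, h]
  simpa using hom_smul (L := L) (m := m) x₀ x 0 0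

lemma hom_ne_zero {x₀ x : M} (hx : x ∈ (trivializationAt ℂ L x₀).baseSet)
    {v : ℂ × (Fin (m + 1) → L x)} (hv : v ≠ 0) : hom x₀ x v ≠ 0 := by
  intro h
  apply hv
  rw [← unhom_hom hx v, h]
  ext <;> simp [unhom]

lemma homogenize_ne_zero (i : Option (Fin (m + 1))) (w : Fin (m + 1) → ℂ) :
    homogenize i w ≠ 0 := by
  intro h
  simpa [homogenize_self] using congrFun h i

lemma ProjBundle.mk_eq_of (F : ∀ x, ℙ ℂ (ℂ × (Fin (m + 1) → L x))) {x x' : M} (h : x' = x)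
    {P : ℙ ℂ (ℂ × (Fin (m + 1) → L x))} (hP : F x = P) :
    (⟨x', F x'⟩ : ProjBundle n L m) = ⟨x, P⟩ := by
  subst h; rw [hP]

lemma mk_eq_of_smul {V : Type*} [AddCommGroup V] [Module ℂ V] {v : V} (hv : v ≠ 0) (P : ℙ ℂ V)
    {r : ℂ} (h : v = r • P.rep) : Projectivization.mk ℂ v hv = P := by
  conv_rhs => rw [← P.mk_rep]
  rw [Projectivization.mk_eq_mk_iff']
  exact ⟨r, h.symm⟩

lemma rep_mk {V : Type*} [AddCommGroup V] [Module ℂ V] {v : V} (hv : v ≠ 0) :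
    ∃ r : ℂ, r ≠ 0 ∧ (Projectivization.mk ℂ v hv).rep = r • v := by
  obtain ⟨a, ha⟩ := Projectivization.exists_smul_eq_mk_rep ℂ v hv
  exact ⟨a, a.ne_zero, ha.symm⟩

lemma one_zero_ne_zero (x : M) : ((1, 0) : ℂ × (Fin (m + 1) → L x)) ≠ 0 := by
  intro h; simpa using congrArg Prod.fst h

open Classical in
/-- The point in the fibre of `ℙ(𝒪 ⊕ L^{⊕(m+1)})` with homogeneous coordinates `W` in the frame
near `x₀`. -/
def pointOf (x₀ x : M) (W : Option (Fin (m + 1)) → ℂ) : ℙ ℂ (ℂ × (Fin (m + 1) → L x)) :=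
  if h : unhom (L := L) x₀ x W ≠ 0 then Projectivization.mk ℂ _ h
  else Projectivization.mk ℂ _ (one_zero_ne_zero x)

variable (L) in
/-- The domain, in the chart of `M` at `x₀`, over which the coordinates of `M` and `L` at `x₀`
are defined. -/
def baseDomain (x₀ : M) : Set (Fin n → ℂ) :=
  (chartAt (Fin n → ℂ) x₀).target ∩
    (chartAt (Fin n → ℂ) x₀).symm ⁻¹' (trivializationAt ℂ L x₀).baseSet

variable (L) in
/-- The domain where the coordinates of `M` and `L` at `x₁` are defined as well. -/
def baseOverlap (x₀ x₁ : M) : Set (Fin n → ℂ) :=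
  baseDomain L x₀ ∩ (chartAt (Fin n → ℂ) x₀).symm ⁻¹'
    ((chartAt (Fin n → ℂ) x₁).source ∩ (trivializationAt ℂ L x₁).baseSet)

lemma isOpen_baseOverlap (x₀ x₁ : M) : IsOpen (baseOverlap (n := n) L x₀ x₁) := by
  have h := (chartAt (Fin n → ℂ) x₀).continuousOn_symm.isOpen_inter_preimage
    (chartAt (Fin n → ℂ) x₀).open_target
    (((trivializationAt ℂ L x₀).open_baseSet).inter
      ((chartAt (Fin n → ℂ) x₁).open_source.inter (trivializationAt ℂ L x₁).open_baseSet))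
  convert h using 1
  ext z; simp [baseOverlap, baseDomain, and_assoc]

lemma continuousOn_chart_baseOverlap (x₀ x₁ : M) :
    ContinuousOn (fun z => chartAt (Fin n → ℂ) x₁ ((chartAt (Fin n → ℂ) x₀).symm z))
      (baseOverlap L x₀ x₁) :=
  (chartAt (Fin n → ℂ) x₁).continuousOn.comp
    ((chartAt (Fin n → ℂ) x₀).continuousOn_symm.mono fun _ hz => hz.1.1) fun _ hz => hz.2.1

lemma continuousOn_transition_baseOverlap (x₀ x₁ : M) :
    ContinuousOn (fun z => transition L x₀ x₁ ((chartAt (Fin n → ℂ) x₀).symm z))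
      (baseOverlap L x₀ x₁) :=
  (continuousOn_transition x₀ x₁).comp
    ((chartAt (Fin n → ℂ) x₀).continuousOn_symm.mono fun _ hz => hz.1.1)
    fun _ hz => ⟨hz.1.2, hz.2.2⟩

lemma hom_pointOf_rep {x₀ x₁ x : M} (hx : x ∈ (trivializationAt ℂ L x₀).baseSet)
    {W : Option (Fin (m + 1)) → ℂ} (hW : W ≠ 0) :
    ∃ r : ℂ, r ≠ 0 ∧ hom x₁ x (pointOf (L := L) x₀ x W).rep =
      r • twist (transition L x₀ x₁ x) W := by
  have h := unhom_ne_zero (L := L) hx hW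
  obtain ⟨r, hr, h'⟩ := rep_mk h
  refine ⟨r, hr, ?_⟩
  rw [pointOf, dif_pos h, h', hom_smul, hom_unhom]

lemma pointOf_eq {x₀ x : M} (hx : x ∈ (trivializationAt ℂ L x₀).baseSet)
    (P : ℙ ℂ (ℂ × (Fin (m + 1) → L x))) {r : ℂ} (hr : r ≠ 0) :
    pointOf x₀ x (r • hom x₀ x P.rep) = P := by
  have h0 : r • hom x₀ x P.rep ≠ 0 := smul_ne_zero hr (hom_ne_zero hx P.rep_nonzero)
  have h := unhom_ne_zero (L := L) hx h0
  rw [pointOf, dif_pos h]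
  apply mk_eq_of_smul (r := r)
  rw [← hom_smul, unhom_hom hx]

/-- The chart of `ℙ(𝒪 ⊕ L^{⊕(m+1)})` given by the chart of `M` and the frame of `L` at `x₀` and by
the affine coordinates with index `i` on the fibres. -/
def projChart (x₀ : M) (i : Option (Fin (m + 1))) :
    PartialEquiv (ProjBundle n L m) (Fin n ⊕ Fin (m + 1) → ℂ) where
  toFun p := Sum.elim (chartAt (Fin n → ℂ) x₀ p.base) (affine i (hom x₀ p.base p.point.rep))
  invFun u := ⟨(chartAt (Fin n → ℂ) x₀).symm (u ∘ Sum.inl),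
    pointOf x₀ _ (homogenize i (u ∘ Sum.inr))⟩
  source := {p | p.base ∈ (chartAt (Fin n → ℂ) x₀).source ∧
    p.base ∈ (trivializationAt ℂ L x₀).baseSet ∧ hom x₀ p.base p.point.rep i ≠ 0}
  target := {u | u ∘ Sum.inl ∈ baseDomain L x₀}
  map_source' := by
    rintro ⟨x, P⟩ ⟨hx, hb, _⟩
    simp only [mem_ofPred_eq, Sum.elim_comp_inl, baseDomain, mem_inter_iff, mem_preimage] at *
    exact ⟨(chartAt _ x₀).map_source hx, by rwa [(chartAt _ x₀).left_inv hx]⟩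
  map_target' := by
    intro u hu
    obtain ⟨r, hr, h⟩ := hom_pointOf_rep (L := L) (x₁ := x₀) hu.2
      (homogenize_ne_zero i (u ∘ Sum.inr))
    refine ⟨(chartAt _ x₀).map_target hu.1, hu.2, ?_⟩
    rw [h, twist_self hu.2]
    simp [hr]
  left_inv' := by
    rintro ⟨x, P⟩ ⟨hx, hb, hi⟩
    simp only [Sum.elim_comp_inl, Sum.elim_comp_inr]
    refine ProjBundle.mk_eq_of (fun x' => pointOf x₀ x' (homogenize i (affine i (hom x₀ x P.rep))))
      ((chartAt _ x₀).left_inv hx) ?_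
    rw [homogenize_affine i hi]
    exact pointOf_eq hb P (inv_ne_zero hi)
  right_inv' := by
    intro u hu
    obtain ⟨r, hr, h⟩ := hom_pointOf_rep (L := L) (x₁ := x₀) hu.2
      (homogenize_ne_zero i (u ∘ Sum.inr))
    simp only [h, twist_self hu.2, affine_smul i hr, affine_homogenize]
    rw [(chartAt _ x₀).right_inv hu.1]
    exact Sum.elim_comp_inl_inr u

lemma projChart_trans {x₀ x₁ : M} {i j : Option (Fin (m + 1))} {u : Fin n ⊕ Fin (m + 1) → ℂ}
    (hu : u ∈ (projChart (n := n) (L := L) x₀ i).target) :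
    (projChart (n := n) (L := L) x₁ j ((projChart (n := n) x₀ i).symm u) =
      Sum.elim (chartAt (Fin n → ℂ) x₁ ((chartAt (Fin n → ℂ) x₀).symm (u ∘ Sum.inl)))
        (affine j (twist (transition L x₀ x₁ ((chartAt (Fin n → ℂ) x₀).symm (u ∘ Sum.inl)))
          (homogenize i (u ∘ Sum.inr))))) ∧
    ((projChart (n := n) x₀ i).symm u ∈ (projChart (n := n) (L := L) x₁ j).source ↔
      u ∘ Sum.inl ∈ baseOverlap L x₀ x₁ ∧
      twist (transition L x₀ x₁ ((chartAt (Fin n → ℂ) x₀).symm (u ∘ Sum.inl)))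
          (homogenize i (u ∘ Sum.inr)) j ≠ 0) := by
  have hu' : u ∘ Sum.inl ∈ baseDomain L x₀ := hu
  obtain ⟨r, hr, h⟩ := hom_pointOf_rep (L := L) (x₁ := x₁) hu'.2
      (homogenize_ne_zero i (u ∘ Sum.inr))
  constructor
  · change Sum.elim (chartAt (Fin n → ℂ) x₁ ((chartAt (Fin n → ℂ) x₀).symm (u ∘ Sum.inl)))
      (affine j (hom x₁ ((chartAt (Fin n → ℂ) x₀).symm (u ∘ Sum.inl))
        (pointOf x₀ ((chartAt (Fin n → ℂ) x₀).symm (u ∘ Sum.inl)) (homogenize i (u ∘ Sum.inr))).rep)) = _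
    rw [h, affine_smul j hr]
  · change (((chartAt (Fin n → ℂ) x₀).symm (u ∘ Sum.inl)) ∈ _ ∧ ((chartAt (Fin n → ℂ) x₀).symm (u ∘ Sum.inl)) ∈ _ ∧
      hom x₁ ((chartAt (Fin n → ℂ) x₀).symm (u ∘ Sum.inl))
        (pointOf x₀ ((chartAt (Fin n → ℂ) x₀).symm (u ∘ Sum.inl)) (homogenize i (u ∘ Sum.inr))).rep j ≠ 0) ↔ _
    rw [h]
    simp only [baseOverlap, mem_inter_iff, mem_preimage, Pi.smul_apply, smul_eq_mul, ne_eq,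
      mul_eq_zero, hr, false_or, and_assoc, hu', true_and]

lemma continuousOn_twist (x₀ x₁ : M) (i o : Option (Fin (m + 1))) :
    ContinuousOn (fun u : Fin n ⊕ Fin (m + 1) → ℂ =>
      twist (transition L x₀ x₁ ((chartAt (Fin n → ℂ) x₀).symm (u ∘ Sum.inl)))
        (homogenize i (u ∘ Sum.inr)) o) {u | u ∘ Sum.inl ∈ baseOverlap L x₀ x₁} := by
  have h1 : ContinuousOn (fun u : Fin n ⊕ Fin (m + 1) → ℂ =>
      transition L x₀ x₁ ((chartAt (Fin n → ℂ) x₀).symm (u ∘ Sum.inl)))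
      {u | u ∘ Sum.inl ∈ baseOverlap L x₀ x₁} :=
    (continuousOn_transition_baseOverlap x₀ x₁).comp
      (by fun_prop : Continuous fun u : Fin n ⊕ Fin (m + 1) → ℂ => u ∘ Sum.inl).continuousOn
      fun _ hu => hu
  have h2 : ∀ o, Continuous fun u : Fin n ⊕ Fin (m + 1) → ℂ => homogenize i (u ∘ Sum.inr) o :=
    fun o => (continuous_homogenize i o).comp (by fun_prop)
  rcases o with _ | k
  · exact (h2 none).continuousOn
  · exact h1.mul (h2 (some k)).continuousOn

lemma isOpen_overlap (x₀ x₁ : M) :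
    IsOpen {u : Fin n ⊕ Fin (m + 1) → ℂ | u ∘ Sum.inl ∈ baseOverlap L x₀ x₁} :=
  (isOpen_baseOverlap x₀ x₁).preimage
    (by fun_prop : Continuous fun u : Fin n ⊕ Fin (m + 1) → ℂ => u ∘ Sum.inl)

lemma continuousOn_base (x₀ x₁ : M) (l : Fin n) :
    ContinuousOn (fun u : Fin n ⊕ Fin (m + 1) → ℂ =>
      chartAt (Fin n → ℂ) x₁ ((chartAt (Fin n → ℂ) x₀).symm (u ∘ Sum.inl)) l)
      {u | u ∘ Sum.inl ∈ baseOverlap L x₀ x₁} := by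
  have h := (continuousOn_chart_baseOverlap (L := L) x₀ x₁).comp
    (by fun_prop : Continuous fun u : Fin n ⊕ Fin (m + 1) → ℂ => u ∘ Sum.inl).continuousOn
    (s := {u | u ∘ Sum.inl ∈ baseOverlap L x₀ x₁}) fun _ hu => hu
  exact continuousOn_pi.1 h l

variable (n L m) in
/-- The holomorphic atlas of `ℙ(𝒪 ⊕ L^{⊕(m+1)})`. -/
def projCore : ChartedSpaceCore (Fin n ⊕ Fin (m + 1) → ℂ) (ProjBundle n L m) where
  atlas := {e | ∃ (x₀ : M) (i : Option (Fin (m + 1))), e = projChart x₀ i}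
  chartAt p := projChart p.base (Function.ne_iff.1
    (hom_ne_zero (mem_baseSet_trivializationAt ℂ L p.base) p.point.rep_nonzero)).choose
  mem_chart_source p := ⟨mem_chart_source _ _, mem_baseSet_trivializationAt ℂ L p.base,
    (Function.ne_iff.1
      (hom_ne_zero (mem_baseSet_trivializationAt ℂ L p.base) p.point.rep_nonzero)).choose_spec⟩
  chart_mem_atlas p := ⟨_, _, rfl⟩
  open_source := by
    rintro _ _ ⟨x₀, i, rfl⟩ ⟨x₁, j, rfl⟩
    have h := (continuousOn_twist (L := L) (n := n) x₀ x₁ i j).isOpen_inter_preimage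
      (isOpen_overlap x₀ x₁) isOpen_compl_singleton (t := {0}ᶜ)
    convert h using 1
    ext u
    rw [PartialEquiv.trans_source, PartialEquiv.symm_source]
    constructor
    · rintro ⟨h1, h2⟩
      exact (projChart_trans h1).2.1 h2
    · intro h1
      have h2 : u ∈ (projChart (n := n) (L := L) x₀ i).target := h1.1.1
      exact ⟨h2, (projChart_trans h2).2.2 h1⟩
  continuousOn_toFun := by
    rintro _ _ ⟨x₀, i, rfl⟩ ⟨x₁, j, rfl⟩
    have hs : ∀ u ∈ ((projChart (L := L) (n := n) x₀ i).symm.trans (projChart x₁ j)).source,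
        u ∈ (projChart (n := n) (L := L) x₀ i).target ∧ u ∘ Sum.inl ∈ baseOverlap L x₀ x₁ ∧
        twist (transition L x₀ x₁ ((chartAt (Fin n → ℂ) x₀).symm (u ∘ Sum.inl)))
          (homogenize i (u ∘ Sum.inr)) j ≠ 0 := by
      intro u hu
      rw [PartialEquiv.trans_source, PartialEquiv.symm_source] at hu
      exact ⟨hu.1, (projChart_trans hu.1).2.1 hu.2⟩
    refine ContinuousOn.congr ?_ fun u hu => (projChart_trans (hs u hu).1).1
    refine continuousOn_pi.2 ?_
    rintro (l | k)
    · exact (continuousOn_base x₀ x₁ l).mono fun u hu => (hs u hu).2.1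
    · exact ((continuousOn_twist x₀ x₁ i _).mono fun u hu => (hs u hu).2.1).div
        ((continuousOn_twist x₀ x₁ i j).mono fun u hu => (hs u hu).2.1) fun u hu => (hs u hu).2.2

instance : TopologicalSpace (ProjBundle n L m) := (projCore n L m).toTopologicalSpace

instance : ChartedSpace (Fin n ⊕ Fin (m + 1) → ℂ) (ProjBundle n L m) :=
  (projCore n L m).toChartedSpace

/-- The coordinates of a vector of `L^{⊕(m+1)}` in the frame near `x₀`. -/
def homL (x₀ x : M) (v : Fin (m + 1) → L x) : Fin (m + 1) → ℂ := fun k => coord x₀ x (v k)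

lemma homL_smul (x₀ x : M) (r : ℂ) (v : Fin (m + 1) → L x) :
    homL x₀ x (r • v) = r • homL x₀ x v := by
  ext k; simp [homL]

lemma hom_some (x₀ x : M) (v : ℂ × (Fin (m + 1) → L x)) (k : Fin (m + 1)) :
    hom x₀ x v (some k) = homL x₀ x v.2 k := rfl

/-- For a point `(x, [t : v], ℓ)` of the blow-up with homogeneous coordinates `W` of `[t : v]` and
`Λ` of `ℓ`: the coordinates `Λ k / Λ i`, `k ≠ i`, together with, in place of the trivial one with
`k = i`, the coordinate `v_i / t` (if `b = false`, near the exceptional divisor) or `t / v_i`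
(if `b = true`, near the divisor at infinity). -/
def blowCoord (i : Fin (m + 1)) (b : Bool) (W : Option (Fin (m + 1)) → ℂ)
    (Λ : Fin (m + 1) → ℂ) : Fin (m + 1) → ℂ :=
  Function.update (fun k => Λ k / Λ i) i
    (bif b then W none / W (some i) else W (some i) / W none)

/-- The locus on which these coordinates are defined. -/
def BlowDefined (i : Fin (m + 1)) (b : Bool) (W : Option (Fin (m + 1)) → ℂ)
    (Λ : Fin (m + 1) → ℂ) : Prop :=
  (bif b then W (some i) else W none) ≠ 0 ∧ Λ i ≠ 0

/-- Homogeneous coordinates of the line `ℓ`, from the coordinates on the blow-up. -/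
def blowLine (i : Fin (m + 1)) (w : Fin (m + 1) → ℂ) : Fin (m + 1) → ℂ := Function.update w i 1

/-- Homogeneous coordinates of the point `[t : v]`, from the coordinates on the blow-up. -/
def blowPoint (i : Fin (m + 1)) (b : Bool) (w : Fin (m + 1) → ℂ) : Option (Fin (m + 1)) → ℂ :=
  fun o => o.elim (bif b then w i else 1) fun k => (bif b then 1 else w i) * blowLine i w k

lemma blowLine_self (i : Fin (m + 1)) (w : Fin (m + 1) → ℂ) : blowLine i w i = 1 := by
  simp [blowLine]

lemma blowPoint_ne_zero (i : Fin (m + 1)) (b : Bool) (w : Fin (m + 1) → ℂ) :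
    blowPoint i b w ≠ 0 := by
  intro h
  cases b
  · simpa [blowPoint] using congrFun h none
  · simpa [blowPoint, blowLine] using congrFun h (some i)

lemma blowCoord_smul (i : Fin (m + 1)) (b : Bool) {r r' : ℂ} (hr : r ≠ 0) (hr' : r' ≠ 0)
    (W : Option (Fin (m + 1)) → ℂ) (Λ : Fin (m + 1) → ℂ) :
    blowCoord i b (r • W) (r' • Λ) = blowCoord i b W Λ := by
  cases b <;> simp [blowCoord, mul_div_mul_left _ _ hr, mul_div_mul_left _ _ hr']

lemma blowDefined_smul (i : Fin (m + 1)) (b : Bool) {r r' : ℂ} (hr : r ≠ 0) (hr' : r' ≠ 0)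
    (W : Option (Fin (m + 1)) → ℂ) (Λ : Fin (m + 1) → ℂ) :
    BlowDefined i b (r • W) (r' • Λ) ↔ BlowDefined i b W Λ := by
  cases b <;> simp [BlowDefined, hr, hr']

lemma blowDefined_blowPoint (i : Fin (m + 1)) (b : Bool) (w : Fin (m + 1) → ℂ) :
    BlowDefined i b (blowPoint i b w) (blowLine i w) := by
  cases b <;> simp [BlowDefined, blowPoint, blowLine]

lemma blowCoord_blowPoint (i : Fin (m + 1)) (b : Bool) (w : Fin (m + 1) → ℂ) :
    blowCoord i b (blowPoint i b w) (blowLine i w) = w := by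
  ext k
  by_cases hk : k = i
  · subst hk; cases b <;> simp [blowCoord, blowPoint, blowLine]
  · simp [blowCoord, blowLine, hk]

lemma blowLine_blowCoord {i : Fin (m + 1)} {b : Bool} {W : Option (Fin (m + 1)) → ℂ}
    {Λ : Fin (m + 1) → ℂ} (h : BlowDefined i b W Λ) :
    blowLine i (blowCoord i b W Λ) = (Λ i)⁻¹ • Λ := by
  ext k
  by_cases hk : k = i
  · subst hk; simp [blowLine, h.2]
  · simp [blowLine, blowCoord, hk, div_eq_inv_mul]

lemma blowPoint_blowCoord {i : Fin (m + 1)} {b : Bool} {W : Option (Fin (m + 1)) → ℂ}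
    {Λ : Fin (m + 1) → ℂ} (h : BlowDefined i b W Λ) {t : ℂ} (ht : ∀ k, W (some k) = t * Λ k) :
    blowPoint i b (blowCoord i b W Λ) = (bif b then W (some i) else W none)⁻¹ • W := by
  obtain ⟨h1, h2⟩ := h
  have hl := blowLine_blowCoord (b := b) ⟨h1, h2⟩
  ext o
  rcases o with _ | k
  · cases b
    · simp_all [blowPoint]
    · simp [blowPoint, blowCoord, div_eq_inv_mul]
  · simp only [blowPoint, hl, Option.elim_some]
    cases b
    · simp only [cond_false, blowCoord, Function.update_self, Pi.smul_apply, smul_eq_mul, ht] at *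
      field_simp
    · simp only [cond_true, Pi.smul_apply, smul_eq_mul, ht] at *
      have : t ≠ 0 := left_ne_zero_of_mul h1
      field_simp

lemma homL_ne_zero {x₀ x : M} (hx : x ∈ (trivializationAt ℂ L x₀).baseSet)
    {v : Fin (m + 1) → L x} (hv : v ≠ 0) : homL x₀ x v ≠ 0 := by
  intro h
  apply hv
  ext k
  rw [← coord_smul_frame hx (v k)]
  simp [show coord x₀ x (v k) = 0 from congrFun h k]

lemma unhomL_ne_zero {x₀ x : M} (hx : x ∈ (trivializationAt ℂ L x₀).baseSet)
    {Λ : Fin (m + 1) → ℂ} (hΛ : Λ ≠ 0) : (fun k => Λ k • frame x₀ x : Fin (m + 1) → L x) ≠ 0 := by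
  intro h
  apply hΛ
  ext k
  have := congrArg (coord x₀ x) (congrFun h k)
  simpa [coord_frame hx] using this

lemma blowLine_ne_zero (i : Fin (m + 1)) (w : Fin (m + 1) → ℂ) : blowLine i w ≠ 0 := by
  intro h; simpa [blowLine_self] using congrFun h i

lemma exists_eq_mul (x₀ : M) (q : BlowUp n L m) :
    ∃ t : ℂ, ∀ k, hom x₀ q.base q.point.rep (some k) = t * homL x₀ q.base q.line.rep k := by
  have h1 : q.point.rep ∈ q.point.submodule := by
    rw [Projectivization.submodule_eq]; exact Submodule.mem_span_singleton_self _
  have h2 := q.mem_line _ h1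
  rw [Projectivization.submodule_eq, Submodule.mem_span_singleton] at h2
  obtain ⟨t, ht⟩ := h2
  refine ⟨t, fun k => ?_⟩
  rw [hom_some, ← ht, homL_smul]; rfl

lemma BlowUp.ext' {q q' : BlowUp n L m} (h : q.base = q'.base)
    (hp : HEq q.point q'.point) (hl : HEq q.line q'.line) : q = q' := by
  obtain ⟨x, P, l, _⟩ := q
  obtain ⟨x', P', l', _⟩ := q'
  subst h; cases hp; cases hl; rfl

open Classical in
/-- The point of the blow-up in the fibre over `x` with coordinates `w`, with respect to the frame
near `x₀` and the coordinates with index `(i, b)`. -/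
def blowPointOf (n : ℕ) (x₀ x : M) (i : Fin (m + 1)) (b : Bool) (w : Fin (m + 1) → ℂ) :
    BlowUp n L m :=
  if hx : x ∈ (trivializationAt ℂ L x₀).baseSet then
    { base := x
      point := .mk ℂ _ (unhom_ne_zero (L := L) hx (blowPoint_ne_zero i b w))
      line := .mk ℂ _ (unhomL_ne_zero (L := L) hx (blowLine_ne_zero i w))
      mem_line := by
        intro v hv
        rw [Projectivization.submodule_mk, Submodule.mem_span_singleton] at hv ⊢
        obtain ⟨c, rfl⟩ := hv
        refine ⟨c * (bif b then 1 else w i), ?_⟩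
        ext k
        simp [unhom, blowPoint, mul_smul] }
  else
    { base := x
      point := .mk ℂ _ (one_zero_ne_zero x)
      line := .mk ℂ _ (unhomL_ne_zero (L := L) (mem_baseSet_trivializationAt ℂ L x)
        (blowLine_ne_zero i w))
      mem_line := by
        intro v hv
        rw [Projectivization.submodule_mk, Submodule.mem_span_singleton] at hv
        obtain ⟨c, rfl⟩ := hv
        simp }

lemma blowPointOf_base (x₀ x : M) (i : Fin (m + 1)) (b : Bool) (w : Fin (m + 1) → ℂ) :
    (blowPointOf (L := L) n x₀ x i b w).base = x := by
  unfold blowPointOf; split_ifs <;> rfl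

/-- The transformation of the coordinates of the line `ℓ` under a change of frame. -/
lemma homL_unhomL (x₀ x₁ x : M) (Λ : Fin (m + 1) → ℂ) :
    homL x₁ x (fun k => Λ k • frame x₀ x : Fin (m + 1) → L x) = transition L x₀ x₁ x • Λ := by
  ext k; simp [homL, transition, mul_comm]

lemma transition_ne_zero {x₀ x₁ x : M} (hx : x ∈ (trivializationAt ℂ L x₀).baseSet)
    (hx' : x ∈ (trivializationAt ℂ L x₁).baseSet) : transition L x₀ x₁ x ≠ 0 := by
  intro h
  have h1 := coord_smul_frame hx' (frame (L := L) x₀ x)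
  rw [show coord x₁ x (frame (L := L) x₀ x) = 0 from h, zero_smul] at h1
  have h2 := coord_frame (L := L) hx
  rw [← h1, map_zero] at h2
  exact zero_ne_one h2

lemma blowPointOf_coord {x₀ x₁ x : M} (hx : x ∈ (trivializationAt ℂ L x₀).baseSet)
    (i : Fin (m + 1)) (b : Bool) (w : Fin (m + 1) → ℂ) :
    ∃ r r' : ℂ, r ≠ 0 ∧ r' ≠ 0 ∧
      hom x₁ _ (blowPointOf (L := L) n x₀ x i b w).point.rep =
        r • twist (transition L x₀ x₁ x) (blowPoint i b w) ∧
      homL x₁ _ (blowPointOf (L := L) n x₀ x i b w).line.rep =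
        r' • transition L x₀ x₁ x • blowLine i w := by
  rw [blowPointOf, dif_pos hx]
  obtain ⟨r, hr, h⟩ := rep_mk (unhom_ne_zero (L := L) hx (blowPoint_ne_zero i b w))
  obtain ⟨r', hr', h'⟩ := rep_mk (unhomL_ne_zero (L := L) hx (blowLine_ne_zero i w))
  refine ⟨r, r', hr, hr', ?_, ?_⟩
  · simp only [h, hom_smul, hom_unhom]
  · simp only [h', homL_smul, homL_unhomL]

lemma blowPointOf_eq {x₀ : M} {q : BlowUp n L m}
    (hx : q.base ∈ (trivializationAt ℂ L x₀).baseSet) {i : Fin (m + 1)} {b : Bool}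
    (h : BlowDefined i b (hom x₀ q.base q.point.rep) (homL x₀ q.base q.line.rep)) :
    blowPointOf n x₀ q.base i b
      (blowCoord i b (hom x₀ q.base q.point.rep) (homL x₀ q.base q.line.rep)) = q := by
  obtain ⟨t, ht⟩ := exists_eq_mul x₀ q
  rw [blowPointOf, dif_pos hx]
  refine BlowUp.ext' rfl (heq_of_eq ?_) (heq_of_eq ?_)
  · refine mk_eq_of_smul _ _ (r := (bif b then hom x₀ q.base q.point.rep (some i)
      else hom x₀ q.base q.point.rep none)⁻¹) ?_
    rw [blowPoint_blowCoord h ht, ← hom_smul, unhom_hom hx]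
  · refine mk_eq_of_smul _ _ (r := (homL x₀ q.base q.line.rep i)⁻¹) ?_
    rw [blowLine_blowCoord h]
    ext k
    simp only [Pi.smul_apply, smul_eq_mul, mul_smul, homL, coord_smul_frame hx]

/-- The chart of the blow-up given by the chart of `M` and the frame of `L` at `x₀` and by the
coordinates with index `(i, b)` on the fibres. -/
def blowChart (x₀ : M) (i : Fin (m + 1)) (b : Bool) :
    PartialEquiv (BlowUp n L m) (Fin n ⊕ Fin (m + 1) → ℂ) where
  toFun q := Sum.elim (chartAt (Fin n → ℂ) x₀ q.base)
    (blowCoord i b (hom x₀ q.base q.point.rep) (homL x₀ q.base q.line.rep))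
  invFun u := blowPointOf n x₀ ((chartAt (Fin n → ℂ) x₀).symm (u ∘ Sum.inl)) i b (u ∘ Sum.inr)
  source := {q | q.base ∈ (chartAt (Fin n → ℂ) x₀).source ∧
    q.base ∈ (trivializationAt ℂ L x₀).baseSet ∧
    BlowDefined i b (hom x₀ q.base q.point.rep) (homL x₀ q.base q.line.rep)}
  target := {u | u ∘ Sum.inl ∈ baseDomain L x₀}
  map_source' := by
    rintro q ⟨hx, hb, _⟩
    simp only [mem_ofPred_eq, Sum.elim_comp_inl, baseDomain, mem_inter_iff, mem_preimage] at *
    exact ⟨(chartAt _ x₀).map_source hx, by rwa [(chartAt _ x₀).left_inv hx]⟩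
  map_target' := by
    intro u hu
    obtain ⟨r, r', hr, hr', h, h'⟩ := blowPointOf_coord (L := L) (n := n) (x₁ := x₀) hu.2 i b
      (u ∘ Sum.inr)
    rw [twist_self hu.2] at h
    rw [show transition L x₀ x₀ _ = 1 from coord_frame hu.2, one_smul] at h'
    refine ⟨?_, ?_, ?_⟩
    · rw [blowPointOf_base]; exact (chartAt _ x₀).map_target hu.1
    · rw [blowPointOf_base]; exact hu.2
    · rw [h, h', blowDefined_smul i b hr hr']; exact blowDefined_blowPoint i b _
  left_inv' := by
    rintro q ⟨hx, hb, hi⟩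
    simp only [Sum.elim_comp_inl, Sum.elim_comp_inr]
    rw [(chartAt _ x₀).left_inv hx]
    exact blowPointOf_eq hb hi
  right_inv' := by
    intro u hu
    obtain ⟨r, r', hr, hr', h, h'⟩ := blowPointOf_coord (L := L) (n := n) (x₁ := x₀) hu.2 i b
      (u ∘ Sum.inr)
    rw [twist_self hu.2] at h
    rw [show transition L x₀ x₀ _ = 1 from coord_frame hu.2, one_smul] at h'
    rw [h, h', blowCoord_smul i b hr hr', blowCoord_blowPoint, blowPointOf_base,
      (chartAt _ x₀).right_inv hu.1]
    exact Sum.elim_comp_inl_inr u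

lemma blowChart_trans {x₀ x₁ : M} {i j : Fin (m + 1)} {b c : Bool}
    {u : Fin n ⊕ Fin (m + 1) → ℂ} (hu : u ∈ (blowChart (n := n) (L := L) x₀ i b).target) :
    (u ∘ Sum.inl ∈ baseOverlap L x₀ x₁ →
      blowChart (n := n) (L := L) x₁ j c ((blowChart (n := n) x₀ i b).symm u) =
      Sum.elim (chartAt (Fin n → ℂ) x₁ ((chartAt (Fin n → ℂ) x₀).symm (u ∘ Sum.inl)))
        (blowCoord j c (twist (transition L x₀ x₁
          ((chartAt (Fin n → ℂ) x₀).symm (u ∘ Sum.inl))) (blowPoint i b (u ∘ Sum.inr)))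
          (blowLine i (u ∘ Sum.inr)))) ∧
    ((blowChart (n := n) x₀ i b).symm u ∈ (blowChart (n := n) (L := L) x₁ j c).source ↔
      u ∘ Sum.inl ∈ baseOverlap L x₀ x₁ ∧
      BlowDefined j c (twist (transition L x₀ x₁
          ((chartAt (Fin n → ℂ) x₀).symm (u ∘ Sum.inl))) (blowPoint i b (u ∘ Sum.inr)))
          (blowLine i (u ∘ Sum.inr))) := by
  have hu' : u ∘ Sum.inl ∈ baseDomain L x₀ := hu
  obtain ⟨r, r', hr, hr', h, h'⟩ := blowPointOf_coord (L := L) (n := n) (x₁ := x₁) hu'.2 i b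
    (u ∘ Sum.inr)
  rw [smul_smul] at h'
  constructor
  · intro ho
    have hg : transition L x₀ x₁ ((chartAt (Fin n → ℂ) x₀).symm (u ∘ Sum.inl)) ≠ 0 :=
      transition_ne_zero hu'.2 ho.2.2
    change Sum.elim (chartAt (Fin n → ℂ) x₁ (blowPointOf n x₀ _ i b _).base)
      (blowCoord j c (hom x₁ _ (blowPointOf n x₀ ((chartAt (Fin n → ℂ) x₀).symm (u ∘ Sum.inl))
        i b (u ∘ Sum.inr)).point.rep) (homL x₁ _ (blowPointOf n x₀
        ((chartAt (Fin n → ℂ) x₀).symm (u ∘ Sum.inl)) i b (u ∘ Sum.inr)).line.rep)) = _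
    rw [h, h', blowCoord_smul j c hr (mul_ne_zero hr' hg), blowPointOf_base]
  · change ((blowPointOf n x₀ ((chartAt (Fin n → ℂ) x₀).symm (u ∘ Sum.inl)) i b
        (u ∘ Sum.inr)).base ∈ _ ∧ (blowPointOf n x₀ ((chartAt (Fin n → ℂ) x₀).symm
        (u ∘ Sum.inl)) i b (u ∘ Sum.inr)).base ∈ (trivializationAt ℂ L x₁).baseSet ∧
      BlowDefined j c (hom x₁ _ (blowPointOf n x₀ ((chartAt (Fin n → ℂ) x₀).symm (u ∘ Sum.inl))
        i b (u ∘ Sum.inr)).point.rep) (homL x₁ _ (blowPointOf n x₀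
        ((chartAt (Fin n → ℂ) x₀).symm (u ∘ Sum.inl)) i b (u ∘ Sum.inr)).line.rep)) ↔ _
    rw [h, h', blowPointOf_base]
    simp only [baseOverlap, mem_inter_iff, mem_preimage, hu', true_and, and_assoc]
    refine and_congr_right fun _ => and_congr_right fun hb => ?_
    exact blowDefined_smul j c hr (mul_ne_zero hr' (transition_ne_zero hu'.2 hb)) _ _

lemma continuous_blowLine (i k : Fin (m + 1)) :
    Continuous fun u : Fin n ⊕ Fin (m + 1) → ℂ => blowLine i (u ∘ Sum.inr) k := by
  by_cases hk : k = i
  · subst hk; simp only [blowLine, Function.update_self]; fun_prop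
  · simp only [blowLine, Function.update_of_ne hk]; fun_prop

lemma continuousOn_twist_blowPoint (x₀ x₁ : M) (i : Fin (m + 1)) (b : Bool)
    (o : Option (Fin (m + 1))) :
    ContinuousOn (fun u : Fin n ⊕ Fin (m + 1) → ℂ =>
      twist (transition L x₀ x₁ ((chartAt (Fin n → ℂ) x₀).symm (u ∘ Sum.inl)))
        (blowPoint i b (u ∘ Sum.inr)) o) {u | u ∘ Sum.inl ∈ baseOverlap L x₀ x₁} := by
  have h1 : ContinuousOn (fun u : Fin n ⊕ Fin (m + 1) → ℂ =>
      transition L x₀ x₁ ((chartAt (Fin n → ℂ) x₀).symm (u ∘ Sum.inl)))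
      {u | u ∘ Sum.inl ∈ baseOverlap L x₀ x₁} :=
    (continuousOn_transition_baseOverlap x₀ x₁).comp
      (by fun_prop : Continuous fun u : Fin n ⊕ Fin (m + 1) → ℂ => u ∘ Sum.inl).continuousOn
      fun _ hu => hu
  rcases o with _ | k
  · cases b <;> simp only [twist, blowPoint, Option.elim_none, cond_true, cond_false] <;> fun_prop
  · have h2 : Continuous fun u : Fin n ⊕ Fin (m + 1) → ℂ =>
        (bif b then 1 else (u ∘ Sum.inr) i) * blowLine i (u ∘ Sum.inr) k := by
      refine Continuous.mul ?_ (continuous_blowLine i k)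
      cases b <;> simp only [cond_true, cond_false] <;> fun_prop
    exact h1.mul h2.continuousOn

variable (n L m) in
/-- The holomorphic atlas of the blow-up. -/
def blowCore : ChartedSpaceCore (Fin n ⊕ Fin (m + 1) → ℂ) (BlowUp n L m) where
  atlas := {e | ∃ (x₀ : M) (i : Fin (m + 1)) (b : Bool), e = blowChart x₀ i b}
  chartAt q := blowChart q.base (Function.ne_iff.1
    (homL_ne_zero (mem_baseSet_trivializationAt ℂ L q.base) q.line.rep_nonzero)).choose
    (open Classical in decide (hom q.base q.base q.point.rep none = 0))
  mem_chart_source q := by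
    have hb := mem_baseSet_trivializationAt ℂ L q.base
    have h := (Function.ne_iff.1 (homL_ne_zero hb q.line.rep_nonzero)).choose_spec
    refine ⟨mem_chart_source _ _, hb, ?_, h⟩
    by_cases h0 : hom q.base q.base q.point.rep none = 0
    · simp only [h0, decide_true, cond_true]
      obtain ⟨t, ht⟩ := exists_eq_mul q.base q
      rw [ht]
      refine mul_ne_zero ?_ h
      rintro rfl
      apply hom_ne_zero hb q.point.rep_nonzero
      ext o
      rcases o with _ | k
      · exact h0
      · simp [ht]
    · simp [h0]
  chart_mem_atlas q := ⟨_, _, _, rfl⟩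
  open_source := by
    rintro _ _ ⟨x₀, i, b, rfl⟩ ⟨x₁, j, c, rfl⟩
    have h1 := (continuousOn_twist_blowPoint (L := L) (n := n) x₀ x₁ i b
      (bif c then some j else none)).isOpen_inter_preimage
      (isOpen_overlap x₀ x₁) isOpen_compl_singleton (t := {0}ᶜ)
    have h2 := isOpen_compl_singleton (x := (0 : ℂ)).preimage (continuous_blowLine (n := n) i j)
    convert h1.inter h2 using 1
    ext u
    rw [PartialEquiv.trans_source, PartialEquiv.symm_source]
    have key : u ∈ (blowChart (n := n) (L := L) x₀ i b).target →
        ((blowChart (n := n) x₀ i b).symm u ∈ (blowChart (n := n) (L := L) x₁ j c).source ↔ _) :=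
      fun h => (blowChart_trans h).2
    constructor
    · rintro ⟨h1, h2⟩
      obtain ⟨h3, h4, h5⟩ := (key h1).1 h2
      exact ⟨⟨h3, by cases c <;> exact h4⟩, h5⟩
    · rintro ⟨⟨h3, h4⟩, h5⟩
      have h1 : u ∈ (blowChart (n := n) (L := L) x₀ i b).target := h3.1
      exact ⟨h1, (key h1).2 ⟨h3, by cases c <;> exact h4, h5⟩⟩
  continuousOn_toFun := by
    rintro _ _ ⟨x₀, i, b, rfl⟩ ⟨x₁, j, c, rfl⟩
    have hs : ∀ u ∈ ((blowChart (L := L) (n := n) x₀ i b).symm.trans (blowChart x₁ j c)).source,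
        u ∈ (blowChart (n := n) (L := L) x₀ i b).target ∧ u ∘ Sum.inl ∈ baseOverlap L x₀ x₁ ∧
        BlowDefined j c (twist (transition L x₀ x₁
          ((chartAt (Fin n → ℂ) x₀).symm (u ∘ Sum.inl))) (blowPoint i b (u ∘ Sum.inr)))
          (blowLine i (u ∘ Sum.inr)) := by
      intro u hu
      rw [PartialEquiv.trans_source, PartialEquiv.symm_source] at hu
      exact ⟨hu.1, (blowChart_trans hu.1).2.1 hu.2⟩
    refine ContinuousOn.congr ?_ fun u hu =>
      (blowChart_trans (hs u hu).1).1 (hs u hu).2.1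
    refine continuousOn_pi.2 ?_
    rintro (l | k)
    · exact (continuousOn_base x₀ x₁ l).mono fun u hu => (hs u hu).2.1
    · have ht : ∀ o, ContinuousOn _ _ := fun o =>
        (continuousOn_twist_blowPoint (L := L) (n := n) x₀ x₁ i b o).mono
          fun u hu => (hs u hu).2.1
      by_cases hk : k = j
      · subst hk
        cases c
        · simp only [Sum.elim_inr, blowCoord, Function.update_self, cond_false]
          exact (ht (some k)).div (ht none) fun u hu => (hs u hu).2.2.1
        · simp only [Sum.elim_inr, blowCoord, Function.update_self, cond_true]
          exact (ht none).div (ht (some k)) fun u hu => (hs u hu).2.2.1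
      · simp only [Sum.elim_inr, blowCoord, Function.update_of_ne hk]
        exact (continuous_blowLine i k).continuousOn.div (continuous_blowLine i j).continuousOn
          fun u hu => (hs u hu).2.2.2

instance : TopologicalSpace (BlowUp n L m) := (blowCore n L m).toTopologicalSpace

instance : ChartedSpace (Fin n ⊕ Fin (m + 1) → ℂ) (BlowUp n L m) :=
  (blowCore n L m).toChartedSpace

/-- The divisor at infinity `D_∞ = ℙ(L^{⊕(m+1)}) ⊆ X`. -/
def divisorAtInfinity (n : ℕ) (L : M → Type*) [∀ x, AddCommGroup (L x)] [∀ x, Module ℂ (L x)]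
    (m : ℕ) : Set (ProjBundle n L m) :=
  {p | ∀ w ∈ p.point.submodule, w.1 = 0}

/-- The zero section `P₀ = ℙ(𝒪) ⊆ X`. -/
def zeroSection (n : ℕ) (L : M → Type*) [∀ x, AddCommGroup (L x)] [∀ x, Module ℂ (L x)]
    (m : ℕ) : Set (ProjBundle n L m) :=
  {p | ∀ w ∈ p.point.submodule, w.2 = 0}

/-- The blow-down map `π̃ : X̃ → X`. -/
def blowDown (q : BlowUp n L m) : ProjBundle n L m := ⟨q.base, q.point⟩

/-- The exceptional divisor `E = π̃⁻¹(P₀)`. -/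
def exceptionalDivisor (n : ℕ) (L : M → Type*) [∀ x, AddCommGroup (L x)] [∀ x, Module ℂ (L x)]
    (m : ℕ) : Set (BlowUp n L m) :=
  blowDown ⁻¹' zeroSection n L m

/-- The class `π^*[θ] + c [D_∞]` on `X`, where `[θ]` is a class on `M`. -/
def bundleClass (n : ℕ) {M : Type*} [TopologicalSpace M] [ChartedSpace (Fin n → ℂ) M]
    (L : M → Type*) [∀ x, AddCommGroup (L x)] [∀ x, Module ℂ (L x)]
    [∀ x, TopologicalSpace (L x)] [TopologicalSpace (TotalSpace ℂ L)] [FiberBundle ℂ L]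
    [VectorBundle ℂ ℂ L] (m : ℕ) (Θ : DeRham2 (Fin n) M) (c : ℝ) :
    DeRham2 (Fin n ⊕ Fin (m + 1)) (ProjBundle n L m) :=
  pullbackClass ProjBundle.base Θ + c • divisorClass (divisorAtInfinity n L m)

/-- The class `α̃_s = π̃^*α - s[E]` on the blow-up. -/
def twistedClass (α : DeRham2 (Fin n ⊕ Fin (m + 1)) (ProjBundle n L m)) (s : ℝ) :
    DeRham2 (Fin n ⊕ Fin (m + 1)) (BlowUp n L m) :=
  pullbackClass blowDown α - s • divisorClass (exceptionalDivisor n L m)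

end Bundles

/-! ### Slopes -/

/-- For two classes `a`, `b` on a compact complex manifold of dimension `N = n + (m + 1)`, the slope
`N (a^{N-1} · b) / a^N`. -/
def jSlope {n m : ℕ} {Y : Type*} [TopologicalSpace Y]
    [ChartedSpace (Fin n ⊕ Fin (m + 1) → ℂ) Y] (a b : DeRham2 (Fin n ⊕ Fin (m + 1)) Y) : ℝ :=
  (m + n + 1) * topIntersection (Sum.inr 0) a b / topSelfIntersection a

section Invariant

variable {n m : ℕ} {M : Type*} [TopologicalSpace M] [ChartedSpace (Fin n → ℂ) M]
  {L : M → Type*} [∀ x, AddCommGroup (L x)] [∀ x, Module ℂ (L x)]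
  [∀ x, TopologicalSpace (L x)] [TopologicalSpace (TotalSpace ℂ L)] [FiberBundle ℂ L]
  [VectorBundle ℂ ℂ L]

/-- The slopes of the pairs `(α̃_s, π̃^*β)` with `α̃_s` ample (Kähler). -/
def ampleSlopes (α β : DeRham2 (Fin n ⊕ Fin (m + 1)) (ProjBundle n L m)) : Set ℝ :=
  {ζ | ∃ s : ℝ, IsKahlerClass (twistedClass α s) ∧
    ζ = jSlope (twistedClass α s) (pullbackClass blowDown β)}

/-- The invariant minimal slope `ζ_inv` of `(X, α, β)`. -/
def zetaInv (α β : DeRham2 (Fin n ⊕ Fin (m + 1)) (ProjBundle n L m)) : ℝ :=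
  sInf (ampleSlopes α β)

end Invariant

/-- `I_{m,n,s}(x) = ∫_s^x (1 + t)^n t^m dt`. -/
def integralI (m n : ℕ) (s x : ℝ) : ℝ := ∫ t in s..x, (1 + t) ^ n * t ^ m

/-- `μ_s = ((1 + a)^n a^m b + n I_{m,n-1,s}(a)) / I_{m,n,s}(a)`; for `n = 0` the term with `n - 1`
has the coefficient `0`. -/
def muS (m n : ℕ) (a b s : ℝ) : ℝ :=
  ((1 + a) ^ n * a ^ m * b + n * integralI m (n - 1) s a) / integralI m n s a

/-- `ψ` solves the boundary value problem
`ψ' + ψ (n / (1 + x) + m / x) = μ_s - n / (1 + x)` on `(s, a)`, `ψ(s) = 0`, `ψ(a) = b`. -/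
def SolvesODE (m n : ℕ) (a b s : ℝ) (ψ : ℝ → ℝ) : Prop :=
  ContinuousOn ψ (Icc s a) ∧ ψ s = 0 ∧ ψ a = b ∧
  ∀ x ∈ Ioo s a, HasDerivAt ψ
    (muS m n a b s - n / (1 + x) - ψ x * (n / (1 + x) + m / x)) x

/-- `λ`: the infimum of the `s ∈ [0, a)` for which this problem has a solution which is positive on
`(s, a]`. -/
def lam (m n : ℕ) (a b : ℝ) : ℝ :=
  sInf {s | s ∈ Ico 0 a ∧ ∃ ψ : ℝ → ℝ, SolvesODE m n a b s ψ ∧ ∀ x ∈ Ioc s a, 0 < ψ x}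

end

end KahlerProj

open KahlerProj

namespace KahlerProj

noncomputable section

/-! ### Linear algebra of top degree wedge products of 2-forms -/

section Wedge

variable {ι : Type*} [Fintype ι]

section TwoForms

variable {V : Type*} [NormedAddCommGroup V] [NormedSpace ℝ V] (θ : V [⋀^Fin 2]→L[ℝ] ℝ)

lemma two_add_left (a b c : V) : θ ![a + b, c] = θ ![a, c] + θ ![b, c] :=
  θ.toAlternatingMap.map_vecCons_add ![c] a b

lemma two_smul_left (r : ℝ) (a c : V) : θ ![r • a, c] = r * θ ![a, c] :=
  θ.toAlternatingMap.map_vecCons_smul ![c] r a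

lemma two_swap (a c : V) : θ ![a, c] = -θ ![c, a] := by
  have h := θ.toAlternatingMap.map_swap ![a, c] (i := 0) (j := 1) (by decide)
  have e : (![a, c] ∘ Equiv.swap (0 : Fin 2) 1) = ![c, a] := by
    ext i; fin_cases i <;> simp
  rw [e] at h
  have h' : θ ![c, a] = -θ ![a, c] := h
  rw [h', neg_neg]

lemma two_add_right (a b c : V) : θ ![c, a + b] = θ ![c, a] + θ ![c, b] := by
  rw [two_swap, two_add_left, two_swap θ c a, two_swap θ c b]; ring

lemma two_smul_right (r : ℝ) (a c : V) : θ ![c, r • a] = r * θ ![c, a] := by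
  rw [two_swap, two_smul_left, two_swap θ c a]; ring

lemma two_neg_right (a c : V) : θ ![c, -a] = -θ ![c, a] := by
  simpa using two_smul_right θ (-1) a c

lemma two_ext {θ θ' : V [⋀^Fin 2]→L[ℝ] ℝ} (h : ∀ a b, θ ![a, b] = θ' ![a, b]) : θ = θ' := by
  ext v
  have : v = ![v 0, v 1] := by ext i; fin_cases i <;> rfl
  rw [this]; exact h _ _

lemma two_comp {W : Type*} [NormedAddCommGroup W] [NormedSpace ℝ W] (T : W →L[ℝ] V) (a b : W) :
    θ.compContinuousLinearMap T ![a, b] = θ ![T a, T b] := by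
  rw [ContinuousAlternatingMap.compContinuousLinearMap_apply]
  congr 1; ext i; fin_cases i <;> rfl

end TwoForms

variable [DecidableEq ι]

/-- The multilinear map `v ↦ ∏ j, θ_j(v_{j,0}, v_{j,1})`. -/
def prodTwo {V : Type*} [NormedAddCommGroup V] [NormedSpace ℝ V] (θ : ι → V [⋀^Fin 2]→L[ℝ] ℝ) :
    MultilinearMap ℝ (fun _ : ι × Fin 2 => V) ℝ :=
  MultilinearMap.mk' (fun v => ∏ j, θ j ![v (j, 0), v (j, 1)])
    (by
      rintro v ⟨j, b⟩ x y
      simp only [← Finset.mul_prod_erase Finset.univ _ (Finset.mem_univ j)]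
      have h : ∀ z : V, ∏ i ∈ Finset.univ.erase j, θ i ![Function.update v (j, b) z (i, 0),
          Function.update v (j, b) z (i, 1)] =
          ∏ i ∈ Finset.univ.erase j, θ i ![v (i, 0), v (i, 1)] := fun z =>
        Finset.prod_congr rfl fun i hi => by
          rw [Function.update_of_ne, Function.update_of_ne] <;>
            simp [Finset.ne_of_mem_erase hi]
      rw [h, h, h, ← add_mul]
      congr 1
      fin_cases b
      · simp [two_add_left]
      · simp [two_add_right])
    (by
      rintro v ⟨j, b⟩ r x
      simp only [← Finset.mul_prod_erase Finset.univ _ (Finset.mem_univ j)]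
      have h : ∀ z : V, ∏ i ∈ Finset.univ.erase j, θ i ![Function.update v (j, b) z (i, 0),
          Function.update v (j, b) z (i, 1)] =
          ∏ i ∈ Finset.univ.erase j, θ i ![v (i, 0), v (i, 1)] := fun z =>
        Finset.prod_congr rfl fun i hi => by
          rw [Function.update_of_ne, Function.update_of_ne] <;>
            simp [Finset.ne_of_mem_erase hi]
      rw [h, h, smul_eq_mul, ← mul_assoc]
      congr 1
      fin_cases b
      · simp [two_smul_left]
      · simp [two_smul_right])

/-- The alternating map `2^N ⋀_j θ_j`. -/
def wedgeAlt {V : Type*} [NormedAddCommGroup V] [NormedSpace ℝ V] (θ : ι → V [⋀^Fin 2]→L[ℝ] ℝ) :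
    V [⋀^ι × Fin 2]→ₗ[ℝ] ℝ :=
  MultilinearMap.alternatization (prodTwo θ)

lemma wedgeAlt_apply {V : Type*} [NormedAddCommGroup V] [NormedSpace ℝ V]
    (θ : ι → V [⋀^Fin 2]→L[ℝ] ℝ) (v : ι × Fin 2 → V) :
    wedgeAlt θ v = ∑ σ : Equiv.Perm (ι × Fin 2),
      ((Equiv.Perm.sign σ : ℤ) : ℝ) * ∏ j : ι, θ j ![v (σ (j, 0)), v (σ (j, 1))] := by
  rw [wedgeAlt, MultilinearMap.alternatization_apply]
  refine Finset.sum_congr rfl fun σ _ => ?_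
  rw [Units.smul_def, zsmul_eq_mul]
  rfl

/-- The oriented real basis `e_j, √-1 e_j` of `ℂ^ι`. -/
def realBasis (ι : Type*) [Fintype ι] [DecidableEq ι] : Module.Basis (ι × Fin 2) ℝ (ι → ℂ) :=
  (Pi.basis fun _ : ι => Complex.basisOneI).reindex (Equiv.sigmaEquivProd ι (Fin 2))

lemma realBasis_apply (p : ι × Fin 2) :
    realBasis ι p = Pi.single p.1 (if p.2 = 0 then 1 else Complex.I) := by
  obtain ⟨j, b⟩ := p
  simp only [realBasis, Module.Basis.reindex_apply]
  change (Pi.basis fun _ : ι => Complex.basisOneI) ⟨j, b⟩ = _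
  rw [Pi.basis_apply]
  fin_cases b <;> simp

lemma wedgeDensity_eq (θ : ι → (ι → ℂ) [⋀^Fin 2]→L[ℝ] ℝ) :
    wedgeDensity θ = (2 ^ Fintype.card ι : ℝ)⁻¹ * wedgeAlt θ (realBasis ι) := by
  simp only [wedgeDensity, wedgeAlt_apply, realBasis_apply]

lemma wedgeDensity_comp (θ : ι → (ι → ℂ) [⋀^Fin 2]→L[ℝ] ℝ) (T : (ι → ℂ) →L[ℝ] (ι → ℂ)) :
    wedgeDensity (fun j => (θ j).compContinuousLinearMap T) = T.det * wedgeDensity θ := by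
  have h1 : wedgeAlt (fun j => (θ j).compContinuousLinearMap T) (realBasis ι) =
      wedgeAlt θ ((T : (ι → ℂ) →ₗ[ℝ] (ι → ℂ)) ∘ realBasis ι) := by
    simp only [wedgeAlt_apply, two_comp]; rfl
  have h2 := (wedgeAlt θ).eq_smul_basis_det (realBasis ι)
  rw [wedgeDensity_eq, wedgeDensity_eq, h1, h2]
  simp only [AlternatingMap.smul_apply, Module.Basis.det_comp, Module.Basis.det_self, smul_eq_mul,
    ContinuousLinearMap.det]
  ring

lemma wedgeDensity_perm (θ : ι → (ι → ℂ) [⋀^Fin 2]→L[ℝ] ℝ) (ρ : Equiv.Perm ι) :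
    wedgeDensity (fun j => θ (ρ j)) = wedgeDensity θ := by
  rw [wedgeDensity_eq, wedgeDensity_eq, wedgeAlt_apply, wedgeAlt_apply]
  congr 1
  let P : Equiv.Perm (ι × Fin 2) := Equiv.prodCongrLeft fun _ => ρ
  have hP : Equiv.Perm.sign P = 1 := by
    rw [Equiv.Perm.sign_prodCongrLeft]
    simp
  refine Fintype.sum_equiv (Equiv.mulRight P⁻¹) _ _ fun σ => ?_
  rw [Equiv.coe_mulRight, Equiv.Perm.sign_mul, Equiv.Perm.sign_inv, hP, mul_one]
  congr 1
  refine Fintype.prod_equiv ρ _ _ fun j => ?_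
  have : ∀ b, P⁻¹ (ρ j, b) = (j, b) := fun b => by
    rw [Equiv.Perm.inv_eq_iff_eq]; rfl
  simp only [Equiv.Perm.coe_mul, Function.comp_apply, this]

/-- `wedgeDensity` as a multilinear map of the 2-forms. -/
def wedgeMultilinear (ι : Type*) [Fintype ι] [DecidableEq ι] :
    MultilinearMap ℝ (fun _ : ι => (ι → ℂ) [⋀^Fin 2]→L[ℝ] ℝ) ℝ :=
  MultilinearMap.mk' wedgeDensity
    (by
      intro θ j x y
      simp only [wedgeDensity_eq, wedgeAlt_apply, ← mul_add, ← Finset.sum_add_distrib]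
      congr 1
      refine Finset.sum_congr rfl fun σ _ => ?_
      congr 1
      simp only [← Finset.mul_prod_erase Finset.univ _ (Finset.mem_univ j), Function.update_self,
        ContinuousAlternatingMap.add_apply, add_mul]
      congr 2 <;> exact Finset.prod_congr rfl fun i hi => by
        rw [Function.update_of_ne (Finset.ne_of_mem_erase hi),
          Function.update_of_ne (Finset.ne_of_mem_erase hi)])
    (by
      intro θ j r x
      simp only [wedgeDensity_eq, wedgeAlt_apply, smul_eq_mul, Finset.mul_sum]
      refine Finset.sum_congr rfl fun σ _ => ?_
      simp only [← Finset.mul_prod_erase Finset.univ _ (Finset.mem_univ j), Function.update_self,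
        ContinuousAlternatingMap.smul_apply, smul_eq_mul]
      have h : ∀ z, ∏ i ∈ Finset.univ.erase j, (Function.update θ j z i)
          ![realBasis ι (σ (i, 0)), realBasis ι (σ (i, 1))] = ∏ i ∈ Finset.univ.erase j, (θ i)
          ![realBasis ι (σ (i, 0)), realBasis ι (σ (i, 1))] := fun z =>
        Finset.prod_congr rfl fun i hi => by
          rw [Function.update_of_ne (Finset.ne_of_mem_erase hi)]
      rw [h, h]; ring)

lemma wedgeMultilinear_apply (θ : ι → (ι → ℂ) [⋀^Fin 2]→L[ℝ] ℝ) :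
    wedgeMultilinear ι θ = wedgeDensity θ := rfl

/-- The wedge product of the decomposable forms `c_{j,0} ∧ c_{j,1}` is a determinant. -/
lemma wedgeAlt_decomposable {V : Type*} [NormedAddCommGroup V] [NormedSpace ℝ V]
    (θ : ι → V [⋀^Fin 2]→L[ℝ] ℝ) (c : ι × Fin 2 → V → ℝ)
    (h : ∀ j v w, θ j ![v, w] = c (j, 0) v * c (j, 1) w - c (j, 0) w * c (j, 1) v)
    (v : ι × Fin 2 → V) :
    wedgeAlt θ v = 2 ^ Fintype.card ι * (Matrix.of fun q p => c p (v q)).det := by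
  have h2 : ∀ (σ : Equiv.Perm (ι × Fin 2)) j, θ j ![v (σ (j, 0)), v (σ (j, 1))] =
      ∑ τ : Equiv.Perm (Fin 2), ((Equiv.Perm.sign τ : ℤ) : ℝ) *
        ∏ b, c (j, b) (v (σ (j, τ b))) := by
    intro σ j
    have := Matrix.det_apply' (Matrix.of fun b b' : Fin 2 => c (j, b') (v (σ (j, b))))
    rw [Matrix.det_fin_two] at this
    simp only [Matrix.of_apply] at this
    rw [h, ← this]; ring
  simp only [wedgeAlt_apply, h2]
  simp only [Finset.prod_univ_sum, Fintype.piFinset_univ, Finset.mul_sum]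
  rw [Finset.sum_comm]
  have h3 : ∀ τ : ι → Equiv.Perm (Fin 2), ∑ σ : Equiv.Perm (ι × Fin 2),
      ((Equiv.Perm.sign σ : ℤ) : ℝ) * ∏ j, (((Equiv.Perm.sign (τ j) : ℤ) : ℝ) *
        ∏ b, c (j, b) (v (σ (j, τ j b)))) = (Matrix.of fun q p => c p (v q)).det := by
    intro τ
    rw [Matrix.det_apply']
    let P : Equiv.Perm (ι × Fin 2) := Equiv.prodCongrRight τ
    have hP : Equiv.Perm.sign P = ∏ j, Equiv.Perm.sign (τ j) := Equiv.Perm.sign_prodCongrRight τ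
    refine Fintype.sum_equiv (Equiv.mulRight P) _ _ fun σ => ?_
    rw [Equiv.coe_mulRight, Equiv.Perm.sign_mul, hP, Finset.prod_mul_distrib]
    push_cast
    rw [mul_assoc]
    congr 2
    rw [← Fintype.prod_prod_type' (f := fun j b => c (j, b) (v (σ (j, τ j b))))]
    rfl
  rw [Finset.sum_congr rfl fun τ _ => h3 τ]
  simp [Fintype.card_perm]

/-- The 2-form `a ∧ b`. -/
def wedge2 {V : Type*} [NormedAddCommGroup V] [NormedSpace ℝ V] (a b : V →L[ℝ] ℝ) :
    V [⋀^Fin 2]→L[ℝ] ℝ :=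
  ContinuousAlternatingMap.alternatizeUncurryFin
    ((ContinuousAlternatingMap.ofSubsingletonLIE (𝕜 := ℝ) (E := V) (F := ℝ)
      (0 : Fin 1)).toContinuousLinearEquiv.toContinuousLinearMap.comp (a.smulRight b))

lemma alternatizeUncurryFin_two {V : Type*} [NormedAddCommGroup V] [NormedSpace ℝ V]
    (f : V →L[ℝ] V [⋀^Fin 1]→L[ℝ] ℝ) (v w : V) :
    ContinuousAlternatingMap.alternatizeUncurryFin f ![v, w] = f v ![w] - f w ![v] := by
  rw [ContinuousAlternatingMap.alternatizeUncurryFin_apply, Fin.sum_univ_two]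
  have h0 : Fin.removeNth (α := fun _ => V) 0 ![v, w] = ![w] := by
    ext i; fin_cases i; rfl
  have h1 : Fin.removeNth (α := fun _ => V) 1 ![v, w] = ![v] := by
    ext i; fin_cases i; rfl
  rw [h0, h1]
  simp [sub_eq_add_neg]

lemma wedge2_apply {V : Type*} [NormedAddCommGroup V] [NormedSpace ℝ V] (a b : V →L[ℝ] ℝ)
    (v w : V) : wedge2 a b ![v, w] = a v * b w - a w * b v :=
  alternatizeUncurryFin_two _ v w

/-- The form `dx_k ∧ dy_k` on `ℂ^ι`. -/
def areaForm (k : ι) : (ι → ℂ) [⋀^Fin 2]→L[ℝ] ℝ :=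
  wedge2 (Complex.reCLM.comp (ContinuousLinearMap.proj (R := ℝ) (φ := fun _ : ι => ℂ) k))
    (Complex.imCLM.comp (ContinuousLinearMap.proj (R := ℝ) (φ := fun _ : ι => ℂ) k))

lemma areaForm_apply (k : ι) (v w : ι → ℂ) :
    areaForm k ![v, w] = (v k).re * (w k).im - (w k).re * (v k).im :=
  wedge2_apply _ _ v w

lemma wedgeDensity_areaForm (r : ι → ι) :
    wedgeDensity (fun j => areaForm (r j)) = if Function.Injective r then 1 else 0 := by
  have key : ∀ r : ι → ι, wedgeDensity (fun j => areaForm (r j)) =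
      (Matrix.of fun q p : ι × Fin 2 => if q = (r p.1, p.2) then (1 : ℝ) else 0).det := by
    intro r
    rw [wedgeDensity_eq, wedgeAlt_decomposable _
      (fun p v => if p.2 = 0 then (v (r p.1)).re else (v (r p.1)).im), ← mul_assoc,
      inv_mul_cancel₀ (by positivity), one_mul]
    · congr 1
      ext ⟨j, b⟩ ⟨k, d⟩
      simp only [Matrix.of_apply, realBasis_apply, Prod.mk.injEq]
      by_cases hj : j = r k
      · subst hj
        fin_cases b <;> fin_cases d <;> simp
      · have : r k ≠ j := fun h => hj h.symm
        fin_cases b <;> fin_cases d <;> simp [hj, this]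
    · intro j v w
      simp [areaForm_apply]
  split_ifs with h
  · have hb : Function.Bijective r := Finite.injective_iff_bijective.1 h
    have := wedgeDensity_perm (fun j => areaForm j) (Equiv.ofBijective r hb)
    simp only [Equiv.ofBijective_apply] at this
    refine this.trans ((key id).trans ?_)
    rw [show (Matrix.of fun q p : ι × Fin 2 => if q = (id p.1, p.2) then (1 : ℝ) else 0) = 1 by
      ext p q; simp [Matrix.one_apply], Matrix.det_one]
  · obtain ⟨j, k, hjk, hne⟩ := Function.not_injective_iff.1 h
    rw [key]
    refine Matrix.det_zero_of_column_eq (i := (j, 0)) (j := (k, 0)) (by simpa using hne) fun q => ?_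
    simp [hjk]

lemma wedgeDensity_diagonal (d : ι → ℝ) :
    wedgeDensity (fun _ : ι => ∑ k, d k • areaForm k) = (Fintype.card ι).factorial * ∏ k, d k := by
  rw [← wedgeMultilinear_apply, MultilinearMap.map_sum]
  simp only [MultilinearMap.map_smul_univ, wedgeMultilinear_apply, wedgeDensity_areaForm]
  rw [← Fintype.sum_of_injective (fun σ : Equiv.Perm ι => (σ : ι → ι)) DFunLike.coe_injective
    (fun _ => ∏ k, d k)]
  · simp [Fintype.card_perm]
  · intro r hr
    rw [if_neg, smul_zero]
    intro h
    exact hr ⟨Equiv.ofBijective r (Finite.injective_iff_bijective.1 h), rfl⟩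
  · intro σ
    rw [if_pos σ.injective, smul_eq_mul, mul_one]
    exact (Equiv.prod_comp σ d).symm

/-- A form invariant under the complex structure is determined by its values on complex lines. -/
lemma eq_of_invariant {θ θ' : (ι → ℂ) [⋀^Fin 2]→L[ℝ] ℝ}
    (h : ∀ v w, θ ![Complex.I • v, Complex.I • w] = θ ![v, w])
    (h' : ∀ v w, θ' ![Complex.I • v, Complex.I • w] = θ' ![v, w])
    (hq : ∀ v, θ ![v, Complex.I • v] = θ' ![v, Complex.I • v]) : θ = θ' := by
  have key : ∀ (η : (ι → ℂ) [⋀^Fin 2]→L[ℝ] ℝ),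
      (∀ v w, η ![Complex.I • v, Complex.I • w] = η ![v, w]) → ∀ v w,
      2 * η ![v, Complex.I • w] = η ![v + w, Complex.I • (v + w)] - η ![v, Complex.I • v]
        - η ![w, Complex.I • w] := by
    intro η hη v w
    have h1 : η ![w, Complex.I • v] = η ![v, Complex.I • w] := by
      rw [← hη, smul_smul, Complex.I_mul_I, neg_one_smul, two_neg_right, two_swap, neg_neg]
    rw [smul_add, two_add_left, two_add_right, two_add_right, h1]; ring
  refine two_ext fun v w => ?_
  have e : w = Complex.I • (-(Complex.I • w)) := by
    rw [smul_neg, smul_smul, Complex.I_mul_I, neg_one_smul, neg_neg]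
  have h1 := key θ h v (-(Complex.I • w))
  have h2 := key θ' h' v (-(Complex.I • w))
  rw [hq, hq, hq, ← h2, ← e] at h1
  linarith

lemma det_restrictScalars_eq (T : (ι → ℂ) →L[ℂ] (ι → ℂ)) :
    (T.restrictScalars ℝ).det = ‖T.det‖ ^ 2 := by
  rw [← Complex.normSq_eq_norm_sq]
  simp [ContinuousLinearMap.det, LinearMap.det_restrictScalars, Algebra.norm_complex_eq]

/-- The top wedge power of the form with Hermitian matrix `h`. -/
theorem wedgeDensity_hermitian {θ : (ι → ℂ) [⋀^Fin 2]→L[ℝ] ℝ}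
    (hJ : ∀ v w, θ ![Complex.I • v, Complex.I • w] = θ ![v, w]) {h : Matrix ι ι ℂ}
    (hh : h.IsHermitian) (hq : ∀ v, θ ![v, Complex.I • v] = (star v ⬝ᵥ (h.mulVec v)).re) :
    wedgeDensity (fun _ : ι => θ) = (Fintype.card ι).factorial * h.det.re := by
  obtain ⟨U, d, hs⟩ : ∃ (U : Matrix ι ι ℂ) (d : ι → ℝ),
      h = U * Matrix.diagonal (fun k => (d k : ℂ)) * star U := by
    refine ⟨hh.eigenvectorUnitary, hh.eigenvalues, ?_⟩
    conv_lhs => rw [hh.spectral_theorem, Unitary.conjStarAlgAut_apply]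
    rfl
  let T : (ι → ℂ) →L[ℂ] (ι → ℂ) := LinearMap.toContinuousLinearMap (Matrix.toLin' (star U))
  have hT : ∀ v, T v = (star U).mulVec v := fun v => rfl
  have key : θ = (∑ k, d k • areaForm k).compContinuousLinearMap
      (T.restrictScalars ℝ) := by
    refine eq_of_invariant hJ ?_ ?_
    · intro v w
      simp only [two_comp, ContinuousLinearMap.coe_restrictScalars', map_smul,
        ContinuousAlternatingMap.sum_apply, ContinuousAlternatingMap.smul_apply, areaForm_apply]
      refine Finset.sum_congr rfl fun k _ => ?_
      congr 1
      simp; ring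
    · intro v
      rw [hq, two_comp]
      simp only [ContinuousLinearMap.coe_restrictScalars', map_smul,
        ContinuousAlternatingMap.sum_apply, ContinuousAlternatingMap.smul_apply, areaForm_apply]
      have e : star v ⬝ᵥ (h.mulVec v) = star (T v) ⬝ᵥ
          (Matrix.diagonal (fun k => (d k : ℂ))).mulVec (T v) := by
        rw [hs, hT, Matrix.star_mulVec, Matrix.star_eq_conjTranspose, Matrix.conjTranspose_conjTranspose,
          ← Matrix.dotProduct_mulVec, Matrix.mulVec_mulVec, Matrix.mulVec_mulVec, mul_assoc]
      rw [e, dotProduct, Complex.re_sum]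
      refine Finset.sum_congr rfl fun k _ => ?_
      simp [Matrix.mulVec_diagonal]
      ring
  have e1 : (fun _ : ι => θ) = fun _ : ι => (∑ k, d k •
      areaForm k).compContinuousLinearMap (T.restrictScalars ℝ) := by rw [← key]
  rw [e1, wedgeDensity_comp (fun _ => ∑ k, d k • areaForm k), wedgeDensity_diagonal,
    det_restrictScalars_eq]
  have e2 : T.det = (star U).det := by
    simp [ContinuousLinearMap.det, T]
  have e3 : U.det = star (star U).det := by
    rw [← Matrix.det_conjTranspose, Matrix.star_eq_conjTranspose, Matrix.conjTranspose_conjTranspose]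
  rw [e2]
  have e4 : h.det.re = ‖(star U).det‖ ^ 2 * ∏ k, d k := by
    conv_lhs => rw [hs, Matrix.det_mul, Matrix.det_mul, Matrix.det_diagonal, e3]
    rw [mul_right_comm, ← Complex.ofReal_prod, Complex.re_mul_ofReal, Complex.star_def,
      ← Complex.normSq_eq_conj_mul_self, Complex.ofReal_re, Complex.normSq_eq_norm_sq]
  rw [e4]; ring

end Wedge

end

end KahlerProj

namespace KahlerProj

noncomputable section

/-! ### Smoothness of maps with values in alternating forms -/

section AlternatingSmooth

variable {V W E : Type*} [NormedAddCommGroup V] [NormedSpace ℝ V] [FiniteDimensional ℝ V]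
  [NormedAddCommGroup W] [NormedSpace ℝ W] [FiniteDimensional ℝ W]
  [NormedAddCommGroup E] [NormedSpace ℝ E] {k : ℕ} {r : ℕ∞ω}

lemma two_le_infty : (2 : ℕ∞ω) ≤ ∞ := by
  exact WithTop.coe_le_coe.2 (le_top : (2 : ℕ∞) ≤ ⊤)

/-- Evaluation of alternating forms on the vectors of a basis. -/
def evalBasis (V : Type*) [NormedAddCommGroup V] [NormedSpace ℝ V] [FiniteDimensional ℝ V]
    (k : ℕ) : (V [⋀^Fin k]→L[ℝ] ℝ) →ₗ[ℝ] ((Fin k → Fin (Module.finrank ℝ V)) → ℝ) where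
  toFun A := fun v => A fun i => Module.finBasis ℝ V (v i)
  map_add' _ _ := rfl
  map_smul' _ _ := rfl

lemma evalBasis_injective : Function.Injective (evalBasis V k) := by
  intro A B h
  refine ContinuousAlternatingMap.toAlternatingMap_injective ?_
  refine Module.Basis.ext_alternating (Module.finBasis ℝ V) fun v _ => ?_
  exact congrFun h v

lemma contDiffAt_alternating {f : E → V [⋀^Fin k]→L[ℝ] ℝ} {x : E}
    (h : ∀ v, ContDiffAt ℝ r (fun u => f u v) x) : ContDiffAt ℝ r f x := by
  obtain ⟨P, hP⟩ := LinearMap.exists_leftInverse_of_injective (evalBasis V k)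
    (LinearMap.ker_eq_bot.2 evalBasis_injective)
  have h1 : f = fun u => P (evalBasis V k (f u)) := by
    ext1 u; exact (LinearMap.congr_fun hP (f u)).symm
  rw [h1]
  exact (LinearMap.toContinuousLinearMap P).contDiff.contDiffAt.comp x
    (contDiffAt_pi.2 fun v => h _)

lemma contDiffAt_alternating_apply_const {f : E → V [⋀^Fin k]→L[ℝ] ℝ} {x : E}
    (h : ContDiffAt ℝ r f x) (v : Fin k → V) : ContDiffAt ℝ r (fun u => f u v) x :=
  (ContinuousAlternatingMap.apply ℝ V ℝ v).contDiff.contDiffAt.comp x h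

lemma contDiffAt_alternating_apply {f : E → V [⋀^Fin k]→L[ℝ] ℝ} {w : E → Fin k → V} {x : E}
    (h : ContDiffAt ℝ r f x) (hw : ∀ i, ContDiffAt ℝ r (fun u => w u i) x) :
    ContDiffAt ℝ r (fun u => f u (w u)) x := by
  set b := Module.finBasis ℝ V
  have e : (fun u => f u (w u)) = fun u => ∑ s : Fin k → Fin (Module.finrank ℝ V),
      (∏ i, b.repr (w u i) (s i)) * f u fun i => b (s i) := by
    ext u
    conv_lhs => rw [show w u = fun i => ∑ j, b.repr (w u i) j • b j from
      funext fun i => (b.sum_repr (w u i)).symm]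
    have := (f u).toMultilinearMap.map_sum (g := fun i j => b.repr (w u i) j • b j)
    refine this.trans (Finset.sum_congr rfl fun s _ => ?_)
    exact (f u).toMultilinearMap.map_smul_univ _ _
  rw [e]
  refine ContDiffAt.sum fun s _ => ContDiffAt.mul (contDiffAt_prod fun i _ => ?_)
    (contDiffAt_alternating_apply_const h _)
  exact (LinearMap.toContinuousLinearMap (b.coord (s i))).contDiff.contDiffAt.comp x (hw i)

lemma contDiffAt_compContinuousLinearMap {f : E → V [⋀^Fin k]→L[ℝ] ℝ} {T : E → W →L[ℝ] V}
    {x : E} (h : ContDiffAt ℝ r f x) (hT : ContDiffAt ℝ r T x) :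
    ContDiffAt ℝ r (fun u => (f u).compContinuousLinearMap (T u)) x :=
  contDiffAt_alternating fun v => contDiffAt_alternating_apply h (w := fun u i => T u (v i)) fun i =>
    hT.clm_apply contDiffAt_const

end AlternatingSmooth

/-! ### Complex manifolds: transition maps and expressions of forms in charts -/

section Charts

variable {ι : Type*} [Fintype ι] {Y : Type*} [TopologicalSpace Y] [ChartedSpace (ι → ℂ) Y]
  {κ : Type*} [Fintype κ] {Z : Type*} [TopologicalSpace Z] [ChartedSpace (κ → ℂ) Z]

lemma contDiffOn_transition [IsManifold 𝓘(ℂ, ι → ℂ) ω Y] {c c' : OpenPartialHomeomorph Y (ι → ℂ)}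
    (hc : c ∈ atlas (ι → ℂ) Y) (hc' : c' ∈ atlas (ι → ℂ) Y) :
    ContDiffOn ℂ ω (c' ∘ c.symm) (c.symm.trans c').source := by
  have h := HasGroupoid.compatible (G := contDiffGroupoid ω 𝓘(ℂ, ι → ℂ)) hc hc'
  exact contMDiffOn_iff_contDiffOn.1 (contMDiffOn_of_mem_contDiffGroupoid h)

instance isManifold_real [h : IsManifold 𝓘(ℂ, ι → ℂ) ω Y] : IsManifold 𝓘(ℝ, ι → ℂ) ∞ Y := by
  refine isManifold_of_contDiffOn _ _ _ fun e e' he he' => ?_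
  have := ((contDiffOn_transition he he').restrict_scalars ℝ).of_le (m := ∞) le_top
  simpa using this

variable [IsManifold 𝓘(ℂ, ι → ℂ) ω Y] [IsManifold 𝓘(ℂ, κ → ℂ) ω Z]

lemma contDiffAt_transition {c c' : OpenPartialHomeomorph Y (ι → ℂ)}
    (hc : c ∈ atlas (ι → ℂ) Y) (hc' : c' ∈ atlas (ι → ℂ) Y) {u : ι → ℂ} (hu : u ∈ c.target)
    (hu' : c.symm u ∈ c'.source) : ContDiffAt ℂ ω (c' ∘ c.symm) u :=
  (contDiffOn_transition hc hc').contDiffAt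
    ((c.symm.trans c').open_source.mem_nhds (by simp [hu, hu']))

lemma contDiffAt_transition_real {c c' : OpenPartialHomeomorph Y (ι → ℂ)}
    (hc : c ∈ atlas (ι → ℂ) Y) (hc' : c' ∈ atlas (ι → ℂ) Y) {u : ι → ℂ} (hu : u ∈ c.target)
    (hu' : c.symm u ∈ c'.source) : ContDiffAt ℝ ∞ (c' ∘ c.symm) u :=
  ((contDiffAt_transition hc hc' hu hu').restrict_scalars ℝ).of_le le_top

lemma mem_maximalAtlas_real {c : OpenPartialHomeomorph Y (ι → ℂ)} (hc : c ∈ atlas (ι → ℂ) Y) :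
    c ∈ IsManifold.maximalAtlas 𝓘(ℝ, ι → ℂ) ∞ Y :=
  IsManifold.subset_maximalAtlas hc

lemma mdifferentiableAt_chart_symm {c : OpenPartialHomeomorph Y (ι → ℂ)}
    (hc : c ∈ atlas (ι → ℂ) Y) {u : ι → ℂ} (hu : u ∈ c.target) :
    MDifferentiableAt 𝓘(ℝ, ι → ℂ) 𝓘(ℝ, ι → ℂ) c.symm u :=
  (contMDiffAt_symm_of_mem_maximalAtlas (mem_maximalAtlas_real hc) hu).mdifferentiableAt (by simp)

lemma mdifferentiableAt_chart {c : OpenPartialHomeomorph Y (ι → ℂ)}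
    (hc : c ∈ atlas (ι → ℂ) Y) {y : Y} (hy : y ∈ c.source) :
    MDifferentiableAt 𝓘(ℝ, ι → ℂ) 𝓘(ℝ, ι → ℂ) c y :=
  (contMDiffAt_of_mem_maximalAtlas (mem_maximalAtlas_real hc) hy).mdifferentiableAt (by simp)

lemma eventually_mem_overlap {c : OpenPartialHomeomorph Y (ι → ℂ)} {u : ι → ℂ}
    (hu : u ∈ c.target) {U : Set Y} (hU : IsOpen U) (hu' : c.symm u ∈ U) :
    ∀ᶠ u' in 𝓝 u, u' ∈ c.target ∧ c.symm u' ∈ U :=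
  (c.isOpen_inter_preimage_symm hU).mem_nhds ⟨hu, hu'⟩

lemma form_comp_congr {k : ℕ} {W : Type*} [NormedAddCommGroup W] [NormedSpace ℝ W]
    (θ : RealForm ι Y k) {y y' : Y} (h : y = y') {T T' : W →L[ℝ] (ι → ℂ)} (hT : T = T') :
    (θ y).compContinuousLinearMap T = (θ y').compContinuousLinearMap T' := by
  rw [h, hT]

lemma inChart_pullbackForm {k : ℕ} (θ : RealForm ι Y k) {f : Z → Y}
    {c : OpenPartialHomeomorph Z (κ → ℂ)} {c' : OpenPartialHomeomorph Y (ι → ℂ)}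
    (hc : c ∈ atlas (κ → ℂ) Z) (hc' : c' ∈ atlas (ι → ℂ) Y) {u : κ → ℂ} (hu : u ∈ c.target)
    (hf : MDifferentiableAt 𝓘(ℝ, κ → ℂ) 𝓘(ℝ, ι → ℂ) f (c.symm u))
    (hu' : f (c.symm u) ∈ c'.source) :
    inChart (pullbackForm f θ) c u =
      (inChart θ c' (c' (f (c.symm u)))).compContinuousLinearMap (fderiv ℝ (c' ∘ f ∘ c.symm) u) := by
  have h1 : MDifferentiableAt 𝓘(ℝ, κ → ℂ) 𝓘(ℝ, ι → ℂ) (f ∘ c.symm) u :=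
    hf.comp u (mdifferentiableAt_chart_symm hc hu)
  have h2 : mfderiv 𝓘(ℝ, κ → ℂ) 𝓘(ℝ, ι → ℂ) (f ∘ c.symm) u =
      (mfderiv 𝓘(ℝ, κ → ℂ) 𝓘(ℝ, ι → ℂ) f (c.symm u)).comp
        (mfderiv 𝓘(ℝ, κ → ℂ) 𝓘(ℝ, κ → ℂ) c.symm u) :=
    mfderiv_comp u hf (mdifferentiableAt_chart_symm hc hu)
  have h3 : MDifferentiableAt 𝓘(ℝ, κ → ℂ) 𝓘(ℝ, ι → ℂ) (c' ∘ (f ∘ c.symm)) u :=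
    (mdifferentiableAt_chart hc' hu').comp u h1
  have h4 : mfderiv 𝓘(ℝ, κ → ℂ) 𝓘(ℝ, ι → ℂ) (c'.symm ∘ (c' ∘ (f ∘ c.symm))) u =
      (mfderiv 𝓘(ℝ, ι → ℂ) 𝓘(ℝ, ι → ℂ) c'.symm (c' (f (c.symm u)))).comp
        (mfderiv 𝓘(ℝ, κ → ℂ) 𝓘(ℝ, ι → ℂ) (c' ∘ (f ∘ c.symm)) u) :=
    mfderiv_comp u (mdifferentiableAt_chart_symm hc' (c'.map_source hu')) h3
  have h5 : (c'.symm ∘ (c' ∘ (f ∘ c.symm))) =ᶠ[𝓝 u] f ∘ c.symm := by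
    filter_upwards [h1.continuousAt.preimage_mem_nhds (c'.open_source.mem_nhds hu')] with u' hu''
    exact c'.left_inv hu''
  have h6 : (mfderiv 𝓘(ℝ, κ → ℂ) 𝓘(ℝ, ι → ℂ) (c'.symm ∘ (c' ∘ (f ∘ c.symm))) u :
      (κ → ℂ) →L[ℝ] (ι → ℂ)) = mfderiv 𝓘(ℝ, κ → ℂ) 𝓘(ℝ, ι → ℂ) (f ∘ c.symm) u :=
    h5.mfderiv_eq
  have h7 : mfderiv 𝓘(ℝ, κ → ℂ) 𝓘(ℝ, ι → ℂ) (c' ∘ (f ∘ c.symm)) u =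
    fderiv ℝ (c' ∘ f ∘ c.symm) u := mfderiv_eq_fderiv
  rw [h4, h2, h7] at h6
  have hl : c'.symm (c' (f (c.symm u))) = f (c.symm u) := c'.left_inv hu'
  let A : (κ → ℂ) →L[ℝ] (ι → ℂ) := mfderiv 𝓘(ℝ, κ → ℂ) 𝓘(ℝ, ι → ℂ) f (c.symm u)
  let B : (κ → ℂ) →L[ℝ] (κ → ℂ) := mfderiv 𝓘(ℝ, κ → ℂ) 𝓘(ℝ, κ → ℂ) c.symm u
  let C : (ι → ℂ) →L[ℝ] (ι → ℂ) :=
    mfderiv 𝓘(ℝ, ι → ℂ) 𝓘(ℝ, ι → ℂ) c'.symm (c' (f (c.symm u)))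
  let D : (κ → ℂ) →L[ℝ] (ι → ℂ) := fderiv ℝ (c' ∘ f ∘ c.symm) u
  have h8 : A.comp B = C.comp D := h6.symm
  exact form_comp_congr θ hl.symm h8

lemma inChart_trans {k : ℕ} (θ : RealForm ι Y k) {c c' : OpenPartialHomeomorph Y (ι → ℂ)}
    (hc : c ∈ atlas (ι → ℂ) Y) (hc' : c' ∈ atlas (ι → ℂ) Y) {u : ι → ℂ} (hu : u ∈ c.target)
    (hu' : c.symm u ∈ c'.source) :
    inChart θ c u =
      (inChart θ c' (c' (c.symm u))).compContinuousLinearMap (fderiv ℝ (c' ∘ c.symm) u) := by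
  have h := inChart_pullbackForm θ (f := id) hc hc' hu mdifferentiableAt_id hu'
  rw [Function.id_comp] at h
  refine Eq.trans ?_ h
  let A : (ι → ℂ) →L[ℝ] (ι → ℂ) := mfderiv 𝓘(ℝ, ι → ℂ) 𝓘(ℝ, ι → ℂ) (id : Y → Y) (c.symm u)
  let B : (ι → ℂ) →L[ℝ] (ι → ℂ) := mfderiv 𝓘(ℝ, ι → ℂ) 𝓘(ℝ, ι → ℂ) c.symm u
  have hA : A = ContinuousLinearMap.id ℝ _ := mfderiv_id
  have hB : B = A.comp B := by rw [hA]; rfl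
  exact form_comp_congr θ rfl hB

/-- The form given in each chart `c` by `F c`. -/
def formOfCharts {k : ℕ} (F : OpenPartialHomeomorph Y (ι → ℂ) → (ι → ℂ) → (ι → ℂ) [⋀^Fin k]→L[ℝ] ℝ) :
    RealForm ι Y k :=
  fun y => F (chartAt (ι → ℂ) y) (chartAt (ι → ℂ) y y)

lemma inChart_chartAt {k : ℕ} (θ : RealForm ι Y k) (y : Y) :
    inChart θ (chartAt (ι → ℂ) y) (chartAt (ι → ℂ) y y) = θ y := by
  have hl : (chartAt (ι → ℂ) y).symm (chartAt (ι → ℂ) y y) = y :=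
    (chartAt (ι → ℂ) y).left_inv (mem_chart_source _ y)
  let A : (ι → ℂ) →L[ℝ] (ι → ℂ) :=
    mfderiv 𝓘(ℝ, ι → ℂ) 𝓘(ℝ, ι → ℂ) (chartAt (ι → ℂ) y).symm (chartAt (ι → ℂ) y y)
  have h : A = ContinuousLinearMap.id ℝ _ := by
    have hm := mdifferentiableAt_chart_symm (chart_mem_atlas (ι → ℂ) y)
      (mem_chart_target (ι → ℂ) y)
    refine hm.mfderiv.trans ?_
    simp only [writtenInExtChartAt, mfld_simps, fderivWithin_univ]
    rw [hl]
    have : (chartAt (ι → ℂ) y ∘ (chartAt (ι → ℂ) y).symm) =ᶠ[𝓝 (chartAt (ι → ℂ) y y)] id := by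
      filter_upwards [(chartAt (ι → ℂ) y).open_target.mem_nhds (mem_chart_target (ι → ℂ) y)]
        with u hu using (chartAt (ι → ℂ) y).right_inv hu
    exact this.fderiv_eq.trans fderiv_id
  exact form_comp_congr θ hl h

lemma inChart_formOfCharts {k : ℕ}
    {F : OpenPartialHomeomorph Y (ι → ℂ) → (ι → ℂ) → (ι → ℂ) [⋀^Fin k]→L[ℝ] ℝ}
    (hF : ∀ c ∈ atlas (ι → ℂ) Y, ∀ c' ∈ atlas (ι → ℂ) Y, ∀ u ∈ c.target, c.symm u ∈ c'.source →
      F c u = (F c' (c' (c.symm u))).compContinuousLinearMap (fderiv ℝ (c' ∘ c.symm) u))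
    {c : OpenPartialHomeomorph Y (ι → ℂ)} (hc : c ∈ atlas (ι → ℂ) Y) {u : ι → ℂ}
    (hu : u ∈ c.target) : inChart (formOfCharts F) c u = F c u := by
  rw [inChart_trans _ hc (chart_mem_atlas (ι → ℂ) (c.symm u)) hu (mem_chart_source _ _),
    inChart_chartAt, hF c hc _ (chart_mem_atlas (ι → ℂ) (c.symm u)) u hu (mem_chart_source _ _)]
  rfl

lemma form_eq_of_inChart {k : ℕ} {θ θ' : RealForm ι Y k} {y : Y}
    {c : OpenPartialHomeomorph Y (ι → ℂ)} (hc : c ∈ atlas (ι → ℂ) Y) (hy : y ∈ c.source)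
    (h : inChart θ c (c y) = inChart θ' c (c y)) : θ y = θ' y := by
  have e := c.left_inv hy
  have h0 := mem_chart_target (ι → ℂ) y
  have h1 : (chartAt (ι → ℂ) y).symm (chartAt (ι → ℂ) y y) = y :=
    (chartAt (ι → ℂ) y).left_inv (mem_chart_source _ y)
  rw [← inChart_chartAt θ, ← inChart_chartAt θ',
    inChart_trans θ (chart_mem_atlas (ι → ℂ) y) hc h0 (by rwa [h1]),
    inChart_trans θ' (chart_mem_atlas (ι → ℂ) y) hc h0 (by rwa [h1]), h1, h]

lemma contDiffAt_inChart_of_chart {k : ℕ} {θ : RealForm ι Y k}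
    {c c' : OpenPartialHomeomorph Y (ι → ℂ)}
    (hc : c ∈ atlas (ι → ℂ) Y) (hc' : c' ∈ atlas (ι → ℂ) Y) {u : ι → ℂ} (hu : u ∈ c.target)
    (hu' : c.symm u ∈ c'.source) (h : ContDiffAt ℝ ∞ (inChart θ c') (c' (c.symm u))) :
    ContDiffAt ℝ ∞ (inChart θ c) u := by
  have h1 : inChart θ c =ᶠ[𝓝 u] fun u => (inChart θ c' ((c' ∘ c.symm) u)).compContinuousLinearMap
      (fderiv ℝ (c' ∘ c.symm) u) := by
    filter_upwards [eventually_mem_overlap hu c'.open_source hu'] with u' h'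
    exact inChart_trans θ hc hc' h'.1 h'.2
  refine ContDiffAt.congr_of_eventuallyEq ?_ h1
  have h2 := contDiffAt_transition_real hc hc' hu hu'
  exact contDiffAt_compContinuousLinearMap (ContDiffAt.comp (g := inChart θ c') (f := c' ∘ c.symm) u h h2) (h2.fderiv_right (by simp))

lemma isSmoothForm_of_local {k : ℕ} {θ : RealForm ι Y k}
    (h : ∀ y, ∃ c ∈ atlas (ι → ℂ) Y, y ∈ c.source ∧ ContDiffAt ℝ ∞ (inChart θ c) (c y)) :
    IsSmoothForm θ := by
  intro c hc u hu
  obtain ⟨c', hc', h1, h2⟩ := h (c.symm u)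
  exact (contDiffAt_inChart_of_chart hc hc' hu h1 h2).contDiffWithinAt

lemma IsSmoothForm.contDiffAt {k : ℕ} {θ : RealForm ι Y k} (h : IsSmoothForm θ)
    {c : OpenPartialHomeomorph Y (ι → ℂ)} (hc : c ∈ atlas (ι → ℂ) Y) {u : ι → ℂ}
    (hu : u ∈ c.target) : ContDiffAt ℝ ∞ (inChart θ c) u :=
  (h c hc).contDiffAt (c.open_target.mem_nhds hu)

lemma contDiffAt_extDeriv {E : Type*} [NormedAddCommGroup E] [NormedSpace ℝ E] {k : ℕ}
    {f : E → E [⋀^Fin k]→L[ℝ] ℝ} {x : E} (h : ContDiffAt ℝ ∞ f x) :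
    ContDiffAt ℝ ∞ (extDeriv f) x :=
  (ContinuousAlternatingMap.alternatizeUncurryFinCLM ℝ E ℝ).contDiff.contDiffAt.comp x
    (h.fderiv_right (m := ∞) (by simp))

/-- The exterior derivative of a form on a manifold. -/
def extDerivForm {k : ℕ} (η : RealForm ι Y k) : RealForm ι Y (k + 1) :=
  formOfCharts fun c => extDeriv (inChart η c)

lemma extDeriv_comp {E F : Type*} [NormedAddCommGroup E] [NormedSpace ℝ E]
    [NormedAddCommGroup F] [NormedSpace ℝ F] {k : ℕ} {θ : F → F [⋀^Fin k]→L[ℝ] ℝ}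
    {θ' : E → E [⋀^Fin k]→L[ℝ] ℝ} {f : E → F} {x : E}
    (h : θ' =ᶠ[𝓝 x] fun x => (θ (f x)).compContinuousLinearMap (fderiv ℝ f x))
    (hθ : DifferentiableAt ℝ θ (f x)) (hf : ContDiffAt ℝ ∞ f x) :
    extDeriv θ' x = (extDeriv θ (f x)).compContinuousLinearMap (fderiv ℝ f x) := by
  rw [h.extDeriv_eq]
  exact extDeriv_pullback hθ hf (by simpa using two_le_infty)

lemma inChart_extDerivForm {k : ℕ} {η : RealForm ι Y k} (h : IsSmoothForm η)
    {c : OpenPartialHomeomorph Y (ι → ℂ)} (hc : c ∈ atlas (ι → ℂ) Y) {u : ι → ℂ}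
    (hu : u ∈ c.target) : inChart (extDerivForm η) c u = extDeriv (inChart η c) u := by
  refine inChart_formOfCharts (F := fun c => extDeriv (inChart η c)) ?_ hc hu
  intro c hc c' hc' u hu hu'
  refine extDeriv_comp (f := c' ∘ c.symm) ?_ (h.differentiableAt hc' (c'.map_source hu'))
    (contDiffAt_transition_real hc hc' hu hu')
  filter_upwards [eventually_mem_overlap hu c'.open_source hu'] with u' h'
  exact inChart_trans η hc hc' h'.1 h'.2

lemma IsSmoothForm.extDerivForm {k : ℕ} {η : RealForm ι Y k} (h : IsSmoothForm η) :
    IsSmoothForm (extDerivForm η) := by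
  intro c hc u hu
  refine ContDiffAt.contDiffWithinAt ?_
  refine (contDiffAt_extDeriv (h.contDiffAt hc hu)).congr_of_eventuallyEq ?_
  filter_upwards [c.open_target.mem_nhds hu] with u' hu'
  exact inChart_extDerivForm h hc hu'

lemma mem_exactForms_iff {θ : RealForm ι Y 2} :
    θ ∈ exactForms ι Y ↔ ∃ η : RealForm ι Y 1, IsSmoothForm η ∧ θ = extDerivForm η := by
  constructor
  · rintro ⟨η, hη, h⟩
    refine ⟨η, hη, funext fun y => ?_⟩
    refine form_eq_of_inChart (chart_mem_atlas (ι → ℂ) y) (mem_chart_source _ y) ?_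
    rw [h _ (chart_mem_atlas _ _) _ (mem_chart_target _ y),
      inChart_extDerivForm hη (chart_mem_atlas _ _) (mem_chart_target _ y)]
  · rintro ⟨η, hη, rfl⟩
    exact ⟨η, hη, fun c hc u hu => inChart_extDerivForm hη hc hu⟩

lemma exactForms_le_closedForms : exactForms ι Y ≤ closedForms ι Y := by
  intro θ hθ
  obtain ⟨η, hη, rfl⟩ := mem_exactForms_iff.1 hθ
  refine ⟨hη.extDerivForm, fun c hc u hu => ?_⟩
  have : inChart (extDerivForm η) c =ᶠ[𝓝 u] extDeriv (inChart η c) := by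
    filter_upwards [c.open_target.mem_nhds hu] with u' hu'
    exact inChart_extDerivForm hη hc hu'
  rw [this.extDeriv_eq]
  exact extDeriv_extDeriv_apply (hη.contDiffAt hc hu) (by simpa using two_le_infty)

section Pullback

variable {f : Z → Y}

lemma contDiffAt_inChart_map (hf : ContMDiff 𝓘(ℝ, κ → ℂ) 𝓘(ℝ, ι → ℂ) ∞ f)
    {c : OpenPartialHomeomorph Z (κ → ℂ)} {c' : OpenPartialHomeomorph Y (ι → ℂ)}
    (hc : c ∈ atlas (κ → ℂ) Z) (hc' : c' ∈ atlas (ι → ℂ) Y) {u : κ → ℂ} (hu : u ∈ c.target)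
    (hu' : f (c.symm u) ∈ c'.source) : ContDiffAt ℝ ∞ (c' ∘ f ∘ c.symm) u :=
  contMDiffAt_iff_contDiffAt.1 <|
    (contMDiffAt_of_mem_maximalAtlas (mem_maximalAtlas_real hc') hu').comp u <|
      hf.contMDiffAt.comp u (contMDiffAt_symm_of_mem_maximalAtlas (mem_maximalAtlas_real hc) hu)

lemma inChart_pullbackForm_eventually (hf : ContMDiff 𝓘(ℝ, κ → ℂ) 𝓘(ℝ, ι → ℂ) ∞ f) {k : ℕ}
    (θ : RealForm ι Y k)
    {c : OpenPartialHomeomorph Z (κ → ℂ)} {c' : OpenPartialHomeomorph Y (ι → ℂ)}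
    (hc : c ∈ atlas (κ → ℂ) Z) (hc' : c' ∈ atlas (ι → ℂ) Y) {u : κ → ℂ} (hu : u ∈ c.target)
    (hu' : f (c.symm u) ∈ c'.source) :
    inChart (pullbackForm f θ) c =ᶠ[𝓝 u] fun u =>
      (inChart θ c' ((c' ∘ f ∘ c.symm) u)).compContinuousLinearMap
        (fderiv ℝ (c' ∘ f ∘ c.symm) u) := by
  filter_upwards [eventually_mem_overlap hu (c'.open_source.preimage hf.continuous) hu'] with u' h'
  exact inChart_pullbackForm θ hc hc' h'.1 (hf.mdifferentiableAt (by simp)) h'.2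

lemma IsSmoothForm.pullbackForm (hf : ContMDiff 𝓘(ℝ, κ → ℂ) 𝓘(ℝ, ι → ℂ) ∞ f) {k : ℕ}
    {θ : RealForm ι Y k} (h : IsSmoothForm θ) : IsSmoothForm (ι := κ) (pullbackForm f θ) := by
  intro c hc u hu
  have hc' := chart_mem_atlas (ι → ℂ) (f (c.symm u))
  have hu' := mem_chart_source (ι → ℂ) (f (c.symm u))
  refine ContDiffAt.contDiffWithinAt ?_
  refine ContDiffAt.congr_of_eventuallyEq ?_
    (inChart_pullbackForm_eventually hf θ hc hc' hu hu')
  have h2 := contDiffAt_inChart_map hf hc hc' hu hu'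
  exact contDiffAt_compContinuousLinearMap
    (ContDiffAt.comp (g := inChart θ (chartAt (ι → ℂ) (f (c.symm u))))
      (f := chartAt (ι → ℂ) (f (c.symm u)) ∘ f ∘ c.symm) u (h.contDiffAt hc' (OpenPartialHomeomorph.map_source _ hu')) h2)
    (h2.fderiv_right (by simp))

lemma extDeriv_inChart_pullbackForm (hf : ContMDiff 𝓘(ℝ, κ → ℂ) 𝓘(ℝ, ι → ℂ) ∞ f) {k : ℕ}
    {θ : RealForm ι Y k} (h : IsSmoothForm θ)
    {c : OpenPartialHomeomorph Z (κ → ℂ)} {c' : OpenPartialHomeomorph Y (ι → ℂ)}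
    (hc : c ∈ atlas (κ → ℂ) Z) (hc' : c' ∈ atlas (ι → ℂ) Y) {u : κ → ℂ} (hu : u ∈ c.target)
    (hu' : f (c.symm u) ∈ c'.source) :
    extDeriv (inChart (pullbackForm f θ) c) u =
      (extDeriv (inChart θ c') (c' (f (c.symm u)))).compContinuousLinearMap
        (fderiv ℝ (c' ∘ f ∘ c.symm) u) :=
  extDeriv_comp (f := c' ∘ f ∘ c.symm) (inChart_pullbackForm_eventually hf θ hc hc' hu hu')
    (h.differentiableAt hc' (c'.map_source hu')) (contDiffAt_inChart_map hf hc hc' hu hu')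

lemma pullbackForm_mem_closedForms (hf : ContMDiff 𝓘(ℝ, κ → ℂ) 𝓘(ℝ, ι → ℂ) ∞ f)
    {θ : RealForm ι Y 2} (h : θ ∈ closedForms ι Y) : pullbackForm f θ ∈ closedForms κ Z := by
  refine ⟨h.1.pullbackForm hf, fun c hc u hu => ?_⟩
  have hc' := chart_mem_atlas (ι → ℂ) (f (c.symm u))
  have hu' := mem_chart_source (ι → ℂ) (f (c.symm u))
  rw [extDeriv_inChart_pullbackForm hf h.1 hc hc' hu hu', h.2 _ hc' _
    (OpenPartialHomeomorph.map_source _ hu')]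
  ext; simp

lemma pullbackForm_mem_exactForms (hf : ContMDiff 𝓘(ℝ, κ → ℂ) 𝓘(ℝ, ι → ℂ) ∞ f)
    {θ : RealForm ι Y 2} (h : θ ∈ exactForms ι Y) : pullbackForm f θ ∈ exactForms κ Z := by
  obtain ⟨η, hη, hd⟩ := h
  refine ⟨pullbackForm f η, hη.pullbackForm hf, fun c hc u hu => ?_⟩
  have hc' := chart_mem_atlas (ι → ℂ) (f (c.symm u))
  have hu' := mem_chart_source (ι → ℂ) (f (c.symm u))
  rw [extDeriv_inChart_pullbackForm hf hη hc hc' hu hu',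
    inChart_pullbackForm θ hc hc' hu (hf.mdifferentiableAt (by simp)) hu',
    hd _ hc' _ (OpenPartialHomeomorph.map_source _ hu')]

lemma pullbackForm_add {k : ℕ} (θ θ' : RealForm ι Y k) :
    pullbackForm (κ := κ) f (θ + θ') = pullbackForm f θ + pullbackForm f θ' := rfl

lemma pullbackForm_sub {k : ℕ} (θ θ' : RealForm ι Y k) :
    pullbackForm (κ := κ) f (θ - θ') = pullbackForm f θ - pullbackForm f θ' := rfl

lemma pullbackForm_smul {k : ℕ} (r : ℝ) (θ : RealForm ι Y k) :
    pullbackForm (κ := κ) f (r • θ) = r • pullbackForm f θ := rfl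

end Pullback

/-! ### De Rham classes -/

lemma deRhamClass_eq_iff {θ θ' : RealForm ι Y 2} (h : θ ∈ closedForms ι Y)
    (h' : θ' ∈ closedForms ι Y) :
    deRhamClass θ = deRhamClass θ' ↔ θ - θ' ∈ exactForms ι Y := by
  rw [deRhamClass, dif_pos h, deRhamClass, dif_pos h', Submodule.Quotient.eq]
  rfl

lemma representative_mem (c : DeRham2 ι Y) : representative c ∈ closedForms ι Y :=
  (Quotient.out c : closedForms ι Y).2

lemma deRhamClass_representative (c : DeRham2 ι Y) : deRhamClass (representative c) = c := by
  rw [deRhamClass, dif_pos (representative_mem c)]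
  exact Quotient.out_eq c

lemma deRhamClass_add {θ θ' : RealForm ι Y 2} (h : θ ∈ closedForms ι Y)
    (h' : θ' ∈ closedForms ι Y) : deRhamClass (θ + θ') = deRhamClass θ + deRhamClass θ' := by
  simp only [deRhamClass, dif_pos h, dif_pos h', dif_pos (add_mem h h')]
  rfl

lemma deRhamClass_smul {θ : RealForm ι Y 2} (h : θ ∈ closedForms ι Y) (r : ℝ) :
    deRhamClass (r • θ) = r • deRhamClass θ := by
  simp only [deRhamClass, dif_pos h, dif_pos (Submodule.smul_mem _ r h)]
  rfl

lemma pullbackClass_deRhamClass {f : Z → Y} (hf : ContMDiff 𝓘(ℝ, κ → ℂ) 𝓘(ℝ, ι → ℂ) ∞ f)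
    {θ : RealForm ι Y 2} (h : θ ∈ closedForms ι Y) :
    pullbackClass (κ := κ) f (deRhamClass θ) = deRhamClass (pullbackForm f θ) := by
  have h1 := representative_mem (deRhamClass θ)
  rw [pullbackClass, deRhamClass_eq_iff (pullbackForm_mem_closedForms hf h1)
    (pullbackForm_mem_closedForms hf h), ← pullbackForm_sub]
  exact pullbackForm_mem_exactForms hf ((deRhamClass_eq_iff h1 h).1 (deRhamClass_representative _))

lemma pullbackClass_add {f : Z → Y} (hf : ContMDiff 𝓘(ℝ, κ → ℂ) 𝓘(ℝ, ι → ℂ) ∞ f)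
    (a b : DeRham2 ι Y) :
    pullbackClass (κ := κ) f (a + b) = pullbackClass f a + pullbackClass f b := by
  have ha := representative_mem a
  have hb := representative_mem b
  rw [← deRhamClass_representative a, ← deRhamClass_representative b, ← deRhamClass_add ha hb,
    pullbackClass_deRhamClass hf (add_mem ha hb), pullbackClass_deRhamClass hf ha,
    pullbackClass_deRhamClass hf hb, pullbackForm_add, deRhamClass_add
    (pullbackForm_mem_closedForms hf ha) (pullbackForm_mem_closedForms hf hb)]

lemma pullbackClass_smul {f : Z → Y} (hf : ContMDiff 𝓘(ℝ, κ → ℂ) 𝓘(ℝ, ι → ℂ) ∞ f)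
    (r : ℝ) (a : DeRham2 ι Y) :
    pullbackClass (κ := κ) f (r • a) = r • pullbackClass f a := by
  have ha := representative_mem a
  rw [← deRhamClass_representative a, ← deRhamClass_smul ha,
    pullbackClass_deRhamClass hf (Submodule.smul_mem _ r ha), pullbackClass_deRhamClass hf ha,
    pullbackForm_smul, deRhamClass_smul (pullbackForm_mem_closedForms hf ha)]

end Charts

end

end KahlerProj

namespace KahlerProj

noncomputable section

/-! ### Integration of top degree wedge products -/

section Integral

variable {ι : Type*} [Fintype ι] [DecidableEq ι] {Y : Type*} [TopologicalSpace Y]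
  [ChartedSpace (ι → ℂ) Y]

/-- The density of `⋀_j θ_j` in a chart. -/
def density (θ : ι → RealForm ι Y 2) (c : OpenPartialHomeomorph Y (ι → ℂ)) (u : ι → ℂ) : ℝ :=
  wedgeDensity fun j => inChart (θ j) c u

/-- The integral over a chart of `g ⋀_j θ_j`. -/
def chartIntegral (θ : ι → RealForm ι Y 2) (c : OpenPartialHomeomorph Y (ι → ℂ)) (g : Y → ℝ) : ℝ :=
  ∫ u in c.target, g (c.symm u) * density θ c u

lemma density_eq_zero {θ : ι → RealForm ι Y 2} {c : OpenPartialHomeomorph Y (ι → ℂ)} {u : ι → ℂ}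
    {j : ι} (h : θ j (c.symm u) = 0) : density θ c u = 0 := by
  rw [density, ← wedgeMultilinear_apply]
  refine MultilinearMap.map_coord_zero _ j ?_
  rw [inChart, h]; rfl

lemma density_update_add (θ : ι → RealForm ι Y 2) (j : ι) (η η' : RealForm ι Y 2)
    (c : OpenPartialHomeomorph Y (ι → ℂ)) (u : ι → ℂ) :
    density (Function.update θ j (η + η')) c u =
      density (Function.update θ j η) c u + density (Function.update θ j η') c u := by
  have h : ∀ η, (fun i => inChart (Function.update θ j η i) c u) =
      Function.update (fun i => inChart (θ i) c u) j (inChart η c u) := by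
    intro η; ext1 i
    by_cases hi : i = j
    · subst hi; simp
    · simp [hi]
  simp only [density, h, inChart_add, ← wedgeMultilinear_apply]
  exact MultilinearMap.map_update_add _ _ _ _ _

lemma density_update_smul (θ : ι → RealForm ι Y 2) (j : ι) (r : ℝ) (η : RealForm ι Y 2)
    (c : OpenPartialHomeomorph Y (ι → ℂ)) (u : ι → ℂ) :
    density (Function.update θ j (r • η)) c u = r * density (Function.update θ j η) c u := by
  have h : ∀ η, (fun i => inChart (Function.update θ j η i) c u) =
      Function.update (fun i => inChart (θ i) c u) j (inChart η c u) := by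
    intro η; ext1 i
    by_cases hi : i = j
    · subst hi; simp
    · simp [hi]
  simp only [density, h, inChart_smul, ← wedgeMultilinear_apply]
  exact MultilinearMap.map_update_smul _ _ _ _ _

lemma contDiffAt_wedgeDensity {E : Type*} [NormedAddCommGroup E] [NormedSpace ℝ E] {r : ℕ∞ω}
    {F : ι → E → (ι → ℂ) [⋀^Fin 2]→L[ℝ] ℝ} {x : E} (h : ∀ j, ContDiffAt ℝ r (F j) x) :
    ContDiffAt ℝ r (fun u => wedgeDensity fun j => F j u) x := by
  simp only [wedgeDensity_eq, wedgeAlt_apply]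
  exact contDiffAt_const.mul (ContDiffAt.sum fun σ _ => contDiffAt_const.mul
    (contDiffAt_prod fun j _ => contDiffAt_alternating_apply_const (h j) _))

variable [IsManifold 𝓘(ℂ, ι → ℂ) ω Y]

lemma continuousOn_density {θ : ι → RealForm ι Y 2} (h : ∀ j, IsSmoothForm (θ j))
    {c : OpenPartialHomeomorph Y (ι → ℂ)} (hc : c ∈ atlas (ι → ℂ) Y) :
    ContinuousOn (density θ c) c.target := fun u hu =>
  (contDiffAt_wedgeDensity fun j => (h j).contDiffAt hc hu).continuousAt.continuousWithinAt

lemma fderiv_real_eq {κ : Type*} [Fintype κ] {f : (κ → ℂ) → (ι → ℂ)} {u : κ → ℂ}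
    (h : DifferentiableAt ℂ f u) :
    fderiv ℝ f u = (fderiv ℂ f u).restrictScalars ℝ := h.fderiv_restrictScalars ℝ

lemma density_trans (θ : ι → RealForm ι Y 2) {c c' : OpenPartialHomeomorph Y (ι → ℂ)}
    (hc : c ∈ atlas (ι → ℂ) Y) (hc' : c' ∈ atlas (ι → ℂ) Y) {u : ι → ℂ} (hu : u ∈ c.target)
    (hu' : c.symm u ∈ c'.source) :
    density θ c u = |(fderiv ℝ (c' ∘ c.symm) u).det| * density θ c' (c' (c.symm u)) := by
  have h1 : (fun j => inChart (θ j) c u) = fun j => (inChart (θ j) c'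
      (c' (c.symm u))).compContinuousLinearMap (fderiv ℝ (c' ∘ c.symm) u) :=
    funext fun j => inChart_trans (θ j) hc hc' hu hu'
  have h2 : DifferentiableAt ℂ (c' ∘ c.symm) u :=
    (contDiffAt_transition hc hc' hu hu').differentiableAt (by simp)
  rw [density, h1, wedgeDensity_comp (fun j => inChart (θ j) c' (c' (c.symm u))), abs_of_nonneg]
  · rfl
  · rw [fderiv_real_eq h2, det_restrictScalars_eq]
    positivity

section ChangeOfCharts

variable {θ : ι → RealForm ι Y 2} {c c' : OpenPartialHomeomorph Y (ι → ℂ)} {g : Y → ℝ}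

lemma transition_image : (c' ∘ c.symm) '' (c.symm.trans c').source = (c'.symm.trans c).source := by
  have := (c.symm.trans c').image_source_eq_target
  rw [← OpenPartialHomeomorph.symm_source, OpenPartialHomeomorph.trans_symm_eq_symm_trans_symm] at this
  simpa using this

lemma density_overlap_eq (hc : c ∈ atlas (ι → ℂ) Y) (hc' : c' ∈ atlas (ι → ℂ) Y) {u : ι → ℂ}
    (hu : u ∈ (c.symm.trans c').source) :
    g (c.symm u) * density θ c u = |(fderiv ℝ (c' ∘ c.symm) u).det| •
      (g (c'.symm ((c' ∘ c.symm) u)) * density θ c' ((c' ∘ c.symm) u)) := by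
  have h : u ∈ c.target ∧ c.symm u ∈ c'.source := by simpa using hu
  rw [density_trans θ hc hc' h.1 h.2, Function.comp_apply, c'.left_inv h.2, smul_eq_mul]
  ring

lemma hasFDerivWithinAt_transition (hc : c ∈ atlas (ι → ℂ) Y) (hc' : c' ∈ atlas (ι → ℂ) Y) :
    ∀ u ∈ (c.symm.trans c').source, HasFDerivWithinAt (c' ∘ c.symm)
      (fderiv ℝ (c' ∘ c.symm) u) (c.symm.trans c').source u := by
  intro u hu
  have h : u ∈ c.target ∧ c.symm u ∈ c'.source := by simpa using hu
  exact ((contDiffAt_transition_real hc hc' h.1 h.2).differentiableAt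
    (by simp)).hasFDerivAt.hasFDerivWithinAt

lemma eq_zero_off_overlap (hg : ∀ y, y ∉ c.source ∩ c'.source → g y = 0) :
    ∀ u ∈ c.target \ (c.symm.trans c').source, g (c.symm u) * density θ c u = 0 := by
  rintro u ⟨hu, hu'⟩
  rw [hg, zero_mul]
  rintro ⟨_, h⟩
  exact hu' (by simpa using ⟨hu, h⟩)

lemma chartIntegral_congr_chart (hc : c ∈ atlas (ι → ℂ) Y) (hc' : c' ∈ atlas (ι → ℂ) Y)
    (hg : ∀ y, y ∉ c.source ∩ c'.source → g y = 0) :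
    chartIntegral θ c g = chartIntegral θ c' g := by
  have hsub : ∀ c c' : OpenPartialHomeomorph Y (ι → ℂ), (c.symm.trans c').source ⊆ c.target :=
    fun c c' u hu => by
      have : u ∈ c.target ∧ c.symm u ∈ c'.source := by simpa using hu
      exact this.1
  have hm : MeasurableSet (c.symm.trans c').source := (c.symm.trans c').open_source.measurableSet
  have hg' : ∀ y, y ∉ c'.source ∩ c.source → g y = 0 := fun y hy => hg y fun h => hy h.symm
  rw [chartIntegral, chartIntegral,
    setIntegral_eq_of_subset_of_forall_sdiff_eq_zero c.open_target.measurableSet (hsub c c')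
      (eq_zero_off_overlap hg),
    setIntegral_eq_of_subset_of_forall_sdiff_eq_zero c'.open_target.measurableSet (hsub c' c)
      (eq_zero_off_overlap hg'), ← transition_image (c := c) (c' := c'),
    integral_image_eq_integral_abs_det_fderiv_smul volume hm (hasFDerivWithinAt_transition hc hc')
      (c.symm.trans c').injOn]
  exact setIntegral_congr_fun hm fun u hu => density_overlap_eq hc hc' hu

lemma integrableOn_congr_chart (hc : c ∈ atlas (ι → ℂ) Y) (hc' : c' ∈ atlas (ι → ℂ) Y)
    (hg : ∀ y, y ∉ c.source ∩ c'.source → g y = 0)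
    (h : IntegrableOn (fun u => g (c.symm u) * density θ c u) c.target) :
    IntegrableOn (fun u => g (c'.symm u) * density θ c' u) c'.target := by
  have hm : MeasurableSet (c.symm.trans c').source := (c.symm.trans c').open_source.measurableSet
  have hg' : ∀ y, y ∉ c'.source ∩ c.source → g y = 0 := fun y hy => hg y fun h => hy h.symm
  refine IntegrableOn.of_forall_sdiff_eq_zero ?_ c'.open_target.measurableSet
    (eq_zero_off_overlap hg')
  rw [← transition_image (c := c) (c' := c'),
    integrableOn_image_iff_integrableOn_abs_det_fderiv_smul volume hm
      (hasFDerivWithinAt_transition hc hc') (c.symm.trans c').injOn]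
  refine IntegrableOn.congr_fun (h.mono_set fun u hu => ?_)
    (fun u hu => density_overlap_eq hc hc' hu) hm
  have : u ∈ c.target ∧ c.symm u ∈ c'.source := by simpa using hu
  exact this.1

end ChangeOfCharts

section Weights

variable [T2Space Y] [CompactSpace Y]

lemma exists_partition : ∃ ρ : SmoothPartitionOfUnity Y 𝓘(ℝ, ι → ℂ) Y univ,
    ρ.IsSubordinate fun y => (chartAt (ι → ℂ) y).source :=
  SmoothPartitionOfUnity.exists_isSubordinate_chartAt_source 𝓘(ℝ, ι → ℂ) Y

variable (ι Y) in
/-- The partition of unity in the definition of `integralWedge`. -/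
def partition : SmoothPartitionOfUnity Y 𝓘(ℝ, ι → ℂ) Y univ :=
  (exists_partition (ι := ι) (Y := Y)).choose

lemma partition_subordinate :
    (partition ι Y).IsSubordinate fun y => (chartAt (ι → ℂ) y).source :=
  (exists_partition (ι := ι) (Y := Y)).choose_spec

lemma partition_continuous (y : Y) : Continuous (partition ι Y y) :=
  (partition ι Y y).contMDiff.continuous

variable (ι Y) in
lemma partition_finite : {y | (Function.support (partition ι Y y)).Nonempty}.Finite :=
  (partition ι Y).locallyFinite.finite_nonempty_of_compact

variable (ι Y) in
/-- The finitely many indices with a non-zero function in the partition of unity. -/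
def partitionIndex : Finset Y := (partition_finite ι Y).toFinset

lemma partition_eq_zero {y : Y} (h : y ∉ partitionIndex ι Y) (p : Y) : partition ι Y y p = 0 := by
  by_contra h'
  exact h ((partition_finite ι Y).mem_toFinset.2 ⟨p, h'⟩)

lemma partition_sum (p : Y) : ∑ y ∈ partitionIndex ι Y, partition ι Y y p = 1 := by
  rw [← (partition ι Y).sum_eq_one (mem_univ p)]
  refine (finsum_eq_sum_of_support_subset _ fun y hy => ?_).symm
  by_contra h
  exact hy (partition_eq_zero h p)

lemma partition_off_source {y p : Y} (h : p ∉ (chartAt (ι → ℂ) y).source) :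
    partition ι Y y p = 0 := by
  by_contra h'
  exact h (partition_subordinate y (subset_tsupport _ h'))

lemma integralWedge_eq (θ : ι → RealForm ι Y 2) :
    integralWedge θ = ∑ y ∈ partitionIndex ι Y,
      chartIntegral θ (chartAt (ι → ℂ) y) (partition ι Y y) := by
  rw [integralWedge, dif_pos (exists_partition (ι := ι) (Y := Y))]
  refine finsum_eq_sum_of_support_subset _ fun y hy => ?_
  by_contra h
  refine hy ?_
  have : ∀ p, (exists_partition (ι := ι) (Y := Y)).choose y p = 0 := partition_eq_zero h
  simp [this]

lemma integrableOn_of_tsupport {c : OpenPartialHomeomorph Y (ι → ℂ)} {f : (ι → ℂ) → ℝ}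
    {ρ : Y → ℝ} (hρ : Continuous ρ) (hs : tsupport ρ ⊆ c.source) (hf : ContinuousOn f c.target) :
    IntegrableOn (fun u => ρ (c.symm u) * f u) c.target := by
  have hK : IsCompact (c '' tsupport ρ) :=
    (isClosed_tsupport ρ).isCompact.image_of_continuousOn (c.continuousOn.mono hs)
  have hKt : c '' tsupport ρ ⊆ c.target := by
    rintro _ ⟨y, hy, rfl⟩; exact c.map_source (hs hy)
  have hcont : ContinuousOn (fun u => ρ (c.symm u) * f u) c.target :=
    (hρ.comp_continuousOn c.continuousOn_symm).mul hf
  refine IntegrableOn.of_forall_sdiff_eq_zero ((hcont.mono hKt).integrableOn_compact hK)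
    c.open_target.measurableSet ?_
  rintro u ⟨hu, hu'⟩
  rw [show ρ (c.symm u) = 0 from ?_, zero_mul]
  by_contra h
  exact hu' ⟨c.symm u, subset_tsupport _ h, c.right_inv hu⟩

lemma integrableOn_weight {θ : ι → RealForm ι Y 2} (hθ : ∀ j, IsSmoothForm (θ j))
    {c : OpenPartialHomeomorph Y (ι → ℂ)} (hc : c ∈ atlas (ι → ℂ) Y) {ρ : Y → ℝ}
    (hρ : Continuous ρ) (hs : tsupport ρ ⊆ c.source) {g : Y → ℝ}
    (hg : @Measurable _ _ (borel Y) _ g) (hb : ∀ y, |g y| ≤ 1) :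
    IntegrableOn (fun u => (ρ (c.symm u) * g (c.symm u)) * density θ c u) c.target := by
  let _ : MeasurableSpace Y := borel Y
  have _ : BorelSpace Y := ⟨rfl⟩
  have h1 := integrableOn_of_tsupport hρ hs (continuousOn_density hθ hc)
  have h2 : AEStronglyMeasurable (fun u => g (c.symm u)) (volume.restrict c.target) :=
    (hg.comp_aemeasurable
      (c.continuousOn_symm.aemeasurable c.open_target.measurableSet)).aestronglyMeasurable
  refine (h1.bdd_mul (c := 1) h2 (Filter.Eventually.of_forall fun u => hb _)).congr
    (Filter.Eventually.of_forall fun u => ?_)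
  simp only; ring

/-- The integral of a top degree wedge product may be computed with any finite family of bounded
measurable functions supported in charts with sum `1` off a null set. -/
theorem integralWedge_eq_sum {K : Type*} [Fintype K] (c : K → OpenPartialHomeomorph Y (ι → ℂ))
    (hc : ∀ k, c k ∈ atlas (ι → ℂ) Y) (g : K → Y → ℝ)
    (hg : ∀ k, @Measurable _ _ (borel Y) _ (g k)) (hb : ∀ k y, |g k y| ≤ 1)
    (hs : ∀ k y, y ∉ (c k).source → g k y = 0) (S : Set Y)
    (hS : ∀ c ∈ atlas (ι → ℂ) Y, volume (c.target ∩ c.symm ⁻¹' S) = 0)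
    {θ : ι → RealForm ι Y 2} (hθ : ∀ j, IsSmoothForm (θ j))
    (hsum : ∀ y, y ∉ S → ∑ k, g k y = 1 ∨ ∃ j, θ j y = 0) :
    integralWedge θ = ∑ k, chartIntegral θ (c k) (g k) := by
  have hint : ∀ y k, IntegrableOn (fun u => (partition ι Y y ((chartAt (ι → ℂ) y).symm u) *
      g k ((chartAt (ι → ℂ) y).symm u)) * density θ (chartAt (ι → ℂ) y) u)
      (chartAt (ι → ℂ) y).target := fun y k =>
    integrableOn_weight hθ (chart_mem_atlas _ y) (partition_continuous y)
      (partition_subordinate y) (hg k) (hb k)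
  have hoff : ∀ y k p, p ∉ (chartAt (ι → ℂ) y).source ∩ (c k).source →
      partition ι Y y p * g k p = 0 := by
    intro y k p hp
    by_cases h1 : p ∈ (chartAt (ι → ℂ) y).source
    · rw [hs k p fun h2 => hp ⟨h1, h2⟩, mul_zero]
    · rw [partition_off_source h1, zero_mul]
  have h1 : ∀ y, chartIntegral θ (chartAt (ι → ℂ) y) (partition ι Y y) =
      ∑ k, chartIntegral θ (chartAt (ι → ℂ) y) (fun p => partition ι Y y p * g k p) := by
    intro y
    simp only [chartIntegral]
    rw [← integral_finsetSum _ fun k _ => hint y k]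
    refine setIntegral_congr_ae (chartAt (ι → ℂ) y).open_target.measurableSet ?_
    have h0 := hS _ (chart_mem_atlas (ι → ℂ) y)
    rw [measure_eq_zero_iff_ae_notMem] at h0
    filter_upwards [h0] with u hu hut
    have hu' : (chartAt (ι → ℂ) y).symm u ∉ S := fun h => hu ⟨hut, h⟩
    rcases hsum _ hu' with h | ⟨j, hj⟩
    · rw [← Finset.sum_mul, ← Finset.mul_sum, h, mul_one]
    · rw [density_eq_zero hj]; simp
  have h2 : ∀ y k, chartIntegral θ (chartAt (ι → ℂ) y) (fun p => partition ι Y y p * g k p) =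
      chartIntegral θ (c k) (fun p => partition ι Y y p * g k p) := fun y k =>
    chartIntegral_congr_chart (chart_mem_atlas _ y) (hc k) (hoff y k)
  rw [integralWedge_eq]
  simp only [h1, h2]
  rw [Finset.sum_comm]
  refine Finset.sum_congr rfl fun k _ => ?_
  simp only [chartIntegral]
  rw [← integral_finsetSum _ fun y _ =>
    integrableOn_congr_chart (chart_mem_atlas _ y) (hc k) (hoff y k) (hint y k)]
  congr 1
  ext u
  rw [← Finset.sum_mul, ← Finset.sum_mul, partition_sum, one_mul]

lemma integralWedge_update_add {θ : ι → RealForm ι Y 2} (hθ : ∀ j, IsSmoothForm (θ j)) (j : ι)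
    {η η' : RealForm ι Y 2} (h : IsSmoothForm η) (h' : IsSmoothForm η') :
    integralWedge (Function.update θ j (η + η')) =
      integralWedge (Function.update θ j η) + integralWedge (Function.update θ j η') := by
  have hu : ∀ {ζ : RealForm ι Y 2}, IsSmoothForm ζ → ∀ i, IsSmoothForm (Function.update θ j ζ i) := by
    intro ζ hζ i
    by_cases hi : i = j
    · subst hi; simpa using hζ
    · simpa [hi] using hθ i
  simp only [integralWedge_eq, ← Finset.sum_add_distrib]
  refine Finset.sum_congr rfl fun y _ => ?_
  simp only [chartIntegral, density_update_add, mul_add]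
  exact integral_add
    (integrableOn_of_tsupport (partition_continuous y) (partition_subordinate y)
      (continuousOn_density (hu h) (chart_mem_atlas _ y)))
    (integrableOn_of_tsupport (partition_continuous y) (partition_subordinate y)
      (continuousOn_density (hu h') (chart_mem_atlas _ y)))

lemma integralWedge_update_smul (θ : ι → RealForm ι Y 2) (j : ι) (r : ℝ) (η : RealForm ι Y 2) :
    integralWedge (Function.update θ j (r • η)) = r * integralWedge (Function.update θ j η) := by
  simp only [integralWedge_eq, Finset.mul_sum]
  refine Finset.sum_congr rfl fun y _ => ?_
  simp only [chartIntegral, density_update_smul]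
  rw [← integral_const_mul]
  congr 1; ext u; ring

lemma integralWedge_perm (θ : ι → RealForm ι Y 2) (σ : Equiv.Perm ι) :
    integralWedge (fun j => θ (σ j)) = integralWedge θ := by
  simp only [integralWedge_eq, chartIntegral, density]
  refine Finset.sum_congr rfl fun y _ => ?_
  congr 1; ext u
  rw [wedgeDensity_perm (fun j => inChart (θ j) (chartAt (ι → ℂ) y) u) σ]

lemma integralWedge_pos [Nonempty Y] {θ : ι → RealForm ι Y 2} (hθ : ∀ j, IsSmoothForm (θ j))
    (hpos : ∀ c ∈ atlas (ι → ℂ) Y, ∀ u ∈ c.target, 0 < density θ c u) : 0 < integralWedge θ := by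
  rw [integralWedge_eq]
  have hnn : ∀ y, 0 ≤ᵐ[volume.restrict (chartAt (ι → ℂ) y).target] fun u =>
      partition ι Y y ((chartAt (ι → ℂ) y).symm u) * density θ (chartAt (ι → ℂ) y) u := by
    intro y
    filter_upwards [ae_restrict_mem (chartAt (ι → ℂ) y).open_target.measurableSet] with u hu
    exact mul_nonneg ((partition ι Y).nonneg y _) (hpos _ (chart_mem_atlas _ y) u hu).le
  refine Finset.sum_pos' (fun y _ => integral_nonneg_of_ae (hnn y)) ?_
  obtain ⟨p⟩ := ‹Nonempty Y›
  have hex : ∃ y ∈ partitionIndex ι Y, partition ι Y y p ≠ 0 := by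
    by_contra! h
    have := partition_sum (ι := ι) p
    rw [Finset.sum_eq_zero h] at this
    exact zero_ne_one this
  obtain ⟨y, hy, hyp⟩ := hex
  refine ⟨y, hy, ?_⟩
  rw [chartIntegral, integral_pos_iff_support_of_nonneg_ae (hnn y)
    (integrableOn_of_tsupport (partition_continuous y) (partition_subordinate y)
      (continuousOn_density hθ (chart_mem_atlas _ y)))]
  set c := chartAt (ι → ℂ) y
  have hpc : p ∈ c.source := by
    by_contra h; exact hyp (partition_off_source h)
  have hopen : IsOpen (c.target ∩ c.symm ⁻¹' {q | partition ι Y y q ≠ 0}) :=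
    c.isOpen_inter_preimage_symm (isOpen_ne_fun (partition_continuous y) continuous_const)
  have h1 : 0 < volume (c.target ∩ c.symm ⁻¹' {q | partition ι Y y q ≠ 0}) :=
    hopen.measure_pos volume ⟨c p, c.map_source hpc, by
      simp only [mem_preimage, c.left_inv hpc]; exact hyp⟩
  rw [Measure.restrict_apply₀']
  · refine h1.trans_le (measure_mono ?_)
    rintro u ⟨hu, hu'⟩
    exact ⟨mul_ne_zero hu' (hpos c (chart_mem_atlas _ y) u hu).ne', hu⟩
  · exact c.open_target.measurableSet.nullMeasurableSet

end Weights

end Integral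

end

end KahlerProj

namespace KahlerProj

noncomputable section

/-! ### Stokes' theorem -/

section PointwiseStokes

lemma sum_sign_mul_swap {P : Type*} [Fintype P] [DecidableEq P] (F : Equiv.Perm P → ℝ) {x y : P}
    (h : x ≠ y) : ∑ σ : Equiv.Perm P, ((Equiv.Perm.sign σ : ℤ) : ℝ) * F σ =
      -∑ σ : Equiv.Perm P, ((Equiv.Perm.sign σ : ℤ) : ℝ) * F (σ * Equiv.swap x y) := by
  rw [← Finset.sum_neg_distrib]
  refine Fintype.sum_equiv (Equiv.mulRight (Equiv.swap x y)) _ _ fun σ => ?_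
  rw [Equiv.coe_mulRight, Equiv.Perm.sign_mul, Equiv.Perm.sign_swap h, mul_assoc,
    Equiv.swap_mul_self, mul_one]
  push_cast; ring

lemma alternatizeUncurryFin_three {V : Type*} [NormedAddCommGroup V] [NormedSpace ℝ V]
    (f : V →L[ℝ] V [⋀^Fin 2]→L[ℝ] ℝ) (a b c : V) :
    ContinuousAlternatingMap.alternatizeUncurryFin f ![a, b, c] =
      f a ![b, c] - f b ![a, c] + f c ![a, b] := by
  rw [ContinuousAlternatingMap.alternatizeUncurryFin_apply, Fin.sum_univ_three]
  have h0 : Fin.removeNth (α := fun _ => V) 0 ![a, b, c] = ![b, c] := by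
    ext i; fin_cases i <;> rfl
  have h1 : Fin.removeNth (α := fun _ => V) 1 ![a, b, c] = ![a, c] := by
    ext i; fin_cases i <;> rfl
  have h2 : Fin.removeNth (α := fun _ => V) 2 ![a, b, c] = ![a, b] := by
    ext i; fin_cases i <;> rfl
  rw [h0, h1, h2]
  simp [sub_eq_add_neg]

lemma fderiv_alternating_apply {E V : Type*} [NormedAddCommGroup E] [NormedSpace ℝ E]
    [NormedAddCommGroup V] [NormedSpace ℝ V] {k : ℕ} {f : E → V [⋀^Fin k]→L[ℝ] ℝ} {u : E}
    (h : DifferentiableAt ℝ f u) (v : Fin k → V) :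
    HasFDerivAt (fun u => f u v)
      ((ContinuousAlternatingMap.apply ℝ V ℝ v).comp (fderiv ℝ f u)) u :=
  (ContinuousAlternatingMap.apply ℝ V ℝ v).hasFDerivAt.comp u h.hasFDerivAt

variable {ι : Type*} [Fintype ι] [DecidableEq ι] {V : Type*} [NormedAddCommGroup V]
  [NormedSpace ℝ V]

/-- The components of `η ∧ ⋀_{j ≠ i} Θ_j`. -/
def stokesComponent (i : ι) (η : V → V [⋀^Fin 1]→L[ℝ] ℝ) (Θ : ι → V → V [⋀^Fin 2]→L[ℝ] ℝ)
    (v : ι × Fin 2 → V) (σ : Equiv.Perm (ι × Fin 2)) (u : V) : ℝ :=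
  η u ![v (σ (i, 1))] * ∏ j ∈ Finset.univ.erase i, Θ j u ![v (σ (j, 0)), v (σ (j, 1))]

lemma wedgeAlt_extDeriv (i : ι) {η : V → V [⋀^Fin 1]→L[ℝ] ℝ} {Θ : ι → V → V [⋀^Fin 2]→L[ℝ] ℝ}
    {u : V} (hη : DifferentiableAt ℝ η u) (hΘ : ∀ j ≠ i, DifferentiableAt ℝ (Θ j) u)
    (hd : ∀ j ≠ i, extDeriv (Θ j) u = 0) (v : ι × Fin 2 → V) :
    wedgeAlt (Function.update (fun j => Θ j u) i (extDeriv η u)) v =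
      2 * ∑ σ : Equiv.Perm (ι × Fin 2), ((Equiv.Perm.sign σ : ℤ) : ℝ) *
        fderiv ℝ (stokesComponent i η Θ v σ) u (v (σ (i, 0))) := by
  set η' := fderiv ℝ η u with hη'
  set Θ' := fun j => fderiv ℝ (Θ j) u with hΘ'
  let R : Equiv.Perm (ι × Fin 2) → Finset ι → ℝ := fun σ s =>
    ∏ j ∈ s, Θ j u ![v (σ (j, 0)), v (σ (j, 1))]
  have hder : ∀ σ, fderiv ℝ (stokesComponent i η Θ v σ) u (v (σ (i, 0))) =
      η' (v (σ (i, 0))) ![v (σ (i, 1))] * R σ (Finset.univ.erase i) +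
      ∑ j ∈ Finset.univ.erase i, η u ![v (σ (i, 1))] *
        (Θ' j (v (σ (i, 0))) ![v (σ (j, 0)), v (σ (j, 1))] *
          R σ ((Finset.univ.erase i).erase j)) := by
    intro σ
    have h1 := fderiv_alternating_apply hη ![v (σ (i, 1))]
    have h2 := HasFDerivAt.finsetProd (u := Finset.univ.erase i)
      (g := fun j u => Θ j u ![v (σ (j, 0)), v (σ (j, 1))]) (x := u)
      (fun j hj => fderiv_alternating_apply (hΘ j (Finset.ne_of_mem_erase hj))
        ![v (σ (j, 0)), v (σ (j, 1))])
    have h3 := (h1.mul h2).fderiv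
    have h4 : stokesComponent i η Θ v σ = (fun u => η u ![v (σ (i, 1))]) *
      fun u => ∏ j ∈ Finset.univ.erase i, Θ j u ![v (σ (j, 0)), v (σ (j, 1))] := rfl
    rw [h4, h3]
    simp only [add_apply, smul_apply,
      sum_apply, smul_eq_mul, ContinuousLinearMap.comp_apply,
      ContinuousAlternatingMap.apply_apply, Finset.mul_sum, R]
    rw [add_comm]
    congr 1
    · rw [mul_comm]
    · exact Finset.sum_congr rfl fun j _ => by rw [mul_comm (Θ' j _ _)]
  simp only [hder, mul_add, Finset.sum_add_distrib]
  have hzero : ∑ σ : Equiv.Perm (ι × Fin 2), ((Equiv.Perm.sign σ : ℤ) : ℝ) *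
      ∑ j ∈ Finset.univ.erase i, η u ![v (σ (i, 1))] *
        (Θ' j (v (σ (i, 0))) ![v (σ (j, 0)), v (σ (j, 1))] *
          R σ ((Finset.univ.erase i).erase j)) = 0 := by
    simp only [Finset.mul_sum]
    rw [Finset.sum_comm]
    refine Finset.sum_eq_zero fun j hj => ?_
    have hji : j ≠ i := Finset.ne_of_mem_erase hj
    have hR : ∀ (σ : Equiv.Perm (ι × Fin 2)) (b : Fin 2),
        R (σ * Equiv.swap (i, 0) (j, b)) ((Finset.univ.erase i).erase j) =
          R σ ((Finset.univ.erase i).erase j) := by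
      intro σ b
      refine Finset.prod_congr rfl fun k hk => ?_
      have hkj : k ≠ j := Finset.ne_of_mem_erase hk
      have hki : k ≠ i := Finset.ne_of_mem_erase (Finset.mem_of_mem_erase hk)
      simp only [Equiv.Perm.coe_mul, Function.comp_apply]
      rw [Equiv.swap_apply_of_ne_of_ne (a := (i, 0)) (x := (k, 0)),
        Equiv.swap_apply_of_ne_of_ne (a := (i, 0)) (x := (k, 1))] <;> simp [hkj, hki]
    have hcl : ∀ a b c : V, Θ' j a ![b, c] - Θ' j b ![a, c] + Θ' j c ![a, b] = 0 := by
      intro a b c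
      rw [← alternatizeUncurryFin_three]
      have := hd j hji
      rw [extDeriv] at this
      rw [hΘ', this]; rfl
    set G : Equiv.Perm (ι × Fin 2) → ℝ := fun σ => η u ![v (σ (i, 1))] *
        (Θ' j (v (σ (i, 0))) ![v (σ (j, 0)), v (σ (j, 1))] *
          R σ ((Finset.univ.erase i).erase j)) with hG
    have e0 := sum_sign_mul_swap G (x := (i, 0)) (y := (j, 0)) (by simp [hji.symm])
    have e1 := sum_sign_mul_swap G (x := (i, 0)) (y := (j, 1)) (by simp [hji.symm])
    have e2 : ∑ σ : Equiv.Perm (ι × Fin 2), ((Equiv.Perm.sign σ : ℤ) : ℝ) * G σ -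
        ∑ σ : Equiv.Perm (ι × Fin 2), ((Equiv.Perm.sign σ : ℤ) : ℝ) *
          G (σ * Equiv.swap (i, 0) (j, 0)) - ∑ σ : Equiv.Perm (ι × Fin 2),
          ((Equiv.Perm.sign σ : ℤ) : ℝ) * G (σ * Equiv.swap (i, 0) (j, 1)) = 0 := by
      rw [← Finset.sum_sub_distrib, ← Finset.sum_sub_distrib]
      refine Finset.sum_eq_zero fun σ _ => ?_
      simp only [hG, hR]
      have s1 : Equiv.swap (i, (0 : Fin 2)) (j, 0) (i, 1) = (i, 1) :=
        Equiv.swap_apply_of_ne_of_ne (by simp) (by simp [hji.symm])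
      have s2 : Equiv.swap (i, (0 : Fin 2)) (j, 1) (i, 1) = (i, 1) :=
        Equiv.swap_apply_of_ne_of_ne (by simp) (by simp [hji.symm])
      have s3 : Equiv.swap (i, (0 : Fin 2)) (j, 0) (j, 1) = (j, 1) :=
        Equiv.swap_apply_of_ne_of_ne (by simp [hji]) (by simp)
      have s4 : Equiv.swap (i, (0 : Fin 2)) (j, 1) (j, 0) = (j, 0) :=
        Equiv.swap_apply_of_ne_of_ne (by simp [hji]) (by simp)
      simp only [Equiv.Perm.coe_mul, Function.comp_apply, s1, s2, s3, s4, Equiv.swap_apply_left,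
        Equiv.swap_apply_right]
      have h := hcl (v (σ (i, 0))) (v (σ (j, 0))) (v (σ (j, 1)))
      rw [two_swap (Θ' j (v (σ (j, 1)))) (v (σ (j, 0)))]
      linear_combination (((Equiv.Perm.sign σ : ℤ) : ℝ) * η u ![v (σ (i, 1))] *
        R σ ((Finset.univ.erase i).erase j)) * h
    linarith
  rw [hzero, mul_zero, add_zero, wedgeAlt_apply]
  have hupd : ∀ σ : Equiv.Perm (ι × Fin 2), ∏ j, (Function.update (fun j => Θ j u) i
      (extDeriv η u) j) ![v (σ (j, 0)), v (σ (j, 1))] =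
      (η' (v (σ (i, 0))) ![v (σ (i, 1))] - η' (v (σ (i, 1))) ![v (σ (i, 0))]) *
        R σ (Finset.univ.erase i) := by
    intro σ
    rw [← Finset.mul_prod_erase Finset.univ _ (Finset.mem_univ i), Function.update_self]
    congr 1
    · exact alternatizeUncurryFin_two _ _ _
    · exact Finset.prod_congr rfl fun j hj => by
        rw [Function.update_of_ne (Finset.ne_of_mem_erase hj)]
  have hR : ∀ σ : Equiv.Perm (ι × Fin 2), R (σ * Equiv.swap (i, 0) (i, 1))
      (Finset.univ.erase i) = R σ (Finset.univ.erase i) := by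
    intro σ
    refine Finset.prod_congr rfl fun k hk => ?_
    have hki : k ≠ i := Finset.ne_of_mem_erase hk
    simp only [Equiv.Perm.coe_mul, Function.comp_apply]
    rw [Equiv.swap_apply_of_ne_of_ne (a := (i, 0)) (x := (k, 0)),
      Equiv.swap_apply_of_ne_of_ne (a := (i, 0)) (x := (k, 1))] <;> simp [hki]
  have e0 := sum_sign_mul_swap (fun σ => η' (v (σ (i, 0))) ![v (σ (i, 1))] *
    R σ (Finset.univ.erase i)) (x := (i, 0)) (y := (i, 1)) (by simp)
  simp only [hR, Equiv.Perm.coe_mul, Function.comp_apply, Equiv.swap_apply_left,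
    Equiv.swap_apply_right] at e0
  simp only [hupd, sub_mul, mul_sub, Finset.sum_sub_distrib]
  linarith

lemma integral_fderiv_eq_zero [MeasurableSpace V] [BorelSpace V] [FiniteDimensional ℝ V]
    (μ : Measure V) [μ.IsAddHaarMeasure] {X : V → ℝ} (hX : ContDiff ℝ 1 X)
    (hc : HasCompactSupport X) (v : V) : ∫ u, fderiv ℝ X u v ∂μ = 0 := by
  have hi : Integrable X μ := hX.continuous.integrable_of_hasCompactSupport hc
  have hi' : Integrable (fun u => fderiv ℝ X u v) μ := by
    refine ((hX.continuous_fderiv (by simp)).clm_apply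
      continuous_const).integrable_of_hasCompactSupport ?_
    exact (hc.fderiv (𝕜 := ℝ)).comp_left (g := fun T : V →L[ℝ] ℝ => T v) rfl
  have h1 : ∀ x, HasLineDerivAt ℝ X (fderiv ℝ X x v) x v := fun x =>
    ((hX.differentiable (by simp)) x).hasFDerivAt.hasLineDerivAt v
  have h0 : ∀ x, HasLineDerivAt ℝ (fun _ : V => (1 : ℝ)) 0 x v := fun x => by
    simpa using (hasFDerivAt_const (𝕜 := ℝ) (1 : ℝ) x).hasLineDerivAt v
  have := integral_bilinear_hasLineDerivAt_right_eq_neg_left_of_integrable (μ := μ) (v := v)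
    (B := ContinuousLinearMap.mul ℝ ℝ) (f := X) (f' := fun u => fderiv ℝ X u v)
    (g := fun _ : V => (1 : ℝ)) (g' := fun _ : V => (0 : ℝ)) (by simpa using hi') (by simp)
    (by simpa using hi) (fun x _ => h1 x) fun x _ => h0 x
  simpa using this.symm

end PointwiseStokes

section Stokes

variable {ι : Type*} [Fintype ι] [DecidableEq ι] {Y : Type*} [TopologicalSpace Y]
  [ChartedSpace (ι → ℂ) Y] [IsManifold 𝓘(ℂ, ι → ℂ) ω Y] [T2Space Y] [CompactSpace Y]

/-- The product of a function and a form. -/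
def mulForm {k : ℕ} (ρ : Y → ℝ) (η : RealForm ι Y k) : RealForm ι Y k := fun y => ρ y • η y

lemma inChart_mulForm {k : ℕ} (ρ : Y → ℝ) (η : RealForm ι Y k)
    (c : OpenPartialHomeomorph Y (ι → ℂ)) (u : ι → ℂ) :
    inChart (mulForm ρ η) c u = ρ (c.symm u) • inChart η c u := rfl

lemma contDiffAt_comp_chart {ρ : Y → ℝ} (hρ : ContMDiff 𝓘(ℝ, ι → ℂ) 𝓘(ℝ, ℝ) ∞ ρ)
    {c : OpenPartialHomeomorph Y (ι → ℂ)} (hc : c ∈ atlas (ι → ℂ) Y) {u : ι → ℂ}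
    (hu : u ∈ c.target) : ContDiffAt ℝ ∞ (fun u => ρ (c.symm u)) u := by
  have h : ContMDiffAt 𝓘(ℝ, ι → ℂ) 𝓘(ℝ, ℝ) ∞ (ρ ∘ c.symm) u :=
    hρ.contMDiffAt.comp u (contMDiffAt_symm_of_mem_maximalAtlas (mem_maximalAtlas_real hc) hu)
  exact h.contDiffAt

lemma IsSmoothForm.mulForm {k : ℕ} {ρ : Y → ℝ} (hρ : ContMDiff 𝓘(ℝ, ι → ℂ) 𝓘(ℝ, ℝ) ∞ ρ)
    {η : RealForm ι Y k} (h : IsSmoothForm η) : IsSmoothForm (mulForm ρ η) := by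
  intro c hc u hu
  exact ((contDiffAt_comp_chart hρ hc hu).smul (h.contDiffAt hc hu)).contDiffWithinAt

lemma extDerivForm_add {k : ℕ} {η η' : RealForm ι Y k} (h : IsSmoothForm η)
    (h' : IsSmoothForm η') : extDerivForm (η + η') = extDerivForm η + extDerivForm η' := by
  funext y
  have hc := chart_mem_atlas (ι → ℂ) y
  have hy := mem_chart_target (ι → ℂ) y
  change extDeriv (inChart (η + η') (chartAt (ι → ℂ) y)) _ =
    extDeriv (inChart η (chartAt (ι → ℂ) y)) _ + extDeriv (inChart η' (chartAt (ι → ℂ) y)) _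
  rw [inChart_add, extDeriv_add (h.differentiableAt hc hy) (h'.differentiableAt hc hy)]

lemma extDerivForm_eq_zero {k : ℕ} {η : RealForm ι Y k} {y : Y} (h : ∀ᶠ p in 𝓝 y, η p = 0) :
    extDerivForm η y = 0 := by
  have h1 : inChart η (chartAt (ι → ℂ) y) =ᶠ[𝓝 (chartAt (ι → ℂ) y y)]
      (0 : (ι → ℂ) → (ι → ℂ) [⋀^Fin k]→L[ℝ] ℝ) := by
    have h2 := (chartAt (ι → ℂ) y).symm.continuousAt (mem_chart_target (ι → ℂ) y)
    rw [ContinuousAt, OpenPartialHomeomorph.left_inv _ (mem_chart_source _ y)] at h2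
    filter_upwards [h2.eventually h] with u hu
    rw [inChart, hu]; rfl
  change extDeriv (inChart η (chartAt (ι → ℂ) y)) _ = 0
  rw [h1.extDeriv_eq, extDeriv_zero_form]

lemma integralWedge_extDerivForm_local {θ : ι → RealForm ι Y 2}
    (hθ : ∀ j, θ j ∈ closedForms ι Y) (i : ι) {η : RealForm ι Y 1} (hη : IsSmoothForm η) (y : Y) :
    integralWedge (Function.update θ i (extDerivForm (mulForm (partition ι Y y) η))) = 0 := by
  set ρ := partition ι Y y
  set c := chartAt (ι → ℂ) y with hcdef
  have hc : c ∈ atlas (ι → ℂ) Y := chart_mem_atlas _ y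
  have hsub : tsupport ρ ⊆ c.source := partition_subordinate y
  set ζ := mulForm ρ η with hζdef
  have hζ : IsSmoothForm ζ := hη.mulForm (partition ι Y y).contMDiff
  set K := c '' tsupport ρ with hKdef
  have hK : IsCompact K :=
    (isClosed_tsupport ρ).isCompact.image_of_continuousOn (c.continuousOn.mono hsub)
  have hKt : K ⊆ c.target := by
    rintro _ ⟨p, hp, rfl⟩; exact c.map_source (hsub hp)
  let η₀ : (ι → ℂ) → (ι → ℂ) [⋀^Fin 1]→L[ℝ] ℝ := c.target.indicator (inChart ζ c)
  have hη₀ : ∀ u ∉ K, η₀ u = 0 := by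
    intro u hu
    by_cases hut : u ∈ c.target
    · rw [show η₀ u = inChart ζ c u from indicator_of_mem hut _, inChart_mulForm,
        show ρ (c.symm u) = 0 from ?_, zero_smul]
      by_contra h
      exact hu ⟨c.symm u, subset_tsupport _ h, c.right_inv hut⟩
    · exact indicator_of_notMem hut _
  have hη₁ : ∀ u ∈ c.target, η₀ =ᶠ[𝓝 u] inChart ζ c := by
    intro u hu
    filter_upwards [c.open_target.mem_nhds hu] with u' hu'
    exact indicator_of_mem hu' _
  let Θ : ι → (ι → ℂ) → (ι → ℂ) [⋀^Fin 2]→L[ℝ] ℝ := fun j => inChart (θ j) c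
  have hX0 : ∀ σ, ∀ u ∉ K, stokesComponent i η₀ Θ (realBasis ι) σ u = 0 := by
    intro σ u hu
    rw [stokesComponent, hη₀ u hu]; simp
  have hX : ∀ σ, ContDiff ℝ 1 (stokesComponent i η₀ Θ (realBasis ι) σ) := by
    intro σ
    rw [contDiff_iff_contDiffAt]
    intro u
    by_cases hu : u ∈ K
    · have hut := hKt hu
      refine ContDiffAt.of_le (n := ∞) ?_ (by exact_mod_cast le_top)
      refine ContDiffAt.mul ?_ (contDiffAt_prod fun j _ => ?_)
      · exact contDiffAt_alternating_apply_const
          ((hζ.contDiffAt hc hut).congr_of_eventuallyEq (hη₁ u hut)) _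
      · exact contDiffAt_alternating_apply_const ((hθ j).1.contDiffAt hc hut) _
    · refine (contDiffAt_const (c := (0 : ℝ))).congr_of_eventuallyEq ?_
      filter_upwards [hK.isClosed.isOpen_compl.mem_nhds hu] with u' hu' using hX0 σ u' hu'
  have hXc : ∀ σ, HasCompactSupport (stokesComponent i η₀ Θ (realBasis ι) σ) := fun σ =>
    HasCompactSupport.intro hK (hX0 σ)
  have hsm : ∀ j, IsSmoothForm (Function.update θ i (extDerivForm ζ) j) := by
    intro j
    by_cases hj : j = i
    · subst hj; simpa using hζ.extDerivForm
    · simpa [hj] using (hθ j).1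
  rw [integralWedge_eq_sum (fun _ : Unit => c) (fun _ => hc) (fun _ => c.source.indicator 1)
    (fun _ => ?_) (fun _ p => ?_) (fun _ p hp => indicator_of_notMem hp _) ∅
    (fun c _ => by simp) hsm (fun p _ => ?_)]
  · simp only [Finset.univ_unique, Finset.sum_singleton, chartIntegral]
    have hden : ∀ u ∈ c.target, c.source.indicator (1 : Y → ℝ) (c.symm u) *
        density (Function.update θ i (extDerivForm ζ)) c u =
        ∑ σ : Equiv.Perm (ι × Fin 2), ((2 ^ Fintype.card ι : ℝ)⁻¹ * 2 *
          ((Equiv.Perm.sign σ : ℤ) : ℝ)) * fderiv ℝ (stokesComponent i η₀ Θ (realBasis ι) σ) u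
            (realBasis ι (σ (i, 0))) := by
      intro u hu
      rw [indicator_of_mem (c.map_target hu), Pi.one_apply, one_mul, density]
      have h1 : (fun j => inChart (Function.update θ i (extDerivForm ζ) j) c u) =
          Function.update (fun j => Θ j u) i (extDeriv η₀ u) := by
        ext1 j
        by_cases hj : j = i
        · subst hj
          rw [Function.update_self, Function.update_self, inChart_extDerivForm hζ hc hu,
            (hη₁ u hu).extDeriv_eq]
        · simp [hj, Θ]
      rw [h1, wedgeDensity_eq, wedgeAlt_extDeriv i
        ((hζ.differentiableAt hc hu).congr_of_eventuallyEq (hη₁ u hu))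
        (fun j _ => (hθ j).1.differentiableAt hc hu) (fun j _ => (hθ j).2 c hc u hu), Finset.mul_sum,
        Finset.mul_sum]
      exact Finset.sum_congr rfl fun σ _ => by ring
    rw [setIntegral_congr_fun c.open_target.measurableSet hden]
    have hint : ∀ σ, Integrable (fun u => fderiv ℝ (stokesComponent i η₀ Θ (realBasis ι) σ) u
        (realBasis ι (σ (i, 0)))) := by
      intro σ
      refine (((hX σ).continuous_fderiv (by simp)).clm_apply
        continuous_const).integrable_of_hasCompactSupport ?_
      exact ((hXc σ).fderiv (𝕜 := ℝ)).comp_left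
        (g := fun T : (ι → ℂ) →L[ℝ] ℝ => T (realBasis ι (σ (i, 0)))) rfl
    rw [integral_finsetSum _ fun σ _ => ((hint σ).const_mul _).integrableOn]
    refine Finset.sum_eq_zero fun σ _ => ?_
    rw [integral_const_mul, setIntegral_eq_integral_of_forall_compl_eq_zero,
      integral_fderiv_eq_zero volume (hX σ) (hXc σ), mul_zero]
    intro u hu
    have : stokesComponent i η₀ Θ (realBasis ι) σ =ᶠ[𝓝 u] fun _ => 0 := by
      filter_upwards [hK.isClosed.isOpen_compl.mem_nhds fun h => hu (hKt h)] with u' hu'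
        using hX0 σ u' hu'
    rw [this.fderiv_eq]; simp
  · let _ : MeasurableSpace Y := borel Y
    have _ : BorelSpace Y := ⟨rfl⟩
    exact (measurable_const (a := (1 : ℝ))).indicator c.open_source.measurableSet
  · by_cases hp : p ∈ c.source <;> simp [hp]
  · by_cases hp : p ∈ c.source
    · left; simp [hp]
    · right
      refine ⟨i, ?_⟩
      rw [Function.update_self]
      refine extDerivForm_eq_zero ?_
      filter_upwards [(isClosed_tsupport ρ).isOpen_compl.mem_nhds fun h => hp (hsub h)] with q hq
      rw [hζdef, mulForm, image_eq_zero_of_notMem_tsupport hq, zero_smul]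

/-- **Stokes' theorem** for the wedge product of an exact form with closed forms. -/
theorem integralWedge_update_exact {θ : ι → RealForm ι Y 2}
    (hθ : ∀ j, θ j ∈ closedForms ι Y) (i : ι) {ξ : RealForm ι Y 2} (hξ : ξ ∈ exactForms ι Y) :
    integralWedge (Function.update θ i ξ) = 0 := by
  obtain ⟨η, hη, rfl⟩ := mem_exactForms_iff.1 hξ
  have key : ∀ s : Finset Y, IsSmoothForm (∑ y ∈ s, mulForm (partition ι Y y) η) ∧
      integralWedge (Function.update θ i
        (extDerivForm (∑ y ∈ s, mulForm (partition ι Y y) η))) = 0 := by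
    classical
    intro s
    induction s using Finset.induction_on with
    | empty =>
      refine ⟨by simpa using IsSmoothForm.zero, ?_⟩
      have h0 : extDerivForm (0 : RealForm ι Y 1) = (0 : ℝ) • extDerivForm η := by
        rw [zero_smul]; funext y
        exact extDerivForm_eq_zero (Filter.Eventually.of_forall fun _ => rfl)
      rw [Finset.sum_empty, h0, integralWedge_update_smul, zero_mul]
    | insert y s hy ih =>
      have h1 : IsSmoothForm (mulForm (partition ι Y y) η) :=
        hη.mulForm (partition ι Y y).contMDiff
      rw [Finset.sum_insert hy]
      refine ⟨h1.add ih.1, ?_⟩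
      rw [extDerivForm_add h1 ih.1, integralWedge_update_add (fun j => (hθ j).1) i h1.extDerivForm
        ih.1.extDerivForm, ih.2, integralWedge_extDerivForm_local hθ i hη, add_zero]
  have h := (key (partitionIndex ι Y)).2
  rwa [show ∑ y ∈ partitionIndex ι Y, mulForm (partition ι Y y) η = η from ?_] at h
  funext p
  rw [Finset.sum_apply]
  simp only [mulForm]
  rw [← Finset.sum_smul, partition_sum, one_smul]

lemma update_mem_closedForms {θ : ι → RealForm ι Y 2} (hθ : ∀ j, θ j ∈ closedForms ι Y) (i : ι)
    {ξ : RealForm ι Y 2} (hξ : ξ ∈ closedForms ι Y) (j : ι) :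
    Function.update θ i ξ j ∈ closedForms ι Y := by
  by_cases hj : j = i
  · subst hj; simpa using hξ
  · simpa [hj] using hθ j

lemma integralWedge_congr {θ θ' : ι → RealForm ι Y 2} (hθ : ∀ j, θ j ∈ closedForms ι Y)
    (hθ' : ∀ j, θ' j ∈ closedForms ι Y) (h : ∀ j, θ' j - θ j ∈ exactForms ι Y) :
    integralWedge θ' = integralWedge θ := by
  have key : ∀ s : Finset ι, (∀ j, s.piecewise θ' θ j ∈ closedForms ι Y) ∧
      integralWedge (s.piecewise θ' θ) = integralWedge θ := by
    intro s
    induction s using Finset.induction_on with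
    | empty => simpa using hθ
    | insert i s hi ih =>
      rw [Finset.piecewise_insert]
      refine ⟨update_mem_closedForms ih.1 i (hθ' i), ?_⟩
      rw [show θ' i = θ i + (θ' i - θ i) by abel, integralWedge_update_add (fun j => (ih.1 j).1) i
        (hθ i).1 (exactForms_le_closedForms (h i)).1, integralWedge_update_exact ih.1 i (h i),
        add_zero, ← ih.2]
      congr 1
      rw [Function.update_eq_self_iff, Finset.piecewise_eq_of_notMem _ _ _ hi]
  simpa using (key Finset.univ).2

lemma intersectionNumber_deRhamClass {θ : ι → RealForm ι Y 2} (hθ : ∀ j, θ j ∈ closedForms ι Y) :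
    intersectionNumber (fun j => deRhamClass (θ j)) = integralWedge θ :=
  integralWedge_congr hθ (fun j => representative_mem _) fun j =>
    (deRhamClass_eq_iff (representative_mem _) (hθ j)).1 (deRhamClass_representative _)

variable (ι Y) in
/-- The intersection numbers as a multilinear map. -/
def intersectionForm : MultilinearMap ℝ (fun _ : ι => DeRham2 ι Y) ℝ :=
  MultilinearMap.mk' intersectionNumber
    (by
      intro c j x y
      have h : ∀ θ ∈ closedForms ι Y, intersectionNumber (Function.update c j (deRhamClass θ)) =
          integralWedge (Function.update (fun i => representative (c i)) j θ) := by
        intro θ hθ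
        rw [← intersectionNumber_deRhamClass
          (update_mem_closedForms (fun i => representative_mem (c i)) j hθ)]
        congr 1; ext1 i
        by_cases hi : i = j
        · subst hi; simp
        · simp [hi, deRhamClass_representative]
      have hx := representative_mem x
      have hy := representative_mem y
      rw [← deRhamClass_representative x, ← deRhamClass_representative y,
        ← deRhamClass_add hx hy, h _ (add_mem hx hy), h _ hx, h _ hy]
      exact integralWedge_update_add (fun i => (representative_mem (c i)).1) j hx.1 hy.1)
    (by
      intro c j r x
      have h : ∀ θ ∈ closedForms ι Y, intersectionNumber (Function.update c j (deRhamClass θ)) =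
          integralWedge (Function.update (fun i => representative (c i)) j θ) := by
        intro θ hθ
        rw [← intersectionNumber_deRhamClass
          (update_mem_closedForms (fun i => representative_mem (c i)) j hθ)]
        congr 1; ext1 i
        by_cases hi : i = j
        · subst hi; simp
        · simp [hi, deRhamClass_representative]
      have hx := representative_mem x
      rw [← deRhamClass_representative x, ← deRhamClass_smul hx,
        h _ (Submodule.smul_mem _ r hx), h _ hx]
      exact integralWedge_update_smul _ j r _)

lemma intersectionForm_apply (c : ι → DeRham2 ι Y) :
    intersectionForm ι Y c = intersectionNumber c := rfl

lemma intersectionNumber_perm (c : ι → DeRham2 ι Y) (σ : Equiv.Perm ι) :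
    intersectionNumber (fun j => c (σ j)) = intersectionNumber c :=
  integralWedge_perm (fun j => representative (c j)) σ

lemma topIntersection_eq (i j : ι) (a b : DeRham2 ι Y) :
    topIntersection i a b = topIntersection j a b := by
  rw [topIntersection, topIntersection, ← intersectionNumber_perm _ (Equiv.swap i j)]
  congr 1; ext1 k
  simp only [Function.update_apply, Equiv.swap_apply_def]
  split_ifs <;> simp_all

/-- The derivative of the volume is a mixed intersection number. -/
lemma hasDerivAt_topSelfIntersection (i : ι) (a b : DeRham2 ι Y) :
    HasDerivAt (fun t : ℝ => topSelfIntersection (a + t • b))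
      (Fintype.card ι * topIntersection i a b) 0 := by
  have h1 : ∀ t : ℝ, topSelfIntersection (a + t • b) = ∑ s : Finset ι,
      t ^ s.card * intersectionNumber (s.piecewise (fun _ => b) fun _ => a) := by
    intro t
    rw [topSelfIntersection, ← intersectionForm_apply]
    have := (intersectionForm ι Y).map_add_univ (fun _ => t • b) fun _ => a
    rw [show (fun _ : ι => a + t • b) = (fun _ : ι => t • b) + fun _ => a by
      ext1 j; simp [add_comm], this]
    refine Finset.sum_congr rfl fun s _ => ?_
    have h2 := (intersectionForm ι Y).map_piecewise_smul (fun _ => t)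
      (s.piecewise (fun _ => b) fun _ => a) s
    rw [Finset.prod_const, smul_eq_mul] at h2
    rw [← intersectionForm_apply, ← h2]
    congr 1; ext1 j
    by_cases hj : j ∈ s <;> simp [hj]
  simp only [h1]
  have h2 : HasDerivAt (fun t : ℝ => ∑ s : Finset ι,
      t ^ s.card * intersectionNumber (s.piecewise (fun _ => b) fun _ => a))
      (∑ s : Finset ι, ((s.card : ℝ) * 0 ^ (s.card - 1)) *
        intersectionNumber (s.piecewise (fun _ => b) fun _ => a)) 0 :=
    HasDerivAt.fun_sum fun s _ => (hasDerivAt_pow s.card (0 : ℝ)).mul_const _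
  convert h2 using 1
  have h3 : ∀ s : Finset ι, (((s.card : ℝ) * 0 ^ (s.card - 1)) *
      intersectionNumber (s.piecewise (fun _ => b) fun _ => a)) =
      if s.card = 1 then intersectionNumber (s.piecewise (fun _ => b) fun _ => a) else 0 := by
    intro s
    split_ifs with hs
    · simp [hs]
    · rcases Nat.lt_or_gt_of_ne hs with h | h
      · have : s.card = 0 := by omega
        simp [this]
      · rw [zero_pow (by omega)]; simp
  rw [Finset.sum_congr rfl fun s _ => h3 s, ← Fintype.sum_of_injective
    (fun j : ι => ({j} : Finset ι)) Finset.singleton_injective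
    (fun j => topIntersection j a b) (fun s => if s.card = 1 then
        intersectionNumber (s.piecewise (fun _ => b) fun _ => a) else 0)]
  · rw [Finset.sum_congr rfl fun j _ => topIntersection_eq j i a b]
    simp
  · intro s hs
    refine if_neg fun h => hs ?_
    obtain ⟨j, rfl⟩ := Finset.card_eq_one.1 h
    exact ⟨j, rfl⟩
  · intro j
    rw [if_pos (Finset.card_singleton j), Finset.piecewise_singleton]
    rfl

end Stokes

end

end KahlerProj

namespace KahlerProj

noncomputable section

/-! ### The operator `ddc` -/

section Ddc

variable {ι κ : Type*} [Fintype ι] [Fintype κ]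

/-- The form `-(1/4π) dφ ∘ J`, whose exterior derivative is `ddc φ`. -/
def dc (φ : (ι → ℂ) → ℝ) (u : ι → ℂ) : (ι → ℂ) [⋀^Fin 1]→L[ℝ] ℝ :=
  ContinuousAlternatingMap.ofSubsingleton ℝ (ι → ℂ) ℝ (0 : Fin 1)
    (-(1 / (4 * Real.pi)) •
      (fderiv ℝ φ u).comp (Complex.I • ContinuousLinearMap.id ℝ (ι → ℂ)))

lemma dc_apply (φ : (ι → ℂ) → ℝ) (u : ι → ℂ) (v : Fin 1 → ι → ℂ) :
    dc φ u v = -(1 / (4 * Real.pi)) * fderiv ℝ φ u (Complex.I • v 0) := rfl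

lemma ddc_eq_extDeriv (φ : (ι → ℂ) → ℝ) : ddc φ = extDeriv (dc φ) := rfl

/-- The second derivative of `φ` along `a` and `b`. -/
def second (φ : (ι → ℂ) → ℝ) (u a b : ι → ℂ) : ℝ := fderiv ℝ (fun u => fderiv ℝ φ u b) u a

variable {φ ψ : (ι → ℂ) → ℝ} {u : ι → ℂ}

lemma eventually_differentiableAt (h : ContDiffAt ℝ ∞ φ u) :
    ∀ᶠ x in 𝓝 u, DifferentiableAt ℝ φ x := by
  filter_upwards [(h.of_le (m := 1) (by simp)).eventually (by simp)] with x hx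
  exact hx.differentiableAt (by simp)

lemma contDiffAt_fderiv_apply (h : ContDiffAt ℝ ∞ φ u) (b : ι → ℂ) :
    ContDiffAt ℝ ∞ (fun u => fderiv ℝ φ u b) u :=
  (h.fderiv_right (m := ∞) (by simp)).clm_apply contDiffAt_const

lemma second_eq (h : ContDiffAt ℝ ∞ φ u) (a b : ι → ℂ) :
    second φ u a b = fderiv ℝ (fderiv ℝ φ) u a b := by
  have h1 : DifferentiableAt ℝ (fderiv ℝ φ) u :=
    (h.fderiv_right (m := ∞) (by simp)).differentiableAt (by simp)
  rw [second, fderiv_clm_apply h1 (differentiableAt_const b)]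
  simp

lemma second_comm (h : ContDiffAt ℝ ∞ φ u) (a b : ι → ℂ) :
    second φ u a b = second φ u b a := by
  rw [second_eq h, second_eq h]
  exact (h.isSymmSndFDerivAt (by simp [two_le_infty])).eq a b

lemma second_neg_right (a b : ι → ℂ) : second φ u a (-b) = -second φ u a b := by
  simp only [second, map_neg]
  rw [fderiv_fun_neg]; rfl

lemma contDiffAt_dc (h : ContDiffAt ℝ ∞ φ u) : ContDiffAt ℝ ∞ (dc φ) u :=
  contDiffAt_alternating fun v =>
    (contDiffAt_const (c := -(1 / (4 * Real.pi)))).mul (contDiffAt_fderiv_apply h _)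

lemma contDiffAt_ddc (h : ContDiffAt ℝ ∞ φ u) : ContDiffAt ℝ ∞ (ddc φ) u :=
  contDiffAt_extDeriv (contDiffAt_dc h)

lemma extDeriv_ddc (h : ContDiffAt ℝ ∞ φ u) : extDeriv (ddc φ) u = 0 :=
  extDeriv_extDeriv_apply (contDiffAt_dc h) (by simp [two_le_infty])

lemma ddc_apply (h : ContDiffAt ℝ ∞ φ u) (v w : ι → ℂ) :
    ddc φ u ![v, w] = -(1 / (4 * Real.pi)) *
      (second φ u v (Complex.I • w) - second φ u w (Complex.I • v)) := by
  have hd : DifferentiableAt ℝ (dc φ) u := (contDiffAt_dc h).differentiableAt (by simp)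
  have key : ∀ v w : ι → ℂ, fderiv ℝ (dc φ) u v ![w] =
      -(1 / (4 * Real.pi)) * second φ u v (Complex.I • w) := by
    intro v w
    have h1 := (fderiv_alternating_apply hd ![w]).fderiv
    have h2 : fderiv ℝ (fun u => dc φ u ![w]) u v = fderiv ℝ (dc φ) u v ![w] := by
      rw [h1]; rfl
    rw [← h2]
    simp only [dc_apply, Matrix.cons_val_zero]
    rw [fderiv_const_mul ((contDiffAt_fderiv_apply h _).differentiableAt (by simp))]
    rfl
  rw [ddc_eq_extDeriv, extDeriv, alternatizeUncurryFin_two, key, key]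
  ring

lemma I_smul_I_smul (v : ι → ℂ) : Complex.I • Complex.I • v = -v := by
  rw [smul_smul, Complex.I_mul_I, neg_one_smul]

lemma ddc_invariant (h : ContDiffAt ℝ ∞ φ u) (v w : ι → ℂ) :
    ddc φ u ![Complex.I • v, Complex.I • w] = ddc φ u ![v, w] := by
  rw [ddc_apply h, ddc_apply h, I_smul_I_smul, I_smul_I_smul, second_neg_right, second_neg_right,
    second_comm h v, second_comm h w]
  ring

lemma ddc_quadratic (h : ContDiffAt ℝ ∞ φ u) (v : ι → ℂ) :
    ddc φ u ![v, Complex.I • v] = 1 / (4 * Real.pi) *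
      (second φ u v v + second φ u (Complex.I • v) (Complex.I • v)) := by
  rw [ddc_apply h, I_smul_I_smul, second_neg_right]
  ring

/-- An invariant 2-form is determined by its associated quadratic form. -/
lemma two_eq_of_quadratic {θ θ' : (ι → ℂ) [⋀^Fin 2]→L[ℝ] ℝ}
    (h : ∀ v w, θ ![Complex.I • v, Complex.I • w] = θ ![v, w])
    (h' : ∀ v w, θ' ![Complex.I • v, Complex.I • w] = θ' ![v, w])
    (hq : ∀ v, θ ![v, Complex.I • v] = θ' ![v, Complex.I • v]) : θ = θ' := by
  refine two_ext fun a b => ?_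
  have key : ∀ (η : (ι → ℂ) [⋀^Fin 2]→L[ℝ] ℝ),
      (∀ v w, η ![Complex.I • v, Complex.I • w] = η ![v, w]) → ∀ v w,
      η ![v + w, Complex.I • (v + w)] = η ![v, Complex.I • v] + η ![w, Complex.I • w] +
        2 * η ![v, Complex.I • w] := by
    intro η hη v w
    have h1 : η ![w, Complex.I • v] = η ![v, Complex.I • w] := by
      rw [← hη w, I_smul_I_smul, two_neg_right, two_swap, neg_neg]
    rw [smul_add, two_add_left, two_add_right, two_add_right, h1]; ring
  have h1 := key θ h a (-(Complex.I • b))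
  have h2 := key θ' h' a (-(Complex.I • b))
  rw [hq, hq, hq, h2] at h1
  have h3 : Complex.I • -(Complex.I • b) = b := by rw [smul_neg, I_smul_I_smul, neg_neg]
  rw [h3] at h1
  linarith

lemma ddc_congr (h : φ =ᶠ[𝓝 u] ψ) : ddc φ u = ddc ψ u := by
  have : dc φ =ᶠ[𝓝 u] dc ψ := by
    filter_upwards [h.eventuallyEq_nhds] with u' hu'
    rw [dc, dc, hu'.fderiv_eq]
  rw [ddc_eq_extDeriv, ddc_eq_extDeriv, this.extDeriv_eq]

lemma ddc_add (h : ContDiffAt ℝ ∞ φ u) (h' : ContDiffAt ℝ ∞ ψ u) :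
    ddc (fun u => φ u + ψ u) u = ddc φ u + ddc ψ u := by
  have h1 : dc (fun u => φ u + ψ u) =ᶠ[𝓝 u] dc φ + dc ψ := by
    filter_upwards [eventually_differentiableAt h, eventually_differentiableAt h'] with u' hu hu'
    ext v
    simp only [dc_apply, Pi.add_apply, ContinuousAlternatingMap.add_apply]
    rw [fderiv_fun_add hu hu']
    simp only [add_apply]; ring
  rw [ddc_eq_extDeriv, h1.extDeriv_eq, extDeriv_add
    ((contDiffAt_dc h).differentiableAt (by simp)) ((contDiffAt_dc h').differentiableAt (by simp))]
  rfl

lemma ddc_const_mul (h : ContDiffAt ℝ ∞ φ u) (r : ℝ) :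
    ddc (fun u => r * φ u) u = r • ddc φ u := by
  have h1 : dc (fun u => r * φ u) =ᶠ[𝓝 u] r • dc φ := by
    filter_upwards [eventually_differentiableAt h] with u' hu
    ext v
    simp only [dc_apply, Pi.smul_apply, ContinuousAlternatingMap.smul_apply, smul_eq_mul]
    rw [fderiv_const_mul hu]
    simp only [smul_apply, smul_eq_mul]; ring
  rw [ddc_eq_extDeriv, h1.extDeriv_eq, extDeriv_smul]
  rfl

/-- `dc` commutes with holomorphic maps. -/
lemma dc_comp {g : (κ → ℂ) → (ι → ℂ)} {z : κ → ℂ} (hg : DifferentiableAt ℂ g z)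
    (hφ : DifferentiableAt ℝ φ (g z)) :
    dc (φ ∘ g) z = (dc φ (g z)).compContinuousLinearMap (fderiv ℝ g z) := by
  ext v
  have hgr : fderiv ℝ g z = (fderiv ℂ g z).restrictScalars ℝ := hg.fderiv_restrictScalars ℝ
  rw [ContinuousAlternatingMap.compContinuousLinearMap_apply, dc_apply, dc_apply,
    fderiv_comp z hφ (hg.restrictScalars ℝ), hgr]
  simp

/-- `ddc` commutes with holomorphic maps. -/
lemma ddc_comp {g : (κ → ℂ) → (ι → ℂ)} {z : κ → ℂ} (hg : ContDiffAt ℂ ω g z)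
    (hφ : ContDiffAt ℝ ∞ φ (g z)) :
    ddc (φ ∘ g) z = (ddc φ (g z)).compContinuousLinearMap (fderiv ℝ g z) := by
  refine extDeriv_comp ?_ ((contDiffAt_dc hφ).differentiableAt (by simp))
    ((hg.restrict_scalars ℝ).of_le le_top)
  filter_upwards [hg.eventually (by simp),
    hg.continuousAt.eventually (eventually_differentiableAt hφ)] with z' h1 h2
  exact dc_comp (h1.differentiableAt (by simp)) h2

/-! ### First and second derivatives along a complex line -/

/-- Along the complex line through `u` in the direction `v`, the function `φ` has the derivative
`∂φ = δ` and the Laplacian `∂∂̄φ = l`. -/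
structure HasJet (φ : (ι → ℂ) → ℝ) (u v : ι → ℂ) (δ : ℂ) (l : ℝ) : Prop where
  smooth : ContDiffAt ℝ ∞ φ u
  fst : fderiv ℝ φ u v = 2 * δ.re
  fst_I : fderiv ℝ φ u (Complex.I • v) = -2 * δ.im
  snd : second φ u v v + second φ u (Complex.I • v) (Complex.I • v) = 4 * l

variable {v : ι → ℂ} {δ δ' : ℂ} {l l' : ℝ}

lemma HasJet.ddc (h : HasJet φ u v δ l) : ddc φ u ![v, Complex.I • v] = l / Real.pi := by
  rw [ddc_quadratic h.smooth, h.snd]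
  field_simp

lemma HasJet.congr (h : HasJet φ u v δ l) (e : ψ =ᶠ[𝓝 u] φ) : HasJet ψ u v δ l := by
  have e2 : ∀ b, (fun u => fderiv ℝ ψ u b) =ᶠ[𝓝 u] fun u => fderiv ℝ φ u b := fun b => by
    filter_upwards [e.eventuallyEq_nhds] with u' hu'
    rw [hu'.fderiv_eq]
  refine ⟨h.smooth.congr_of_eventuallyEq e, ?_, ?_, ?_⟩
  · rw [e.fderiv_eq, h.fst]
  · rw [e.fderiv_eq, h.fst_I]
  · rw [second, second, (e2 _).fderiv_eq, (e2 _).fderiv_eq]; exact h.snd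

lemma HasJet.of_eq (h : HasJet φ u v δ l) (hδ : δ' = δ) (hl : l' = l) : HasJet φ u v δ' l' := by
  rw [hδ, hl]; exact h

lemma HasJet.const (r : ℝ) : HasJet (fun _ => r) u v 0 0 := by
  refine ⟨contDiffAt_const, by simp, by simp, ?_⟩
  simp [second]

lemma second_add (h : ContDiffAt ℝ ∞ φ u) (h' : ContDiffAt ℝ ∞ ψ u) (a b : ι → ℂ) :
    second (fun u => φ u + ψ u) u a b = second φ u a b + second ψ u a b := by
  have e : (fun x => fderiv ℝ (fun u => φ u + ψ u) x b) =ᶠ[𝓝 u]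
      fun x => fderiv ℝ φ x b + fderiv ℝ ψ x b := by
    filter_upwards [eventually_differentiableAt h, eventually_differentiableAt h'] with x h1 h2
    rw [fderiv_fun_add h1 h2]; rfl
  rw [second, e.fderiv_eq, fderiv_fun_add
    ((contDiffAt_fderiv_apply h b).differentiableAt (by simp))
    ((contDiffAt_fderiv_apply h' b).differentiableAt (by simp))]
  rfl

lemma HasJet.add (h : HasJet φ u v δ l) (h' : HasJet ψ u v δ' l') :
    HasJet (fun u => φ u + ψ u) u v (δ + δ') (l + l') := by
  have e := fderiv_fun_add (h.smooth.differentiableAt (by simp))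
    (h'.smooth.differentiableAt (by simp))
  refine ⟨h.smooth.add h'.smooth, ?_, ?_, ?_⟩
  · rw [e, add_apply, h.fst, h'.fst, Complex.add_re]; ring
  · rw [e, add_apply, h.fst_I, h'.fst_I, Complex.add_im]; ring
  · rw [second_add h.smooth h'.smooth, second_add h.smooth h'.smooth]
    linear_combination h.snd + h'.snd

lemma second_mul (h : ContDiffAt ℝ ∞ φ u) (h' : ContDiffAt ℝ ∞ ψ u) (a : ι → ℂ) :
    second (fun u => φ u * ψ u) u a a = φ u * second ψ u a a + ψ u * second φ u a a +
      2 * (fderiv ℝ φ u a * fderiv ℝ ψ u a) := by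
  have e : (fun x => fderiv ℝ (fun u => φ u * ψ u) x a) =ᶠ[𝓝 u]
      fun x => φ x * fderiv ℝ ψ x a + ψ x * fderiv ℝ φ x a := by
    filter_upwards [eventually_differentiableAt h, eventually_differentiableAt h'] with x h1 h2
    rw [fderiv_fun_mul h1 h2]; rfl
  have d1 := h.differentiableAt (by simp)
  have d2 := h'.differentiableAt (by simp)
  have d3 := (contDiffAt_fderiv_apply h a).differentiableAt (by simp)
  have d4 := (contDiffAt_fderiv_apply h' a).differentiableAt (by simp)
  rw [second, e.fderiv_eq, fderiv_fun_add (d1.fun_mul d4) (d2.fun_mul d3), fderiv_fun_mul d1 d4,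
    fderiv_fun_mul d2 d3]
  simp only [add_apply, smul_apply, smul_eq_mul, second]
  ring

lemma HasJet.mul (h : HasJet φ u v δ l) (h' : HasJet ψ u v δ' l') :
    HasJet (fun u => φ u * ψ u) u v (φ u * δ' + ψ u * δ)
      (φ u * l' + ψ u * l + 2 * (δ * (starRingEnd ℂ) δ').re) := by
  have e := fderiv_fun_mul (h.smooth.differentiableAt (by simp))
    (h'.smooth.differentiableAt (by simp))
  refine ⟨h.smooth.mul h'.smooth, ?_, ?_, ?_⟩
  · rw [e, add_apply, smul_apply, smul_apply, h.fst, h'.fst]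
    simp; ring
  · rw [e, add_apply, smul_apply, smul_apply, h.fst_I, h'.fst_I]
    simp; ring
  · rw [second_mul h.smooth h'.smooth, second_mul h.smooth h'.smooth, h.fst, h'.fst, h.fst_I,
      h'.fst_I]
    simp only [Complex.mul_re, Complex.conj_re, Complex.conj_im]
    linear_combination φ u * h'.snd + ψ u * h.snd

lemma HasJet.const_mul (h : HasJet φ u v δ l) (r : ℝ) :
    HasJet (fun u => r * φ u) u v (r * δ) (r * l) :=
  ((HasJet.const r).mul h).of_eq (by simp) (by simp)

lemma HasJet.sum {α : Type*} {s : Finset α} {f : α → (ι → ℂ) → ℝ} {d : α → ℂ} {m : α → ℝ}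
    (h : ∀ i ∈ s, HasJet (f i) u v (d i) (m i)) :
    HasJet (fun u => ∑ i ∈ s, f i u) u v (∑ i ∈ s, d i) (∑ i ∈ s, m i) := by
  classical
  induction s using Finset.induction_on with
  | empty => simpa using HasJet.const (0 : ℝ)
  | insert i s hi ih =>
    simp only [Finset.sum_insert hi]
    exact (h i (Finset.mem_insert_self _ _)).add
      (ih fun j hj => h j (Finset.mem_insert_of_mem hj))

lemma HasJet.comp_real (h : HasJet φ u v δ l) {g g' : ℝ → ℝ} {g'' : ℝ}
    (hg : ContDiffAt ℝ ∞ g (φ u)) (h1 : ∀ᶠ x in 𝓝 (φ u), HasDerivAt g (g' x) x)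
    (h2 : HasDerivAt g' g'' (φ u)) :
    HasJet (fun u => g (φ u)) u v (g' (φ u) * δ) (g' (φ u) * l + g'' * ‖δ‖ ^ 2) := by
  have hd := h.smooth.differentiableAt (by simp)
  have e : ∀ᶠ x in 𝓝 u, fderiv ℝ (fun u => g (φ u)) x = g' (φ x) • fderiv ℝ φ x := by
    filter_upwards [h.smooth.continuousAt.eventually h1, eventually_differentiableAt h.smooth] with x k1 k2
    exact (k1.comp_hasFDerivAt x k2.hasFDerivAt).fderiv
  have es : ∀ a, second (fun u => g (φ u)) u a a =
      g' (φ u) * second φ u a a + g'' * (fderiv ℝ φ u a) ^ 2 := by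
    intro a
    have e2 : (fun x => fderiv ℝ (fun u => g (φ u)) x a) =ᶠ[𝓝 u]
        fun x => g' (φ x) * fderiv ℝ φ x a := by
      filter_upwards [e] with x hx; rw [hx]; rfl
    have d2 := h2.comp_hasFDerivAt u hd.hasFDerivAt
    have d3 := (contDiffAt_fderiv_apply h.smooth a).differentiableAt (by simp)
    have d4 : DifferentiableAt ℝ (fun x => g' (φ x)) u := d2.differentiableAt
    have d5 : fderiv ℝ (fun x => g' (φ x)) u = g'' • fderiv ℝ φ u := d2.fderiv
    rw [second, e2.fderiv_eq, fderiv_fun_mul d4 d3, d5]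
    simp only [add_apply, smul_apply, smul_eq_mul, second]
    ring
  refine ⟨hg.comp u h.smooth, ?_, ?_, ?_⟩
  · rw [e.self_of_nhds, smul_apply, h.fst]; simp; ring
  · rw [e.self_of_nhds, smul_apply, h.fst_I]; simp; ring
  · rw [es, es, h.fst, h.fst_I, ← Complex.normSq_eq_norm_sq, Complex.normSq_apply]
    linear_combination g' (φ u) * h.snd

lemma HasJet.log (h : HasJet φ u v δ l) (h0 : φ u ≠ 0) :
    HasJet (fun u => Real.log (φ u)) u v ((φ u : ℂ)⁻¹ * δ)
      ((φ u)⁻¹ * l - (φ u ^ 2)⁻¹ * ‖δ‖ ^ 2) := by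
  have := h.comp_real (g := Real.log) (g' := fun x => x⁻¹) (Real.contDiffAt_log.2 h0)
    (by filter_upwards [isOpen_ne.mem_nhds h0] with x hx using Real.hasDerivAt_log hx)
    (hasDerivAt_inv h0)
  exact this.of_eq (by simp) (by ring)

lemma HasJet.exp (h : HasJet φ u v δ l) :
    HasJet (fun u => Real.exp (φ u)) u v (Real.exp (φ u) * δ)
      (Real.exp (φ u) * (l + ‖δ‖ ^ 2)) :=
  (h.comp_real (g' := Real.exp) Real.contDiff_exp.contDiffAt
    (Filter.Eventually.of_forall fun x => Real.hasDerivAt_exp x)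
    (Real.hasDerivAt_exp _)).of_eq rfl (by ring)

/-- The squared norm of a coordinate. -/
lemma HasJet.norm_sq_coord (u v : ι → ℂ) (i : ι) :
    HasJet (fun u => ‖u i‖ ^ 2) u v ((starRingEnd ℂ) (u i) * v i) (‖v i‖ ^ 2) := by
  let R : (ι → ℂ) →L[ℝ] ℝ := Complex.reCLM.comp (ContinuousLinearMap.proj i)
  let J : (ι → ℂ) →L[ℝ] ℝ := Complex.imCLM.comp (ContinuousLinearMap.proj i)
  have hj : ∀ (T : (ι → ℂ) →L[ℝ] ℝ) (δ : ℂ), T v = 2 * δ.re → T (Complex.I • v) = -2 * δ.im →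
      HasJet (fun u => T u) u v δ 0 := by
    intro T δ h1 h2
    refine ⟨T.contDiff.contDiffAt, by rw [T.fderiv, h1], by rw [T.fderiv, h2], ?_⟩
    simp [second]
  have hR := hj R (v i / 2) (by simp [R]; ring) (by simp [R]; ring)
  have hJ := hj J (-Complex.I * v i / 2) (by simp [J]; ring) (by simp [J]; ring)
  have h := (hR.mul hR).add (hJ.mul hJ)
  refine (h.congr (Filter.Eventually.of_forall fun x => ?_)).of_eq ?_ ?_
  · simp only
    rw [← Complex.normSq_eq_norm_sq, Complex.normSq_apply]; rfl
  · apply Complex.ext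
    · simp [R, J]; ring
    · simp [R, J]; ring
  · rw [← Complex.normSq_eq_norm_sq, Complex.normSq_apply]
    simp [Complex.conj_ofNat]; ring

/-- Jets and complex linear maps. -/
lemma HasJet.comp_linear {T : (κ → ℂ) →L[ℂ] (ι → ℂ)} {z w : κ → ℂ}
    (h : HasJet φ (T z) (T w) δ l) : HasJet (fun z => φ (T z)) z w δ l := by
  have hT : ∀ x, HasFDerivAt (fun z => T z) (T.restrictScalars ℝ) x := fun x =>
    (T.restrictScalars ℝ).hasFDerivAt
  have hc : ∀ (f : (ι → ℂ) → ℝ) (x : κ → ℂ), DifferentiableAt ℝ f (T x) → ∀ a,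
      fderiv ℝ (fun z => f (T z)) x a = fderiv ℝ f (T x) (T a) := by
    intro f x hf a
    have := (hf.hasFDerivAt.comp x (hT x)).fderiv
    rw [Function.comp_def] at this
    rw [this]; rfl
  have hd := h.smooth.differentiableAt (by simp)
  have hs : ∀ a, second (fun z => φ (T z)) z a a = second φ (T z) (T a) (T a) := by
    intro a
    have e : (fun x => fderiv ℝ (fun z => φ (T z)) x a) =ᶠ[𝓝 z]
        fun x => fderiv ℝ φ (T x) (T a) := by
      filter_upwards [T.continuous.continuousAt.eventually (eventually_differentiableAt h.smooth)]
        with x hx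
      exact hc _ _ hx _
    rw [second, e.fderiv_eq, hc (fun y => fderiv ℝ φ y (T a)) z
      ((contDiffAt_fderiv_apply h.smooth _).differentiableAt (by simp))]
    rfl
  refine ⟨h.smooth.comp z (T.restrictScalars ℝ).contDiff.contDiffAt, ?_, ?_, ?_⟩
  · rw [hc _ _ hd, h.fst]
  · rw [hc _ _ hd, map_smul, h.fst_I]
  · rw [hs, hs, map_smul, h.snd]

/-- The complex derivative `∂φ` of a real function. -/
def del (φ : (ι → ℂ) → ℝ) (u : ι → ℂ) : (ι → ℂ) →ₗ[ℂ] ℂ where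
  toFun v := (fderiv ℝ φ u v - Complex.I * fderiv ℝ φ u (Complex.I • v)) / 2
  map_add' v w := by simp only [smul_add, map_add, Complex.ofReal_add]; ring
  map_smul' c v := by
    have h : ∀ v, fderiv ℝ φ u (c • v) =
        c.re * fderiv ℝ φ u v + c.im * fderiv ℝ φ u (Complex.I • v) := by
      intro v
      have : c • v = c.re • v + c.im • Complex.I • v := by
        ext i
        simp only [Pi.smul_apply, Pi.add_apply, smul_eq_mul, Complex.real_smul]
        conv_lhs => rw [← Complex.re_add_im c]
        ring
      rw [this, map_add, map_smul, map_smul]; simp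
    rw [smul_comm, h, h, I_smul_I_smul, map_neg]
    simp only [RingHom.id_apply, smul_eq_mul, Complex.ofReal_add, Complex.ofReal_mul,
      Complex.ofReal_neg]
    conv_rhs => rw [← Complex.re_add_im c]
    linear_combination (c.im * fderiv ℝ φ u (Complex.I • v) / 2 : ℂ) * Complex.I_mul_I

lemma hasJet_del (h : ContDiffAt ℝ ∞ φ u) (v : ι → ℂ) :
    HasJet φ u v (del φ u v) (Real.pi * KahlerProj.ddc φ u ![v, Complex.I • v]) := by
  refine ⟨h, ?_, ?_, ?_⟩
  · simp [del]; ring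
  · simp [del]; ring
  · rw [ddc_quadratic h]
    field_simp

/-- The jet of `log (1 + |f|² e^ψ)`. -/
lemma HasJet.log_one_add (i : ι) (h : HasJet ψ u v δ l) :
    HasJet (fun u => Real.log (1 + ‖u i‖ ^ 2 * Real.exp (ψ u))) u v
      (Real.exp (ψ u) * (starRingEnd ℂ) (u i) * (v i + u i * δ) /
        (1 + ‖u i‖ ^ 2 * Real.exp (ψ u) : ℝ))
      (‖u i‖ ^ 2 * Real.exp (ψ u) / (1 + ‖u i‖ ^ 2 * Real.exp (ψ u)) * l +
        Real.exp (ψ u) / (1 + ‖u i‖ ^ 2 * Real.exp (ψ u)) ^ 2 * ‖v i + u i * δ‖ ^ 2) := by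
  have hpos : 0 < 1 + ‖u i‖ ^ 2 * Real.exp (ψ u) := by positivity
  have h1 := (((HasJet.const 1).add ((HasJet.norm_sq_coord u v i).mul h.exp))).log hpos.ne'
  have e1 : ((‖u i‖ ^ 2 : ℝ) : ℂ) = u i * (starRingEnd ℂ) (u i) := by
    rw [Complex.mul_conj, Complex.normSq_eq_norm_sq]
  have e2 : (0 : ℂ) + (((‖u i‖ ^ 2 : ℝ) : ℂ) * (Real.exp (ψ u) * δ) +
      Real.exp (ψ u) * ((starRingEnd ℂ) (u i) * v i)) =
      Real.exp (ψ u) * ((starRingEnd ℂ) (u i) * (v i + u i * δ)) := by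
    rw [e1]; ring
  rw [e2] at h1
  refine h1.of_eq ?_ ?_
  · field_simp
  · have e3 : ‖(Real.exp (ψ u) : ℂ) * ((starRingEnd ℂ) (u i) * (v i + u i * δ))‖ ^ 2 =
        Real.exp (ψ u) ^ 2 * ‖u i‖ ^ 2 * ‖v i + u i * δ‖ ^ 2 := by
      rw [norm_mul, norm_mul, RCLike.norm_conj, Complex.norm_real, Real.norm_eq_abs, Real.abs_exp]
      ring
    have e4 : ‖v i + u i * δ‖ ^ 2 = ‖v i‖ ^ 2 + ‖u i‖ ^ 2 * ‖δ‖ ^ 2 +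
        2 * ((starRingEnd ℂ) (u i) * v i * (starRingEnd ℂ) δ).re := by
      simp only [← Complex.normSq_eq_norm_sq, Complex.normSq_apply]
      simp; ring
    have e5 : ((starRingEnd ℂ) (u i) * v i * (starRingEnd ℂ) (Real.exp (ψ u) * δ)).re =
        Real.exp (ψ u) * ((starRingEnd ℂ) (u i) * v i * (starRingEnd ℂ) δ).re := by
      rw [map_mul, Complex.conj_ofReal, mul_left_comm, Complex.re_ofReal_mul]
    rw [e3, e5]
    have e6 : ((starRingEnd ℂ) (u i) * v i * (starRingEnd ℂ) δ).re =
        (‖v i + u i * δ‖ ^ 2 - ‖v i‖ ^ 2 - ‖u i‖ ^ 2 * ‖δ‖ ^ 2) / 2 := by rw [e4]; ring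
    rw [e6]
    field_simp
    ring

end Ddc

end

end KahlerProj

namespace KahlerProj

noncomputable section

/-! ### Division by a coordinate -/

section Division

lemma contDiffOn_integral_param {P : Type*} [NormedAddCommGroup P] [NormedSpace ℝ P]
    {s : Set P} (hs : IsOpen s) {h : P × ℝ → ℂ} (hh : ContDiffOn ℝ ∞ h (s ×ˢ Ioo (-1) 2)) :
    ContDiffOn ℝ ∞ (fun p => ∫ t in Icc (0 : ℝ) 1, h (p, t)) s := by
  let χ : ContDiffBump (1 / 2 : ℝ) := ⟨3 / 4, 1, by norm_num, by norm_num⟩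
  have hχ0 : ∀ x : ℝ, x ∉ Icc (-(1 / 2)) (3 / 2 : ℝ) → χ x = 0 := by
    intro x hx
    refine χ.zero_of_le_dist ?_
    rw [Real.dist_eq]
    by_contra hlt
    rw [not_le, abs_lt] at hlt
    exact hx ⟨by linarith [hlt.1], by linarith [hlt.2]⟩
  have hχ1 : ∀ x ∈ Icc (0 : ℝ) 1, χ x = 1 := by
    intro x hx
    refine χ.one_of_mem_closedBall ?_
    rw [Metric.mem_closedBall, Real.dist_eq, abs_le]
    constructor <;> simp only [χ] <;> linarith [hx.1, hx.2]
  let g : P → ℝ → ℂ := fun p x => χ (-x) • h (p, -x)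
  have hg : ContDiffOn ℝ ∞ (fun q : P × ℝ => g q.1 q.2) (s ×ˢ univ) := by
    rintro ⟨p, x⟩ ⟨hp, -⟩
    refine ContDiffAt.contDiffWithinAt ?_
    by_cases hx : -x ∈ Ioo (-1 : ℝ) 2
    · have h2 : ContDiffAt ℝ ∞ (fun q : P × ℝ => χ (-q.2)) (p, x) :=
        (χ.contDiff.comp (contDiff_neg.comp contDiff_snd)).contDiffAt
      have h3 : ContDiffAt ℝ ∞ (fun q : P × ℝ => h (q.1, -q.2)) (p, x) := by
        have h1 : ContDiffAt ℝ ∞ h (p, -x) :=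
          hh.contDiffAt ((hs.prod isOpen_Ioo).mem_nhds ⟨hp, hx⟩)
        exact h1.comp (p, x) (f := fun q : P × ℝ => (q.1, -q.2))
          (contDiffAt_fst.prodMk contDiffAt_snd.neg)
      exact h2.smul h3
    · have h0 : (fun q : P × ℝ => g q.1 q.2) =ᶠ[𝓝 (p, x)] fun _ => 0 := by
        have : (fun q : P × ℝ => -q.2) ⁻¹' (Icc (-(1 / 2)) (3 / 2))ᶜ ∈ 𝓝 (p, x) := by
          refine (isClosed_Icc.isOpen_compl.preimage (by fun_prop)).mem_nhds fun hx' => hx ?_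
          exact ⟨by linarith [hx'.1], by linarith [hx'.2]⟩
        filter_upwards [this] with q hq
        simp only [g]
        rw [hχ0 _ hq, zero_smul]
      exact contDiffAt_const.congr_of_eventuallyEq h0
  have := contDiffOn_convolution_right_with_param_comp (μ := (volume : Measure ℝ)) (n := ⊤)
    (ContinuousLinearMap.lsmul ℝ ℝ : ℝ →L[ℝ] ℂ →L[ℝ] ℂ) (v := fun _ : P => (0 : ℝ))
    contDiffOn_const (f := (Icc (0 : ℝ) 1).indicator fun _ => (1 : ℝ)) (g := g) hs
    (isCompact_Icc (a := (-(3 / 2) : ℝ)) (b := 1 / 2)) ?_ ?_ hg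
  · refine this.congr fun p hp => ?_
    rw [convolution_def]
    rw [← integral_indicator measurableSet_Icc]
    refine integral_congr_ae (Filter.Eventually.of_forall fun t => ?_)
    by_cases ht : t ∈ Icc (0 : ℝ) 1
    · simp [g, ht, hχ1 t ht]
    · simp [ht]
  · intro p x _ hx
    simp only [g]
    rw [hχ0, zero_smul]
    intro hx'
    exact hx ⟨by linarith [hx'.2], by linarith [hx'.1]⟩
  · exact (integrable_indicator_iff measurableSet_Icc).2
      (by simp) |>.locallyIntegrable

variable {ι : Type*} [Fintype ι] [DecidableEq ι]

/-- A holomorphic function which vanishes on a coordinate hyperplane is divisible by the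
coordinate; the quotient does not vanish where the differential does not. -/
lemma exists_smooth_quotient {f : (ι → ℂ) → ℂ} {u₀ : ι → ℂ} {i : ι} (hf : ContDiffAt ℂ ω f u₀)
    (h0 : u₀ i = 0) (hz : ∀ᶠ u in 𝓝 u₀, u i = 0 → f u = 0) (hd : fderiv ℂ f u₀ ≠ 0) :
    ∃ g : (ι → ℂ) → ℂ, (∀ᶠ u in 𝓝 u₀, ContDiffAt ℝ ∞ g u) ∧ (∀ᶠ u in 𝓝 u₀, f u = u i * g u) ∧
      ∀ᶠ u in 𝓝 u₀, g u ≠ 0 := by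
  obtain ⟨r, hr, hball⟩ := Metric.eventually_nhds_iff_ball.1 ((hf.eventually (by simp)).and hz)
  let e : ι → ℂ := Pi.single i 1
  let q : (ι → ℂ) × ℝ → (ι → ℂ) := fun x => x.1 + ((x.2 - 1 : ℂ) * x.1 i) • e
  have hqi : ∀ x, q x i = x.2 * x.1 i := by intro x; simp [q, e]; ring
  have hqj : ∀ x j, j ≠ i → q x j = x.1 j := by intro x j hj; simp [q, e, hj]
  have hqball : ∀ x : (ι → ℂ) × ℝ, x.1 ∈ Metric.ball u₀ (r / 2) → x.2 ∈ Ioo (-1 : ℝ) 2 →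
      q x ∈ Metric.ball u₀ r := by
    rintro ⟨u, t⟩ hu ht
    rw [Metric.mem_ball, dist_pi_lt_iff (by positivity)] at hu ⊢
    intro j
    by_cases hj : j = i
    · subst hj
      rw [hqi, h0, dist_zero_right, norm_mul, Complex.norm_real, Real.norm_eq_abs]
      have h1 := hu j
      rw [h0, dist_zero_right] at h1
      have h2 : |t| ≤ 2 := abs_le.2 ⟨by linarith [ht.1], ht.2.le⟩
      nlinarith [norm_nonneg (u j), abs_nonneg t]
    · rw [hqj _ _ hj]; linarith [hu j]
  have hq : ContDiff ℝ ∞ q := by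
    have h1 : ContDiff ℝ ∞ fun x : (ι → ℂ) × ℝ => (x.2 - 1 : ℂ) :=
      (Complex.ofRealCLM.contDiff.comp contDiff_snd).sub contDiff_const
    have h2 : ContDiff ℝ ∞ fun x : (ι → ℂ) × ℝ => x.1 i :=
      ((ContinuousLinearMap.proj (R := ℝ) (φ := fun _ : ι => ℂ) i).contDiff).comp contDiff_fst
    exact contDiff_fst.add ((h1.mul h2).smul contDiff_const)
  let h : (ι → ℂ) × ℝ → ℂ := fun x => fderiv ℂ f (q x) e
  have hdf : ∀ u ∈ Metric.ball u₀ r, ContDiffAt ℝ ∞ (fun u => fderiv ℂ f u e) u := fun u hu =>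
    ((((hball u hu).1.fderiv_right (m := ω) (by simp)).clm_apply
      contDiffAt_const).restrict_scalars ℝ).of_le le_top
  have hh : ContDiffOn ℝ ∞ h (Metric.ball u₀ (r / 2) ×ˢ Ioo (-1) 2) := by
    rintro ⟨u, t⟩ ⟨hu, ht⟩
    exact ((hdf _ (hqball (u, t) hu ht)).comp (u, t) hq.contDiffAt).contDiffWithinAt
  have hg := contDiffOn_integral_param Metric.isOpen_ball hh
  set g : (ι → ℂ) → ℂ := fun u => ∫ t in Icc (0 : ℝ) 1, h (u, t)
  have hg1 : ∀ᶠ u in 𝓝 u₀, ContDiffAt ℝ ∞ g u := by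
    filter_upwards [Metric.ball_mem_nhds u₀ (half_pos hr)] with u hu
    exact hg.contDiffAt (Metric.isOpen_ball.mem_nhds hu)
  have hg2 : ∀ᶠ u in 𝓝 u₀, f u = u i * g u := by
    filter_upwards [Metric.ball_mem_nhds u₀ (half_pos hr)] with u hu
    have hder : ∀ t ∈ uIcc (0 : ℝ) 1, HasDerivAt (fun t : ℝ => f (q (u, t))) (u i * h (u, t)) t := by
      intro t ht
      rw [uIcc_of_le zero_le_one] at ht
      have hb := hqball (u, t) hu ⟨by linarith [ht.1], by linarith [ht.2]⟩
      have h1 := ((hball _ hb).1.differentiableAt (by simp)).hasFDerivAt.restrictScalars ℝ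
      have h2 : HasDerivAt (fun t : ℝ => q (u, t)) (u i • e) t := by
        have h3 : HasDerivAt (fun t : ℝ => ((t - 1 : ℂ) * u i)) (1 * u i) t :=
          ((Complex.ofRealCLM.hasDerivAt (x := t)).sub_const 1).mul_const (u i)
        simpa [q] using (h3.smul_const e).const_add u
      have h4 := h1.comp_hasDerivAt t h2
      simpa [h, Function.comp_def] using h4
    have hcont : ContinuousOn (fun t : ℝ => u i * h (u, t)) (uIcc 0 1) := by
      refine continuousOn_const.mul (hh.continuousOn.comp (by fun_prop) fun t ht => ?_)
      rw [uIcc_of_le zero_le_one] at ht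
      exact ⟨hu, by linarith [ht.1], by linarith [ht.2]⟩
    have hint := intervalIntegral.integral_eq_sub_of_hasDerivAt hder hcont.intervalIntegrable
    have e1 : q (u, 1) = u := by simp [q]
    have e0 : f (q (u, 0)) = 0 := by
      refine (hball _ (hqball (u, 0) hu (by norm_num))).2 ?_
      rw [hqi]; simp
    rw [e1, e0, sub_zero, intervalIntegral.integral_const_mul,
      intervalIntegral.integral_of_le zero_le_one, ← integral_Icc_eq_integral_Ioc] at hint
    exact hint.symm
  refine ⟨g, hg1, hg2, ?_⟩
  have hg0 : g u₀ ≠ 0 := by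
    have e0 : ∀ t : ℝ, h (u₀, t) = fderiv ℂ f u₀ e := by
      intro t; simp [h, q, h0]
    have e1 : g u₀ = fderiv ℂ f u₀ e := by
      simp only [g, e0]; simp
    intro hzero
    apply hd
    have hgd : DifferentiableAt ℝ g u₀ := hg1.self_of_nhds.differentiableAt (by simp)
    have h1 : HasFDerivAt f _ u₀ :=
      (((ContinuousLinearMap.proj (R := ℝ) (φ := fun _ : ι => ℂ) i).hasFDerivAt (x := u₀)).mul
        hgd.hasFDerivAt).congr_of_eventuallyEq hg2
    have h2 := ((hf.differentiableAt (by simp)).hasFDerivAt.restrictScalars ℝ).unique h1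
    ext v
    have h3 := DFunLike.congr_fun h2 v
    simpa [h0, hzero] using h3
  exact hg1.self_of_nhds.continuousAt.eventually_ne hg0

end Division

/-! ### Local potentials -/

section Potential

variable {ι κ : Type*} [Fintype ι] [Fintype κ]
  {Y : Type*} [TopologicalSpace Y] [ChartedSpace (ι → ℂ) Y]
  {Z : Type*} [TopologicalSpace Z] [ChartedSpace (κ → ℂ) Z]

variable (ι) in
/-- Smoothness of a real function at a point. -/
abbrev SmoothAt (φ : Y → ℝ) (p : Y) : Prop := ContMDiffAt 𝓘(ℝ, ι → ℂ) 𝓘(ℝ, ℝ) ∞ φ p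

lemma ContMDiffAt.complex_to_real {f : Z → Y} {z : Z}
    (h : ContMDiffAt 𝓘(ℂ, κ → ℂ) 𝓘(ℂ, ι → ℂ) ω f z) :
    ContMDiffAt 𝓘(ℝ, κ → ℂ) 𝓘(ℝ, ι → ℂ) ∞ f z := by
  rw [contMDiffAt_iff] at h ⊢
  exact ⟨h.1, (h.2.restrict_scalars ℝ).of_le le_top⟩

variable [IsManifold 𝓘(ℂ, ι → ℂ) ω Y] [IsManifold 𝓘(ℂ, κ → ℂ) ω Z]

/-- The form which is `ddc φ` in each chart. -/
def ddcForm (φ : Y → ℝ) : RealForm ι Y 2 := formOfCharts fun c => ddc (φ ∘ c.symm)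

lemma SmoothAt.contDiffAt {φ : Y → ℝ} {c : OpenPartialHomeomorph Y (ι → ℂ)}
    (hc : c ∈ atlas (ι → ℂ) Y) {u : ι → ℂ} (hu : u ∈ c.target) (h : SmoothAt ι φ (c.symm u)) :
    ContDiffAt ℝ ∞ (φ ∘ c.symm) u := by
  have h : ContMDiffAt 𝓘(ℝ, ι → ℂ) 𝓘(ℝ, ℝ) ∞ (φ ∘ c.symm) u :=
    h.comp u (contMDiffAt_symm_of_mem_maximalAtlas (mem_maximalAtlas_real hc) hu)
  exact h.contDiffAt

lemma SmoothAt.of_contDiffAt {φ : Y → ℝ} {c : OpenPartialHomeomorph Y (ι → ℂ)}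
    (hc : c ∈ atlas (ι → ℂ) Y) {y : Y} (hy : y ∈ c.source) {F : (ι → ℂ) → ℝ}
    (h : ContDiffAt ℝ ∞ F (c y)) (he : ∀ᶠ q in 𝓝 y, φ q = F (c q)) : SmoothAt ι φ y := by
  have h1 : ContMDiffAt 𝓘(ℝ, ι → ℂ) 𝓘(ℝ, ℝ) ∞ F (c y) := h.contMDiffAt
  exact (h1.comp y (contMDiffAt_of_mem_maximalAtlas (mem_maximalAtlas_real hc)
    hy)).congr_of_eventuallyEq he

lemma contDiffAt_complex_chart {f : Z → Y} {c : OpenPartialHomeomorph Z (κ → ℂ)}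
    {c' : OpenPartialHomeomorph Y (ι → ℂ)} (hc : c ∈ atlas (κ → ℂ) Z) (hc' : c' ∈ atlas (ι → ℂ) Y)
    {u : κ → ℂ} (hu : u ∈ c.target) (hf : ContMDiffAt 𝓘(ℂ, κ → ℂ) 𝓘(ℂ, ι → ℂ) ω f (c.symm u))
    (hu' : f (c.symm u) ∈ c'.source) : ContDiffAt ℂ ω (c' ∘ f ∘ c.symm) u := by
  have h : ContMDiffAt 𝓘(ℂ, κ → ℂ) 𝓘(ℂ, ι → ℂ) ω (c' ∘ f ∘ c.symm) u :=
    (contMDiffAt_of_mem_maximalAtlas (IsManifold.subset_maximalAtlas hc') hu').comp u <|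
      hf.comp u (contMDiffAt_symm_of_mem_maximalAtlas (IsManifold.subset_maximalAtlas hc) hu)
  exact h.contDiffAt

lemma contDiffAt_complex_fun_chart {f : Y → ℂ} {c : OpenPartialHomeomorph Y (ι → ℂ)}
    (hc : c ∈ atlas (ι → ℂ) Y) {u : ι → ℂ} (hu : u ∈ c.target)
    (hf : ContMDiffAt 𝓘(ℂ, ι → ℂ) 𝓘(ℂ, ℂ) ω f (c.symm u)) : ContDiffAt ℂ ω (f ∘ c.symm) u := by
  have h : ContMDiffAt 𝓘(ℂ, ι → ℂ) 𝓘(ℂ, ℂ) ω (f ∘ c.symm) u :=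
    hf.comp u (contMDiffAt_symm_of_mem_maximalAtlas (IsManifold.subset_maximalAtlas hc) hu)
  exact h.contDiffAt

/-- `ddc` is compatible with pullback under holomorphic maps. -/
lemma ddc_chart_comp {φ : Y → ℝ} {f : Z → Y} {c : OpenPartialHomeomorph Z (κ → ℂ)}
    {c' : OpenPartialHomeomorph Y (ι → ℂ)} (hc : c ∈ atlas (κ → ℂ) Z) (hc' : c' ∈ atlas (ι → ℂ) Y)
    {u : κ → ℂ} (hu : u ∈ c.target) (hf : ContMDiffAt 𝓘(ℂ, κ → ℂ) 𝓘(ℂ, ι → ℂ) ω f (c.symm u))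
    (hu' : f (c.symm u) ∈ c'.source) (hφ : SmoothAt ι φ (f (c.symm u))) :
    ddc (φ ∘ f ∘ c.symm) u = (ddc (φ ∘ c'.symm) (c' (f (c.symm u)))).compContinuousLinearMap
      (fderiv ℝ (c' ∘ f ∘ c.symm) u) := by
  have h := ddc_comp (φ := φ ∘ c'.symm) (contDiffAt_complex_chart hc hc' hu hf hu') ?_
  · refine Eq.trans (ddc_congr ?_) h
    have h1 : ContinuousAt (f ∘ c.symm) u := hf.continuousAt.comp (c.symm.continuousAt hu)
    filter_upwards [h1.eventually (c'.open_source.mem_nhds hu')] with u' hu''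
    simp only [Function.comp_apply] at hu'' ⊢
    rw [c'.left_inv hu'']
  · refine SmoothAt.contDiffAt hc' (c'.map_source hu') ?_
    simpa only [Function.comp_apply, c'.left_inv hu'] using hφ

lemma inChart_ddcForm {φ : Y → ℝ} {c : OpenPartialHomeomorph Y (ι → ℂ)}
    (hc : c ∈ atlas (ι → ℂ) Y) {u : ι → ℂ} (hu : u ∈ c.target) (h : SmoothAt ι φ (c.symm u)) :
    inChart (ddcForm φ) c u = ddc (φ ∘ c.symm) u := by
  have hc' := chart_mem_atlas (ι → ℂ) (c.symm u)
  have hu' := mem_chart_source (ι → ℂ) (c.symm u)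
  rw [inChart_trans _ hc hc' hu hu', inChart_chartAt]
  exact (ddc_chart_comp (f := id) hc hc' hu contMDiffAt_id hu' h).symm

/-- The form `θ` has the local potential `φ` near `p`. -/
structure HasPotential (θ : RealForm ι Y 2) (p : Y) (φ : Y → ℝ) : Prop where
  smooth : ∀ᶠ q in 𝓝 p, SmoothAt ι φ q
  eq : ∀ᶠ q in 𝓝 p, θ q = ddcForm φ q

variable {θ θ' : RealForm ι Y 2} {p : Y} {φ φ' : Y → ℝ}

lemma ddcForm_congr (h : φ =ᶠ[𝓝 p] φ') : (ddcForm φ : RealForm ι Y 2) p = ddcForm φ' p := by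
  refine ddc_congr ?_
  have h1 := (chartAt (ι → ℂ) p).symm.continuousAt (mem_chart_target (ι → ℂ) p)
  rw [ContinuousAt, OpenPartialHomeomorph.left_inv _ (mem_chart_source _ p)] at h1
  exact h1.eventually h

lemma SmoothAt.chartAt (h : SmoothAt ι φ p) :
    ContDiffAt ℝ ∞ (φ ∘ (chartAt (ι → ℂ) p).symm) (chartAt (ι → ℂ) p p) :=
  SmoothAt.contDiffAt (chart_mem_atlas _ p) (mem_chart_target _ p)
    (by rwa [OpenPartialHomeomorph.left_inv _ (mem_chart_source _ p)])

lemma ddcForm_add (h : SmoothAt ι φ p) (h' : SmoothAt ι φ' p) :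
    (ddcForm (fun y => φ y + φ' y) : RealForm ι Y 2) p = ddcForm φ p + ddcForm φ' p :=
  ddc_add h.chartAt h'.chartAt

lemma ddcForm_const_mul (h : SmoothAt ι φ p) (r : ℝ) :
    (ddcForm (fun y => r * φ y) : RealForm ι Y 2) p = r • ddcForm φ p :=
  ddc_const_mul h.chartAt r

lemma ddcForm_sub (h : SmoothAt ι φ p) (h' : SmoothAt ι φ' p) :
    (ddcForm (fun y => φ y - φ' y) : RealForm ι Y 2) p = ddcForm φ p - ddcForm φ' p := by
  have h3 : SmoothAt ι (fun y => -1 * φ' y) p := (contMDiffAt_const (c := (-1 : ℝ))).mul h'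
  have h1 := ddcForm_add h h3
  rw [ddcForm_const_mul h' (-1), neg_smul, one_smul, ← sub_eq_add_neg] at h1
  rw [← h1]
  congr 1
  ext1 y; ring

lemma pullbackForm_ddcForm {f : Z → Y} {z : Z}
    (hf : ContMDiffAt 𝓘(ℂ, κ → ℂ) 𝓘(ℂ, ι → ℂ) ω f z) (h : SmoothAt ι φ (f z)) :
    pullbackForm (κ := κ) f (ddcForm φ : RealForm ι Y 2) z = ddcForm (φ ∘ f) z := by
  have hc := chart_mem_atlas (κ → ℂ) z
  have hu := mem_chart_target (κ → ℂ) z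
  have hl : (chartAt (κ → ℂ) z).symm (chartAt (κ → ℂ) z z) = z :=
    (chartAt (κ → ℂ) z).left_inv (mem_chart_source _ z)
  have hs := mem_chart_source (ι → ℂ) (f z)
  rw [← inChart_chartAt (pullbackForm f _)]
  have hf' : ContMDiffAt 𝓘(ℂ, κ → ℂ) 𝓘(ℂ, ι → ℂ) ω f
      ((chartAt (κ → ℂ) z).symm (chartAt (κ → ℂ) z z)) := by rwa [hl]
  have hs' : f ((chartAt (κ → ℂ) z).symm (chartAt (κ → ℂ) z z)) ∈
      (chartAt (ι → ℂ) (f z)).source := by rwa [hl]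
  have h' : SmoothAt ι φ (f ((chartAt (κ → ℂ) z).symm (chartAt (κ → ℂ) z z))) := by rwa [hl]
  rw [inChart_pullbackForm _ hc (chart_mem_atlas (ι → ℂ) (f z)) hu
    ((ContMDiffAt.complex_to_real hf').mdifferentiableAt (by simp)) hs',
    inChart_ddcForm (chart_mem_atlas _ _) (OpenPartialHomeomorph.map_source _ hs'),
    ← ddc_chart_comp hc (chart_mem_atlas (ι → ℂ) (f z)) hu hf' hs' h']
  · rfl
  · rwa [OpenPartialHomeomorph.left_inv _ hs']

lemma HasPotential.congr (h : HasPotential θ p φ) (he : φ' =ᶠ[𝓝 p] φ) :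
    HasPotential θ p φ' := by
  refine ⟨?_, ?_⟩
  · filter_upwards [h.smooth, he.eventuallyEq_nhds] with q h1 h2
    exact h1.congr_of_eventuallyEq h2
  · filter_upwards [h.eq, he.eventuallyEq_nhds] with q h1 h2
    rw [h1, ddcForm_congr h2]

lemma HasPotential.add (h : HasPotential θ p φ) (h' : HasPotential θ' p φ') :
    HasPotential (θ + θ') p (fun y => φ y + φ' y) := by
  refine ⟨?_, ?_⟩
  · filter_upwards [h.smooth, h'.smooth] with q h1 h2 using h1.add h2
  · filter_upwards [h.smooth, h'.smooth, h.eq, h'.eq] with q h1 h2 h3 h4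
    rw [ddcForm_add h1 h2, Pi.add_apply, h3, h4]

lemma HasPotential.const_mul (h : HasPotential θ p φ) (r : ℝ) :
    HasPotential (r • θ) p (fun y => r * φ y) := by
  refine ⟨?_, ?_⟩
  · filter_upwards [h.smooth] with q h1 using contMDiffAt_const.mul h1
  · filter_upwards [h.smooth, h.eq] with q h1 h3
    rw [ddcForm_const_mul h1, Pi.smul_apply, h3]

lemma HasPotential.pullback {f : Z → Y} {z : Z}
    (hf : ContMDiff 𝓘(ℂ, κ → ℂ) 𝓘(ℂ, ι → ℂ) ω f) (h : HasPotential θ (f z) φ) :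
    HasPotential (pullbackForm (κ := κ) f θ) z (φ ∘ f) := by
  have hc := hf.continuous.continuousAt (x := z)
  refine ⟨?_, ?_⟩
  · filter_upwards [hc.eventually h.smooth] with q h1
    exact h1.comp q (ContMDiffAt.complex_to_real (hf q))
  · filter_upwards [hc.eventually h.smooth, hc.eventually h.eq] with q h1 h2
    rw [← pullbackForm_ddcForm (hf q) h1, pullbackForm, pullbackForm, h2]

lemma HasPotential.inChart (h : HasPotential θ p φ) {c : OpenPartialHomeomorph Y (ι → ℂ)}
    (hc : c ∈ atlas (ι → ℂ) Y) (hp : p ∈ c.source) :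
    ∀ᶠ u in 𝓝 (c p), ContDiffAt ℝ ∞ (φ ∘ c.symm) u ∧ inChart θ c u = ddc (φ ∘ c.symm) u := by
  have h1 := c.symm.continuousAt (c.map_source hp)
  rw [ContinuousAt, c.left_inv hp] at h1
  filter_upwards [h1.eventually h.smooth, h1.eventually h.eq, c.open_target.mem_nhds
    (c.map_source hp)] with u h2 h3 h4
  refine ⟨h2.contDiffAt hc h4, ?_⟩
  rw [← inChart_ddcForm hc h4 h2, KahlerProj.inChart, h3]; rfl

lemma HasPotential.contDiffAt (h : HasPotential θ p φ) {c : OpenPartialHomeomorph Y (ι → ℂ)}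
    (hc : c ∈ atlas (ι → ℂ) Y) (hp : p ∈ c.source) : ContDiffAt ℝ ∞ (KahlerProj.inChart θ c) (c p) :=
  (contDiffAt_ddc (h.inChart hc hp).self_of_nhds.1).congr_of_eventuallyEq
    ((h.inChart hc hp).mono fun _ hu => hu.2)

/-- A form with local potentials is closed. -/
lemma closed_of_hasPotential (h : ∀ p, ∃ φ, HasPotential θ p φ) : θ ∈ closedForms ι Y := by
  refine ⟨isSmoothForm_of_local fun y => ?_, fun c hc u hu => ?_⟩
  · obtain ⟨φ, hφ⟩ := h y
    exact ⟨chartAt (ι → ℂ) y, chart_mem_atlas _ y, mem_chart_source _ y,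
      hφ.contDiffAt (chart_mem_atlas _ y) (mem_chart_source _ y)⟩
  · obtain ⟨φ, hφ⟩ := h (c.symm u)
    have h1 := hφ.inChart hc (c.map_target hu)
    rw [c.right_inv hu] at h1
    have h2 : KahlerProj.inChart θ c =ᶠ[𝓝 u] ddc (φ ∘ c.symm) := h1.mono fun _ hu => hu.2
    rw [h2.extDeriv_eq, extDeriv_ddc h1.self_of_nhds.1]

lemma hasPotential_of_eqDdcOn {U : Set Y} (hU : IsOpen U)
    (hφ : ContMDiffOn 𝓘(ℝ, ι → ℂ) 𝓘(ℝ, ℝ) ∞ φ U) (h : EqDdcOn U θ φ) (hp : p ∈ U) :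
    HasPotential θ p φ := by
  refine ⟨?_, ?_⟩
  · filter_upwards [hU.mem_nhds hp] with q hq using hφ.contMDiffAt (hU.mem_nhds hq)
  · filter_upwards [hU.mem_nhds hp] with q hq
    have hl := (chartAt (ι → ℂ) q).left_inv (mem_chart_source _ q)
    have := h _ (chart_mem_atlas (ι → ℂ) q) _ (mem_chart_target (ι → ℂ) q) (by rwa [hl])
    rw [inChart_chartAt] at this
    exact this

lemma eqDdcOn_of_hasPotential {U : Set Y} (h : ∀ p ∈ U, HasPotential θ p φ) : EqDdcOn U θ φ := by
  intro c hc u hu hU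
  have := ((h _ hU).inChart hc (c.map_target hu)).self_of_nhds.2
  rwa [c.right_inv hu] at this

/-- `ddc` of a global smooth function is exact. -/
lemma ddcForm_mem_exactForms {G : Y → ℝ} (hG : ∀ p, SmoothAt ι G p) :
    (ddcForm G : RealForm ι Y 2) ∈ exactForms ι Y := by
  have key : ∀ c ∈ atlas (ι → ℂ) Y, ∀ u ∈ c.target,
      inChart (formOfCharts fun c => dc (G ∘ c.symm)) c u = dc (G ∘ c.symm) u := by
    intro c hc u hu
    refine inChart_formOfCharts (F := fun c => dc (G ∘ c.symm)) ?_ hc hu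
    intro c hc c' hc' u hu hu'
    have hd : DifferentiableAt ℝ (G ∘ c'.symm) ((c' ∘ c.symm) u) :=
      ((hG _).contDiffAt hc' (c'.map_source hu')).differentiableAt (by simp)
    have he : G ∘ c.symm =ᶠ[𝓝 u] (G ∘ c'.symm) ∘ c' ∘ c.symm := by
      filter_upwards [(c.symm.continuousAt hu).eventually (c'.open_source.mem_nhds hu')] with u' h'
      simp only [Function.comp_apply]
      rw [c'.left_inv h']
    have e1 : dc (G ∘ c.symm) u = dc ((G ∘ c'.symm) ∘ c' ∘ c.symm) u := by
      rw [dc, dc, he.fderiv_eq]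
    exact e1.trans
      (dc_comp ((contDiffAt_transition hc hc' hu hu').differentiableAt (by simp)) hd)
  have ev : ∀ c ∈ atlas (ι → ℂ) Y, ∀ u ∈ c.target,
      inChart (formOfCharts fun c => dc (G ∘ c.symm)) c =ᶠ[𝓝 u] dc (G ∘ c.symm) := by
    intro c hc u hu
    filter_upwards [c.open_target.mem_nhds hu] with u' hu' using key c hc u' hu'
  refine ⟨formOfCharts fun c => dc (G ∘ c.symm), fun c hc u hu => ?_, fun c hc u hu => ?_⟩
  · exact ((contDiffAt_dc ((hG _).contDiffAt hc hu)).congr_of_eventuallyEq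
      (ev c hc u hu)).contDiffWithinAt
  · rw [(ev c hc u hu).extDeriv_eq, inChart_ddcForm hc hu (hG _)]; rfl

lemma HasPotential.eq_of_mem_closure (h : HasPotential θ p φ) (h' : HasPotential θ' p φ')
    {D : Set Y} (hp : p ∈ closure Dᶜ) (he : ∀ᶠ q in 𝓝 p, q ∉ D → θ q = θ' q) : θ p = θ' p := by
  set c := chartAt (ι → ℂ) p
  have hc := chart_mem_atlas (ι → ℂ) p
  have hs := mem_chart_source (ι → ℂ) p
  refine form_eq_of_inChart hc hs ?_
  by_contra hne
  have h1 := (h.contDiffAt hc hs).continuousAt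
  have h2 := (h'.contDiffAt hc hs).continuousAt
  have h3 : ∀ᶠ u in 𝓝 (c p), KahlerProj.inChart θ c u ≠ KahlerProj.inChart θ' c u := by
    filter_upwards [(h1.sub h2).eventually_ne (sub_ne_zero.2 hne)] with u hu
    exact sub_ne_zero.1 hu
  have h4 := (c.continuousAt hs).eventually h3
  have h5 := mem_closure_iff_frequently.1 hp
  obtain ⟨q, hq1, hq2, hq3, hq4⟩ :=
    (h5.and_eventually (h4.and (he.and (c.open_source.mem_nhds hs)))).exists
  apply hq2
  rw [KahlerProj.inChart, KahlerProj.inChart, c.left_inv hq4, hq3 hq1]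

/-! ### Pluriharmonic functions -/

lemma ddc_log_norm_sq_coord {κ : Type*} [Fintype κ] {i : κ} {u : κ → ℂ} (h : u i ≠ 0) :
    ContDiffAt ℝ ∞ (fun u : κ → ℂ => Real.log (‖u i‖ ^ 2)) u ∧
      ddc (fun u : κ → ℂ => Real.log (‖u i‖ ^ 2)) u = 0 := by
  have h0 : ‖u i‖ ^ 2 ≠ 0 := by positivity
  have hj := fun v => (HasJet.norm_sq_coord u v i).log h0
  refine ⟨(hj 0).smooth, two_eq_of_quadratic (fun v w => ddc_invariant (hj 0).smooth v w)
    (fun v w => rfl) fun v => ?_⟩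
  rw [(hj v).ddc, norm_mul, RCLike.norm_conj]
  have : (‖u i‖ ^ 2)⁻¹ * ‖v i‖ ^ 2 - ((‖u i‖ ^ 2) ^ 2)⁻¹ * (‖u i‖ * ‖v i‖) ^ 2 = 0 := by
    field_simp; ring
  rw [this]; simp

lemma ddcForm_log_norm_sq {f : Y → ℂ} (hf : ContMDiffAt 𝓘(ℂ, ι → ℂ) 𝓘(ℂ, ℂ) ω f p) (h0 : f p ≠ 0) :
    SmoothAt ι (fun y => Real.log (‖f y‖ ^ 2)) p ∧
      (ddcForm (fun y => Real.log (‖f y‖ ^ 2)) : RealForm ι Y 2) p = 0 := by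
  set c := chartAt (ι → ℂ) p
  have hc := chart_mem_atlas (ι → ℂ) p
  have hs := mem_chart_source (ι → ℂ) p
  have hl : c.symm (c p) = p := c.left_inv hs
  have hF : ContDiffAt ℂ ω (f ∘ c.symm) (c p) :=
    contDiffAt_complex_fun_chart hc (c.map_source hs) (by rwa [hl])
  let g : (ι → ℂ) → (Unit → ℂ) := fun u _ => f (c.symm u)
  have hg : ContDiffAt ℂ ω g (c p) := contDiffAt_pi.2 fun _ => hF
  have h1 := ddc_log_norm_sq_coord (i := ()) (u := g (c p)) (by simpa [g, hl] using h0)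
  have h2 := ddc_comp hg h1.1
  rw [h1.2] at h2
  refine ⟨?_, h2⟩
  refine SmoothAt.of_contDiffAt hc hs
    (h1.1.comp (c p) ((hg.restrict_scalars ℝ).of_le le_top)) ?_
  filter_upwards [c.open_source.mem_nhds hs] with q hq
  have hq' : c.symm (c q) = q := c.left_inv hq
  simp [g, c, hq']

end Potential

end

end KahlerProj

namespace KahlerProj

noncomputable section

/-! ### Chern forms of divisors and of line bundles -/

section Divisor

variable {ι : Type*} [Fintype ι] {Y : Type*} [TopologicalSpace Y] [ChartedSpace (ι → ℂ) Y]

/-- `σ = ‖f‖² e^{-φ}` on the neighbourhood `U` of `p`, where `f` is an equation of `D`. -/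
structure IsNormSqAt (D : Set Y) (σ : Y → ℝ) (p : Y) (U : Set Y) (f : Y → ℂ) (φ : Y → ℝ) :
    Prop where
  isOpen : IsOpen U
  mem : p ∈ U
  equation : IsLocalEquation (ι := ι) D U f
  smooth : ContMDiffOn 𝓘(ℝ, ι → ℂ) 𝓘(ℝ, ℝ) ∞ φ U
  eq : ∀ y ∈ U, σ y = ‖f y‖ ^ 2 * Real.exp (-φ y)

variable {D : Set Y} {σ σ' : Y → ℝ} {p : Y} {U : Set Y} {f : Y → ℂ} {φ : Y → ℝ}

lemma IsNormSqAt.at (h : IsNormSqAt (ι := ι) D σ p U f φ) {q : Y} (hq : q ∈ U) :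
    IsNormSqAt (ι := ι) D σ q U f φ := ⟨h.isOpen, hq, h.equation, h.smooth, h.eq⟩

lemma IsNormSqAt.smoothAt (h : IsNormSqAt (ι := ι) D σ p U f φ) :
    ∀ᶠ q in 𝓝 p, SmoothAt ι φ q := by
  filter_upwards [h.isOpen.mem_nhds h.mem] with q hq
  exact h.smooth.contMDiffAt (h.isOpen.mem_nhds hq)

lemma IsNormSqAt.contMDiffAt (h : IsNormSqAt (ι := ι) D σ p U f φ) :
    ContMDiffAt 𝓘(ℂ, ι → ℂ) 𝓘(ℂ, ℂ) ω f p :=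
  h.equation.1.contMDiffAt (h.isOpen.mem_nhds h.mem)

lemma IsNormSqAt.ne_zero (h : IsNormSqAt (ι := ι) D σ p U f φ) (hp : p ∉ D) : f p ≠ 0 := fun h0 =>
  hp ((h.equation.2.1 p h.mem).1 h0)

lemma IsNormSqAt.log_eq (h : IsNormSqAt (ι := ι) D σ p U f φ) (hp : p ∉ D) :
    Real.log (σ p) = Real.log (‖f p‖ ^ 2) - φ p := by
  rw [h.eq p h.mem, Real.log_mul (pow_ne_zero _ (norm_ne_zero_iff.2 (h.ne_zero hp)))
    (Real.exp_pos _).ne', Real.log_exp]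
  ring

lemma IsNormSqAt.eventually_notMem (h : IsNormSqAt (ι := ι) D σ p U f φ) (hp : p ∉ D) :
    ∀ᶠ q in 𝓝 p, q ∈ U ∧ q ∉ D := by
  filter_upwards [h.isOpen.mem_nhds h.mem, h.contMDiffAt.continuousAt.eventually_ne
    (h.ne_zero hp)] with q hq h0
  exact ⟨hq, fun hD => h0 ((h.equation.2.1 q hq).2 hD)⟩

lemma IsNormSqAt.log_eventuallyEq (h : IsNormSqAt (ι := ι) D σ p U f φ) (hp : p ∉ D) :
    (fun q => Real.log (σ q)) =ᶠ[𝓝 p] fun q => Real.log (‖f q‖ ^ 2) - φ q := by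
  filter_upwards [h.eventually_notMem hp] with q hq using (h.at hq.1).log_eq hq.2

variable [IsManifold 𝓘(ℂ, ι → ℂ) ω Y]

lemma IsNormSqAt.smoothAt_log (h : IsNormSqAt (ι := ι) D σ p U f φ) (hp : p ∉ D) :
    SmoothAt ι (fun q => Real.log (σ q)) p := by
  refine ContMDiffAt.congr_of_eventuallyEq ?_ (h.log_eventuallyEq hp)
  exact (ddcForm_log_norm_sq h.contMDiffAt (h.ne_zero hp)).1.sub h.smoothAt.self_of_nhds

lemma IsNormSqAt.ddcForm_log (h : IsNormSqAt (ι := ι) D σ p U f φ) (hp : p ∉ D) :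
    (ddcForm (fun q => Real.log (σ q)) : RealForm ι Y 2) p = -ddcForm φ p := by
  have h1 := ddcForm_log_norm_sq h.contMDiffAt (h.ne_zero hp)
  rw [ddcForm_congr (h.log_eventuallyEq hp), ddcForm_sub h1.1 h.smoothAt.self_of_nhds, h1.2,
    zero_sub]

lemma IsNormSqAt.mem_closure (h : IsNormSqAt (ι := ι) D σ p U f φ) : p ∈ closure Dᶜ := by
  by_cases hp : p ∈ D
  · by_contra hc
    rw [mem_closure_iff_frequently, Filter.not_frequently] at hc
    have h0 : f =ᶠ[𝓝 p] fun _ => 0 := by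
      filter_upwards [hc, h.isOpen.mem_nhds h.mem] with q h1 h2
      exact (h.equation.2.1 q h2).2 (not_not.1 h1)
    refine h.equation.2.2 p ⟨h.mem, hp⟩ ?_
    rw [h0.mfderiv_eq, mfderiv_const]
    rfl
  · exact subset_closure hp

/-- A norm of the canonical section determines the Chern form. -/
lemma exists_divisorForm (h : ∀ p, ∃ U f φ, IsNormSqAt (ι := ι) D σ p U f φ) :
    ∃ θ : RealForm ι Y 2, ∀ p U f φ, IsNormSqAt (ι := ι) D σ p U f φ → HasPotential θ p φ := by
  choose U f φ hd using h
  have hpot : ∀ {p U f φ}, IsNormSqAt (ι := ι) D σ p U f φ → HasPotential (ddcForm φ) p φ :=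
    fun h => ⟨h.smoothAt, Filter.Eventually.of_forall fun _ => rfl⟩
  have key : ∀ {q U f φ U' f' φ'}, IsNormSqAt (ι := ι) D σ q U f φ →
      IsNormSqAt (ι := ι) D σ q U' f' φ' →
      (ddcForm φ : RealForm ι Y 2) q = ddcForm φ' q := by
    intro q U f φ U' f' φ' h1 h2
    refine (hpot h1).eq_of_mem_closure (hpot h2) h1.mem_closure ?_
    filter_upwards [h1.isOpen.mem_nhds h1.mem, h2.isOpen.mem_nhds h2.mem] with r hr1 hr2 hD
    have e1 := (h1.at hr1).ddcForm_log hD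
    rw [(h2.at hr2).ddcForm_log hD] at e1
    exact (neg_injective e1).symm
  refine ⟨fun p => ddcForm (φ p) p, fun p U' f' φ' h => ⟨h.smoothAt, ?_⟩⟩
  filter_upwards [h.isOpen.mem_nhds h.mem] with q hq
  exact key (hd q) (h.at hq)

variable [DecidableEq ι]

/-- Two norms of the canonical section have a smooth positive ratio, if the divisor is a coordinate
hyperplane in suitable charts. -/
lemma exists_log_ratio (h : ∃ U f φ, IsNormSqAt (ι := ι) D σ p U f φ)
    (h' : ∃ U f φ, IsNormSqAt (ι := ι) D σ' p U f φ ∧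
      (p ∈ D → ∃ c ∈ atlas (ι → ℂ) Y, p ∈ c.source ∧ ∃ i, ∀ᶠ q in 𝓝 p, f q = c q i)) :
    ∃ G : Y → ℝ, (∀ᶠ q in 𝓝 p, SmoothAt ι G q) ∧
      ∀ᶠ q in 𝓝 p, q ∉ D → G q = Real.log (σ q) - Real.log (σ' q) := by
  obtain ⟨U, f, φ, h⟩ := h
  obtain ⟨U', f', φ', h', hc⟩ := h'
  by_cases hp : p ∈ D
  · obtain ⟨c, hc, hs, i, hi⟩ := hc hp
    have hl := c.left_inv hs
    have ht := c.map_source hs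
    have hcont := c.continuousAt hs
    have hcs := c.symm.continuousAt ht
    rw [ContinuousAt, hl] at hcs
    have hF : ContDiffAt ℂ ω (f ∘ c.symm) (c p) :=
      contDiffAt_complex_fun_chart hc ht (by rw [hl]; exact h.contMDiffAt)
    have h0 : c p i = 0 := by
      rw [← hi.self_of_nhds]; exact (h'.equation.2.1 p h'.mem).2 hp
    have hz : ∀ᶠ u in 𝓝 (c p), u i = 0 → (f ∘ c.symm) u = 0 := by
      filter_upwards [c.open_target.mem_nhds ht, hcs.eventually hi,
        hcs.eventually (h.isOpen.mem_nhds h.mem), hcs.eventually (h'.isOpen.mem_nhds h'.mem)]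
        with u h1 h2 h3 h4 h5
      rw [c.right_inv h1, h5] at h2
      exact (h.equation.2.1 _ h3).2 ((h'.equation.2.1 _ h4).1 h2)
    have hd : fderiv ℂ (f ∘ c.symm) (c p) ≠ 0 := by
      intro hd
      refine h.equation.2.2 p ⟨h.mem, hp⟩ ?_
      have e1 : f =ᶠ[𝓝 p] (f ∘ c.symm) ∘ c := by
        filter_upwards [c.open_source.mem_nhds hs] with q hq
        simp [c.left_inv hq]
      have e2 : MDifferentiableAt 𝓘(ℂ, ι → ℂ) 𝓘(ℂ, ι → ℂ) c p :=
        (contMDiffAt_of_mem_maximalAtlas (n := ω) (IsManifold.subset_maximalAtlas hc)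
          hs).mdifferentiableAt (by simp)
      have e3 : MDifferentiableAt 𝓘(ℂ, ι → ℂ) 𝓘(ℂ, ℂ) (f ∘ c.symm) (c p) :=
        (hF.differentiableAt (by simp)).mdifferentiableAt
      rw [e1.mfderiv_eq, mfderiv_comp p e3 e2, mfderiv_eq_fderiv, hd]
      exact ContinuousLinearMap.zero_comp _
    obtain ⟨g, hg1, hg2, hg3⟩ := exists_smooth_quotient hF h0 hz hd
    refine ⟨fun q => Real.log (‖g (c q)‖ ^ 2) - φ q + φ' q, ?_, ?_⟩
    · filter_upwards [hcont.eventually hg1, hcont.eventually hg3, h.smoothAt, h'.smoothAt,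
        c.open_source.mem_nhds hs] with q k1 k2 k3 k4 k5
      refine ContMDiffAt.add (ContMDiffAt.sub ?_ k3) k4
      refine SmoothAt.of_contDiffAt hc k5 (F := fun u => Real.log (‖g u‖ ^ 2)) ?_
        (Filter.Eventually.of_forall fun _ => rfl)
      exact (k1.norm_sq ℝ).log (pow_ne_zero _ (norm_ne_zero_iff.2 k2))
    · filter_upwards [hcont.eventually hg2, hcont.eventually hg3, hi, h.isOpen.mem_nhds h.mem,
        h'.isOpen.mem_nhds h'.mem, c.open_source.mem_nhds hs] with q k1 k2 k3 k4 k5 k6 hq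
      have hf' := (h'.at k5).ne_zero hq
      rw [(h.at k4).log_eq hq, (h'.at k5).log_eq hq]
      rw [Function.comp_apply, c.left_inv k6, ← k3] at k1
      rw [k1, norm_mul, mul_pow, Real.log_mul (pow_ne_zero _ (norm_ne_zero_iff.2 hf'))
        (pow_ne_zero _ (norm_ne_zero_iff.2 k2))]
      ring
  · refine ⟨fun q => Real.log (σ q) - Real.log (σ' q), ?_, Filter.Eventually.of_forall fun _ _ => rfl⟩
    filter_upwards [h.eventually_notMem hp, h'.eventually_notMem hp] with q h1 h2
    exact ((h.at h1.1).smoothAt_log h1.2).sub ((h'.at h2.1).smoothAt_log h1.2)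

lemma sub_mem_exactForms_of_isNormSqAt {θ θ' : RealForm ι Y 2}
    (h : ∀ p, ∃ U f φ, IsNormSqAt (ι := ι) D σ p U f φ ∧ HasPotential θ p φ)
    (h' : ∀ p, ∃ U f φ, IsNormSqAt (ι := ι) D σ' p U f φ ∧ HasPotential θ' p φ ∧
      (p ∈ D → ∃ c ∈ atlas (ι → ℂ) Y, p ∈ c.source ∧ ∃ i, ∀ᶠ q in 𝓝 p, f q = c q i)) :
    θ - θ' ∈ exactForms ι Y := by
  have hG : ∀ p, ∃ G : Y → ℝ, (∀ᶠ q in 𝓝 p, SmoothAt ι G q) ∧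
      ∀ᶠ q in 𝓝 p, q ∉ D → G q = Real.log (σ q) - Real.log (σ' q) := fun p =>
    exists_log_ratio (by obtain ⟨U, f, φ, h1, _⟩ := h p; exact ⟨U, f, φ, h1⟩)
      (by obtain ⟨U, f, φ, h1, _, h2⟩ := h' p; exact ⟨U, f, φ, h1, h2⟩)
  choose G hG1 hG2 using hG
  have hcl : ∀ p, p ∈ closure Dᶜ := fun p => by
    obtain ⟨U, f, φ, h1, _⟩ := h p; exact h1.mem_closure
  have hloc : ∀ p, (fun q => G q q) =ᶠ[𝓝 p] G p := by
    intro p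
    filter_upwards [hG1 p, (hG2 p).eventually_nhds] with q h1 h2
    by_contra hne
    have c1 := (hG1 q).self_of_nhds.continuousAt
    have c2 := h1.continuousAt
    have h3 := (c1.sub c2).eventually_ne (sub_ne_zero.2 hne)
    obtain ⟨r, r1, r2, r3, r4⟩ := ((mem_closure_iff_frequently.1 (hcl q)).and_eventually
      (h3.and (h2.and (hG2 q)))).exists
    exact r2 (by rw [Pi.sub_apply, r3 r1, r4 r1, sub_self])
  have hsm : ∀ p, SmoothAt ι (fun q => G q q) p := fun p =>
    (hG1 p).self_of_nhds.congr_of_eventuallyEq (hloc p)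
  have hex := ddcForm_mem_exactForms hsm
  have e : θ - θ' = (-1 : ℝ) • ddcForm (fun q => G q q) := by
    funext p
    obtain ⟨U, f, φ, k1, k2⟩ := h p
    obtain ⟨U', f', φ', k1', k2', -⟩ := h' p
    have p1 : HasPotential (θ + (-1 : ℝ) • θ') p _ := k2.add (k2'.const_mul (-1))
    have p2 : HasPotential ((-1 : ℝ) • (ddcForm (fun q => G q q) : RealForm ι Y 2)) p _ :=
      (HasPotential.mk (φ := fun q => G q q) (Filter.Eventually.of_forall hsm)
        (Filter.Eventually.of_forall fun _ => rfl)).const_mul (-1)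
    have := p1.eq_of_mem_closure p2 (hcl p) ?_
    · rw [← this]; simp [sub_eq_add_neg]
    filter_upwards [k1.isOpen.mem_nhds k1.mem, k1'.isOpen.mem_nhds k1'.mem, k2.eq, k2'.eq,
      (hG2 p).eventually_nhds, (hloc p).eventuallyEq_nhds] with q r1 r2 r3 r4 r5 r6 hq
    have s1 := (k1.at r1).ddcForm_log hq
    have s2 := (k1'.at r2).ddcForm_log hq
    have s3 : (fun q => G q q) =ᶠ[𝓝 q] fun q => Real.log (σ q) - Real.log (σ' q) := by
      filter_upwards [r5, r6, ((k1.at r1).eventually_notMem hq)] with r t1 t2 t3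
      rw [t2, t1 t3.2]
    simp only [Pi.add_apply, Pi.smul_apply]
    rw [ddcForm_congr s3, ddcForm_sub ((k1.at r1).smoothAt_log hq) ((k1'.at r2).smoothAt_log hq),
      s1, s2, r3, r4]
    simp only [neg_smul, one_smul]
    abel
  rw [e]
  exact Submodule.smul_mem _ _ hex

/-- The class of a divisor, computed by a norm of the canonical section for which the local
equations are coordinates. -/
theorem exists_divisorClass_eq
    (h : ∀ p, ∃ U f φ, IsNormSqAt (ι := ι) D σ p U f φ ∧
      (p ∈ D → ∃ c ∈ atlas (ι → ℂ) Y, p ∈ c.source ∧ ∃ i, ∀ᶠ q in 𝓝 p, f q = c q i)) :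
    ∃ θ : RealForm ι Y 2, divisorClass D = deRhamClass θ ∧
      ∀ p U f φ, IsNormSqAt (ι := ι) D σ p U f φ → HasPotential θ p φ := by
  obtain ⟨θ, hθ⟩ := exists_divisorForm (D := D) (σ := σ) fun p => by
    obtain ⟨U, f, φ, h1, _⟩ := h p; exact ⟨U, f, φ, h1⟩
  have hcl : θ ∈ closedForms ι Y := closed_of_hasPotential fun p => by
    obtain ⟨U, f, φ, h1, _⟩ := h p; exact ⟨φ, hθ p U f φ h1⟩
  refine ⟨θ, ?_, hθ⟩
  have hex : ∃ c : DeRham2 ι Y, ∃ θ, IsDivisorChernForm D θ ∧ θ ∈ closedForms ι Y ∧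
      deRhamClass θ = c := by
    refine ⟨_, θ, ⟨σ, fun p => ?_⟩, hcl, rfl⟩
    obtain ⟨U, f, φ, h1, _⟩ := h p
    exact ⟨U, f, φ, h1.isOpen, h1.mem, h1.equation, h1.smooth, h1.eq,
      eqDdcOn_of_hasPotential fun q hq => hθ q U f φ (h1.at hq)⟩
  obtain ⟨θ₁, ⟨σ₁, hσ₁⟩, hcl₁, he⟩ := Classical.epsilon_spec hex
  rw [divisorClass, ← he, deRhamClass_eq_iff hcl₁ hcl]
  refine sub_mem_exactForms_of_isNormSqAt (D := D) (σ := σ₁) (σ' := σ) (fun p => ?_) fun p => ?_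
  · obtain ⟨U, f, φ, h1, h2, h3, h4, h5, h6⟩ := hσ₁ p
    exact ⟨U, f, φ, ⟨h1, h2, h3, h4, h5⟩, hasPotential_of_eqDdcOn h1 h4 h6 h2⟩
  · obtain ⟨U, f, φ, h1, h2⟩ := h p
    exact ⟨U, f, φ, h1, hθ p U f φ h1, h2⟩

end Divisor

section LineBundle

variable {ι : Type*} [Fintype ι] {M : Type*} [TopologicalSpace M] [ChartedSpace (ι → ℂ) M]
  [IsManifold 𝓘(ℂ, ι → ℂ) ω M]
  {L : M → Type*} [∀ x, AddCommGroup (L x)] [∀ x, Module ℂ (L x)]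
  [∀ x, TopologicalSpace (L x)] [TopologicalSpace (TotalSpace ℂ L)] [FiberBundle ℂ L]
  [VectorBundle ℂ ℂ L]

lemma frame_ne_zero {x₀ x : M} (hx : x ∈ (trivializationAt ℂ L x₀).baseSet) :
    frame (L := L) x₀ x ≠ 0 := by
  intro h
  have := coord_frame (L := L) hx
  rw [h, map_zero] at this
  exact zero_ne_one this

/-- The squared norm of the local frame. -/
def HermitianMetric.frameNorm (h : HermitianMetric (ι := ι) L) (x₀ x : M) : ℝ :=
  h.normSq x (frame x₀ x)

variable (h : HermitianMetric (ι := ι) L)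

lemma HermitianMetric.frameNorm_pos {x₀ x : M} (hx : x ∈ (trivializationAt ℂ L x₀).baseSet) :
    0 < h.frameNorm x₀ x := h.normSq_pos _ _ (frame_ne_zero hx)

lemma HermitianMetric.frameNorm_smooth {x₀ x : M} (hx : x ∈ (trivializationAt ℂ L x₀).baseSet) :
    SmoothAt ι (h.frameNorm x₀) x :=
  (h.smooth (trivializationAt ℂ L x₀)).contMDiffAt
    ((trivializationAt ℂ L x₀).open_baseSet.mem_nhds hx)

lemma HermitianMetric.smooth_log {x₀ x : M} (hx : x ∈ (trivializationAt ℂ L x₀).baseSet) :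
    SmoothAt ι (fun x => Real.log (h.frameNorm x₀ x)) x := by
  have h1 : ContMDiffAt 𝓘(ℝ, ℝ) 𝓘(ℝ, ℝ) ∞ Real.log (h.frameNorm x₀ x) :=
    (Real.contDiffAt_log.2 (h.frameNorm_pos hx).ne').contMDiffAt
  exact h1.comp x (h.frameNorm_smooth hx)

lemma HermitianMetric.normSq_frame {x₀ x₁ x : M} (hx₀ : x ∈ (trivializationAt ℂ L x₀).baseSet)
    (hx₁ : x ∈ (trivializationAt ℂ L x₁).baseSet) :
    h.frameNorm x₀ x = ‖transition L x₀ x₁ x‖ ^ 2 * h.frameNorm x₁ x := by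
  rw [frameNorm, frameNorm, ← h.normSq_smul, transition, coord_smul_frame hx₁]

lemma IsChernForm.hasPotential {θ : RealForm ι M 2} (hθ : IsChernForm h θ) {x₀ x : M}
    (hx : x ∈ (trivializationAt ℂ L x₀).baseSet) :
    HasPotential θ x fun x => -Real.log (h.frameNorm x₀ x) :=
  hasPotential_of_eqDdcOn (trivializationAt ℂ L x₀).open_baseSet
    (fun y hy => (h.smooth_log hy).neg.contMDiffWithinAt) (hθ (trivializationAt ℂ L x₀)) hx

/-- The Chern forms of two Hermitian metrics are cohomologous. -/
lemma IsChernForm.sub_mem_exactForms {h h' : HermitianMetric (ι := ι) L} {θ θ' : RealForm ι M 2}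
    (hθ : IsChernForm h θ) (hθ' : IsChernForm h' θ') : θ - θ' ∈ exactForms ι M := by
  let G : M → ℝ := fun x => Real.log (h.frameNorm x x) - Real.log (h'.frameNorm x x)
  have hG : ∀ x₀ x, x ∈ (trivializationAt ℂ L x₀).baseSet →
      G x = Real.log (h.frameNorm x₀ x) - Real.log (h'.frameNorm x₀ x) := by
    intro x₀ x hx
    have hx' := mem_baseSet_trivializationAt ℂ L x
    have ht : ‖transition L x x₀ x‖ ^ 2 ≠ 0 :=
      pow_ne_zero _ (norm_ne_zero_iff.2 (transition_ne_zero hx' hx))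
    simp only [G]
    rw [h.normSq_frame hx' hx, h'.normSq_frame hx' hx, Real.log_mul ht (h.frameNorm_pos hx).ne',
      Real.log_mul ht (h'.frameNorm_pos hx).ne']
    ring
  have hev : ∀ x, G =ᶠ[𝓝 x] fun y => Real.log (h.frameNorm x y) - Real.log (h'.frameNorm x y) := by
    intro x
    filter_upwards [(trivializationAt ℂ L x).open_baseSet.mem_nhds
      (mem_baseSet_trivializationAt ℂ L x)] with y hy using hG x y hy
  have hsm : ∀ x, SmoothAt ι G x := fun x =>
    ((h.smooth_log (mem_baseSet_trivializationAt ℂ L x)).sub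
      (h'.smooth_log (mem_baseSet_trivializationAt ℂ L x))).congr_of_eventuallyEq (hev x)
  have e : θ - θ' = (-1 : ℝ) • ddcForm G := by
    funext x
    have hx := mem_baseSet_trivializationAt ℂ L x
    have e1 := ddcForm_const_mul (h.smooth_log hx) (-1)
    have e2 := ddcForm_const_mul (h'.smooth_log hx) (-1)
    simp only [neg_mul, one_mul, neg_smul, one_smul] at e1 e2
    rw [Pi.sub_apply, Pi.smul_apply, (hθ.hasPotential h hx).eq.self_of_nhds,
      (hθ'.hasPotential h' hx).eq.self_of_nhds, ddcForm_congr (hev x),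
      ddcForm_sub (h.smooth_log hx) (h'.smooth_log hx), e1, e2]
    simp only [neg_smul, one_smul]
    abel
  rw [e]
  exact Submodule.smul_mem _ _ (ddcForm_mem_exactForms hsm)

lemma IsChernForm.closed {h : HermitianMetric (ι := ι) L} {θ : RealForm ι M 2}
    (hθ : IsChernForm h θ) : θ ∈ closedForms ι M :=
  closed_of_hasPotential fun x => ⟨_, hθ.hasPotential h (mem_baseSet_trivializationAt ℂ L x)⟩

lemma IsChernForm.chernClass_eq {h : HermitianMetric (ι := ι) L} {θ : RealForm ι M 2}
    (hθ : IsChernForm h θ) : chernClass ι L = deRhamClass θ := by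
  have hex : ∃ c : DeRham2 ι M, ∃ (h : HermitianMetric (ι := ι) L) (θ : RealForm ι M 2),
      IsChernForm h θ ∧ θ ∈ closedForms ι M ∧ deRhamClass θ = c := ⟨_, h, θ, hθ, hθ.closed, rfl⟩
  obtain ⟨h₁, θ₁, hθ₁, hcl, he⟩ := Classical.epsilon_spec hex
  rw [chernClass, ← he, deRhamClass_eq_iff hcl hθ.closed]
  exact hθ₁.sub_mem_exactForms hθ

/-- A representative of `c₁(L⁻¹)` for a negative line bundle `L`: a Kähler form with the local
potentials `log h`. -/
theorem IsNegativeLineBundle.exists_form (hL : IsNegativeLineBundle ι L) :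
    ∃ (h : HermitianMetric (ι := ι) L) (θ : RealForm ι M 2), IsKahlerForm θ ∧
      deRhamClass θ = -chernClass ι L ∧ ∀ x₀ x, x ∈ (trivializationAt ℂ L x₀).baseSet →
        HasPotential θ x fun x => Real.log (h.frameNorm x₀ x) := by
  obtain ⟨h, θ, hθ, hK⟩ := hL
  refine ⟨h, -θ, hK, ?_, fun x₀ x hx => ?_⟩
  · rw [hθ.chernClass_eq]
    have := deRhamClass_smul hθ.closed (-1)
    simpa using this
  · have := (hθ.hasPotential h hx).const_mul (-1)
    simpa using this

end LineBundle

end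

end KahlerProj

namespace KahlerProj

noncomputable section

/-! ### The complex structure of the projective bundle and of its blow-up -/

lemma contMDiffAt_of_charts {ι κ : Type*} [Fintype ι] [Fintype κ]
    {Y : Type*} [TopologicalSpace Y] [ChartedSpace (ι → ℂ) Y]
    {Z : Type*} [TopologicalSpace Z] [ChartedSpace (κ → ℂ) Z]
    [IsManifold 𝓘(ℂ, ι → ℂ) ω Y] [IsManifold 𝓘(ℂ, κ → ℂ) ω Z]
    {f : Z → Y} {c : OpenPartialHomeomorph Z (κ → ℂ)} {c' : OpenPartialHomeomorph Y (ι → ℂ)}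
    (hc : c ∈ atlas (κ → ℂ) Z) (hc' : c' ∈ atlas (ι → ℂ) Y) {z : Z} (hz : z ∈ c.source)
    {F : (κ → ℂ) → (ι → ℂ)} (hF : ContDiffAt ℂ ω F (c z)) (ht : F (c z) ∈ c'.target)
    (he : ∀ q ∈ c.source, f q = c'.symm (F (c q))) :
    ContMDiffAt 𝓘(ℂ, κ → ℂ) 𝓘(ℂ, ι → ℂ) ω f z := by
  have h1 : ContMDiffAt 𝓘(ℂ, κ → ℂ) 𝓘(ℂ, ι → ℂ) ω (c'.symm ∘ F ∘ c) z :=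
    (contMDiffAt_symm_of_mem_maximalAtlas (IsManifold.subset_maximalAtlas hc') ht).comp z <|
      hF.contMDiffAt.comp z
        (contMDiffAt_of_mem_maximalAtlas (IsManifold.subset_maximalAtlas hc) hz)
  refine h1.congr_of_eventuallyEq ?_
  filter_upwards [c.open_source.mem_nhds hz] with q hq using he q hq

lemma separated_of_continuousOn {Y T : Type*} [TopologicalSpace Y] [TopologicalSpace T] [T2Space T]
    {f : Y → T} {U : Set Y} (hU : IsOpen U) (hf : ContinuousOn f U) {p q : Y} (hp : p ∈ U)
    (hq : q ∈ U) (h : f p ≠ f q) :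
    ∃ u v : Set Y, IsOpen u ∧ IsOpen v ∧ p ∈ u ∧ q ∈ v ∧ Disjoint u v := by
  obtain ⟨u, v, hu, hv, hpu, hqv, hd⟩ := t2_separation h
  refine ⟨U ∩ f ⁻¹' u, U ∩ f ⁻¹' v, hf.isOpen_inter_preimage hU hu,
    hf.isOpen_inter_preimage hU hv, ⟨hp, hpu⟩, ⟨hq, hqv⟩, ?_⟩
  exact (hd.preimage f).mono inter_subset_right inter_subset_right

section Base

variable {n : ℕ} {M : Type*} [TopologicalSpace M] [ChartedSpace (Fin n → ℂ) M]
  [IsManifold 𝓘(ℂ, Fin n → ℂ) ω M]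
  {L : M → Type*} [∀ x, AddCommGroup (L x)] [∀ x, Module ℂ (L x)]
  [∀ x, TopologicalSpace (L x)] [TopologicalSpace (TotalSpace ℂ L)] [FiberBundle ℂ L]
  [VectorBundle ℂ ℂ L]

lemma contDiffAt_base_change {x₀ x₁ : M} {z : Fin n → ℂ} (hz : z ∈ baseOverlap L x₀ x₁) :
    ContDiffAt ℂ ω (fun z => chartAt (Fin n → ℂ) x₁ ((chartAt (Fin n → ℂ) x₀).symm z)) z :=
  contDiffAt_transition (chart_mem_atlas _ _) (chart_mem_atlas _ _) hz.1.1 hz.2.1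

lemma contDiffAt_transition_function [ContMDiffVectorBundle ω ℂ L 𝓘(ℂ, Fin n → ℂ)] {x₀ x₁ : M}
    {z : Fin n → ℂ} (hz : z ∈ baseOverlap L x₀ x₁) :
    ContDiffAt ℂ ω (fun z => transition L x₀ x₁ ((chartAt (Fin n → ℂ) x₀).symm z)) z := by
  have h := contMDiffOn_coordChangeL (n := ω) (IB := 𝓘(ℂ, Fin n → ℂ)) (F := ℂ)
    (trivializationAt ℂ L x₀) (trivializationAt ℂ L x₁)
  have hm : (chartAt (Fin n → ℂ) x₀).symm z ∈
      (trivializationAt ℂ L x₀).baseSet ∩ (trivializationAt ℂ L x₁).baseSet := ⟨hz.1.2, hz.2.2⟩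
  have ho := ((trivializationAt ℂ L x₀).open_baseSet.inter
    (trivializationAt ℂ L x₁).open_baseSet).mem_nhds hm
  have h1 := h.contMDiffAt ho
  have h2 : ContMDiffAt 𝓘(ℂ, Fin n → ℂ) 𝓘(ℂ, ℂ) ω (transition L x₀ x₁)
      ((chartAt (Fin n → ℂ) x₀).symm z) := by
    refine (h1.clm_apply (contMDiffAt_const (c := (1 : ℂ)))).congr_of_eventuallyEq ?_
    filter_upwards [ho] with x hx
    change _ = Trivialization.coordChangeL ℂ _ _ x (1 : ℂ)
    rw [Trivialization.coordChangeL_apply _ _ hx]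
    simp [transition, coord, frame, Trivialization.linearMapAt_apply, hx.2,
      Trivialization.mk_symm _ hx.1]
  exact contDiffAt_complex_fun_chart (chart_mem_atlas _ x₀) hz.1.1 h2

lemma isOpen_baseDomain (x₀ : M) : IsOpen (baseDomain (n := n) L x₀) :=
  (chartAt (Fin n → ℂ) x₀).isOpen_inter_preimage_symm (trivializationAt ℂ L x₀).open_baseSet

end Base

section Coordinates

variable {n m : ℕ}

/-- The projection to the coordinates of the base. -/
def projInl (n m : ℕ) : (Fin n ⊕ Fin (m + 1) → ℂ) →L[ℂ] (Fin n → ℂ) :=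
  ContinuousLinearMap.pi fun j => ContinuousLinearMap.proj (Sum.inl j)

lemma projInl_apply (u : Fin n ⊕ Fin (m + 1) → ℂ) : projInl n m u = u ∘ Sum.inl := rfl

lemma contDiffAt_coordinate {ι : Type*} [Fintype ι] (i : ι) (u : ι → ℂ) :
    ContDiffAt ℂ ω (fun u : ι → ℂ => u i) u :=
  (ContinuousLinearMap.proj (R := ℂ) (φ := fun _ : ι => ℂ) i).contDiff.contDiffAt

lemma contDiffAt_homogenize (i o : Option (Fin (m + 1))) (u : Fin n ⊕ Fin (m + 1) → ℂ) :
    ContDiffAt ℂ ω (fun u : Fin n ⊕ Fin (m + 1) → ℂ => homogenize i (u ∘ Sum.inr) o) u := by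
  unfold homogenize
  rcases Equiv.swap none i o with _ | k
  · exact contDiffAt_const
  · exact contDiffAt_coordinate _ u

lemma contDiffAt_blowLine (i k : Fin (m + 1)) (u : Fin n ⊕ Fin (m + 1) → ℂ) :
    ContDiffAt ℂ ω (fun u : Fin n ⊕ Fin (m + 1) → ℂ => blowLine i (u ∘ Sum.inr) k) u := by
  by_cases hk : k = i
  · subst hk; simp only [blowLine, Function.update_self]; exact contDiffAt_const
  · simp only [blowLine, Function.update_of_ne hk]; exact contDiffAt_coordinate _ u

lemma contDiffAt_blowPoint (i : Fin (m + 1)) (b : Bool) (o : Option (Fin (m + 1)))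
    (u : Fin n ⊕ Fin (m + 1) → ℂ) :
    ContDiffAt ℂ ω (fun u : Fin n ⊕ Fin (m + 1) → ℂ => blowPoint i b (u ∘ Sum.inr) o) u := by
  rcases o with _ | k
  · cases b
    · exact contDiffAt_const
    · exact contDiffAt_coordinate (Sum.inr i) u
  · refine ContDiffAt.mul ?_ (contDiffAt_blowLine i k u)
    cases b
    · exact contDiffAt_coordinate (Sum.inr i) u
    · exact contDiffAt_const

end Coordinates

variable {n m : ℕ} {M : Type*} [TopologicalSpace M] [ChartedSpace (Fin n → ℂ) M]
  {L : M → Type*} [∀ x, AddCommGroup (L x)] [∀ x, Module ℂ (L x)]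
  [∀ x, TopologicalSpace (L x)] [TopologicalSpace (TotalSpace ℂ L)] [FiberBundle ℂ L]
  [VectorBundle ℂ ℂ L]

/-- The points of `M` at which the coordinates at `x₀` are defined. -/
def coordSet (n : ℕ) {M : Type*} [TopologicalSpace M] [ChartedSpace (Fin n → ℂ) M] (L : M → Type*)
    [∀ x, AddCommGroup (L x)] [∀ x, Module ℂ (L x)]
    [∀ x, TopologicalSpace (L x)] [TopologicalSpace (TotalSpace ℂ L)] [FiberBundle ℂ L]
    (x₀ : M) : Set M :=
  (chartAt (Fin n → ℂ) x₀).source ∩ (trivializationAt ℂ L x₀).baseSet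

lemma isOpen_coordSet (x₀ : M) : IsOpen (coordSet n L x₀) :=
  (chartAt (Fin n → ℂ) x₀).open_source.inter (trivializationAt ℂ L x₀).open_baseSet

lemma mem_coordSet (x₀ : M) : x₀ ∈ coordSet n L x₀ :=
  ⟨mem_chart_source _ _, mem_baseSet_trivializationAt ℂ L x₀⟩

lemma compactSpace_of_fibres [T2Space M] [CompactSpace M] {Y : Type*} [TopologicalSpace Y]
    {base : Y → M} {J : Type*} [Finite J]
    (c : M → J → OpenPartialHomeomorph Y (Fin n ⊕ Fin (m + 1) → ℂ))
    (ht : ∀ x₀ j, {u | u ∘ Sum.inl ∈ baseDomain L x₀} ⊆ (c x₀ j).target)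
    (hc : ∀ x₀ p, base p ∈ coordSet n L x₀ → ∃ j, p ∈ (c x₀ j).source ∧
      c x₀ j p ∘ Sum.inl = chartAt (Fin n → ℂ) x₀ (base p) ∧ ∀ k, ‖c x₀ j p (Sum.inr k)‖ ≤ 1) :
    CompactSpace Y := by
  have hK : ∀ x₀ : M, ∃ K : Set M, IsCompact K ∧ x₀ ∈ interior K ∧ K ⊆ coordSet n L x₀ := fun x₀ =>
    exists_compact_subset (isOpen_coordSet x₀) (mem_coordSet x₀)
  choose K hK1 hK2 hK3 using hK
  obtain ⟨t, ht'⟩ := CompactSpace.elim_nhds_subcover (fun x => K x) fun x =>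
    mem_interior_iff_mem_nhds.1 (hK2 x)
  let S : M → Set (Fin n ⊕ Fin (m + 1) → ℂ) := fun x₀ =>
    (fun x : (Fin n → ℂ) × (Fin (m + 1) → ℂ) => Sum.elim x.1 x.2) ''
      ((chartAt (Fin n → ℂ) x₀ '' K x₀) ×ˢ Metric.closedBall 0 1)
  have hS : ∀ x₀, IsCompact (S x₀) := by
    intro x₀
    refine IsCompact.image (IsCompact.prod ?_ (isCompact_closedBall 0 1)) ?_
    · exact (hK1 x₀).image_of_continuousOn
        ((chartAt (Fin n → ℂ) x₀).continuousOn.mono fun x hx => (hK3 x₀ hx).1)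
    · refine continuous_pi ?_
      rintro (l | k) <;> simp <;> fun_prop
  have hSt : ∀ x₀ j, S x₀ ⊆ (c x₀ j).target := by
    rintro x₀ j _ ⟨⟨_, w⟩, ⟨⟨x, hx, rfl⟩, -⟩, rfl⟩
    refine ht x₀ j ?_
    have hx' := hK3 x₀ hx
    simp only [mem_ofPred_eq, Sum.elim_comp_inl]
    refine ⟨(chartAt _ x₀).map_source hx'.1, ?_⟩
    rw [mem_preimage, (chartAt _ x₀).left_inv hx'.1]
    exact hx'.2
  refine ⟨?_⟩
  have hU : (univ : Set Y) = ⋃ x₀ ∈ t, ⋃ j, (c x₀ j).symm '' S x₀ := by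
    refine (eq_univ_of_forall fun p => ?_).symm
    have hp : base p ∈ ⋃ x ∈ t, K x := by rw [ht']; trivial
    simp only [mem_iUnion] at hp ⊢
    obtain ⟨x₀, hx₀, hp⟩ := hp
    obtain ⟨j, hj, h1, h2⟩ := hc x₀ p (hK3 x₀ hp)
    refine ⟨x₀, hx₀, j, c x₀ j p, ⟨(chartAt _ x₀ (base p), c x₀ j p ∘ Sum.inr),
      ⟨⟨_, hp, rfl⟩, ?_⟩, ?_⟩, (c x₀ j).left_inv hj⟩
    · rw [mem_closedBall_zero_iff, pi_norm_le_iff_of_nonneg zero_le_one]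
      exact h2
    · simp only [← h1]; exact Sum.elim_comp_inl_inr _
  rw [hU]
  refine t.isCompact_biUnion fun x₀ _ => isCompact_iUnion fun j => ?_
  exact (hS x₀).image_of_continuousOn ((c x₀ j).continuousOn_symm.mono (hSt x₀ j))

/-! #### The projective bundle -/

/-- The charts of the projective bundle, as partial homeomorphisms. -/
def projHomeo (x₀ : M) (i : Option (Fin (m + 1))) :
    OpenPartialHomeomorph (ProjBundle n L m) (Fin n ⊕ Fin (m + 1) → ℂ) :=
  (projCore n L m).openPartialHomeomorph (projChart x₀ i) ⟨x₀, i, rfl⟩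

lemma projHomeo_mem_atlas (x₀ : M) (i : Option (Fin (m + 1))) :
    projHomeo x₀ i ∈ atlas (Fin n ⊕ Fin (m + 1) → ℂ) (ProjBundle n L m) :=
  mem_iUnion₂.2 ⟨_, ⟨x₀, i, rfl⟩, rfl⟩

lemma exists_projHomeo {c : OpenPartialHomeomorph (ProjBundle n L m) (Fin n ⊕ Fin (m + 1) → ℂ)}
    (hc : c ∈ atlas (Fin n ⊕ Fin (m + 1) → ℂ) (ProjBundle n L m)) :
    ∃ x₀ i, c = projHomeo x₀ i := by
  obtain ⟨_, ⟨x₀, i, rfl⟩, rfl⟩ := mem_iUnion₂.1 hc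
  exact ⟨x₀, i, rfl⟩

section ProjLemmas

variable {x₀ x₁ : M} {i j : Option (Fin (m + 1))} {p : ProjBundle n L m}

lemma mem_projHomeo_source : p ∈ (projHomeo x₀ i).source ↔
    p.base ∈ coordSet n L x₀ ∧ hom x₀ p.base p.point.rep i ≠ 0 := by
  change (_ ∧ _ ∧ _) ↔ _
  rw [coordSet, mem_inter_iff, and_assoc]

lemma mem_projHomeo_target {u : Fin n ⊕ Fin (m + 1) → ℂ} :
    u ∈ (projHomeo (L := L) x₀ i).target ↔ u ∘ Sum.inl ∈ baseDomain L x₀ := Iff.rfl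

lemma projHomeo_inl : projHomeo x₀ i p ∘ Sum.inl = chartAt (Fin n → ℂ) x₀ p.base := rfl

lemma projHomeo_inr : projHomeo x₀ i p ∘ Sum.inr = affine i (hom x₀ p.base p.point.rep) := rfl

lemma hom_eq_homogenize (hp : p ∈ (projHomeo x₀ i).source) :
    hom x₀ p.base p.point.rep =
      hom x₀ p.base p.point.rep i • homogenize i (projHomeo x₀ i p ∘ Sum.inr) := by
  have h := (mem_projHomeo_source.1 hp).2
  rw [projHomeo_inr, homogenize_affine i h, smul_smul, mul_inv_cancel₀ h, one_smul]

lemma exists_mem_projHomeo_source (p : ProjBundle n L m) (hp : p.base ∈ coordSet n L x₀) :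
    ∃ i, p ∈ (projHomeo x₀ i).source ∧ ∀ k, ‖projHomeo x₀ i p (Sum.inr k)‖ ≤ 1 := by
  have h0 := hom_ne_zero hp.2 p.point.rep_nonzero
  obtain ⟨i, hi⟩ := Finite.exists_max fun o => ‖hom x₀ p.base p.point.rep o‖
  have hne : hom x₀ p.base p.point.rep i ≠ 0 := by
    intro h
    apply h0
    ext o
    have := hi o
    rw [h, norm_zero] at this
    exact norm_le_zero_iff.1 this
  refine ⟨i, mem_projHomeo_source.2 ⟨hp, hne⟩, fun k => ?_⟩
  change ‖affine i (hom x₀ p.base p.point.rep) k‖ ≤ 1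
  rw [affine, norm_div, div_le_one (norm_pos_iff.2 hne)]
  exact hi _

lemma proj_base_eq (hp : p ∈ (projHomeo x₀ i).source) :
    p.base = (chartAt (Fin n → ℂ) x₀).symm (projInl n m (projHomeo x₀ i p)) := by
  rw [projInl_apply, projHomeo_inl,
    (chartAt (Fin n → ℂ) x₀).left_inv (mem_projHomeo_source.1 hp).1.1]

end ProjLemmas

instance [T2Space M] [CompactSpace M] : CompactSpace (ProjBundle n L m) :=
  compactSpace_of_fibres (L := L) (base := ProjBundle.base) projHomeo
    (fun x₀ j u hu => hu) fun x₀ p hp => by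
      obtain ⟨i, h1, h2⟩ := exists_mem_projHomeo_source p hp
      exact ⟨i, h1, projHomeo_inl, h2⟩

section Analytic

variable [IsManifold 𝓘(ℂ, Fin n → ℂ) ω M] [ContMDiffVectorBundle ω ℂ L 𝓘(ℂ, Fin n → ℂ)]

lemma contDiffAt_twist {x₀ x₁ : M} {W : (Fin n ⊕ Fin (m + 1) → ℂ) → Option (Fin (m + 1)) → ℂ}
    {u : Fin n ⊕ Fin (m + 1) → ℂ} (hu : u ∘ Sum.inl ∈ baseOverlap L x₀ x₁)
    (hW : ∀ o, ContDiffAt ℂ ω (fun u => W u o) u) (o : Option (Fin (m + 1))) :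
    ContDiffAt ℂ ω (fun u => twist (transition L x₀ x₁
      ((chartAt (Fin n → ℂ) x₀).symm (u ∘ Sum.inl))) (W u) o) u := by
  rcases o with _ | k
  · exact hW none
  · have h := (contDiffAt_transition_function (L := L) (x₀ := x₀) (x₁ := x₁) hu).comp u
      (projInl n m).contDiff.contDiffAt
    exact h.mul (hW (some k))

lemma contDiffAt_inl {x₀ x₁ : M} {u : Fin n ⊕ Fin (m + 1) → ℂ}
    (hu : u ∘ Sum.inl ∈ baseOverlap L x₀ x₁) (l : Fin n) :
    ContDiffAt ℂ ω (fun u : Fin n ⊕ Fin (m + 1) → ℂ =>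
      chartAt (Fin n → ℂ) x₁ ((chartAt (Fin n → ℂ) x₀).symm (u ∘ Sum.inl)) l) u :=
  contDiffAt_pi.1 ((contDiffAt_base_change (L := L) hu).comp u (projInl n m).contDiff.contDiffAt) l

instance : IsManifold 𝓘(ℂ, Fin n ⊕ Fin (m + 1) → ℂ) ω (ProjBundle n L m) := by
  refine isManifold_of_contDiffOn _ _ _ fun e e' he he' => ?_
  obtain ⟨x₀, i, rfl⟩ := exists_projHomeo he
  obtain ⟨x₁, j, rfl⟩ := exists_projHomeo he'
  simp only [modelWithCornersSelf_coe, modelWithCornersSelf_coe_symm, Function.id_comp,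
    Function.comp_id, preimage_id_eq, id_eq, range_id, inter_univ]
  intro u hu
  have hu' : u ∈ (projHomeo (n := n) (L := L) x₀ i).target ∧
      (projHomeo (n := n) x₀ i).symm u ∈ (projHomeo (n := n) (L := L) x₁ j).source := by
    rwa [OpenPartialHomeomorph.trans_source] at hu
  have hs : ∀ u, u ∈ ((projHomeo (n := n) (L := L) x₀ i).symm.trans (projHomeo x₁ j)).source →
      ((projHomeo (n := n) (L := L) x₀ i).symm.trans (projHomeo x₁ j)) u =
      Sum.elim (chartAt (Fin n → ℂ) x₁ ((chartAt (Fin n → ℂ) x₀).symm (u ∘ Sum.inl)))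
        (affine j (twist (transition L x₀ x₁ ((chartAt (Fin n → ℂ) x₀).symm (u ∘ Sum.inl)))
          (homogenize i (u ∘ Sum.inr)))) := fun u hu => by
    rw [OpenPartialHomeomorph.trans_source] at hu
    exact (projChart_trans (n := n) (L := L) hu.1).1
  obtain ⟨ho, hj⟩ := (projChart_trans (n := n) (L := L) hu'.1).2.1 hu'.2
  refine (ContDiffAt.contDiffWithinAt ?_).congr hs (hs u hu)
  refine contDiffAt_pi.2 ?_
  have hW := contDiffAt_twist ho fun o => contDiffAt_homogenize i o u
  rintro (l | k)
  · exact contDiffAt_inl ho l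
  · exact (hW _).div (hW j) hj

lemma contMDiff_proj_base : ContMDiff 𝓘(ℂ, Fin n ⊕ Fin (m + 1) → ℂ) 𝓘(ℂ, Fin n → ℂ) ω
    (ProjBundle.base : ProjBundle n L m → M) := by
  intro p
  obtain ⟨i, hi, -⟩ := exists_mem_projHomeo_source p (mem_coordSet p.base)
  refine contMDiffAt_of_charts (projHomeo_mem_atlas p.base i) (chart_mem_atlas _ p.base) hi
    (projInl n m).contDiff.contDiffAt ?_ fun q hq => proj_base_eq hq
  rw [projInl_apply, projHomeo_inl]
  exact mem_chart_target _ _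

end Analytic

/-- The relative squared norm of the homogeneous coordinate with index `o`. -/
def relNorm {J : Type*} [Fintype J] (W : J → ℂ) (o : J) : ℝ := ‖W o‖ ^ 2 / ∑ o', ‖W o'‖ ^ 2

lemma sum_norm_sq_pos {J : Type*} [Fintype J] {W : J → ℂ} {o : J} (h : W o ≠ 0) :
    0 < ∑ o', ‖W o'‖ ^ 2 :=
  Finset.sum_pos' (fun _ _ => by positivity) ⟨o, Finset.mem_univ _, by positivity⟩

lemma relNorm_smul {J : Type*} [Fintype J] (W : J → ℂ) (o : J) {r : ℂ} (hr : r ≠ 0) :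
    relNorm (r • W) o = relNorm W o := by
  simp only [relNorm, Pi.smul_apply, smul_eq_mul, norm_mul, mul_pow, ← Finset.mul_sum]
  rw [mul_div_mul_left]
  positivity

lemma relNorm_eq_zero {J : Type*} [Fintype J] {W : J → ℂ} (o : J) (h : W ≠ 0) :
    relNorm W o = 0 ↔ W o = 0 := by
  obtain ⟨o', ho'⟩ := Function.ne_iff.1 h
  have := sum_norm_sq_pos ho'
  simp [relNorm, this.ne']

lemma continuousAt_relNorm {J X : Type*} [Fintype J] [TopologicalSpace X] {W : X → J → ℂ} {x : X}
    (hW : ∀ o, ContinuousAt (fun x => W x o) x) (h : W x ≠ 0) (o : J) :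
    ContinuousAt (fun x => relNorm (W x) o) x := by
  obtain ⟨o', ho'⟩ := Function.ne_iff.1 h
  refine ContinuousAt.div ((hW o).norm.pow 2) ?_ (sum_norm_sq_pos ho').ne'
  exact tendsto_finsetSum _ fun o _ => (hW o).norm.pow 2

lemma isOpen_base_coordSet (x₀ : M) :
    IsOpen {p : ProjBundle n L m | p.base ∈ coordSet n L x₀} := by
  have : {p : ProjBundle n L m | p.base ∈ coordSet n L x₀} = ⋃ i, (projHomeo x₀ i).source := by
    ext p
    simp only [mem_ofPred_eq, mem_iUnion]
    constructor
    · intro hp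
      obtain ⟨i, hi, -⟩ := exists_mem_projHomeo_source p hp
      exact ⟨i, hi⟩
    · rintro ⟨i, hi⟩
      exact (mem_projHomeo_source.1 hi).1
  rw [this]
  exact isOpen_iUnion fun i => (projHomeo x₀ i).open_source

lemma continuousOn_relNorm_proj (x₀ : M) (o : Option (Fin (m + 1))) :
    ContinuousOn (fun p : ProjBundle n L m => relNorm (hom x₀ p.base p.point.rep) o)
      {p | p.base ∈ coordSet n L x₀} := by
  intro p hp
  obtain ⟨i, hi, -⟩ := exists_mem_projHomeo_source p hp
  refine ContinuousAt.continuousWithinAt ?_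
  have h1 : ContinuousAt (fun p : ProjBundle n L m =>
      relNorm (homogenize i (projHomeo x₀ i p ∘ Sum.inr)) o) p := by
    refine continuousAt_relNorm
      (W := fun p : ProjBundle n L m => homogenize i (projHomeo x₀ i p ∘ Sum.inr))
      (fun o => ?_) (homogenize_ne_zero _ _) o
    exact ContinuousAt.comp (g := fun u : Fin n ⊕ Fin (m + 1) → ℂ => homogenize i (u ∘ Sum.inr) o)
      (contDiffAt_homogenize i o _).continuousAt ((projHomeo x₀ i).continuousAt hi)
  refine h1.congr ?_
  filter_upwards [(projHomeo x₀ i).open_source.mem_nhds hi] with q hq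
  rw [hom_eq_homogenize hq, relNorm_smul _ _ (mem_projHomeo_source.1 hq).2]

instance [IsManifold 𝓘(ℂ, Fin n → ℂ) ω M] [ContMDiffVectorBundle ω ℂ L 𝓘(ℂ, Fin n → ℂ)]
    [T2Space M] : T2Space (ProjBundle n L m) := by
  refine ⟨fun p q hpq => ?_⟩
  by_cases hb : p.base = q.base
  · have hp : p.base ∈ coordSet n L p.base := mem_coordSet _
    have hq : q.base ∈ coordSet n L p.base := by rw [← hb]; exact hp
    by_cases hr : ∀ o, relNorm (hom p.base p.base p.point.rep) o =
        relNorm (hom p.base q.base q.point.rep) o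
    · obtain ⟨i, hi, -⟩ := exists_mem_projHomeo_source p hp
      have hi' : q ∈ (projHomeo p.base i).source := by
        refine mem_projHomeo_source.2 ⟨hq, ?_⟩
        rw [ne_eq, ← relNorm_eq_zero i (hom_ne_zero hq.2 q.point.rep_nonzero), ← hr i,
          relNorm_eq_zero i (hom_ne_zero hp.2 p.point.rep_nonzero)]
        exact (mem_projHomeo_source.1 hi).2
      exact separated_of_continuousOn (projHomeo p.base i).open_source
        (projHomeo p.base i).continuousOn hi hi' fun h => hpq ((projHomeo p.base i).injOn hi hi' h)
    · obtain ⟨o, ho⟩ := not_forall.1 hr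
      exact separated_of_continuousOn (isOpen_base_coordSet p.base)
        (continuousOn_relNorm_proj p.base o) hp hq ho
  · exact separated_of_continuousOn isOpen_univ contMDiff_proj_base.continuous.continuousOn
      (mem_univ p) (mem_univ q) hb

/-! #### The blow-up -/

/-- The charts of the blow-up, as partial homeomorphisms. -/
def blowHomeo (x₀ : M) (i : Fin (m + 1)) (b : Bool) :
    OpenPartialHomeomorph (BlowUp n L m) (Fin n ⊕ Fin (m + 1) → ℂ) :=
  (blowCore n L m).openPartialHomeomorph (blowChart x₀ i b) ⟨x₀, i, b, rfl⟩

lemma blowHomeo_mem_atlas (x₀ : M) (i : Fin (m + 1)) (b : Bool) :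
    blowHomeo x₀ i b ∈ atlas (Fin n ⊕ Fin (m + 1) → ℂ) (BlowUp n L m) :=
  mem_iUnion₂.2 ⟨_, ⟨x₀, i, b, rfl⟩, rfl⟩

lemma exists_blowHomeo {c : OpenPartialHomeomorph (BlowUp n L m) (Fin n ⊕ Fin (m + 1) → ℂ)}
    (hc : c ∈ atlas (Fin n ⊕ Fin (m + 1) → ℂ) (BlowUp n L m)) :
    ∃ x₀ i b, c = blowHomeo x₀ i b := by
  obtain ⟨_, ⟨x₀, i, b, rfl⟩, rfl⟩ := mem_iUnion₂.1 hc
  exact ⟨x₀, i, b, rfl⟩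

section BlowLemmas

variable {x₀ x₁ : M} {i j : Fin (m + 1)} {b c : Bool} {q : BlowUp n L m}

lemma mem_blowHomeo_source : q ∈ (blowHomeo x₀ i b).source ↔ q.base ∈ coordSet n L x₀ ∧
    BlowDefined i b (hom x₀ q.base q.point.rep) (homL x₀ q.base q.line.rep) := by
  change (_ ∧ _ ∧ _) ↔ _
  rw [coordSet, mem_inter_iff, and_assoc]

lemma mem_blowHomeo_target {u : Fin n ⊕ Fin (m + 1) → ℂ} :
    u ∈ (blowHomeo (L := L) x₀ i b).target ↔ u ∘ Sum.inl ∈ baseDomain L x₀ := Iff.rfl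

lemma blowHomeo_inl : blowHomeo x₀ i b q ∘ Sum.inl = chartAt (Fin n → ℂ) x₀ q.base := rfl

lemma blowHomeo_inr : blowHomeo x₀ i b q ∘ Sum.inr =
    blowCoord i b (hom x₀ q.base q.point.rep) (homL x₀ q.base q.line.rep) := rfl

lemma blowHomeo_symm_base (u : Fin n ⊕ Fin (m + 1) → ℂ) :
    ((blowHomeo (L := L) x₀ i b).symm u).base = (chartAt (Fin n → ℂ) x₀).symm (u ∘ Sum.inl) :=
  blowPointOf_base _ _ _ _ _

lemma hom_eq_blowPoint (hq : q ∈ (blowHomeo x₀ i b).source) :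
    hom x₀ q.base q.point.rep = (bif b then hom x₀ q.base q.point.rep (some i)
      else hom x₀ q.base q.point.rep none) • blowPoint i b (blowHomeo x₀ i b q ∘ Sum.inr) := by
  have h := (mem_blowHomeo_source.1 hq).2
  obtain ⟨t, ht⟩ := exists_eq_mul x₀ q
  rw [blowHomeo_inr, blowPoint_blowCoord h ht, smul_smul, mul_inv_cancel₀ h.1, one_smul]

lemma homL_eq_blowLine (hq : q ∈ (blowHomeo x₀ i b).source) :
    homL x₀ q.base q.line.rep =
      homL x₀ q.base q.line.rep i • blowLine i (blowHomeo x₀ i b q ∘ Sum.inr) := by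
  have h := (mem_blowHomeo_source.1 hq).2
  rw [blowHomeo_inr, blowLine_blowCoord h, smul_smul, mul_inv_cancel₀ h.2, one_smul]

lemma hom_some_ne_zero (hq : q.base ∈ coordSet n L x₀) (h : hom x₀ q.base q.point.rep none = 0)
    (hi : homL x₀ q.base q.line.rep i ≠ 0) : hom x₀ q.base q.point.rep (some i) ≠ 0 := by
  obtain ⟨t, ht⟩ := exists_eq_mul x₀ q
  rw [ht]
  refine mul_ne_zero ?_ hi
  rintro rfl
  apply hom_ne_zero hq.2 q.point.rep_nonzero
  ext o
  rcases o with _ | k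
  · exact h
  · simp [ht]

lemma exists_mem_blowHomeo_source (q : BlowUp n L m) (hq : q.base ∈ coordSet n L x₀) :
    ∃ i b, q ∈ (blowHomeo x₀ i b).source ∧ ∀ k, ‖blowHomeo x₀ i b q (Sum.inr k)‖ ≤ 1 := by
  have h0 := homL_ne_zero hq.2 q.line.rep_nonzero
  obtain ⟨i, hi⟩ := Finite.exists_max fun k => ‖homL x₀ q.base q.line.rep k‖
  have hne : homL x₀ q.base q.line.rep i ≠ 0 := by
    intro h
    apply h0
    ext o
    have := hi o
    rw [h, norm_zero] at this
    exact norm_le_zero_iff.1 this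
  have hk : ∀ k, ‖homL x₀ q.base q.line.rep k / homL x₀ q.base q.line.rep i‖ ≤ 1 := fun k => by
    rw [norm_div, div_le_one (norm_pos_iff.2 hne)]; exact hi k
  rcases le_total ‖hom x₀ q.base q.point.rep (some i)‖ ‖hom x₀ q.base q.point.rep none‖ with h | h
  · have h1 : hom x₀ q.base q.point.rep none ≠ 0 := by
      intro h1
      rw [h1, norm_zero, norm_le_zero_iff] at h
      exact hom_some_ne_zero hq h1 hne h
    refine ⟨i, false, mem_blowHomeo_source.2 ⟨hq, h1, hne⟩, fun k => ?_⟩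
    change ‖blowCoord i false _ _ k‖ ≤ 1
    by_cases hki : k = i
    · subst hki
      simp only [blowCoord, Function.update_self, cond_false]
      rw [norm_div, div_le_one (norm_pos_iff.2 h1)]; exact h
    · rw [blowCoord, Function.update_of_ne hki]; exact hk k
  · have h1 : hom x₀ q.base q.point.rep (some i) ≠ 0 := by
      intro h1
      rw [h1, norm_zero, norm_le_zero_iff] at h
      exact hom_some_ne_zero hq h hne h1
    refine ⟨i, true, mem_blowHomeo_source.2 ⟨hq, h1, hne⟩, fun k => ?_⟩
    change ‖blowCoord i true _ _ k‖ ≤ 1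
    by_cases hki : k = i
    · subst hki
      simp only [blowCoord, Function.update_self, cond_true]
      rw [norm_div, div_le_one (norm_pos_iff.2 h1)]; exact h
    · rw [blowCoord, Function.update_of_ne hki]; exact hk k

lemma blow_base_eq (hq : q ∈ (blowHomeo x₀ i b).source) :
    q.base = (chartAt (Fin n → ℂ) x₀).symm (projInl n m (blowHomeo x₀ i b q)) := by
  rw [projInl_apply, blowHomeo_inl,
    (chartAt (Fin n → ℂ) x₀).left_inv (mem_blowHomeo_source.1 hq).1.1]

/-- The blow-down map in coordinates. -/
def blowDownCoord (n : ℕ) (i : Fin (m + 1)) (b : Bool) (u : Fin n ⊕ Fin (m + 1) → ℂ) :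
    Fin n ⊕ Fin (m + 1) → ℂ :=
  Sum.elim (u ∘ Sum.inl) (affine (bif b then some i else none) (blowPoint i b (u ∘ Sum.inr)))

lemma blowPoint_self (i : Fin (m + 1)) (b : Bool) (w : Fin (m + 1) → ℂ) :
    blowPoint i b w (bif b then some i else none) = 1 := by
  cases b <;> simp [blowPoint, blowLine]

lemma blowDown_mem_source (hq : q ∈ (blowHomeo x₀ i b).source) :
    blowDown q ∈ (projHomeo x₀ (bif b then some i else none)).source := by
  obtain ⟨h1, h2⟩ := mem_blowHomeo_source.1 hq
  exact mem_projHomeo_source.2 ⟨h1, by cases b <;> exact h2.1⟩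

lemma projHomeo_blowDown (hq : q ∈ (blowHomeo x₀ i b).source) :
    projHomeo x₀ (bif b then some i else none) (blowDown q) =
      blowDownCoord n i b (blowHomeo x₀ i b q) := by
  have h2 := (mem_blowHomeo_source.1 hq).2
  have h3 := projHomeo_inr (x₀ := x₀) (i := bif b then some i else none) (p := blowDown q)
  change _ = affine _ (hom x₀ q.base q.point.rep) at h3
  rw [hom_eq_blowPoint hq, affine_smul _ (by cases b <;> exact h2.1)] at h3
  rw [blowDownCoord, ← h3]
  exact (Sum.elim_comp_inl_inr _).symm

lemma blowDownCoord_mem_target {u : Fin n ⊕ Fin (m + 1) → ℂ}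
    (hu : u ∈ (blowHomeo (L := L) x₀ i b).target) (o : Option (Fin (m + 1))) :
    blowDownCoord n i b u ∈ (projHomeo (L := L) x₀ o).target := by
  rw [mem_projHomeo_target, blowDownCoord, Sum.elim_comp_inl]
  exact hu

lemma contDiffAt_blowDownCoord (u : Fin n ⊕ Fin (m + 1) → ℂ) :
    ContDiffAt ℂ ω (blowDownCoord n i b) u := by
  refine contDiffAt_pi.2 ?_
  rintro (l | k)
  · exact contDiffAt_coordinate _ u
  · simp only [blowDownCoord, Sum.elim_inr, affine, blowPoint_self, div_one]
    exact contDiffAt_blowPoint i b _ u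

end BlowLemmas

instance [T2Space M] [CompactSpace M] : CompactSpace (BlowUp n L m) :=
  compactSpace_of_fibres (L := L) (base := BlowUp.base) (J := Fin (m + 1) × Bool)
    (fun x₀ j => blowHomeo x₀ j.1 j.2) (fun x₀ j u hu => hu) fun x₀ p hp => by
      obtain ⟨i, b, h1, h2⟩ := exists_mem_blowHomeo_source p hp
      exact ⟨(i, b), h1, blowHomeo_inl, h2⟩

section BlowAnalytic

variable [IsManifold 𝓘(ℂ, Fin n → ℂ) ω M] [ContMDiffVectorBundle ω ℂ L 𝓘(ℂ, Fin n → ℂ)]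

instance : IsManifold 𝓘(ℂ, Fin n ⊕ Fin (m + 1) → ℂ) ω (BlowUp n L m) := by
  refine isManifold_of_contDiffOn _ _ _ fun e e' he he' => ?_
  obtain ⟨x₀, i, b, rfl⟩ := exists_blowHomeo he
  obtain ⟨x₁, j, c, rfl⟩ := exists_blowHomeo he'
  simp only [modelWithCornersSelf_coe, modelWithCornersSelf_coe_symm, Function.id_comp,
    Function.comp_id, preimage_id_eq, id_eq, range_id, inter_univ]
  intro u hu
  have hu' : u ∈ (blowHomeo (n := n) (L := L) x₀ i b).target ∧
      (blowHomeo (n := n) x₀ i b).symm u ∈ (blowHomeo (n := n) (L := L) x₁ j c).source := by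
    rwa [OpenPartialHomeomorph.trans_source] at hu
  have hs : ∀ u, u ∈ ((blowHomeo (n := n) (L := L) x₀ i b).symm.trans (blowHomeo x₁ j c)).source →
      ((blowHomeo (n := n) (L := L) x₀ i b).symm.trans (blowHomeo x₁ j c)) u =
      Sum.elim (chartAt (Fin n → ℂ) x₁ ((chartAt (Fin n → ℂ) x₀).symm (u ∘ Sum.inl)))
        (blowCoord j c (twist (transition L x₀ x₁
          ((chartAt (Fin n → ℂ) x₀).symm (u ∘ Sum.inl))) (blowPoint i b (u ∘ Sum.inr)))
          (blowLine i (u ∘ Sum.inr))) := fun u hu => by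
    rw [OpenPartialHomeomorph.trans_source] at hu
    have h := blowChart_trans (n := n) (L := L) (x₀ := x₀) (i := i) (b := b) (x₁ := x₁) (j := j) (c := c) hu.1
    exact h.1 (h.2.1 hu.2).1
  obtain ⟨ho, hj⟩ := (blowChart_trans (n := n) (L := L) (x₀ := x₀) (i := i) (b := b) (x₁ := x₁) (j := j) (c := c) hu'.1).2.1 hu'.2
  refine (ContDiffAt.contDiffWithinAt ?_).congr hs (hs u hu)
  refine contDiffAt_pi.2 ?_
  have hW := contDiffAt_twist ho fun o => contDiffAt_blowPoint i b o u
  rintro (l | k)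
  · exact contDiffAt_inl ho l
  · by_cases hk : k = j
    · subst hk
      cases c
      · simp only [Sum.elim_inr, blowCoord, Function.update_self, cond_false]
        exact (hW (some k)).div (hW none) hj.1
      · simp only [Sum.elim_inr, blowCoord, Function.update_self, cond_true]
        exact (hW none).div (hW (some k)) hj.1
    · simp only [Sum.elim_inr, blowCoord, Function.update_of_ne hk]
      exact (contDiffAt_blowLine i k u).div (contDiffAt_blowLine i j u) hj.2

lemma contMDiff_blow_base : ContMDiff 𝓘(ℂ, Fin n ⊕ Fin (m + 1) → ℂ) 𝓘(ℂ, Fin n → ℂ) ω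
    (BlowUp.base : BlowUp n L m → M) := by
  intro p
  obtain ⟨i, b, hi, -⟩ := exists_mem_blowHomeo_source p (mem_coordSet p.base)
  refine contMDiffAt_of_charts (blowHomeo_mem_atlas p.base i b) (chart_mem_atlas _ p.base) hi
    (projInl n m).contDiff.contDiffAt ?_ fun q hq => blow_base_eq hq
  rw [projInl_apply, blowHomeo_inl]
  exact mem_chart_target _ _

lemma contMDiff_blowDown : ContMDiff 𝓘(ℂ, Fin n ⊕ Fin (m + 1) → ℂ)
    𝓘(ℂ, Fin n ⊕ Fin (m + 1) → ℂ) ω (blowDown : BlowUp n L m → ProjBundle n L m) := by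
  intro p
  obtain ⟨i, b, hi, -⟩ := exists_mem_blowHomeo_source p (mem_coordSet p.base)
  refine contMDiffAt_of_charts (blowHomeo_mem_atlas p.base i b)
    (projHomeo_mem_atlas p.base (bif b then some i else none)) hi
    (contDiffAt_blowDownCoord (i := i) (b := b) _)
    (blowDownCoord_mem_target ((blowHomeo p.base i b).map_source hi) _) fun q hq => ?_
  rw [← projHomeo_blowDown hq, OpenPartialHomeomorph.left_inv _ (blowDown_mem_source hq)]

lemma isOpen_blow_base_coordSet (x₀ : M) :
    IsOpen {p : BlowUp n L m | p.base ∈ coordSet n L x₀} :=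
  (isOpen_coordSet x₀).preimage contMDiff_blow_base.continuous

lemma continuousOn_relNorm_blow (x₀ : M) (o : Option (Fin (m + 1))) :
    ContinuousOn (fun p : BlowUp n L m => relNorm (hom x₀ p.base p.point.rep) o)
      {p | p.base ∈ coordSet n L x₀} :=
  (continuousOn_relNorm_proj x₀ o).comp (f := (blowDown : BlowUp n L m → ProjBundle n L m))
    contMDiff_blowDown.continuous.continuousOn fun _ hp => hp

lemma continuousOn_relNorm_line (x₀ : M) (k : Fin (m + 1)) :
    ContinuousOn (fun p : BlowUp n L m => relNorm (homL x₀ p.base p.line.rep) k)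
      {p | p.base ∈ coordSet n L x₀} := by
  intro p hp
  obtain ⟨i, b, hi, -⟩ := exists_mem_blowHomeo_source p hp
  refine ContinuousAt.continuousWithinAt ?_
  have h1 : ContinuousAt (fun p : BlowUp n L m =>
      relNorm (blowLine i (blowHomeo x₀ i b p ∘ Sum.inr)) k) p := by
    refine continuousAt_relNorm
      (W := fun p : BlowUp n L m => blowLine i (blowHomeo x₀ i b p ∘ Sum.inr))
      (fun o => ?_) (blowLine_ne_zero _ _) k
    exact ContinuousAt.comp (g := fun u : Fin n ⊕ Fin (m + 1) → ℂ => blowLine i (u ∘ Sum.inr) o)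
      (contDiffAt_blowLine i o _).continuousAt ((blowHomeo x₀ i b).continuousAt hi)
  refine h1.congr ?_
  filter_upwards [(blowHomeo x₀ i b).open_source.mem_nhds hi] with q hq
  rw [homL_eq_blowLine hq, relNorm_smul _ _ (mem_blowHomeo_source.1 hq).2.2]

instance [T2Space M] : T2Space (BlowUp n L m) := by
  refine ⟨fun p q hpq => ?_⟩
  by_cases hb : p.base = q.base
  · have hp : p.base ∈ coordSet n L p.base := mem_coordSet _
    have hq : q.base ∈ coordSet n L p.base := by rw [← hb]; exact hp
    by_cases hr : ∀ o, relNorm (hom p.base p.base p.point.rep) o =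
        relNorm (hom p.base q.base q.point.rep) o
    · by_cases hr' : ∀ k, relNorm (homL p.base p.base p.line.rep) k =
          relNorm (homL p.base q.base q.line.rep) k
      · obtain ⟨i, b, hi, -⟩ := exists_mem_blowHomeo_source p hp
        have hi' : q ∈ (blowHomeo p.base i b).source := by
          obtain ⟨-, h1, h2⟩ := mem_blowHomeo_source.1 hi
          have e1 : ∀ o, hom p.base p.base p.point.rep o ≠ 0 →
              hom p.base q.base q.point.rep o ≠ 0 := fun o ho => by
            rwa [ne_eq, ← relNorm_eq_zero o (hom_ne_zero hq.2 q.point.rep_nonzero), ← hr o,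
              relNorm_eq_zero o (hom_ne_zero hp.2 p.point.rep_nonzero)]
          refine mem_blowHomeo_source.2 ⟨hq, ?_, ?_⟩
          · cases b
            · exact e1 none h1
            · exact e1 (some i) h1
          · rwa [ne_eq, ← relNorm_eq_zero i (homL_ne_zero hq.2 q.line.rep_nonzero), ← hr' i,
              relNorm_eq_zero i (homL_ne_zero hp.2 p.line.rep_nonzero)]
        exact separated_of_continuousOn (blowHomeo p.base i b).open_source
          (blowHomeo p.base i b).continuousOn hi hi' fun h =>
            hpq ((blowHomeo p.base i b).injOn hi hi' h)
      · obtain ⟨o, ho⟩ := not_forall.1 hr'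
        exact separated_of_continuousOn (isOpen_blow_base_coordSet p.base)
          (continuousOn_relNorm_line p.base o) hp hq ho
    · obtain ⟨o, ho⟩ := not_forall.1 hr
      exact separated_of_continuousOn (isOpen_blow_base_coordSet p.base)
        (continuousOn_relNorm_blow p.base o) hp hq ho
  · exact separated_of_continuousOn isOpen_univ contMDiff_blow_base.continuous.continuousOn
      (mem_univ p) (mem_univ q) hb

end BlowAnalytic

end

end KahlerProj

namespace KahlerProj

noncomputable section

/-! ### Chern forms of the divisors -/

lemma isNormSqAt_of_chart {ι : Type*} [Fintype ι] {Y : Type*} [TopologicalSpace Y]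
    [ChartedSpace (ι → ℂ) Y] [IsManifold 𝓘(ℂ, ι → ℂ) ω Y] {D : Set Y} {σ : Y → ℝ} {p : Y}
    {c : OpenPartialHomeomorph Y (ι → ℂ)} (hc : c ∈ atlas (ι → ℂ) Y) (hp : p ∈ c.source)
    {F : (ι → ℂ) → ℂ} {Φ : (ι → ℂ) → ℝ} (hF : ∀ u ∈ c.target, ContDiffAt ℂ ω F u)
    (hΦ : ∀ u ∈ c.target, ContDiffAt ℝ ∞ Φ u) (hD : ∀ y ∈ c.source, F (c y) = 0 ↔ y ∈ D)
    (hd : ∀ u ∈ c.target, F u = 0 → fderiv ℂ F u ≠ 0)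
    (hσ : ∀ y ∈ c.source, σ y = ‖F (c y)‖ ^ 2 * Real.exp (-Φ (c y))) :
    IsNormSqAt (ι := ι) D σ p c.source (fun y => F (c y)) fun y => Φ (c y) := by
  have hf : ∀ y ∈ c.source, ContMDiffAt 𝓘(ℂ, ι → ℂ) 𝓘(ℂ, ℂ) ω (fun y => F (c y)) y := fun y hy =>
    (hF _ (c.map_source hy)).contMDiffAt.comp y
      (contMDiffAt_of_mem_maximalAtlas (IsManifold.subset_maximalAtlas hc) hy)
  refine ⟨c.open_source, hp, ⟨fun y hy => (hf y hy).contMDiffWithinAt, hD, ?_⟩, ?_, hσ⟩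
  · rintro y ⟨hy, hyD⟩ h0
    refine hd (c y) (c.map_source hy) ((hD y hy).2 hyD) ?_
    have h1 : HasMFDerivAt 𝓘(ℂ, ι → ℂ) 𝓘(ℂ, ℂ) (fun y => F (c y)) (c.symm (c y)) 0 := by
      rw [c.left_inv hy, ← h0]
      exact ((hf y hy).mdifferentiableAt (by simp)).hasMFDerivAt
    have h2 : MDifferentiableAt 𝓘(ℂ, ι → ℂ) 𝓘(ℂ, ι → ℂ) c.symm (c y) :=
      (contMDiffAt_symm_of_mem_maximalAtlas (n := ω) (IsManifold.subset_maximalAtlas hc)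
        (c.map_source hy)).mdifferentiableAt (by simp)
    have h3 := (h1.comp (c y) h2.hasMFDerivAt).hasFDerivAt
    have h4 : HasFDerivAt F (0 : (ι → ℂ) →L[ℂ] ℂ) (c y) := by
      refine HasFDerivAt.congr_of_eventuallyEq (f := (fun y => F (c y)) ∘ c.symm) ?_ ?_
      · have h5 : ((0 : (ι → ℂ) →L[ℂ] ℂ).comp (mfderiv 𝓘(ℂ, ι → ℂ) 𝓘(ℂ, ι → ℂ) c.symm (c y) :
            (ι → ℂ) →L[ℂ] (ι → ℂ))) = 0 := ContinuousLinearMap.zero_comp _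
        exact h5 ▸ h3
      · filter_upwards [c.open_target.mem_nhds (c.map_source hy)] with u hu
        simp [c.right_inv hu]
    exact h4.fderiv
  · exact fun y hy => ((hΦ _ (c.map_source hy)).contMDiffAt.comp y
      (contMDiffAt_of_mem_maximalAtlas (mem_maximalAtlas_real hc) hy)).contMDiffWithinAt

lemma fderiv_coordinate_ne_zero {ι : Type*} [Fintype ι] [DecidableEq ι] (i : ι) (u : ι → ℂ) :
    fderiv ℂ (fun u : ι → ℂ => u i) u ≠ 0 := by
  intro h
  have h1 : HasFDerivAt (fun u : ι → ℂ => u i)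
      (ContinuousLinearMap.proj (R := ℂ) (φ := fun _ : ι => ℂ) i) u :=
    (ContinuousLinearMap.proj (R := ℂ) (φ := fun _ : ι => ℂ) i).hasFDerivAt
  rw [h1.fderiv] at h
  have := DFunLike.congr_fun h (Pi.single i 1)
  simp at this

variable {n m : ℕ} {M : Type*} [TopologicalSpace M] [ChartedSpace (Fin n → ℂ) M]
  {L : M → Type*} [∀ x, AddCommGroup (L x)] [∀ x, Module ℂ (L x)]
  [∀ x, TopologicalSpace (L x)] [TopologicalSpace (TotalSpace ℂ L)] [FiberBundle ℂ L]
  [VectorBundle ℂ ℂ L]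

/-- The Hermitian norm on `ℂ ⊕ ℂ^{m+1}` with weight `H` on the second summand. -/
def weightNorm (H : ℝ) (W : Option (Fin (m + 1)) → ℂ) : ℝ :=
  ‖W none‖ ^ 2 + H * ∑ k, ‖W (some k)‖ ^ 2

lemma weightNorm_pos {H : ℝ} (hH : 0 < H) {W : Option (Fin (m + 1)) → ℂ} (hW : W ≠ 0) :
    0 < weightNorm H W := by
  obtain ⟨o, ho⟩ := Function.ne_iff.1 hW
  have h0 : 0 ≤ ∑ k, ‖W (some k)‖ ^ 2 := Finset.sum_nonneg fun k _ => by positivity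
  rcases o with _ | k
  · have : 0 < ‖W none‖ ^ 2 := by have := norm_pos_iff.2 ho; positivity
    exact add_pos_of_pos_of_nonneg this (mul_nonneg hH.le h0)
  · have h1 : 0 < ‖W (some k)‖ ^ 2 := by have := norm_pos_iff.2 ho; positivity
    have h2 : 0 < ∑ k, ‖W (some k)‖ ^ 2 :=
      Finset.sum_pos' (fun k _ => by positivity) ⟨k, Finset.mem_univ _, h1⟩
    exact add_pos_of_nonneg_of_pos (by positivity) (mul_pos hH h2)

lemma weightNorm_smul (H : ℝ) (r : ℂ) (W : Option (Fin (m + 1)) → ℂ) :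
    weightNorm H (r • W) = ‖r‖ ^ 2 * weightNorm H W := by
  simp only [weightNorm, Pi.smul_apply, smul_eq_mul, norm_mul, mul_pow, ← Finset.mul_sum]
  ring

variable (h : HermitianMetric (ι := Fin n) L)

/-- The Hermitian norm on the fibres of `𝒪 ⊕ L^{⊕(m+1)}`. -/
def fibreNorm {x : M} (v : ℂ × (Fin (m + 1) → L x)) : ℝ :=
  ‖v.1‖ ^ 2 + ∑ k, h.normSq x (v.2 k)

lemma sum_normSq_eq {x₀ x : M} (hx : x ∈ (trivializationAt ℂ L x₀).baseSet)
    (v : Fin (m + 1) → L x) :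
    ∑ k, h.normSq x (v k) = h.frameNorm x₀ x * ∑ k, ‖coord x₀ x (v k)‖ ^ 2 := by
  rw [Finset.mul_sum]
  refine Finset.sum_congr rfl fun k _ => ?_
  conv_lhs => rw [← coord_smul_frame hx (v k), h.normSq_smul]
  rw [HermitianMetric.frameNorm, mul_comm]

lemma fibreNorm_eq {x₀ x : M} (hx : x ∈ (trivializationAt ℂ L x₀).baseSet)
    (v : ℂ × (Fin (m + 1) → L x)) :
    fibreNorm h v = weightNorm (h.frameNorm x₀ x) (hom x₀ x v) := by
  rw [fibreNorm, sum_normSq_eq h hx]; rfl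

/-- The squared norm of the frame near `x₀`, in coordinates. -/
def chartNorm (x₀ : M) (z : Fin n → ℂ) : ℝ :=
  h.frameNorm x₀ ((chartAt (Fin n → ℂ) x₀).symm z)

lemma chartNorm_pos [IsManifold 𝓘(ℂ, Fin n → ℂ) ω M] {x₀ : M} {z : Fin n → ℂ} (hz : z ∈ baseDomain L x₀) :
    0 < chartNorm h x₀ z := h.frameNorm_pos hz.2

section Smooth

variable [IsManifold 𝓘(ℂ, Fin n → ℂ) ω M]

lemma contDiffAt_chartNorm {x₀ : M} {z : Fin n → ℂ} (hz : z ∈ baseDomain L x₀) :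
    ContDiffAt ℝ ∞ (chartNorm h x₀) z :=
  SmoothAt.contDiffAt (chart_mem_atlas _ x₀) hz.1 (h.frameNorm_smooth hz.2)

lemma contDiffAt_chartNorm_inl {x₀ : M} {u : Fin n ⊕ Fin (m + 1) → ℂ}
    (hu : u ∘ Sum.inl ∈ baseDomain L x₀) :
    ContDiffAt ℝ ∞ (fun u : Fin n ⊕ Fin (m + 1) → ℂ => chartNorm h x₀ (u ∘ Sum.inl)) u :=
  ContDiffAt.comp (g := chartNorm h x₀) u (contDiffAt_chartNorm h hu)
    (((projInl n m).restrictScalars ℝ).contDiff.contDiffAt)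

end Smooth

lemma contDiffAt_norm_sq {ι : Type*} [Fintype ι] {F : (ι → ℂ) → ℂ} {u : ι → ℂ}
    (hF : ContDiffAt ℂ ω F u) : ContDiffAt ℝ ∞ (fun u => ‖F u‖ ^ 2) u :=
  ((hF.restrict_scalars ℝ).of_le le_top).norm_sq ℝ

lemma contDiffAt_weightNorm {H : (Fin n ⊕ Fin (m + 1) → ℂ) → ℝ}
    {W : (Fin n ⊕ Fin (m + 1) → ℂ) → Option (Fin (m + 1)) → ℂ} {u : Fin n ⊕ Fin (m + 1) → ℂ}
    (hH : ContDiffAt ℝ ∞ H u) (hW : ∀ o, ContDiffAt ℂ ω (fun u => W u o) u) :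
    ContDiffAt ℝ ∞ (fun u => weightNorm (H u) (W u)) u :=
  (contDiffAt_norm_sq (hW none)).add (hH.mul (ContDiffAt.sum fun k _ => contDiffAt_norm_sq (hW (some k))))

/-! #### The divisor at infinity -/

/-- The squared norm of the canonical section of `𝒪(D_∞)`. -/
def infinityNorm (p : ProjBundle n L m) : ℝ := ‖p.point.rep.1‖ ^ 2 / fibreNorm h p.point.rep

lemma mem_divisorAtInfinity {p : ProjBundle n L m} :
    p ∈ divisorAtInfinity n L m ↔ p.point.rep.1 = 0 := by
  constructor
  · intro hp
    refine hp _ ?_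
    rw [Projectivization.submodule_eq]
    exact Submodule.mem_span_singleton_self _
  · intro hp w hw
    rw [Projectivization.submodule_eq] at hw
    obtain ⟨r, rfl⟩ := Submodule.mem_span_singleton.1 hw
    simp [hp]

lemma mem_zeroSection {p : ProjBundle n L m} :
    p ∈ zeroSection n L m ↔ p.point.rep.2 = 0 := by
  constructor
  · intro hp
    refine hp _ ?_
    rw [Projectivization.submodule_eq]
    exact Submodule.mem_span_singleton_self _
  · intro hp w hw
    rw [Projectivization.submodule_eq] at hw
    obtain ⟨r, rfl⟩ := Submodule.mem_span_singleton.1 hw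
    simp [hp]

/-- The potential of the Chern form of `𝒪(D_∞)`, in coordinates. -/
def infinityPotential (x₀ : M) (i : Option (Fin (m + 1))) (u : Fin n ⊕ Fin (m + 1) → ℂ) : ℝ :=
  Real.log (weightNorm (chartNorm h x₀ (u ∘ Sum.inl)) (homogenize i (u ∘ Sum.inr)))

lemma chartNorm_projHomeo {x₀ : M} {i : Option (Fin (m + 1))} {p : ProjBundle n L m}
    (hp : p ∈ (projHomeo x₀ i).source) :
    chartNorm h x₀ (projHomeo x₀ i p ∘ Sum.inl) = h.frameNorm x₀ p.base := by
  rw [chartNorm, projHomeo_inl, (chartAt (Fin n → ℂ) x₀).left_inv (mem_projHomeo_source.1 hp).1.1]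

variable [IsManifold 𝓘(ℂ, Fin n → ℂ) ω M] [ContMDiffVectorBundle ω ℂ L 𝓘(ℂ, Fin n → ℂ)]

lemma isNormSqAt_infinity (x₀ : M) (i : Option (Fin (m + 1))) {p : ProjBundle n L m}
    (hp : p ∈ (projHomeo x₀ i).source) :
    IsNormSqAt (ι := Fin n ⊕ Fin (m + 1)) (divisorAtInfinity n L m) (infinityNorm h) p
      (projHomeo x₀ i).source (fun y => homogenize i (projHomeo x₀ i y ∘ Sum.inr) none)
      fun y => infinityPotential h x₀ i (projHomeo x₀ i y) := by
  have hpos : ∀ u ∈ (projHomeo (n := n) (L := L) x₀ i).target,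
      0 < weightNorm (chartNorm h x₀ (u ∘ Sum.inl)) (homogenize i (u ∘ Sum.inr)) := fun u hu =>
    weightNorm_pos (chartNorm_pos h hu) (homogenize_ne_zero _ _)
  refine isNormSqAt_of_chart (projHomeo_mem_atlas x₀ i) hp
    (F := fun u => homogenize i (u ∘ Sum.inr) none) (Φ := infinityPotential h x₀ i)
    (fun u _ => contDiffAt_homogenize i none u) (fun u hu => ?_) (fun y hy => ?_) (fun u _ h0 => ?_)
    fun y hy => ?_
  · exact (contDiffAt_weightNorm (contDiffAt_chartNorm_inl h hu)
      fun o => contDiffAt_homogenize i o u).log (hpos u hu).ne'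
  · have h1 := congrFun (hom_eq_homogenize hy) none
    rw [mem_divisorAtInfinity]
    change y.point.rep.1 = _ at h1
    rw [h1, Pi.smul_apply, smul_eq_mul, mul_eq_zero, or_iff_right (mem_projHomeo_source.1 hy).2]
  · rcases i with _ | k
    · exact absurd (homogenize_self (none : Option (Fin (m + 1))) (u ∘ Sum.inr)) (by
        rw [h0]; exact zero_ne_one)
    · have : (fun u : Fin n ⊕ Fin (m + 1) → ℂ => homogenize (some k) (u ∘ Sum.inr) none) =
          fun u => u (Sum.inr k) := by
        ext u; simp [homogenize]
      rw [this]
      exact fderiv_coordinate_ne_zero _ _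
  · have h1 := hom_eq_homogenize hy
    have hr := (mem_projHomeo_source.1 hy).2
    have h2 : y.point.rep.1 = hom x₀ y.base y.point.rep none := rfl
    have h3 := hpos _ ((projHomeo x₀ i).map_source hy)
    rw [infinityPotential, Real.exp_neg, Real.exp_log h3, infinityNorm, h2,
      fibreNorm_eq h (mem_projHomeo_source.1 hy).1.2, h1, weightNorm_smul, Pi.smul_apply,
      smul_eq_mul, norm_mul, mul_pow, ← chartNorm_projHomeo h hy,
      mul_div_mul_left _ _ (by positivity), div_eq_mul_inv]

theorem exists_infinityForm : ∃ θ : RealForm (Fin n ⊕ Fin (m + 1)) (ProjBundle n L m) 2,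
    divisorClass (divisorAtInfinity n L m) = deRhamClass θ ∧
    ∀ x₀ i, ∀ p ∈ (projHomeo x₀ i).source,
      HasPotential θ p fun y => infinityPotential h x₀ i (projHomeo x₀ i y) := by
  obtain ⟨θ, h1, h2⟩ := exists_divisorClass_eq (ι := Fin n ⊕ Fin (m + 1))
    (D := divisorAtInfinity n L m) (σ := infinityNorm h) fun p => by
      obtain ⟨i, hi, -⟩ := exists_mem_projHomeo_source p (mem_coordSet p.base)
      refine ⟨_, _, _, isNormSqAt_infinity h p.base i hi, fun hp =>
        ⟨_, projHomeo_mem_atlas p.base i, hi, ?_⟩⟩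
      rcases i with _ | k
      · exact absurd (mem_divisorAtInfinity.1 hp) (mem_projHomeo_source.1 hi).2
      · exact ⟨Sum.inr k, .of_forall fun q => by simp [homogenize]⟩
  exact ⟨θ, h1, fun x₀ i p hp => h2 _ _ _ _ (isNormSqAt_infinity h x₀ i hp)⟩

/-! #### The exceptional divisor -/

/-- The squared norm of the canonical section of `𝒪(E)`. -/
def exceptionalNorm (q : BlowUp n L m) : ℝ :=
  (∑ k, h.normSq q.base (q.point.rep.2 k)) / fibreNorm h q.point.rep

/-- The squared norm of the coordinates of the line, in the chart with index `i`. -/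
def lineNorm (i : Fin (m + 1)) (w : Fin (m + 1) → ℂ) : ℝ := ∑ k, ‖blowLine i w k‖ ^ 2

lemma lineNorm_pos (i : Fin (m + 1)) (w : Fin (m + 1) → ℂ) : 0 < lineNorm i w :=
  sum_norm_sq_pos (o := i) (by simp [blowLine_self])

lemma contDiffAt_lineNorm (i : Fin (m + 1)) (u : Fin n ⊕ Fin (m + 1) → ℂ) :
    ContDiffAt ℝ ∞ (fun u : Fin n ⊕ Fin (m + 1) → ℂ => lineNorm i (u ∘ Sum.inr)) u :=
  ContDiffAt.sum fun k _ => contDiffAt_norm_sq (contDiffAt_blowLine i k u)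

/-- The potential of the Chern form of `𝒪(E)`, in coordinates. -/
def exceptionalPotential (x₀ : M) (i : Fin (m + 1)) (b : Bool) (u : Fin n ⊕ Fin (m + 1) → ℂ) : ℝ :=
  Real.log (weightNorm (chartNorm h x₀ (u ∘ Sum.inl)) (blowPoint i b (u ∘ Sum.inr))) -
    Real.log (chartNorm h x₀ (u ∘ Sum.inl) * lineNorm i (u ∘ Sum.inr))

lemma chartNorm_blowHomeo {x₀ : M} {i : Fin (m + 1)} {b : Bool} {q : BlowUp n L m}
    (hq : q ∈ (blowHomeo x₀ i b).source) :
    chartNorm h x₀ (blowHomeo x₀ i b q ∘ Sum.inl) = h.frameNorm x₀ q.base := by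
  rw [chartNorm, blowHomeo_inl, (chartAt (Fin n → ℂ) x₀).left_inv (mem_blowHomeo_source.1 hq).1.1]

lemma sum_blowPoint (i : Fin (m + 1)) (b : Bool) (w : Fin (m + 1) → ℂ) :
    ∑ k, ‖blowPoint i b w (some k)‖ ^ 2 = ‖bif b then 1 else w i‖ ^ 2 * lineNorm i w := by
  rw [lineNorm, Finset.mul_sum]
  refine Finset.sum_congr rfl fun k _ => ?_
  rw [← mul_pow, ← norm_mul]; rfl

lemma mem_exceptionalDivisor {x₀ : M} {i : Fin (m + 1)} {b : Bool} {q : BlowUp n L m}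
    (hq : q ∈ (blowHomeo x₀ i b).source) :
    q ∈ exceptionalDivisor n L m ↔ (bif b then 1 else blowHomeo x₀ i b q (Sum.inr i)) = 0 := by
  have h1 := hom_eq_blowPoint hq
  have h2 := mem_blowHomeo_source.1 hq
  change blowDown q ∈ zeroSection n L m ↔ _
  rw [mem_zeroSection]
  change q.point.rep.2 = 0 ↔ _
  have h3 : q.point.rep.2 = 0 ↔ ∀ k, hom x₀ q.base q.point.rep (some k) = 0 := by
    constructor
    · intro h k; simp [hom, h]
    · intro h
      have := unhom_hom h2.1.2 q.point.rep
      rw [← this]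
      ext k
      simp [unhom, h]
  have h4 : ∀ k, hom x₀ q.base q.point.rep (some k) = (bif b then hom x₀ q.base q.point.rep (some i)
      else hom x₀ q.base q.point.rep none) * ((bif b then 1 else blowHomeo x₀ i b q (Sum.inr i)) *
        blowLine i (blowHomeo x₀ i b q ∘ Sum.inr) k) := fun k => congrFun h1 (some k)
  have h5 : (bif b then hom x₀ q.base q.point.rep (some i)
      else hom x₀ q.base q.point.rep none) ≠ 0 := by cases b <;> exact h2.2.1
  rw [h3]
  constructor
  · intro h
    have := h i
    rw [h4, mul_eq_zero, or_iff_right h5, blowLine_self, mul_one] at this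
    exact this
  · intro h k
    rw [h4, h, zero_mul, mul_zero]

lemma isNormSqAt_exceptional (x₀ : M) (i : Fin (m + 1)) (b : Bool) {q : BlowUp n L m}
    (hq : q ∈ (blowHomeo x₀ i b).source) :
    IsNormSqAt (ι := Fin n ⊕ Fin (m + 1)) (exceptionalDivisor n L m) (exceptionalNorm h) q
      (blowHomeo x₀ i b).source (fun y => bif b then 1 else blowHomeo x₀ i b y (Sum.inr i))
      fun y => exceptionalPotential h x₀ i b (blowHomeo x₀ i b y) := by
  have hpos : ∀ u ∈ (blowHomeo (n := n) (L := L) x₀ i b).target,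
      0 < weightNorm (chartNorm h x₀ (u ∘ Sum.inl)) (blowPoint i b (u ∘ Sum.inr)) := fun u hu =>
    weightNorm_pos (chartNorm_pos h hu) (blowPoint_ne_zero _ _ _)
  refine isNormSqAt_of_chart (blowHomeo_mem_atlas x₀ i b) hq
    (F := fun u => bif b then 1 else u (Sum.inr i)) (Φ := exceptionalPotential h x₀ i b)
    (fun u _ => ?_) (fun u hu => ?_) (fun y hy => (mem_exceptionalDivisor hy).symm)
    (fun u _ h0 => ?_) fun y hy => ?_
  · cases b
    · exact contDiffAt_coordinate _ _
    · exact contDiffAt_const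
  · exact ((contDiffAt_weightNorm (contDiffAt_chartNorm_inl h hu)
      fun o => contDiffAt_blowPoint i b o u).log (hpos u hu).ne').sub
      (((contDiffAt_chartNorm_inl h hu).mul (contDiffAt_lineNorm i u)).log
        (mul_pos (chartNorm_pos h hu) (lineNorm_pos i _)).ne')
  · cases b
    · exact fderiv_coordinate_ne_zero _ _
    · exact absurd h0 one_ne_zero
  · have h1 := hom_eq_blowPoint hy
    have hm := mem_blowHomeo_source.1 hy
    have hu := (blowHomeo x₀ i b).map_source hy
    have h3 := hpos _ hu
    have h5 : (bif b then hom x₀ y.base y.point.rep (some i)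
      else hom x₀ y.base y.point.rep none) ≠ 0 := by cases b <;> exact hm.2.1
    have h6 := chartNorm_pos h hu
    have h7 := lineNorm_pos i (blowHomeo x₀ i b y ∘ Sum.inr)
    have h8 : ∑ k, h.normSq y.base (y.point.rep.2 k) = ‖bif b then hom x₀ y.base y.point.rep (some i)
        else hom x₀ y.base y.point.rep none‖ ^ 2 * (chartNorm h x₀ (blowHomeo x₀ i b y ∘ Sum.inl) *
        (‖bif b then 1 else blowHomeo x₀ i b y (Sum.inr i)‖ ^ 2 *
          lineNorm i (blowHomeo x₀ i b y ∘ Sum.inr))) := by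
      rw [sum_normSq_eq h hm.1.2, chartNorm_blowHomeo h hy]
      have : ∑ k, ‖coord x₀ y.base (y.point.rep.2 k)‖ ^ 2 =
          ∑ k, ‖hom x₀ y.base y.point.rep (some k)‖ ^ 2 := rfl
      have h9 := sum_blowPoint i b (blowHomeo x₀ i b y ∘ Sum.inr)
      rw [Function.comp_apply] at h9
      rw [this, ← h9, mul_left_comm]
      refine congrArg _ ?_
      rw [Finset.mul_sum]
      refine (Finset.sum_congr rfl fun k _ => ?_)
      rw [← mul_pow, ← norm_mul]
      exact congrArg (fun z : ℂ => ‖z‖ ^ 2) (congrFun h1 (some k))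
    rw [exceptionalPotential, neg_sub, Real.exp_sub, Real.exp_log h3, Real.exp_log (mul_pos h6 h7),
      exceptionalNorm, fibreNorm_eq h hm.1.2, h8, h1, weightNorm_smul, ← h1,
      ← chartNorm_blowHomeo h hy, mul_div_mul_left _ _ (by positivity)]
    ring

theorem exists_exceptionalForm : ∃ θ : RealForm (Fin n ⊕ Fin (m + 1)) (BlowUp n L m) 2,
    divisorClass (exceptionalDivisor n L m) = deRhamClass θ ∧
    ∀ x₀ i b, ∀ q ∈ (blowHomeo x₀ i b).source,
      HasPotential θ q fun y => exceptionalPotential h x₀ i b (blowHomeo x₀ i b y) := by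
  obtain ⟨θ, h1, h2⟩ := exists_divisorClass_eq (ι := Fin n ⊕ Fin (m + 1))
    (D := exceptionalDivisor n L m) (σ := exceptionalNorm h) fun q => by
      obtain ⟨i, b, hi, -⟩ := exists_mem_blowHomeo_source q (mem_coordSet q.base)
      refine ⟨_, _, _, isNormSqAt_exceptional h q.base i b hi, fun hq =>
        ⟨_, blowHomeo_mem_atlas q.base i b, hi, ?_⟩⟩
      cases b
      · exact ⟨Sum.inr i, .of_forall fun q => rfl⟩
      · exact absurd ((mem_exceptionalDivisor hi).1 hq) one_ne_zero
  exact ⟨θ, h1, fun x₀ i b q hq => h2 _ _ _ _ (isNormSqAt_exceptional h x₀ i b hq)⟩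

/-! #### Reference forms -/

/-- The potential of the reference form in the class `p π̃^*π^*[ω] + c π̃^*[D_∞] - s [E]`. -/
def refPotential (x₀ : M) (i : Fin (m + 1)) (b : Bool) (p c s : ℝ) (u : Fin n ⊕ Fin (m + 1) → ℂ) :
    ℝ :=
  p * Real.log (chartNorm h x₀ (u ∘ Sum.inl)) +
    c * Real.log (weightNorm (chartNorm h x₀ (u ∘ Sum.inl)) (blowPoint i b (u ∘ Sum.inr))) +
    (-s) * exceptionalPotential h x₀ i b u

lemma infinityPotential_blowDownCoord (x₀ : M) (i : Fin (m + 1)) (b : Bool)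
    (u : Fin n ⊕ Fin (m + 1) → ℂ) :
    infinityPotential h x₀ (bif b then some i else none) (blowDownCoord n i b u) =
      Real.log (weightNorm (chartNorm h x₀ (u ∘ Sum.inl)) (blowPoint i b (u ∘ Sum.inr))) := by
  rw [infinityPotential, blowDownCoord, Sum.elim_comp_inl, Sum.elim_comp_inr,
    homogenize_affine _ (by rw [blowPoint_self]; exact one_ne_zero), blowPoint_self, inv_one,
    one_smul]

/-- The class `p π̃^*π^*Θ + c π̃^*[D_∞] - s [E]`. -/
def refClass (n : ℕ) {M : Type*} [TopologicalSpace M] [ChartedSpace (Fin n → ℂ) M]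
    (L : M → Type*) [∀ x, AddCommGroup (L x)] [∀ x, Module ℂ (L x)]
    [∀ x, TopologicalSpace (L x)] [TopologicalSpace (TotalSpace ℂ L)] [FiberBundle ℂ L]
    [VectorBundle ℂ ℂ L] (m : ℕ) (Θ : DeRham2 (Fin n) M) (p c s : ℝ) :
    DeRham2 (Fin n ⊕ Fin (m + 1)) (BlowUp n L m) :=
  twistedClass (p • pullbackClass ProjBundle.base Θ + c • divisorClass (divisorAtInfinity n L m)) s

theorem exists_refForm {θ : RealForm (Fin n) M 2} (hθ : ∀ x₀ x,
    x ∈ (trivializationAt ℂ L x₀).baseSet →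
      HasPotential θ x fun x => Real.log (h.frameNorm x₀ x)) (p c s : ℝ) :
    ∃ τ : RealForm (Fin n ⊕ Fin (m + 1)) (BlowUp n L m) 2, τ ∈ closedForms _ _ ∧
      refClass n L m (deRhamClass θ) p c s = deRhamClass τ ∧
      ∀ x₀ i b, ∀ q ∈ (blowHomeo x₀ i b).source,
        HasPotential τ q fun q => refPotential h x₀ i b p c s (blowHomeo x₀ i b q) := by
  obtain ⟨D, hD, hD'⟩ := exists_infinityForm (m := m) h
  obtain ⟨E, hE, hE'⟩ := exists_exceptionalForm (m := m) h
  have cθ : θ ∈ closedForms _ _ := closed_of_hasPotential fun x =>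
    ⟨_, hθ x x (mem_baseSet_trivializationAt ℂ L x)⟩
  have cD : D ∈ closedForms _ _ := closed_of_hasPotential fun q => by
    obtain ⟨i, hi, -⟩ := exists_mem_projHomeo_source q (mem_coordSet q.base)
    exact ⟨_, hD' _ _ _ hi⟩
  have cE : E ∈ closedForms _ _ := closed_of_hasPotential fun q => by
    obtain ⟨i, b, hi, -⟩ := exists_mem_blowHomeo_source q (mem_coordSet q.base)
    exact ⟨_, hE' _ _ _ _ hi⟩
  have sB : ContMDiff 𝓘(ℝ, Fin n ⊕ Fin (m + 1) → ℂ) 𝓘(ℝ, Fin n → ℂ) ∞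
      (ProjBundle.base : ProjBundle n L m → M) := fun q => ContMDiffAt.complex_to_real (contMDiff_proj_base q)
  have sD : ContMDiff 𝓘(ℝ, Fin n ⊕ Fin (m + 1) → ℂ) 𝓘(ℝ, Fin n ⊕ Fin (m + 1) → ℂ) ∞
      (blowDown : BlowUp n L m → ProjBundle n L m) := fun q => ContMDiffAt.complex_to_real (contMDiff_blowDown q)
  have c1 := pullbackForm_mem_closedForms sB cθ
  have c2 := (closedForms _ _).add_mem ((closedForms _ _).smul_mem p c1)
    ((closedForms _ _).smul_mem c cD)
  have c3 := pullbackForm_mem_closedForms sD c2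
  refine ⟨pullbackForm blowDown (p • pullbackForm ProjBundle.base θ + c • D) + (-s) • E,
    (closedForms _ _).add_mem c3 ((closedForms _ _).smul_mem _ cE), ?_, fun x₀ i b q hq => ?_⟩
  · rw [deRhamClass_add c3 ((closedForms _ _).smul_mem _ cE), deRhamClass_smul cE,
      ← pullbackClass_deRhamClass sD c2, deRhamClass_add ((closedForms _ _).smul_mem p c1)
      ((closedForms _ _).smul_mem c cD), deRhamClass_smul c1, deRhamClass_smul cD,
      ← pullbackClass_deRhamClass sB cθ, ← hD, ← hE, neg_smul, ← sub_eq_add_neg]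
    rfl
  · have hm := mem_blowHomeo_source.1 hq
    have h1 := ((hθ x₀ (blowDown q).base hm.1.2).pullback contMDiff_proj_base).const_mul p
    have h2 := (hD' x₀ _ _ (blowDown_mem_source hq)).const_mul c
    have h3 := ((h1.add h2).pullback contMDiff_blowDown).add ((hE' x₀ i b q hq).const_mul (-s))
    refine h3.congr ?_
    filter_upwards [(blowHomeo x₀ i b).open_source.mem_nhds hq] with y hy
    simp only [Function.comp_apply, refPotential]
    rw [projHomeo_blowDown hy, infinityPotential_blowDownCoord, chartNorm_blowHomeo h hy]
    rfl

end

end KahlerProj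

namespace KahlerProj

noncomputable section

/-! ### The reference forms in coordinates -/

lemma HasJet.del_eq {ι : Type*} [Fintype ι] {φ : (ι → ℂ) → ℝ} {u v : ι → ℂ} {δ : ℂ} {l : ℝ}
    (h : HasJet φ u v δ l) : del φ u v = δ := by
  change ((fderiv ℝ φ u v : ℂ) - Complex.I * (fderiv ℝ φ u (Complex.I • v) : ℝ)) / 2 = δ
  rw [h.fst, h.fst_I]
  apply Complex.ext <;> simp

section Line

variable {n m : ℕ}

/-- The variation of the coordinates of the line. -/
def lineVec (i : Fin (m + 1)) (v : Fin (m + 1) → ℂ) : Fin (m + 1) → ℂ := Function.update v i 0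

/-- The Levi form of `log Λ`, the Fubini–Study form. -/
def fubiniStudy (i : Fin (m + 1)) (w v : Fin (m + 1) → ℂ) : ℝ :=
  (lineNorm i w)⁻¹ * ∑ k, ‖lineVec i v k‖ ^ 2 -
    (lineNorm i w ^ 2)⁻¹ * ‖∑ k, (starRingEnd ℂ) (blowLine i w k) * lineVec i v k‖ ^ 2

lemma hasJet_log_lineNorm (i : Fin (m + 1)) (u v : Fin n ⊕ Fin (m + 1) → ℂ) :
    HasJet (fun u : Fin n ⊕ Fin (m + 1) → ℂ => Real.log (lineNorm i (u ∘ Sum.inr))) u v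
      ((lineNorm i (u ∘ Sum.inr) : ℂ)⁻¹ *
        ∑ k, (starRingEnd ℂ) (blowLine i (u ∘ Sum.inr) k) * lineVec i (v ∘ Sum.inr) k)
      (fubiniStudy i (u ∘ Sum.inr) (v ∘ Sum.inr)) := by
  have h : HasJet (fun u : Fin n ⊕ Fin (m + 1) → ℂ => lineNorm i (u ∘ Sum.inr)) u v
      (∑ k, (starRingEnd ℂ) (blowLine i (u ∘ Sum.inr) k) * lineVec i (v ∘ Sum.inr) k)
      (∑ k, ‖lineVec i (v ∘ Sum.inr) k‖ ^ 2) := by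
    refine HasJet.sum fun k _ => ?_
    by_cases hk : k = i
    · subst hk
      simp only [blowLine, lineVec, Function.update_self]
      exact (HasJet.const _).of_eq (by simp) (by simp)
    · simp only [blowLine, lineVec, Function.update_of_ne hk]
      exact HasJet.norm_sq_coord u v (Sum.inr k)
  exact h.log (lineNorm_pos _ _).ne'

lemma norm_sum_blowLine_le (i : Fin (m + 1)) (w v : Fin (m + 1) → ℂ) :
    ‖∑ k, (starRingEnd ℂ) (blowLine i w k) * lineVec i v k‖ ^ 2 ≤
      (lineNorm i w - 1) * ∑ k, ‖lineVec i v k‖ ^ 2 := by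
  have h1 : ∑ k, (starRingEnd ℂ) (blowLine i w k) * lineVec i v k =
      ∑ k ∈ Finset.univ.erase i, (starRingEnd ℂ) (blowLine i w k) * lineVec i v k := by
    rw [← Finset.add_sum_erase _ _ (Finset.mem_univ i)]
    simp [lineVec]
  have h2 : lineNorm i w - 1 = ∑ k ∈ Finset.univ.erase i, ‖blowLine i w k‖ ^ 2 := by
    rw [lineNorm, ← Finset.add_sum_erase _ _ (Finset.mem_univ i), blowLine_self]
    simp
  have h3 : ∑ k ∈ Finset.univ.erase i, ‖lineVec i v k‖ ^ 2 = ∑ k, ‖lineVec i v k‖ ^ 2 := by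
    rw [← Finset.add_sum_erase _ _ (Finset.mem_univ i)]
    simp [lineVec]
  rw [h1, h2, ← h3]
  calc _ ≤ (∑ k ∈ Finset.univ.erase i, ‖blowLine i w k‖ * ‖lineVec i v k‖) ^ 2 := by
        refine pow_le_pow_left₀ (norm_nonneg _) ((norm_sum_le _ _).trans (le_of_eq ?_)) 2
        refine Finset.sum_congr rfl fun k _ => ?_
        rw [norm_mul, RCLike.norm_conj]
    _ ≤ _ := Finset.sum_mul_sq_le_sq_mul_sq _ _ _

lemma fubiniStudy_ge (i : Fin (m + 1)) (w v : Fin (m + 1) → ℂ) :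
    (lineNorm i w ^ 2)⁻¹ * ∑ k, ‖lineVec i v k‖ ^ 2 ≤ fubiniStudy i w v := by
  have h0 := lineNorm_pos i w
  have h1 := mul_le_mul_of_nonneg_left (norm_sum_blowLine_le i w v)
    (inv_nonneg.2 (sq_nonneg (lineNorm i w)))
  have h2 : (lineNorm i w)⁻¹ = (lineNorm i w ^ 2)⁻¹ * lineNorm i w := by field_simp
  rw [fubiniStudy, h2]
  linarith

lemma fubiniStudy_nonneg (i : Fin (m + 1)) (w v : Fin (m + 1) → ℂ) : 0 ≤ fubiniStudy i w v :=
  le_trans (mul_nonneg (by positivity) (Finset.sum_nonneg fun _ _ => by positivity))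
    (fubiniStudy_ge i w v)

lemma fubiniStudy_pos (i : Fin (m + 1)) (w : Fin (m + 1) → ℂ) {v : Fin (m + 1) → ℂ}
    (hv : lineVec i v ≠ 0) : 0 < fubiniStudy i w v := by
  obtain ⟨k, hk⟩ := Function.ne_iff.1 hv
  have h0 := lineNorm_pos i w
  refine lt_of_lt_of_le (mul_pos (by positivity) ?_) (fubiniStudy_ge i w v)
  refine Finset.sum_pos' (fun _ _ => by positivity) ⟨k, Finset.mem_univ _, ?_⟩
  have := norm_pos_iff.2 hk
  positivity

end Line

variable {n m : ℕ} {M : Type*} [TopologicalSpace M] [ChartedSpace (Fin n → ℂ) M]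
  [IsManifold 𝓘(ℂ, Fin n → ℂ) ω M]
  {L : M → Type*} [∀ x, AddCommGroup (L x)] [∀ x, Module ℂ (L x)]
  [∀ x, TopologicalSpace (L x)] [TopologicalSpace (TotalSpace ℂ L)] [FiberBundle ℂ L]
  [VectorBundle ℂ ℂ L] (h : HermitianMetric (ι := Fin n) L)

/-- The logarithm of the squared norm of the frame of the tautological line. -/
def logFrame (x₀ : M) (i : Fin (m + 1)) (u : Fin n ⊕ Fin (m + 1) → ℂ) : ℝ :=
  Real.log (chartNorm h x₀ (u ∘ Sum.inl)) + Real.log (lineNorm i (u ∘ Sum.inr))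

/-- The sign of the fibre coordinate in the charts of the blow-up. -/
def fibreSign (b : Bool) : ℝ := bif b then -1 else 1

variable {x₀ : M} {i : Fin (m + 1)} {b : Bool} {u : Fin n ⊕ Fin (m + 1) → ℂ}

lemma exp_logFrame (hu : u ∘ Sum.inl ∈ baseDomain L x₀) :
    Real.exp (logFrame h x₀ i u) =
      chartNorm h x₀ (u ∘ Sum.inl) * lineNorm i (u ∘ Sum.inr) := by
  rw [logFrame, Real.exp_add, Real.exp_log (chartNorm_pos h hu), Real.exp_log (lineNorm_pos _ _)]

lemma refPotential_eq (hu : u ∘ Sum.inl ∈ baseDomain L x₀) (p c s : ℝ) :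
    refPotential h x₀ i b p c s u = p * Real.log (chartNorm h x₀ (u ∘ Sum.inl)) +
      (bif b then c else s) * logFrame h x₀ i u + (c - s) *
        Real.log (1 + ‖u (Sum.inr i)‖ ^ 2 * Real.exp (fibreSign b * logFrame h x₀ i u)) := by
  have h1 := exp_logFrame (i := i) h hu
  have h2 : Real.log (chartNorm h x₀ (u ∘ Sum.inl) * lineNorm i (u ∘ Sum.inr)) =
      logFrame h x₀ i u := by rw [← h1, Real.log_exp]
  have h3 : weightNorm (chartNorm h x₀ (u ∘ Sum.inl)) (blowPoint i b (u ∘ Sum.inr)) =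
      ‖bif b then u (Sum.inr i) else 1‖ ^ 2 + ‖bif b then 1 else u (Sum.inr i)‖ ^ 2 *
        Real.exp (logFrame h x₀ i u) := by
    rw [weightNorm, sum_blowPoint, h1]
    rw [mul_left_comm]; rfl
  rw [refPotential, exceptionalPotential, h2, h3]
  cases b
  · simp only [cond_false, norm_one, one_pow, fibreSign, one_mul]
    ring
  · simp only [cond_true, norm_one, one_pow, fibreSign, one_mul, neg_mul]
    have h4 : ‖u (Sum.inr i)‖ ^ 2 + Real.exp (logFrame h x₀ i u) = Real.exp (logFrame h x₀ i u) *
        (1 + ‖u (Sum.inr i)‖ ^ 2 * Real.exp (-logFrame h x₀ i u)) := by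
      have : Real.exp (logFrame h x₀ i u) * Real.exp (-logFrame h x₀ i u) = 1 := by
        rw [← Real.exp_add, add_neg_cancel, Real.exp_zero]
      linear_combination (-‖u (Sum.inr i)‖ ^ 2) * this
    rw [h4, Real.log_mul (Real.exp_pos _).ne' (by positivity), Real.log_exp]
    ring

lemma hasJet_log_chartNorm (hu : u ∘ Sum.inl ∈ baseDomain L x₀) (v : Fin n ⊕ Fin (m + 1) → ℂ) :
    HasJet (fun u : Fin n ⊕ Fin (m + 1) → ℂ => Real.log (chartNorm h x₀ (u ∘ Sum.inl))) u v
      (del (fun z => Real.log (chartNorm h x₀ z)) (u ∘ Sum.inl) (v ∘ Sum.inl))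
      (Real.pi * ddc (fun z => Real.log (chartNorm h x₀ z)) (u ∘ Sum.inl)
        ![v ∘ Sum.inl, Complex.I • (v ∘ Sum.inl)]) :=
  HasJet.comp_linear (T := projInl n m) (hasJet_del
    ((contDiffAt_chartNorm h hu).log (chartNorm_pos h hu).ne') (v ∘ Sum.inl))

/-- The Levi form of `logFrame`. -/
def leviBase (x₀ : M) (z v : Fin n → ℂ) : ℝ :=
  Real.pi * ddc (fun z => Real.log (chartNorm h x₀ z)) z ![v, Complex.I • v]

lemma hasJet_logFrame (hu : u ∘ Sum.inl ∈ baseDomain L x₀) (v : Fin n ⊕ Fin (m + 1) → ℂ) :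
    HasJet (logFrame h x₀ i) u v (del (logFrame h x₀ i) u v)
      (leviBase h x₀ (u ∘ Sum.inl) (v ∘ Sum.inl) +
        fubiniStudy i (u ∘ Sum.inr) (v ∘ Sum.inr)) := by
  have h1 := (hasJet_log_chartNorm h hu v).add (hasJet_log_lineNorm i u v)
  exact h1.of_eq (HasJet.del_eq h1) rfl

lemma del_logFrame_single (hu : u ∘ Sum.inl ∈ baseDomain L x₀) :
    del (logFrame h x₀ i) u (Pi.single (Sum.inr i) 1) = 0 := by
  have h1 := (hasJet_log_chartNorm h hu (Pi.single (Sum.inr i) 1)).add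
    (hasJet_log_lineNorm i u (Pi.single (Sum.inr i) 1))
  rw [HasJet.del_eq (φ := logFrame h x₀ i) h1]
  have e1 : (Pi.single (Sum.inr i) 1 : Fin n ⊕ Fin (m + 1) → ℂ) ∘ Sum.inl = 0 := by
    ext j; simp
  have e2 : lineVec i ((Pi.single (Sum.inr i) 1 : Fin n ⊕ Fin (m + 1) → ℂ) ∘ Sum.inr) = 0 := by
    ext k
    by_cases hk : k = i
    · subst hk; simp [lineVec]
    · simp [lineVec, hk]
  simp [e1, e2]

/-- The moment map of the rotation of the fibres: `|w|² E / (1 + |w|² E)`. -/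
def fibreRatio (x₀ : M) (i : Fin (m + 1)) (b : Bool) (u : Fin n ⊕ Fin (m + 1) → ℂ) : ℝ :=
  ‖u (Sum.inr i)‖ ^ 2 * Real.exp (fibreSign b * logFrame h x₀ i u) /
    (1 + ‖u (Sum.inr i)‖ ^ 2 * Real.exp (fibreSign b * logFrame h x₀ i u))

lemma fibreRatio_mem (x₀ : M) (i : Fin (m + 1)) (b : Bool) (u : Fin n ⊕ Fin (m + 1) → ℂ) :
    fibreRatio h x₀ i b u ∈ Ico 0 1 := by
  have : 0 ≤ ‖u (Sum.inr i)‖ ^ 2 * Real.exp (fibreSign b * logFrame h x₀ i u) := by positivity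
  refine ⟨by rw [fibreRatio]; positivity, ?_⟩
  rw [fibreRatio, div_lt_one (by positivity)]
  linarith

/-- The Calabi momentum coordinate of the reference form. -/
def momentum (x₀ : M) (i : Fin (m + 1)) (b : Bool) (c s : ℝ) (u : Fin n ⊕ Fin (m + 1) → ℂ) : ℝ :=
  (bif b then c else s) + fibreSign b * (c - s) * fibreRatio h x₀ i b u

/-- The coefficient of the vertical part of the reference form. -/
def verticalCoeff (x₀ : M) (i : Fin (m + 1)) (b : Bool) (u : Fin n ⊕ Fin (m + 1) → ℂ) : ℝ :=
  Real.exp (fibreSign b * logFrame h x₀ i u) /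
    (1 + ‖u (Sum.inr i)‖ ^ 2 * Real.exp (fibreSign b * logFrame h x₀ i u)) ^ 2

lemma verticalCoeff_pos (x₀ : M) (i : Fin (m + 1)) (b : Bool) (u : Fin n ⊕ Fin (m + 1) → ℂ) :
    0 < verticalCoeff h x₀ i b u := by
  rw [verticalCoeff]; positivity

/-- The vertical part of a tangent vector. -/
def verticalPart (x₀ : M) (i : Fin (m + 1)) (b : Bool) (u v : Fin n ⊕ Fin (m + 1) → ℂ) : ℂ :=
  v (Sum.inr i) + u (Sum.inr i) * (fibreSign b * del (logFrame h x₀ i) u v)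

lemma hasJet_refPotential (hu : u ∘ Sum.inl ∈ baseDomain L x₀) (p c s : ℝ)
    (v : Fin n ⊕ Fin (m + 1) → ℂ) :
    ∃ δ, HasJet (refPotential h x₀ i b p c s) u v δ
      ((p + momentum h x₀ i b c s u) * leviBase h x₀ (u ∘ Sum.inl) (v ∘ Sum.inl) +
        momentum h x₀ i b c s u * fubiniStudy i (u ∘ Sum.inr) (v ∘ Sum.inr) +
        (c - s) * verticalCoeff h x₀ i b u * ‖verticalPart h x₀ i b u v‖ ^ 2) := by
  have h1 := hasJet_logFrame (i := i) h hu v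
  have h2 := HasJet.log_one_add (Sum.inr i) (h1.const_mul (fibreSign b))
  have h3 := (((hasJet_log_chartNorm h hu v).const_mul p).add
    (h1.const_mul (bif b then c else s))).add (h2.const_mul (c - s))
  refine ⟨_, (h3.congr ?_).of_eq rfl ?_⟩
  · have ho : IsOpen {u : Fin n ⊕ Fin (m + 1) → ℂ | u ∘ Sum.inl ∈ baseDomain L x₀} :=
      (isOpen_baseDomain (L := L) x₀).preimage (projInl n m).continuous
    filter_upwards [ho.mem_nhds hu] with u' hu'
    exact refPotential_eq h hu' p c s
  · rw [momentum, fibreRatio, verticalCoeff, verticalPart, leviBase]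
    ring

theorem refForm_quadratic [ContMDiffVectorBundle ω ℂ L 𝓘(ℂ, Fin n → ℂ)]
    {θ : RealForm (Fin n) M 2} (hθ : ∀ x₀ x,
    x ∈ (trivializationAt ℂ L x₀).baseSet →
      HasPotential θ x fun x => Real.log (h.frameNorm x₀ x))
    {p c s : ℝ} {τ : RealForm (Fin n ⊕ Fin (m + 1)) (BlowUp n L m) 2}
    (hτ : ∀ q ∈ (blowHomeo (L := L) x₀ i b).source,
        HasPotential τ q fun q => refPotential h x₀ i b p c s (blowHomeo x₀ i b q))
    (hu : u ∈ (blowHomeo (L := L) x₀ i b).target) (v : Fin n ⊕ Fin (m + 1) → ℂ) :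
    inChart τ (blowHomeo (L := L) x₀ i b) u ![v, Complex.I • v] =
      (p + momentum h x₀ i b c s u) * inChart θ (chartAt (Fin n → ℂ) x₀) (u ∘ Sum.inl)
        ![v ∘ Sum.inl, Complex.I • (v ∘ Sum.inl)] +
      (momentum h x₀ i b c s u * fubiniStudy i (u ∘ Sum.inr) (v ∘ Sum.inr) +
        (c - s) * verticalCoeff h x₀ i b u * ‖verticalPart h x₀ i b u v‖ ^ 2) / Real.pi := by
  have hz : u ∘ Sum.inl ∈ baseDomain L x₀ := hu
  have h1 := ((hτ _ ((blowHomeo (L := L) x₀ i b).map_target hu)).inChart (blowHomeo_mem_atlas x₀ i b)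
    ((blowHomeo (L := L) x₀ i b).map_target hu)).self_of_nhds
  rw [(blowHomeo (L := L) x₀ i b).right_inv hu] at h1
  have h2 := ((hθ x₀ _ hz.2).inChart (chart_mem_atlas _ x₀)
    ((chartAt _ x₀).map_target hz.1)).self_of_nhds
  rw [(chartAt _ x₀).right_inv hz.1] at h2
  have h3 : ((fun q => refPotential h x₀ i b p c s (blowHomeo x₀ i b q)) ∘
      (blowHomeo (L := L) x₀ i b).symm) =ᶠ[𝓝 u] refPotential h x₀ i b p c s := by
    filter_upwards [(blowHomeo (L := L) x₀ i b).open_target.mem_nhds hu] with u' hu'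
    simp [(blowHomeo (L := L) x₀ i b).right_inv hu']
  obtain ⟨δ, h4⟩ := hasJet_refPotential (i := i) (b := b) h hz p c s v
  rw [h1.2, ddc_congr h3, h4.ddc, h2.2]
  have h5 : ddc ((fun x => Real.log (h.frameNorm x₀ x)) ∘ (chartAt (Fin n → ℂ) x₀).symm)
      (u ∘ Sum.inl) ![v ∘ Sum.inl, Complex.I • (v ∘ Sum.inl)] =
      leviBase h x₀ (u ∘ Sum.inl) (v ∘ Sum.inl) / Real.pi := by
    rw [leviBase, mul_div_cancel_left₀ _ Real.pi_ne_zero]; rfl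
  rw [h5]
  ring

end

end KahlerProj

namespace KahlerProj

noncomputable section

/-! ### The volume density of the reference forms -/

section Hermitian

variable {ι : Type*} [Fintype ι] [DecidableEq ι]

/-- The Hermitian matrix of an invariant form. -/
def hermitianMatrix (θ : (ι → ℂ) [⋀^Fin 2]→L[ℝ] ℝ) : Matrix ι ι ℂ := fun j k =>
  (θ ![Pi.single j 1, Complex.I • Pi.single k 1] : ℂ) +
    (θ ![Pi.single j 1, Pi.single k 1] : ℂ) * Complex.I

variable {θ : (ι → ℂ) [⋀^Fin 2]→L[ℝ] ℝ}

lemma two_sum_left {α : Type*} (s : Finset α) (f : α → ι → ℂ) (w : ι → ℂ) :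
    θ ![∑ a ∈ s, f a, w] = ∑ a ∈ s, θ ![f a, w] := by
  classical
  induction s using Finset.induction_on with
  | empty =>
    have := two_smul_left θ 0 (0 : ι → ℂ) w
    simpa using this
  | insert a s ha ih => rw [Finset.sum_insert ha, Finset.sum_insert ha, two_add_left, ih]

lemma two_sum_right {α : Type*} (s : Finset α) (f : α → ι → ℂ) (w : ι → ℂ) :
    θ ![w, ∑ a ∈ s, f a] = ∑ a ∈ s, θ ![w, f a] := by
  rw [two_swap, two_sum_left, ← Finset.sum_neg_distrib]
  exact Finset.sum_congr rfl fun a _ => (two_swap _ _ _).symm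


lemma two_I_left (hJ : ∀ v w, θ ![Complex.I • v, Complex.I • w] = θ ![v, w])
    (v w : ι → ℂ) : θ ![Complex.I • v, w] = -θ ![v, Complex.I • w] := by
  have := hJ v (Complex.I • w)
  rw [I_smul_I_smul, two_neg_right] at this
  linarith

lemma hermitianMatrix_isHermitian (hJ : ∀ v w, θ ![Complex.I • v, Complex.I • w] = θ ![v, w]) :
    (hermitianMatrix θ).IsHermitian := by
  ext j k
  have h1 : θ ![Pi.single k 1, Complex.I • Pi.single j 1] =
      θ ![Pi.single j 1, Complex.I • Pi.single k 1] := by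
    rw [two_swap, two_I_left hJ, neg_neg]
  have h2 : θ ![Pi.single k 1, Pi.single j 1] = -θ ![Pi.single j 1, Pi.single k 1] := two_swap _ _ _
  simp [hermitianMatrix, h1, h2]

lemma hermitianMatrix_quadratic (hJ : ∀ v w, θ ![Complex.I • v, Complex.I • w] = θ ![v, w])
    (v : ι → ℂ) :
    θ ![v, Complex.I • v] = (star v ⬝ᵥ ((hermitianMatrix θ).mulVec v)).re := by
  have hv : v = ∑ j, ((v j).re • (Pi.single j 1 : ι → ℂ) +
      (v j).im • (Complex.I • (Pi.single j 1 : ι → ℂ))) := by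
    ext l
    simp only [Finset.sum_apply, Pi.add_apply, Pi.smul_apply, Pi.single_apply]
    rw [Finset.sum_eq_single l (fun b _ hb => by simp [hb.symm]) (by simp)]
    simp [Complex.re_add_im]
  have h1 : ∀ w, θ ![v, w] = ∑ j, ((v j).re * θ ![Pi.single j 1, w] -
      (v j).im * θ ![Pi.single j 1, Complex.I • w]) := by
    intro w
    conv_lhs => rw [hv]
    rw [two_sum_left]
    refine Finset.sum_congr rfl fun j _ => ?_
    rw [two_add_left, two_smul_left, two_smul_left, two_I_left hJ]
    ring
  have h2 : ∀ w, θ ![w, v] = ∑ k, ((v k).re * θ ![w, Pi.single k 1] +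
      (v k).im * θ ![w, Complex.I • Pi.single k 1]) := by
    intro w
    conv_lhs => rw [hv]
    rw [two_sum_right]
    refine Finset.sum_congr rfl fun j _ => ?_
    rw [two_add_right, two_smul_right, two_smul_right]
  have h3 : ∀ j, θ ![Pi.single j 1, Complex.I • v] = ∑ k, ((v k).re *
      θ ![Pi.single j 1, Complex.I • Pi.single k 1] -
      (v k).im * θ ![Pi.single j 1, Pi.single k 1]) := by
    intro j
    rw [← neg_neg (θ ![Pi.single j 1, Complex.I • v]), ← two_I_left hJ, h2,
      ← Finset.sum_neg_distrib]
    refine Finset.sum_congr rfl fun k _ => ?_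
    rw [two_I_left hJ, hJ]
    ring
  have h4 : ∀ j, θ ![Pi.single j 1, Complex.I • Complex.I • v] = -θ ![Pi.single j 1, v] := by
    intro j; rw [I_smul_I_smul, two_neg_right]
  rw [h1]
  simp only [dotProduct, Matrix.mulVec, Complex.re_sum]
  refine Finset.sum_congr rfl fun j _ => ?_
  rw [h3, h4, h2, Finset.mul_sum, Finset.mul_sum, mul_neg, sub_neg_eq_add, Finset.mul_sum,
    ← Finset.sum_add_distrib, Complex.re_sum]
  refine Finset.sum_congr rfl fun k _ => ?_
  simp [hermitianMatrix]
  ring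

lemma wedgeDensity_eq_det (hJ : ∀ v w, θ ![Complex.I • v, Complex.I • w] = θ ![v, w]) :
    wedgeDensity (fun _ : ι => θ) =
    (Fintype.card ι).factorial * (hermitianMatrix θ).det.re :=
  wedgeDensity_hermitian hJ (hermitianMatrix_isHermitian hJ) (hermitianMatrix_quadratic hJ)

end Hermitian

section Determinant

variable {n m : ℕ}

/-- The matrix of the Fubini–Study form at the point `z`. -/
def fubiniStudyMatrix (Λ : ℝ) (z : Fin m → ℂ) : Matrix (Fin m) (Fin m) ℂ :=
  (Λ : ℂ)⁻¹ • (1 - Matrix.vecMulVec ((Λ : ℂ)⁻¹ • z) (star z))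

lemma fubiniStudyMatrix_isHermitian (Λ : ℝ) (z : Fin m → ℂ) :
    (fubiniStudyMatrix Λ z).IsHermitian := by
  ext j k
  simp [fubiniStudyMatrix, Matrix.vecMulVec_apply, Matrix.one_apply, eq_comm]
  left
  ring

lemma fubiniStudyMatrix_det (z : Fin m → ℂ) :
    (fubiniStudyMatrix (1 + ∑ k, ‖z k‖ ^ 2) z).det =
      (((1 + ∑ k, ‖z k‖ ^ 2 : ℝ) : ℂ)⁻¹) ^ (m + 1) := by
  have h0 : 0 < 1 + ∑ k, ‖z k‖ ^ 2 := by positivity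
  have h1 : star z ⬝ᵥ z = ((∑ k, ‖z k‖ ^ 2 : ℝ) : ℂ) := by
    simp only [dotProduct, Pi.star_apply, Complex.ofReal_sum]
    refine Finset.sum_congr rfl fun k _ => ?_
    rw [Complex.star_def, Complex.conj_mul', Complex.ofReal_pow]
  rw [fubiniStudyMatrix, Matrix.det_smul, Fintype.card_fin, sub_eq_add_neg, ← Matrix.neg_vecMulVec,
    Matrix.vecMulVec_eq Unit, Matrix.det_one_add_replicateCol_mul_replicateRow, pow_succ]
  congr 1
  rw [dotProduct_neg, dotProduct_smul, h1, smul_eq_mul]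
  have : ((1 + ∑ k, ‖z k‖ ^ 2 : ℝ) : ℂ) ≠ 0 := by exact_mod_cast h0.ne'
  have e : ((∑ k, ‖z k‖ ^ 2 : ℝ) : ℂ) = ((1 + ∑ k, ‖z k‖ ^ 2 : ℝ) : ℂ) - 1 := by push_cast; ring
  rw [e]
  field_simp
  ring

lemma fubiniStudyMatrix_quadratic (Λ : ℝ) (z y : Fin m → ℂ) :
    (star y ⬝ᵥ (fubiniStudyMatrix Λ z).mulVec y).re =
      Λ⁻¹ * ∑ k, ‖y k‖ ^ 2 - (Λ ^ 2)⁻¹ * ‖∑ k, (starRingEnd ℂ) (z k) * y k‖ ^ 2 := by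
  have h1 : star y ⬝ᵥ y = ((∑ k, ‖y k‖ ^ 2 : ℝ) : ℂ) := by
    simp only [dotProduct, Pi.star_apply, Complex.ofReal_sum]
    refine Finset.sum_congr rfl fun k _ => ?_
    rw [Complex.star_def, Complex.conj_mul', Complex.ofReal_pow]
  have h2 : star y ⬝ᵥ z = (starRingEnd ℂ) (star z ⬝ᵥ y) := by
    simp [dotProduct, mul_comm]
  have h3 : star z ⬝ᵥ y = ∑ k, (starRingEnd ℂ) (z k) * y k := rfl
  rw [fubiniStudyMatrix, Matrix.smul_mulVec, Matrix.sub_mulVec, Matrix.one_mulVec,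
    Matrix.vecMulVec_mulVec, dotProduct_smul, dotProduct_sub, h1]
  simp only [op_smul_eq_smul, dotProduct_smul, smul_eq_mul, h2, h3]
  set a := ∑ k, (starRingEnd ℂ) (z k) * y k
  have h4 : (Λ : ℂ)⁻¹ * (((∑ k, ‖y k‖ ^ 2 : ℝ) : ℂ) - a * ((Λ : ℂ)⁻¹ * (starRingEnd ℂ) a)) =
      ((Λ⁻¹ * ∑ k, ‖y k‖ ^ 2 - (Λ ^ 2)⁻¹ * ‖a‖ ^ 2 : ℝ) : ℂ) := by
    have := Complex.mul_conj' a
    push_cast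
    rw [← this]
    ring
  rw [h4, Complex.ofReal_re]

/-- A block diagonal matrix with a first block of size one. -/
def consMatrix (κ : ℂ) (F : Matrix (Fin m) (Fin m) ℂ) : Matrix (Fin (m + 1)) (Fin (m + 1)) ℂ :=
  Fin.cons (Fin.cons κ 0) fun j => Fin.cons 0 (F j)

@[simp] lemma consMatrix_zero_zero (κ : ℂ) (F : Matrix (Fin m) (Fin m) ℂ) :
    consMatrix κ F 0 0 = κ := rfl

@[simp] lemma consMatrix_zero_succ (κ : ℂ) (F : Matrix (Fin m) (Fin m) ℂ) (k : Fin m) :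
    consMatrix κ F 0 k.succ = 0 := rfl

@[simp] lemma consMatrix_succ_zero (κ : ℂ) (F : Matrix (Fin m) (Fin m) ℂ) (k : Fin m) :
    consMatrix κ F k.succ 0 = 0 := rfl

@[simp] lemma consMatrix_succ_succ (κ : ℂ) (F : Matrix (Fin m) (Fin m) ℂ) (j k : Fin m) :
    consMatrix κ F j.succ k.succ = F j k := rfl

lemma consMatrix_det (κ : ℂ) (F : Matrix (Fin m) (Fin m) ℂ) :
    (consMatrix κ F).det = κ * F.det := by
  rw [Matrix.det_succ_row_zero, Fin.sum_univ_succ, Finset.sum_eq_zero, add_zero]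
  · have : (consMatrix κ F).submatrix Fin.succ (Fin.succAbove 0) = F := by
      ext j k; simp
    rw [this]
    simp
  · intro j _
    simp

lemma consMatrix_isHermitian (κ : ℝ) {F : Matrix (Fin m) (Fin m) ℂ} (hF : F.IsHermitian) :
    (consMatrix (κ : ℂ) F).IsHermitian := by
  ext j k
  refine Fin.cases ?_ (fun j => ?_) j <;> refine Fin.cases ?_ (fun k => ?_) k
  · simp
  · simp
  · simp
  · simpa using hF.apply j k

lemma consMatrix_quadratic (κ : ℝ) (F : Matrix (Fin m) (Fin m) ℂ) (y : Fin (m + 1) → ℂ) :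
    (star y ⬝ᵥ (consMatrix (κ : ℂ) F).mulVec y).re =
      κ * ‖y 0‖ ^ 2 + (star (Fin.tail y) ⬝ᵥ F.mulVec (Fin.tail y)).re := by
  have h1 : star (y 0) * (κ * y 0) = ((κ * ‖y 0‖ ^ 2 : ℝ) : ℂ) := by
    have := Complex.conj_mul' (y 0)
    push_cast
    rw [← this, Complex.star_def]
    ring
  have h2 : star y ⬝ᵥ (consMatrix (κ : ℂ) F).mulVec y =
      star (y 0) * (κ * y 0) + star (Fin.tail y) ⬝ᵥ F.mulVec (Fin.tail y) := by
    simp [dotProduct, Matrix.mulVec, Fin.sum_univ_succ, Fin.tail]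
  rw [h2, h1, Complex.add_re, Complex.ofReal_re]

lemma fubiniStudy_zero_eq (w y : Fin (m + 1) → ℂ) :
    fubiniStudy 0 w y = (lineNorm 0 w)⁻¹ * ∑ k : Fin m, ‖Fin.tail y k‖ ^ 2 -
      (lineNorm 0 w ^ 2)⁻¹ * ‖∑ k : Fin m, (starRingEnd ℂ) (Fin.tail w k) * Fin.tail y k‖ ^ 2 := by
  simp [fubiniStudy, Fin.sum_univ_succ, lineVec, blowLine, Fin.tail]

lemma lineNorm_zero_eq (w : Fin (m + 1) → ℂ) : lineNorm 0 w = 1 + ∑ k, ‖Fin.tail w k‖ ^ 2 := by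
  simp [lineNorm, Fin.sum_univ_succ, blowLine, Fin.tail]

theorem wedgeDensity_of_quadratic {θ : (Fin n ⊕ Fin (m + 1) → ℂ) [⋀^Fin 2]→L[ℝ] ℝ}
    {θ₀ : (Fin n → ℂ) [⋀^Fin 2]→L[ℝ] ℝ}
    (hJ : ∀ v w, θ ![Complex.I • v, Complex.I • w] = θ ![v, w])
    (hJ₀ : ∀ v w, θ₀ ![Complex.I • v, Complex.I • w] = θ₀ ![v, w])
    {ℓ : (Fin n ⊕ Fin (m + 1) → ℂ) →ₗ[ℂ] ℂ} (hℓ : ℓ (Pi.single (Sum.inr 0) 1) = 1) {X x κ : ℝ}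
    {w : Fin (m + 1) → ℂ}
    (hq : ∀ v, θ ![v, Complex.I • v] = X * θ₀ ![v ∘ Sum.inl, Complex.I • (v ∘ Sum.inl)] +
      (x * fubiniStudy 0 w (v ∘ Sum.inr) + κ * ‖ℓ v‖ ^ 2)) :
    wedgeDensity (fun _ : Fin n ⊕ Fin (m + 1) => θ) = (n + m + 1).factorial / n.factorial *
      (X ^ n * x ^ m * κ * (lineNorm 0 w)⁻¹ ^ (m + 1)) * wedgeDensity fun _ : Fin n => θ₀ := by
  let F := fubiniStudyMatrix (lineNorm 0 w) (Fin.tail w)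
  let D : Matrix (Fin n ⊕ Fin (m + 1)) (Fin n ⊕ Fin (m + 1)) ℂ :=
    Matrix.fromBlocks ((X : ℂ) • hermitianMatrix θ₀) 0 0 (consMatrix (κ : ℂ) ((x : ℂ) • F))
  let r : Fin n ⊕ Fin (m + 1) → ℂ := fun j => ℓ (Pi.single j 1)
  let R : Matrix (Fin n ⊕ Fin (m + 1)) (Fin n ⊕ Fin (m + 1)) ℂ :=
    (1 : Matrix _ _ ℂ).updateRow (Sum.inr 0) r
  have hsmul : ∀ {ι : Type} [Fintype ι] {A : Matrix ι ι ℂ} (t : ℝ), A.IsHermitian →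
      ((t : ℂ) • A).IsHermitian := by
    intro ι _ A t hA
    rw [Matrix.IsHermitian, Matrix.conjTranspose_smul, hA.eq, Complex.star_def, Complex.conj_ofReal]
  have hD : D.IsHermitian := by
    refine Matrix.IsHermitian.fromBlocks (hsmul X (hermitianMatrix_isHermitian hJ₀)) (by simp) ?_
    exact consMatrix_isHermitian κ (hsmul x (fubiniStudyMatrix_isHermitian _ _))
  have hR : R.det = 1 := by
    have h1 : R.det = Matrix.cramer (Matrix.transpose 1) r (Sum.inr 0) :=
      (Matrix.cramer_transpose_apply _ _ _).symm
    rw [h1, Matrix.transpose_one, Matrix.cramer_one]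
    exact hℓ
  have hh : (R.conjTranspose * D * R).IsHermitian :=
    Matrix.isHermitian_conjTranspose_mul_mul R hD
  have hRv : ∀ v j, R.mulVec v j = if j = Sum.inr 0 then ℓ v else v j := by
    intro v j
    by_cases hj : j = Sum.inr 0
    · subst hj
      simp only [R, Matrix.mulVec, Matrix.updateRow_self, if_true]
      have : v = ∑ k, v k • (Pi.single k 1 : Fin n ⊕ Fin (m + 1) → ℂ) := by
        rw [← pi_eq_sum_univ' v]
      conv_rhs => rw [this, map_sum]
      simp only [dotProduct, r, map_smul, smul_eq_mul, mul_comm]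
    · simp only [R, Matrix.mulVec, Matrix.updateRow_ne hj, hj, if_false]
      simp [dotProduct, Matrix.one_apply]
  have hquad : ∀ v, θ ![v, Complex.I • v] =
      (star v ⬝ᵥ ((R.conjTranspose * D * R).mulVec v)).re := by
    intro v
    have h1 : star v ⬝ᵥ ((R.conjTranspose * D * R).mulVec v) =
        star (R.mulVec v) ⬝ᵥ (D.mulVec (R.mulVec v)) := by
      rw [Matrix.mul_assoc, ← Matrix.mulVec_mulVec, ← Matrix.mulVec_mulVec,
        Matrix.dotProduct_mulVec, ← Matrix.star_mulVec]
    have h2 : R.mulVec v ∘ Sum.inl = v ∘ Sum.inl := by ext j; simp [hRv]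
    have h3 : Fin.tail (R.mulVec v ∘ Sum.inr) = Fin.tail (v ∘ Sum.inr) := by
      ext j; simp [hRv, Fin.tail]
    have h4 : R.mulVec v (Sum.inr 0) = ℓ v := by simp [hRv]
    have h5 : star (R.mulVec v) ⬝ᵥ (D.mulVec (R.mulVec v)) =
        star (v ∘ Sum.inl) ⬝ᵥ (((X : ℂ) • hermitianMatrix θ₀).mulVec (v ∘ Sum.inl)) +
        star (R.mulVec v ∘ Sum.inr) ⬝ᵥ ((consMatrix (κ : ℂ) ((x : ℂ) • F)).mulVec
          (R.mulVec v ∘ Sum.inr)) := by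
      rw [Matrix.fromBlocks_mulVec, Matrix.zero_mulVec, Matrix.zero_mulVec, add_zero, zero_add,
        ← h2]
      simp [dotProduct]
    rw [h1, h5, Complex.add_re, consMatrix_quadratic, Function.comp_apply, h4, h3,
      Matrix.smul_mulVec, dotProduct_smul, smul_eq_mul, Complex.re_ofReal_mul,
      ← hermitianMatrix_quadratic hJ₀, Matrix.smul_mulVec, dotProduct_smul, smul_eq_mul,
      Complex.re_ofReal_mul, fubiniStudyMatrix_quadratic, ← fubiniStudy_zero_eq, hq]
    ring
  have hdet : (R.conjTranspose * D * R).det = ((X ^ n * x ^ m * κ * (lineNorm 0 w)⁻¹ ^ (m + 1) : ℝ)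
      : ℂ) * (hermitianMatrix θ₀).det := by
    rw [Matrix.det_mul, Matrix.det_mul, Matrix.det_conjTranspose, hR, star_one, one_mul, mul_one,
      Matrix.det_fromBlocks_zero₂₁, Matrix.det_smul, consMatrix_det, Matrix.det_smul]
    have : F.det = (((lineNorm 0 w : ℝ) : ℂ)⁻¹) ^ (m + 1) := by
      have := fubiniStudyMatrix_det (Fin.tail w)
      rwa [← lineNorm_zero_eq] at this
    rw [this, Fintype.card_fin, Fintype.card_fin]
    push_cast
    ring
  have hf : (n.factorial : ℝ) ≠ 0 := by exact_mod_cast n.factorial_ne_zero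
  rw [wedgeDensity_hermitian hJ hh hquad, hdet, Complex.re_ofReal_mul, wedgeDensity_eq_det hJ₀,
    Fintype.card_sum, Fintype.card_fin, Fintype.card_fin, ← add_assoc]
  field_simp

end Determinant

end

end KahlerProj

namespace KahlerProj

noncomputable section

open Filter

/-! ### Integrals over the fibres -/

/-- Integration of a nonnegative radial function over `ℂ`. -/
lemma lintegral_radial {f Φ : ℝ → ℝ} {l : ℝ} (hf : ∀ r, 0 < r → 0 ≤ f r)
    (hΦ : ∀ r, 0 ≤ r → HasDerivAt Φ (r * f r) r) (hl : Tendsto Φ atTop (𝓝 l)) :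
    ∫⁻ w : ℂ, ENNReal.ofReal (f ‖w‖) = ENNReal.ofReal (2 * Real.pi * (l - Φ 0)) := by
  have hpos : ∀ r ∈ Ioi (0 : ℝ), 0 ≤ r * f r := fun r hr => mul_nonneg (le_of_lt hr) (hf r hr)
  have hint := integrableOn_Ioi_deriv_of_nonneg' (fun r hr => hΦ r hr) hpos hl
  have hval := integral_Ioi_of_hasDerivAt_of_nonneg' (fun r hr => hΦ r hr) hpos hl
  have h1 : Integrable (fun w : ℂ => f ‖w‖) := by
    rw [integrable_fun_norm_addHaar (volume : Measure ℂ) (f := f)]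
    simpa using hint
  have h2 : ∫ w : ℂ, f ‖w‖ = 2 * Real.pi * (l - Φ 0) := by
    rw [integral_fun_norm_addHaar (volume : Measure ℂ) f]
    simp only [Complex.finrank_real_complex, Nat.add_one_sub_one, pow_one, smul_eq_mul, hval,
      nsmul_eq_mul]
    rw [Measure.real, Complex.volume_ball]
    simp
    ring
  have h3 : ∀ᵐ w : ℂ, 0 ≤ f ‖w‖ := by
    have : ∀ᵐ w : ℂ, w ≠ 0 := by simp [ae_iff]
    filter_upwards [this] with w hw using hf _ (norm_pos_iff.2 hw)
  rw [← h2, ofReal_integral_eq_lintegral_ofReal h1 h3]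

lemma lintegral_inv_pow {B : ℝ} (hB : 0 < B) (k : ℕ) :
    ∫⁻ w : ℂ, ENNReal.ofReal ((B + ‖w‖ ^ 2)⁻¹ ^ (k + 2)) =
      ENNReal.ofReal (Real.pi / (k + 1) * B⁻¹ ^ (k + 1)) := by
  have hp : ∀ r : ℝ, 0 < B + r ^ 2 := fun r => by positivity
  have h1 : ∀ r : ℝ, 0 ≤ r → HasDerivAt (fun r : ℝ => -(1 / (2 * (k + 1))) *
      (B + r ^ 2)⁻¹ ^ (k + 1)) (r * (B + r ^ 2)⁻¹ ^ (k + 2)) r := by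
    intro r _
    have h := (((hasDerivAt_pow 2 r).const_add B).inv (hp r).ne').pow (k + 1)
    refine (h.const_mul (-(1 / (2 * ((k : ℝ) + 1))))).congr_deriv ?_
    have := (hp r).ne'
    have hk : (k : ℝ) + 1 ≠ 0 := by positivity
    push_cast
    simp only [Pi.inv_apply, pow_add, inv_pow]
    field_simp
  have h2 : Tendsto (fun r : ℝ => -(1 / (2 * ((k : ℝ) + 1))) * (B + r ^ 2)⁻¹ ^ (k + 1)) atTop
      (𝓝 (-(1 / (2 * ((k : ℝ) + 1))) * 0 ^ (k + 1))) := by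
    refine Tendsto.const_mul _ (Tendsto.pow ?_ _)
    exact (tendsto_atTop_add_const_left _ B (tendsto_pow_atTop two_ne_zero)).inv_tendsto_atTop
  rw [lintegral_radial (f := fun r => (B + r ^ 2)⁻¹ ^ (k + 2)) (fun r _ => by positivity) h1 h2]
  congr 1
  have hk : (k : ℝ) + 1 ≠ 0 := by positivity
  simp
  field_simp

/-- The volume of projective space. -/
lemma lintegral_fubiniStudy (m : ℕ) {B : ℝ} (hB : 0 < B) :
    ∫⁻ w : Fin m → ℂ, ENNReal.ofReal ((B + ∑ k, ‖w k‖ ^ 2)⁻¹ ^ (m + 1)) =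
      ENNReal.ofReal (Real.pi ^ m / m.factorial * B⁻¹) := by
  induction m with
  | zero =>
    have : (volume : Measure (Fin 0 → ℂ)) = Measure.dirac isEmptyElim := by
      rw [volume_pi, Measure.pi_of_empty]
    simp [this]
  | succ m ih =>
    have e := (volume_preserving_piFinSuccAbove (fun _ : Fin (m + 1) => ℂ) 0).symm
    rw [← e.lintegral_comp_emb (MeasurableEquiv.measurableEmbedding _), Measure.volume_eq_prod,
      lintegral_prod_symm]
    · have h1 : ∀ y : Fin m → ℂ, ∫⁻ x : ℂ, ENNReal.ofReal ((B + ∑ k,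
          ‖((MeasurableEquiv.piFinSuccAbove (fun _ : Fin (m + 1) => ℂ) 0).symm (x, y)) k‖ ^ 2)⁻¹ ^
            (m + 1 + 1)) = ENNReal.ofReal (Real.pi / (m + 1)) *
            ENNReal.ofReal ((B + ∑ k, ‖y k‖ ^ 2)⁻¹ ^ (m + 1)) := by
        intro y
        have hB' : 0 < B + ∑ k, ‖y k‖ ^ 2 := by positivity
        rw [← ENNReal.ofReal_mul (by positivity), ← lintegral_inv_pow hB' m]
        refine lintegral_congr fun x => ?_
        simp only [MeasurableEquiv.piFinSuccAbove_symm_apply, Fin.sum_univ_succ]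
        congr 3
        simp
        ring
      simp only [h1]
      rw [lintegral_const_mul _ (by fun_prop), ih, ← ENNReal.ofReal_mul (by positivity)]
      congr 1
      rw [Nat.factorial_succ]
      push_cast
      field_simp
      ring
    · refine Measurable.aemeasurable (Measurable.ennreal_ofReal ?_)
      have : Measurable fun w : Fin (m + 1) → ℂ => (B + ∑ k, ‖w k‖ ^ 2)⁻¹ ^ (m + 1 + 1) := by
        fun_prop
      exact this.comp (MeasurableEquiv.measurable _)

/-- The integral over the fibres of `ℙ(𝒪 ⊕ L)`, in terms of the momentum. -/
lemma lintegral_momentum {P : ℝ → ℝ} (hP : Continuous P) {s c E : ℝ} (hsc : s ≤ c)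
    (hP0 : ∀ x ∈ Icc s c, 0 ≤ P x) (hE : 0 < E) :
    ∫⁻ w : ℂ, ENNReal.ofReal (P (s + (c - s) * (‖w‖ ^ 2 * E / (1 + ‖w‖ ^ 2 * E))) *
      ((c - s) * (E / (1 + ‖w‖ ^ 2 * E) ^ 2))) = ENNReal.ofReal (Real.pi * ∫ x in s..c, P x) := by
  have hp : ∀ r : ℝ, 0 < 1 + r ^ 2 * E := fun r => by positivity
  have hsub : 0 ≤ c - s := sub_nonneg.2 hsc
  let ξ : ℝ → ℝ := fun r => s + (c - s) * (r ^ 2 * E / (1 + r ^ 2 * E))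
  have hξ : ∀ r, ξ r ∈ Icc s c := by
    intro r
    have h0 : 0 ≤ r ^ 2 * E / (1 + r ^ 2 * E) := by have := hp r; positivity
    have h1 : r ^ 2 * E / (1 + r ^ 2 * E) ≤ 1 := by rw [div_le_one (hp r)]; linarith
    constructor
    · exact le_add_of_nonneg_right (mul_nonneg hsub h0)
    · have := mul_le_mul_of_nonneg_left h1 hsub
      simp only [ξ]; linarith
  have hd : ∀ r, HasDerivAt ξ ((c - s) * (2 * r * E / (1 + r ^ 2 * E) ^ 2)) r := by
    intro r
    have h1 : HasDerivAt (fun r : ℝ => r ^ 2 * E) (2 * r * E) r := by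
      simpa using (hasDerivAt_pow 2 r).mul_const E
    have h2 := (h1.div (h1.const_add 1) (hp r).ne').const_mul (c - s)
    refine (h2.const_add s).congr_deriv ?_
    ring
  have hΦ : ∀ r, 0 ≤ r → HasDerivAt (fun r => 2⁻¹ * ∫ x in s..ξ r, P x)
      (r * (P (ξ r) * ((c - s) * (E / (1 + r ^ 2 * E) ^ 2)))) r := by
    intro r _
    have h1 : HasDerivAt (fun y => ∫ x in s..y, P x) (P (ξ r)) (ξ r) :=
      intervalIntegral.integral_hasDerivAt_right (hP.intervalIntegrable _ _)
        (hP.stronglyMeasurableAtFilter _ _) hP.continuousAt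
    refine ((h1.comp r (hd r)).const_mul 2⁻¹).congr_deriv ?_
    ring
  have hlim : Tendsto ξ atTop (𝓝 c) := by
    have h1 : Tendsto (fun r : ℝ => r ^ 2 * E / (1 + r ^ 2 * E)) atTop (𝓝 (1 - 0)) := by
      have h2 : (fun r : ℝ => r ^ 2 * E / (1 + r ^ 2 * E)) = fun r => 1 - (1 + r ^ 2 * E)⁻¹ := by
        ext r; have := (hp r).ne'; field_simp; ring
      rw [h2]
      refine tendsto_const_nhds.sub ?_
      exact (tendsto_atTop_add_const_left _ 1
        ((tendsto_pow_atTop two_ne_zero).atTop_mul_const hE)).inv_tendsto_atTop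
    have h3 := (h1.const_mul (c - s)).const_add s
    simpa using h3
  have hl : Tendsto (fun r => 2⁻¹ * ∫ x in s..ξ r, P x) atTop (𝓝 (2⁻¹ * ∫ x in s..c, P x)) := by
    have hc : Continuous fun y => ∫ x in s..y, P x :=
      intervalIntegral.continuous_primitive (fun a b => hP.intervalIntegrable a b) s
    exact ((hc.tendsto c).comp hlim).const_mul _
  have h0 : ξ 0 = s := by simp [ξ]
  have := lintegral_radial (f := fun r => P (ξ r) * ((c - s) * (E / (1 + r ^ 2 * E) ^ 2)))
    (fun r _ => mul_nonneg (hP0 _ (hξ r)) (by have := hp r; positivity)) hΦ hl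
  rw [h0, intervalIntegral.integral_same] at this
  rw [this]
  congr 1
  ring

lemma lintegral_fibre (m : ℕ) {P : ℝ → ℝ} (hP : Continuous P) {s c H : ℝ} (hsc : s ≤ c)
    (hP0 : ∀ x ∈ Icc s c, 0 ≤ P x) (hH : 0 < H) :
    ∫⁻ w : Fin (m + 1) → ℂ, ENNReal.ofReal (P (s + (c - s) * (‖w 0‖ ^ 2 * (H * lineNorm 0 w) /
      (1 + ‖w 0‖ ^ 2 * (H * lineNorm 0 w)))) * ((c - s) * (H * lineNorm 0 w /
      (1 + ‖w 0‖ ^ 2 * (H * lineNorm 0 w)) ^ 2)) * (lineNorm 0 w)⁻¹ ^ (m + 1)) =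
      ENNReal.ofReal (Real.pi ^ (m + 1) / m.factorial * ∫ x in s..c, P x) := by
  have hJ : 0 ≤ ∫ x in s..c, P x := intervalIntegral.integral_nonneg hsc hP0
  have e := (volume_preserving_piFinSuccAbove (fun _ : Fin (m + 1) => ℂ) 0).symm
  rw [← e.lintegral_comp_emb (MeasurableEquiv.measurableEmbedding _), Measure.volume_eq_prod,
    lintegral_prod_symm]
  · have h0 : ∀ (x : ℂ) (y : Fin m → ℂ),
        ((MeasurableEquiv.piFinSuccAbove (fun _ : Fin (m + 1) => ℂ) 0).symm (x, y)) 0 = x :=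
      fun x y => by simp
    have h1 : ∀ (x : ℂ) (y : Fin m → ℂ), lineNorm 0
        ((MeasurableEquiv.piFinSuccAbove (fun _ : Fin (m + 1) => ℂ) 0).symm (x, y)) =
        1 + ∑ k, ‖y k‖ ^ 2 := fun x y => by
      rw [lineNorm_zero_eq]; simp [Fin.tail]
    simp only [h0, h1]
    have h2 : ∀ y : Fin m → ℂ, ∫⁻ x : ℂ, ENNReal.ofReal (P (s + (c - s) *
        (‖x‖ ^ 2 * (H * (1 + ∑ k, ‖y k‖ ^ 2)) / (1 + ‖x‖ ^ 2 * (H * (1 + ∑ k, ‖y k‖ ^ 2))))) *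
        ((c - s) * (H * (1 + ∑ k, ‖y k‖ ^ 2) / (1 + ‖x‖ ^ 2 * (H * (1 + ∑ k, ‖y k‖ ^ 2))) ^ 2)) *
        (1 + ∑ k, ‖y k‖ ^ 2)⁻¹ ^ (m + 1)) = ENNReal.ofReal (Real.pi * ∫ x in s..c, P x) *
        ENNReal.ofReal ((1 + ∑ k, ‖y k‖ ^ 2)⁻¹ ^ (m + 1)) := by
      intro y
      have hy : 0 < 1 + ∑ k, ‖y k‖ ^ 2 := by positivity
      rw [← lintegral_momentum hP hsc hP0 (mul_pos hH hy), ← lintegral_mul_const']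
      · refine lintegral_congr fun x => ?_
        rw [← ENNReal.ofReal_mul' (by positivity)]
      · exact ENNReal.ofReal_ne_top
    simp only [h2]
    rw [lintegral_const_mul _ (by fun_prop), lintegral_fubiniStudy m one_pos,
      ← ENNReal.ofReal_mul (mul_nonneg Real.pi_pos.le hJ)]
    congr 1
    ring
  · refine Measurable.aemeasurable (Measurable.ennreal_ofReal ?_)
    have hc : Continuous fun w : Fin (m + 1) → ℂ => lineNorm 0 w := by
      simp only [lineNorm_zero_eq, Fin.tail]; fun_prop
    have hne : ∀ w : Fin (m + 1) → ℂ, 1 + ‖w 0‖ ^ 2 * (H * lineNorm 0 w) ≠ 0 := fun w => by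
      have := lineNorm_pos 0 w; positivity
    have hw : Continuous fun w : Fin (m + 1) → ℂ =>
        P (s + (c - s) * (‖w 0‖ ^ 2 * (H * lineNorm 0 w) /
        (1 + ‖w 0‖ ^ 2 * (H * lineNorm 0 w)))) * ((c - s) * (H * lineNorm 0 w /
        (1 + ‖w 0‖ ^ 2 * (H * lineNorm 0 w)) ^ 2)) * (lineNorm 0 w)⁻¹ ^ (m + 1) := by
      refine ((hP.comp ?_).mul ?_).mul ((hc.inv₀ fun w => (lineNorm_pos 0 w).ne').pow _)
      · exact continuous_const.add (continuous_const.mul (Continuous.div (by fun_prop)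
          (by fun_prop) hne))
      · exact continuous_const.mul (Continuous.div (by fun_prop) (by fun_prop)
          fun w => pow_ne_zero 2 (hne w))
    exact hw.measurable.comp (MeasurableEquiv.measurable _)

end

end KahlerProj

namespace KahlerProj

noncomputable section

/-! ### Integration over the fibre bundles -/

section Chart

variable {ι : Type*} [Fintype ι] [DecidableEq ι] {Y : Type*} [TopologicalSpace Y]
  [ChartedSpace (ι → ℂ) Y]

lemma measurableSet_chart_preimage (c : OpenPartialHomeomorph Y (ι → ℂ)) {A : Set Y}
    (hA : @MeasurableSet Y (borel Y) A) : MeasurableSet (c.target ∩ c.symm ⁻¹' A) := by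
  let _ : MeasurableSpace Y := borel Y
  have _ : BorelSpace Y := ⟨rfl⟩
  have h : Measurable (c.target.domRestrict c.symm) :=
    (continuousOn_iff_continuous_domRestrict.1 c.continuousOn_symm).measurable
  have h2 := (c.open_target.measurableSet).subtype_image (h hA)
  convert h2 using 1
  ext u
  simp only [mem_inter_iff, mem_preimage, mem_image, Subtype.exists, domRestrict_apply]
  constructor
  · exact fun h => ⟨u, h.1, h.2, rfl⟩
  · rintro ⟨v, h1, h2, rfl⟩
    exact ⟨h1, h2⟩

lemma chartIntegral_indicator (θ : ι → RealForm ι Y 2) (c : OpenPartialHomeomorph Y (ι → ℂ))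
    {A : Set Y} (hA : @MeasurableSet Y (borel Y) A) :
    chartIntegral θ c (A.indicator 1) = ∫ u in c.target ∩ c.symm ⁻¹' A, density θ c u := by
  classical
  have h1 : chartIntegral θ c (A.indicator 1) =
      ∫ u in c.target, (c.target ∩ c.symm ⁻¹' A).indicator (density θ c) u := by
    refine setIntegral_congr_fun c.open_target.measurableSet fun u hu => ?_
    by_cases h : c.symm u ∈ A
    · simp [h, hu]
    · simp [h]
  rw [h1, setIntegral_indicator (measurableSet_chart_preimage c hA), ← inter_assoc, inter_self]

lemma volume_hyperplane (j : ι) : volume {u : ι → ℂ | u j = 0} = 0 :=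
  Measure.pi_hyperplane (fun _ : ι => (volume : Measure ℂ)) j 0

end Chart

variable {n m : ℕ} {M : Type*} [TopologicalSpace M] [ChartedSpace (Fin n → ℂ) M]
  {L : M → Type*} [∀ x, AddCommGroup (L x)] [∀ x, Module ℂ (L x)]
  [∀ x, TopologicalSpace (L x)] [TopologicalSpace (TotalSpace ℂ L)] [FiberBundle ℂ L]
  [VectorBundle ℂ ℂ L]

/-- A finite partition of `M` into Borel sets over which coordinates are defined. -/
structure CoordPartition (n : ℕ) {M : Type*} [TopologicalSpace M] [ChartedSpace (Fin n → ℂ) M]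
    (L : M → Type*) [∀ x, AddCommGroup (L x)] [∀ x, Module ℂ (L x)]
    [∀ x, TopologicalSpace (L x)] [TopologicalSpace (TotalSpace ℂ L)] [FiberBundle ℂ L] where
  card : ℕ
  centre : Fin card → M
  piece : Fin card → Set M
  measurable : ∀ k, @MeasurableSet M (borel M) (piece k)
  subset : ∀ k, piece k ⊆ coordSet n L (centre k)
  cover : ∀ y, ∃ k, y ∈ piece k
  disjoint : ∀ y j k, y ∈ piece j → y ∈ piece k → j = k

variable (n L) in
lemma exists_coordPartition [CompactSpace M] : Nonempty (CoordPartition n L) := by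
  classical
  let _ : MeasurableSpace M := borel M
  have _ : BorelSpace M := ⟨rfl⟩
  obtain ⟨t, ht⟩ := CompactSpace.elim_nhds_subcover (fun x => coordSet n L x) fun x =>
    (isOpen_coordSet x).mem_nhds (mem_coordSet x)
  let e := t.equivFin
  let c : Fin t.card → M := fun k => e.symm k
  have hc : ∀ y, ∃ k, y ∈ coordSet n L (c k) := by
    intro y
    have hy : y ∈ ⋃ x ∈ t, coordSet n L x := by rw [ht]; trivial
    simp only [mem_iUnion] at hy
    obtain ⟨x, hx, hy⟩ := hy
    exact ⟨e ⟨x, hx⟩, by simpa [c] using hy⟩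
  refine ⟨⟨t.card, c, fun k => coordSet n L (c k) \ ⋃ j : Fin t.card, ⋃ _ : j < k,
    coordSet n L (c j), fun k => ?_, fun k => sdiff_subset, fun y => ?_, fun y j k hj hk => ?_⟩⟩
  · exact (isOpen_coordSet _).measurableSet.diff (isOpen_iUnion fun j => isOpen_iUnion fun _ =>
      isOpen_coordSet _).measurableSet
  · obtain ⟨k, hk, hmin⟩ := WellFounded.has_min (wellFounded_lt (α := Fin t.card))
      {k | y ∈ coordSet n L (c k)} (hc y)
    refine ⟨k, hk, ?_⟩
    simp only [mem_iUnion, not_exists]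
    exact fun j hj hy => hmin j hy hj
  · by_contra hne
    rcases lt_or_gt_of_ne hne with h | h
    · exact hk.2 (mem_iUnion₂.2 ⟨j, h, hj.1⟩)
    · exact hj.2 (mem_iUnion₂.2 ⟨k, h, hk.1⟩)

namespace CoordPartition

variable (Q : CoordPartition n L)

/-- The pieces of the partition, in coordinates. -/
def domain (k : Fin Q.card) : Set (Fin n → ℂ) :=
  (chartAt (Fin n → ℂ) (Q.centre k)).target ∩ (chartAt (Fin n → ℂ) (Q.centre k)).symm ⁻¹' Q.piece k

lemma domain_subset (k : Fin Q.card) : Q.domain k ⊆ baseDomain L (Q.centre k) :=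
  fun _ hz => ⟨hz.1, (Q.subset k hz.2).2⟩

lemma measurableSet_domain (k : Fin Q.card) : MeasurableSet (Q.domain k) :=
  measurableSet_chart_preimage _ (Q.measurable k)

lemma sum_indicator {Y : Type*} {f : Y → M} {B : Fin Q.card → Set Y} {y : Y}
    (hB : ∀ k, y ∈ B k ↔ f y ∈ Q.piece k) : ∑ k, (B k).indicator (1 : Y → ℝ) y = 1 := by
  classical
  obtain ⟨k, hk⟩ := Q.cover (f y)
  rw [Finset.sum_eq_single k]
  · rw [indicator_of_mem ((hB k).2 hk)]; rfl
  · exact fun j _ hj => indicator_of_notMem (fun h => hj (Q.disjoint _ _ _ ((hB j).1 h) hk)) _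
  · simp

lemma measurable_indicator {Y : Type*} [TopologicalSpace Y] {A : Set Y}
    (hA : @MeasurableSet Y (borel Y) A) :
    @Measurable Y ℝ (borel Y) _ (A.indicator 1) := by
  let _ : MeasurableSpace Y := borel Y
  exact measurable_one.indicator hA

lemma abs_indicator_le {Y : Type*} (A : Set Y) (y : Y) : |A.indicator (1 : Y → ℝ) y| ≤ 1 := by
  by_cases h : y ∈ A <;> simp [h]

variable [T2Space M] [CompactSpace M] [IsManifold 𝓘(ℂ, Fin n → ℂ) ω M]

lemma integralWedge_base {θ : Fin n → RealForm (Fin n) M 2} (hθ : ∀ j, IsSmoothForm (θ j)) :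
    integralWedge θ = ∑ k, ∫ z in Q.domain k,
      density θ (chartAt (Fin n → ℂ) (Q.centre k)) z := by
  rw [integralWedge_eq_sum (fun k => chartAt (Fin n → ℂ) (Q.centre k))
    (fun k => chart_mem_atlas _ _) (fun k => (Q.piece k).indicator 1)
    (fun k => measurable_indicator (Q.measurable k)) (fun k y => abs_indicator_le _ _)
    (fun k y hy => indicator_of_notMem (fun h => hy (Q.subset k h).1) _) ∅ (by simp) hθ
    fun y _ => Or.inl (Q.sum_indicator (f := id) fun k => Iff.rfl)]
  exact Finset.sum_congr rfl fun k _ => chartIntegral_indicator _ _ (Q.measurable k)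

/-- Integration over a bundle over `M` by means of one chart over each piece of the base. -/
lemma integralWedge_total {Y : Type*} [TopologicalSpace Y]
    [ChartedSpace (Fin n ⊕ Fin (m + 1) → ℂ) Y] [T2Space Y] [CompactSpace Y]
    [IsManifold 𝓘(ℂ, Fin n ⊕ Fin (m + 1) → ℂ) ω Y] {base : Y → M} (hb : Continuous base)
    {c : M → OpenPartialHomeomorph Y (Fin n ⊕ Fin (m + 1) → ℂ)}
    (hc : ∀ x, c x ∈ atlas (Fin n ⊕ Fin (m + 1) → ℂ) Y)
    (ht : ∀ x u, u ∈ (c x).target ↔ u ∘ Sum.inl ∈ baseDomain L x)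
    (hcb : ∀ x u, u ∈ (c x).target →
      base ((c x).symm u) = (chartAt (Fin n → ℂ) x).symm (u ∘ Sum.inl))
    {S : Set Y} (hS : ∀ c ∈ atlas (Fin n ⊕ Fin (m + 1) → ℂ) Y,
      volume (c.target ∩ c.symm ⁻¹' S) = 0)
    (hcS : ∀ x y, y ∉ S → base y ∈ coordSet n L x → y ∈ (c x).source)
    {θ : Fin n ⊕ Fin (m + 1) → RealForm (Fin n ⊕ Fin (m + 1)) Y 2}
    (hθ : ∀ j, IsSmoothForm (θ j)) :
    integralWedge θ = ∑ k, ∫ u in {u | u ∘ Sum.inl ∈ Q.domain k},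
      density θ (c (Q.centre k)) u := by
  have hm : ∀ k, @MeasurableSet Y (borel Y) ((c (Q.centre k)).source ∩ base ⁻¹' Q.piece k) := by
    intro k
    let _ : MeasurableSpace Y := borel Y
    have _ : BorelSpace Y := ⟨rfl⟩
    let _ : MeasurableSpace M := borel M
    have _ : BorelSpace M := ⟨rfl⟩
    exact (c (Q.centre k)).open_source.measurableSet.inter (hb.measurable (Q.measurable k))
  rw [integralWedge_eq_sum (fun k => c (Q.centre k)) (fun k => hc _)
    (fun k => ((c (Q.centre k)).source ∩ base ⁻¹' Q.piece k).indicator 1)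
    (fun k => measurable_indicator (hm k)) (fun k y => abs_indicator_le _ _)
    (fun k y hy => indicator_of_notMem (fun h => hy h.1) _) S hS hθ fun y hy => Or.inl
      (Q.sum_indicator (f := base) fun k => ⟨fun h => h.2, fun h => ⟨hcS _ _ hy (Q.subset k h), h⟩⟩)]
  refine Finset.sum_congr rfl fun k _ => ?_
  rw [chartIntegral_indicator _ _ (hm k)]
  congr 2
  ext u
  constructor
  · rintro ⟨hu, -, h⟩
    rw [mem_preimage, hcb _ _ hu] at h
    exact ⟨((ht _ _).1 hu).1, h⟩
  · intro hu
    have hu' : u ∈ (c (Q.centre k)).target := (ht _ _).2 (Q.domain_subset k hu)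
    refine ⟨hu', (c (Q.centre k)).map_target hu', ?_⟩
    rw [mem_preimage, hcb _ _ hu']
    exact hu.2

variable [ContMDiffVectorBundle ω ℂ L 𝓘(ℂ, Fin n → ℂ)]

lemma coord_eq_zero_iff {x₀ x : M} (hx : x ∈ (trivializationAt ℂ L x₀).baseSet) (v : L x) :
    coord x₀ x v = 0 ↔ v = 0 := by
  constructor
  · intro h
    rw [← coord_smul_frame hx v, h, zero_smul]
  · rintro rfl; exact map_zero _

lemma integralWedge_proj {θ : Fin n ⊕ Fin (m + 1) →
    RealForm (Fin n ⊕ Fin (m + 1)) (ProjBundle n L m) 2} (hθ : ∀ j, IsSmoothForm (θ j)) :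
    integralWedge θ = ∑ k, ∫ u in {u | u ∘ Sum.inl ∈ Q.domain k},
      density θ (projHomeo (Q.centre k) none) u := by
  refine Q.integralWedge_total (base := ProjBundle.base) (S := {p : ProjBundle n L m | p.point.rep.1 = 0})
    (c := fun x => projHomeo (L := L) x none) contMDiff_proj_base.continuous
    (fun x => projHomeo_mem_atlas x none) (fun x u => Iff.rfl) (fun x u _ => rfl)
    (fun c hc => ?_) (fun x y hy hx => mem_projHomeo_source.2 ⟨hx, hy⟩) hθ
  obtain ⟨x, i, rfl⟩ := exists_projHomeo hc
  have h : (projHomeo (L := L) x i).target ∩ (projHomeo x i).symm ⁻¹' {p : ProjBundle n L m | p.point.rep.1 = 0} ⊆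
      {u | homogenize i (u ∘ Sum.inr) none = 0} := by
    rintro u ⟨hu, h0⟩
    have h1 := congrFun (hom_eq_homogenize ((projHomeo x i).map_target hu)) none
    have h2 := (mem_projHomeo_source.1 ((projHomeo x i).map_target hu)).2
    change _ = (0 : ℂ) at h0
    change ((projHomeo x i).symm u).point.rep.1 = _ at h1
    rw [h0, (projHomeo x i).right_inv hu, Pi.smul_apply, smul_eq_mul] at h1
    exact (mul_eq_zero.1 h1.symm).resolve_left h2
  refine measure_mono_null h ?_
  rcases i with _ | k
  · have : {u : Fin n ⊕ Fin (m + 1) → ℂ | homogenize none (u ∘ Sum.inr) none = 0} = ∅ := by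
      ext u; simp
    rw [this, measure_empty]
  · have : {u : Fin n ⊕ Fin (m + 1) → ℂ | homogenize (some k) (u ∘ Sum.inr) none = 0} =
        {u | u (Sum.inr k) = 0} := by
      ext u; simp [homogenize]
    rw [this, volume_hyperplane]

lemma integralWedge_blow {θ : Fin n ⊕ Fin (m + 1) →
    RealForm (Fin n ⊕ Fin (m + 1)) (BlowUp n L m) 2} (hθ : ∀ j, IsSmoothForm (θ j)) :
    integralWedge θ = ∑ k, ∫ u in {u | u ∘ Sum.inl ∈ Q.domain k},
      density θ (blowHomeo (Q.centre k) 0 false) u := by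
  refine Q.integralWedge_total (base := BlowUp.base)
    (S := {q : BlowUp n L m | q.point.rep.1 = 0 ∨ q.line.rep 0 = 0})
    (c := fun x => blowHomeo (L := L) x 0 false) contMDiff_blow_base.continuous
    (fun x => blowHomeo_mem_atlas x 0 false) (fun x u => Iff.rfl)
    (fun x u _ => blowHomeo_symm_base u) (fun c hc => ?_) (fun x y hy hx =>
      mem_blowHomeo_source.2 ⟨hx, fun h => hy (Or.inl h),
        fun h => hy (Or.inr ((coord_eq_zero_iff hx.2 _).1 h))⟩) hθ
  obtain ⟨x, i, b, rfl⟩ := exists_blowHomeo hc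
  have h : (blowHomeo (L := L) x i b).target ∩ (blowHomeo x i b).symm ⁻¹'
      {q : BlowUp n L m | q.point.rep.1 = 0 ∨ q.line.rep 0 = 0} ⊆
      {u | blowPoint i b (u ∘ Sum.inr) none = 0} ∪ {u | blowLine i (u ∘ Sum.inr) 0 = 0} := by
    rintro u ⟨hu, h0⟩
    have hm := mem_blowHomeo_source.1 ((blowHomeo x i b).map_target hu)
    rcases h0 with h0 | h0
    · left
      have h1 := congrFun (hom_eq_blowPoint ((blowHomeo x i b).map_target hu)) none
      change ((blowHomeo x i b).symm u).point.rep.1 = _ at h1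
      rw [h0, (blowHomeo x i b).right_inv hu, Pi.smul_apply, smul_eq_mul] at h1
      exact (mul_eq_zero.1 h1.symm).resolve_left (by cases b <;> exact hm.2.1)
    · right
      have h1 := congrFun (homL_eq_blowLine ((blowHomeo x i b).map_target hu)) 0
      have h2 : homL x ((blowHomeo x i b).symm u).base ((blowHomeo x i b).symm u).line.rep 0 = 0 :=
        (coord_eq_zero_iff hm.1.2 _).2 h0
      rw [h2, (blowHomeo x i b).right_inv hu, Pi.smul_apply, smul_eq_mul] at h1
      exact (mul_eq_zero.1 h1.symm).resolve_left hm.2.2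
  refine measure_mono_null h (measure_union_null ?_ ?_)
  · cases b
    · have : {u : Fin n ⊕ Fin (m + 1) → ℂ | blowPoint i false (u ∘ Sum.inr) none = 0} = ∅ := by
        ext u; simp [blowPoint]
      rw [this, measure_empty]
    · exact volume_hyperplane (Sum.inr i)
  · by_cases hi : 0 = i
    · have : {u : Fin n ⊕ Fin (m + 1) → ℂ | blowLine i (u ∘ Sum.inr) 0 = 0} = ∅ := by
        ext u; simp [blowLine, hi]
      rw [this, measure_empty]
    · have : {u : Fin n ⊕ Fin (m + 1) → ℂ | blowLine i (u ∘ Sum.inr) 0 = 0} =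
          {u | u (Sum.inr 0) = 0} := by
        ext u; simp [blowLine, Function.update_of_ne hi]
      rw [this, volume_hyperplane]

end CoordPartition

end

end KahlerProj

namespace KahlerProj

noncomputable section

/-! ### Positive forms -/

section Positive

variable {ι : Type*} [Fintype ι]

/-- Invariant positive constant forms. -/
def IsPositive (θ : (ι → ℂ) [⋀^Fin 2]→L[ℝ] ℝ) : Prop :=
  (∀ v w, θ ![Complex.I • v, Complex.I • w] = θ ![v, w]) ∧ ∀ v, v ≠ 0 → 0 < θ ![v, Complex.I • v]

lemma IsPositive.comp {κ : Type*} [Fintype κ] {θ : (ι → ℂ) [⋀^Fin 2]→L[ℝ] ℝ} (h : IsPositive θ)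
    {T : (κ → ℂ) →L[ℂ] (ι → ℂ)} (hT : Function.Injective T) :
    IsPositive (θ.compContinuousLinearMap (T.restrictScalars ℝ)) := by
  have h1 : ∀ v w : κ → ℂ, θ.compContinuousLinearMap (T.restrictScalars ℝ) ![v, w] =
      θ ![T v, T w] := fun v w => two_comp _ _ _ _
  refine ⟨fun v w => ?_, fun v hv => ?_⟩
  · rw [h1, h1, map_smul, map_smul, h.1]
  · rw [h1, map_smul]
    exact h.2 _ fun h0 => hv (hT (h0.trans (map_zero T).symm))

open scoped ComplexOrder in
lemma IsPositive.wedgeDensity_pos [DecidableEq ι] {θ : (ι → ℂ) [⋀^Fin 2]→L[ℝ] ℝ}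
    (h : IsPositive θ) : 0 < wedgeDensity fun _ : ι => θ := by
  rw [wedgeDensity_eq_det h.1]
  have hp : (hermitianMatrix θ).PosDef := by
    refine Matrix.PosDef.of_dotProduct_mulVec_pos (hermitianMatrix_isHermitian h.1) fun v hv => ?_
    have h1 := h.2 v hv
    rw [hermitianMatrix_quadratic h.1] at h1
    refine Complex.lt_def.2 ⟨h1, ?_⟩
    exact ((hermitianMatrix_isHermitian h.1).im_star_dotProduct_mulVec_self v).symm
  have h2 := (Complex.lt_def.1 hp.det_pos).1
  rw [Complex.zero_re] at h2
  positivity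

variable {Y : Type*} [TopologicalSpace Y] [ChartedSpace (ι → ℂ) Y]
  [IsManifold 𝓘(ℂ, ι → ℂ) ω Y]

lemma injective_fderiv_transition {c c' : OpenPartialHomeomorph Y (ι → ℂ)}
    (hc : c ∈ atlas (ι → ℂ) Y) (hc' : c' ∈ atlas (ι → ℂ) Y) {u : ι → ℂ} (hu : u ∈ c.target)
    (hu' : c.symm u ∈ c'.source) : Function.Injective (fderiv ℂ (c' ∘ c.symm) u) := by
  have h1 : DifferentiableAt ℂ (c' ∘ c.symm) u :=
    (contDiffAt_transition hc hc' hu hu').differentiableAt (by simp)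
  have h2 : DifferentiableAt ℂ (c ∘ c'.symm) ((c' ∘ c.symm) u) :=
    (contDiffAt_transition hc' hc (c'.map_source hu')
      (by rw [c'.left_inv hu']; exact c.map_target hu)).differentiableAt (by simp)
  have h3 : (c ∘ c'.symm) ∘ (c' ∘ c.symm) =ᶠ[𝓝 u] id := by
    filter_upwards [(c.symm.continuousAt hu).eventually (c'.open_source.mem_nhds hu'),
      c.open_target.mem_nhds hu] with u' h4 h5
    simp [c'.left_inv h4, c.right_inv h5]
  have h4 := h3.fderiv_eq (𝕜 := ℂ)
  rw [fderiv_comp _ h2 h1, fderiv_id] at h4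
  intro v w hvw
  have h5 := congrArg (fderiv ℂ (c ∘ c'.symm) ((c' ∘ c.symm) u)) hvw
  have h6 := fun v => DFunLike.congr_fun h4 v
  simp only [ContinuousLinearMap.comp_apply, ContinuousLinearMap.id_apply] at h6
  rwa [h6, h6] at h5

lemma IsPositive.inChart_trans {θ : RealForm ι Y 2} {c c' : OpenPartialHomeomorph Y (ι → ℂ)}
    (hc : c ∈ atlas (ι → ℂ) Y) (hc' : c' ∈ atlas (ι → ℂ) Y) {y : Y} (hy : y ∈ c.source)
    (hy' : y ∈ c'.source) (h : IsPositive (inChart θ c' (c' y))) :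
    IsPositive (inChart θ c (c y)) := by
  have hu := c.map_source hy
  have hu' : c.symm (c y) ∈ c'.source := by rwa [c.left_inv hy]
  rw [KahlerProj.inChart_trans θ hc hc' hu hu', DifferentiableAt.fderiv_restrictScalars ℝ
    ((contDiffAt_transition hc hc' hu hu').differentiableAt (by simp)), c.left_inv hy]
  exact h.comp (injective_fderiv_transition hc hc' hu hu')

lemma IsKahlerForm.isPositive {θ : RealForm ι Y 2} (h : IsKahlerForm θ)
    {c : OpenPartialHomeomorph Y (ι → ℂ)} (hc : c ∈ atlas (ι → ℂ) Y) {u : ι → ℂ}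
    (hu : u ∈ c.target) : IsPositive (inChart θ c u) := by
  rw [← c.right_inv hu]
  refine IsPositive.inChart_trans hc (chart_mem_atlas _ (c.symm u)) (c.map_target hu)
    (mem_chart_source _ _) ?_
  rw [inChart_chartAt]
  exact ⟨h.2.1 _, h.2.2 _⟩

lemma isKahlerForm_of_isPositive {θ : RealForm ι Y 2} (h : θ ∈ closedForms ι Y)
    (h' : ∀ y, ∃ c ∈ atlas (ι → ℂ) Y, y ∈ c.source ∧ IsPositive (inChart θ c (c y))) :
    IsKahlerForm θ := by
  have key : ∀ y, IsPositive (θ y) := by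
    intro y
    obtain ⟨c, hc, hy, hp⟩ := h' y
    have := IsPositive.inChart_trans (chart_mem_atlas _ y) hc (mem_chart_source _ y) hy hp
    rwa [inChart_chartAt] at this
  exact ⟨h, fun y => (key y).1, fun y => (key y).2⟩

variable [DecidableEq ι] [T2Space Y] [CompactSpace Y] [Nonempty Y]

lemma IsKahlerForm.integralWedge_pos {θ : RealForm ι Y 2} (h : IsKahlerForm θ) :
    0 < integralWedge fun _ : ι => θ :=
  KahlerProj.integralWedge_pos (fun _ => h.1.1) fun _ hc _ hu => (h.isPositive hc hu).wedgeDensity_pos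

lemma IsKahlerClass.topSelfIntersection_pos {c : DeRham2 ι Y} (h : IsKahlerClass c) :
    0 < topSelfIntersection c := by
  obtain ⟨θ, hθ, rfl⟩ := h
  rw [topSelfIntersection, intersectionNumber_deRhamClass fun _ => hθ.1]
  exact hθ.integralWedge_pos

/-- A Kähler form on a compact manifold of positive dimension is not exact. -/
lemma IsKahlerForm.deRhamClass_ne_zero [Nonempty ι] {θ : RealForm ι Y 2} (h : IsKahlerForm θ) :
    deRhamClass θ ≠ 0 := by
  intro h0
  have h1 := IsKahlerClass.topSelfIntersection_pos ⟨θ, h, rfl⟩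
  rw [topSelfIntersection, ← intersectionForm_apply, h0] at h1
  exact h1.ne' (MultilinearMap.map_coord_zero _ (Classical.arbitrary ι) rfl)

end Positive

end

end KahlerProj

namespace KahlerProj

noncomputable section

/-! ### The volume of the reference classes -/

variable {n m : ℕ} {M : Type*} [TopologicalSpace M] [ChartedSpace (Fin n → ℂ) M]
  [IsManifold 𝓘(ℂ, Fin n → ℂ) ω M]
  {L : M → Type*} [∀ x, AddCommGroup (L x)] [∀ x, Module ℂ (L x)]
  [∀ x, TopologicalSpace (L x)] [TopologicalSpace (TotalSpace ℂ L)] [FiberBundle ℂ L]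
  [VectorBundle ℂ ℂ L] [ContMDiffVectorBundle ω ℂ L 𝓘(ℂ, Fin n → ℂ)]
  (h : HermitianMetric (ι := Fin n) L) {x₀ : M} {i : Fin (m + 1)} {b : Bool}
  {u : Fin n ⊕ Fin (m + 1) → ℂ}
  {θ : RealForm (Fin n) M 2}

/-- The vertical part of a tangent vector, as a linear map. -/
def verticalMap (x₀ : M) (i : Fin (m + 1)) (b : Bool) (u : Fin n ⊕ Fin (m + 1) → ℂ) :
    (Fin n ⊕ Fin (m + 1) → ℂ) →ₗ[ℂ] ℂ :=
  LinearMap.proj (Sum.inr i) + (u (Sum.inr i) * fibreSign b) • del (logFrame h x₀ i) u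

lemma verticalMap_apply (v : Fin n ⊕ Fin (m + 1) → ℂ) :
    verticalMap h x₀ i b u v = verticalPart h x₀ i b u v := by
  simp [verticalMap, verticalPart, mul_assoc]

lemma HasPotential.inChart_invariant {ι : Type*} [Fintype ι] {Y : Type*} [TopologicalSpace Y]
    [ChartedSpace (ι → ℂ) Y] [IsManifold 𝓘(ℂ, ι → ℂ) ω Y] {θ : RealForm ι Y 2} {φ : Y → ℝ}
    {c : OpenPartialHomeomorph Y (ι → ℂ)} (hc : c ∈ atlas (ι → ℂ) Y) {u : ι → ℂ}
    (hu : u ∈ c.target) (h : HasPotential θ (c.symm u) φ) (v w : ι → ℂ) :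
    KahlerProj.inChart θ c u ![Complex.I • v, Complex.I • w] = KahlerProj.inChart θ c u ![v, w] := by
  have h1 := (h.inChart hc (c.map_target hu)).self_of_nhds
  rw [c.right_inv hu] at h1
  rw [h1.2, ddc_invariant h1.1]

/-- The fibre density of the volume form of a reference form. -/
def fibreDensity (m : ℕ) (P : ℝ → ℝ) (c s H : ℝ) (w : Fin (m + 1) → ℂ) : ℝ :=
  P (s + (c - s) * (‖w 0‖ ^ 2 * (H * lineNorm 0 w) / (1 + ‖w 0‖ ^ 2 * (H * lineNorm 0 w)))) *
    ((c - s) * (H * lineNorm 0 w / (1 + ‖w 0‖ ^ 2 * (H * lineNorm 0 w)) ^ 2)) *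
    (lineNorm 0 w)⁻¹ ^ (m + 1)

lemma fibre_mem_Icc {c s H : ℝ} (hsc : s ≤ c) (hH : 0 < H) (w : Fin (m + 1) → ℂ) :
    s + (c - s) * (‖w 0‖ ^ 2 * (H * lineNorm 0 w) / (1 + ‖w 0‖ ^ 2 * (H * lineNorm 0 w))) ∈
      Icc s c := by
  have h1 := lineNorm_pos 0 w
  have h2 : 0 ≤ ‖w 0‖ ^ 2 * (H * lineNorm 0 w) := by positivity
  have h3 : ‖w 0‖ ^ 2 * (H * lineNorm 0 w) / (1 + ‖w 0‖ ^ 2 * (H * lineNorm 0 w)) ≤ 1 := by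
    rw [div_le_one (by positivity)]; linarith
  have h4 : 0 ≤ ‖w 0‖ ^ 2 * (H * lineNorm 0 w) / (1 + ‖w 0‖ ^ 2 * (H * lineNorm 0 w)) := by
    positivity
  constructor <;> nlinarith [sub_nonneg.2 hsc]

lemma fibreDensity_nonneg {P : ℝ → ℝ} {c s H : ℝ} (hsc : s ≤ c) (hP : ∀ x ∈ Icc s c, 0 ≤ P x)
    (hH : 0 < H) (w : Fin (m + 1) → ℂ) : 0 ≤ fibreDensity m P c s H w := by
  have h1 := lineNorm_pos 0 w
  have h2 := hP _ (fibre_mem_Icc hsc hH w)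
  have h3 := sub_nonneg.2 hsc
  rw [fibreDensity]
  positivity

lemma density_refForm (hθ : ∀ x₀ x, x ∈ (trivializationAt ℂ L x₀).baseSet →
      HasPotential θ x fun x => Real.log (h.frameNorm x₀ x))
    {p c s : ℝ} {τ : RealForm (Fin n ⊕ Fin (m + 1)) (BlowUp n L m) 2}
    (hτ : ∀ q ∈ (blowHomeo (L := L) x₀ 0 false).source,
        HasPotential τ q fun q => refPotential h x₀ 0 false p c s (blowHomeo x₀ 0 false q))
    (hu : u ∘ Sum.inl ∈ baseDomain L x₀) :
    density (fun _ => τ) (blowHomeo (L := L) x₀ 0 false) u =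
      (n + m + 1).factorial / n.factorial / Real.pi ^ (m + 1) *
      fibreDensity m (fun x => (p + x) ^ n * x ^ m) c s (chartNorm h x₀ (u ∘ Sum.inl))
        (u ∘ Sum.inr) *
      density (fun _ => θ) (chartAt (Fin n → ℂ) x₀) (u ∘ Sum.inl) := by
  have hJ := HasPotential.inChart_invariant (blowHomeo_mem_atlas x₀ 0 false) hu
    (hτ _ ((blowHomeo (L := L) x₀ 0 false).map_target hu))
  have hJ₀ := HasPotential.inChart_invariant (chart_mem_atlas _ x₀) hu.1 (hθ x₀ _ hu.2)
  have hℓ : verticalMap h x₀ 0 false u (Pi.single (Sum.inr 0) 1) = 1 := by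
    rw [verticalMap_apply, verticalPart, del_logFrame_single h hu]
    simp
  have h1 := wedgeDensity_of_quadratic hJ hJ₀ hℓ
    (X := p + momentum h x₀ 0 false c s u) (x := momentum h x₀ 0 false c s u / Real.pi)
    (κ := (c - s) * verticalCoeff h x₀ 0 false u / Real.pi) (w := u ∘ Sum.inr) fun v => by
      rw [refForm_quadratic h hθ hτ hu, verticalMap_apply]
      ring
  have hexp : Real.exp (fibreSign false * logFrame h x₀ 0 u) =
      chartNorm h x₀ (u ∘ Sum.inl) * lineNorm 0 (u ∘ Sum.inr) := by
    rw [← exp_logFrame (i := 0) h hu]; simp [fibreSign]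
  have hm : momentum h x₀ 0 false c s u = s + (c - s) * (‖(u ∘ Sum.inr) 0‖ ^ 2 *
      (chartNorm h x₀ (u ∘ Sum.inl) * lineNorm 0 (u ∘ Sum.inr)) / (1 + ‖(u ∘ Sum.inr) 0‖ ^ 2 *
      (chartNorm h x₀ (u ∘ Sum.inl) * lineNorm 0 (u ∘ Sum.inr)))) := by
    rw [momentum, fibreRatio, hexp]; simp [fibreSign]
  have hv : verticalCoeff h x₀ 0 false u = chartNorm h x₀ (u ∘ Sum.inl) * lineNorm 0 (u ∘ Sum.inr) /
      (1 + ‖(u ∘ Sum.inr) 0‖ ^ 2 *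
      (chartNorm h x₀ (u ∘ Sum.inl) * lineNorm 0 (u ∘ Sum.inr))) ^ 2 := by
    rw [verticalCoeff, hexp]; rfl
  rw [density, h1, fibreDensity, ← hm, ← hv, density, div_pow, pow_succ Real.pi]
  have := Real.pi_ne_zero
  field_simp

/-- Fubini's theorem over a coordinate domain of the base. -/
lemma setIntegral_fibre {A : Set (Fin n → ℂ)} (hA : MeasurableSet A)
    {D : (Fin n ⊕ Fin (m + 1) → ℂ) → ℝ} {g : (Fin n → ℂ) → ℝ} {C : ℝ} (hC : 0 ≤ C)
    {f : (Fin n → ℂ) → (Fin (m + 1) → ℂ) → ℝ} {K : ℝ} (hK : 0 ≤ K)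
    (hD : ContinuousOn D {u | u ∘ Sum.inl ∈ A}) (hg : ContinuousOn g A) (hg0 : ∀ z ∈ A, 0 ≤ g z)
    (hf0 : ∀ z ∈ A, ∀ w, 0 ≤ f z w)
    (hDf : ∀ u, u ∘ Sum.inl ∈ A → D u = C * f (u ∘ Sum.inl) (u ∘ Sum.inr) * g (u ∘ Sum.inl))
    (hf : ∀ z ∈ A, ∫⁻ w, ENNReal.ofReal (f z w) = ENNReal.ofReal K) :
    ∫ u in {u | u ∘ Sum.inl ∈ A}, D u = C * K * ∫ z in A, g z := by
  have hm : MeasurableSet {u : Fin n ⊕ Fin (m + 1) → ℂ | u ∘ Sum.inl ∈ A} :=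
    hA.preimage (projInl n m).continuous.measurable
  have hD0 : ∀ u, u ∘ Sum.inl ∈ A → 0 ≤ D u := fun u hu => by
    rw [hDf u hu]
    have := hf0 _ hu (u ∘ Sum.inr)
    have := hg0 _ hu
    positivity
  rw [integral_eq_lintegral_of_nonneg_ae ((ae_restrict_mem hm).mono hD0)
    (hD.aestronglyMeasurable hm), integral_eq_lintegral_of_nonneg_ae
    ((ae_restrict_mem hA).mono hg0) (hg.aestronglyMeasurable hA),
    ← ENNReal.toReal_ofReal (mul_nonneg hC hK), ← ENNReal.toReal_mul]
  congr 1
  let e := MeasurableEquiv.sumPiEquivProdPi fun _ : Fin n ⊕ Fin (m + 1) => ℂ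
  have he : MeasurePreserving e.symm volume volume :=
    volume_measurePreserving_sumPiEquivProdPi_symm fun _ => ℂ
  have hpre : e.symm ⁻¹' {u | u ∘ Sum.inl ∈ A} = A ×ˢ univ := by
    ext ⟨z, w⟩; simp only [mem_preimage, mem_ofPred_eq, mem_prod, mem_univ, and_true]; rfl
  have hDm : AEMeasurable (fun u => ENNReal.ofReal (D u))
      (volume.restrict {u : Fin n ⊕ Fin (m + 1) → ℂ | u ∘ Sum.inl ∈ A}) :=
    (hD.aemeasurable hm).ennreal_ofReal
  rw [← he.setLIntegral_comp_preimage_emb e.symm.measurableEmbedding, hpre,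
    Measure.volume_eq_prod, ← Measure.prod_restrict, Measure.restrict_univ, lintegral_prod]
  · rw [← lintegral_const_mul' _ _ ENNReal.ofReal_ne_top]
    refine setLIntegral_congr_fun hA fun z hz => ?_
    have h1 : ∀ w, D (e.symm (z, w)) = C * f z w * g z := fun w => hDf _ hz
    simp only [h1]
    have h2 : ∀ w, ENNReal.ofReal (C * f z w * g z) =
        ENNReal.ofReal (C * g z) * ENNReal.ofReal (f z w) := fun w => by
      rw [← ENNReal.ofReal_mul (mul_nonneg hC (hg0 z hz))]; congr 1; ring
    simp only [h2]
    rw [lintegral_const_mul' _ _ ENNReal.ofReal_ne_top, hf z hz,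
      ← ENNReal.ofReal_mul (mul_nonneg hC (hg0 z hz)), ← ENNReal.ofReal_mul (mul_nonneg hC hK)]
    congr 1; ring
  · have h3 := (he.restrict_preimage_emb e.symm.measurableEmbedding
      {u | u ∘ Sum.inl ∈ A}).aemeasurable_comp_iff e.symm.measurableEmbedding (g := fun u => ENNReal.ofReal (D u))
    rw [hpre, Measure.volume_eq_prod, ← Measure.prod_restrict, Measure.restrict_univ] at h3
    exact h3.2 hDm

variable [T2Space M] [CompactSpace M]

lemma density_base_nonneg (hK : IsKahlerForm θ) {z : Fin n → ℂ} (hz : z ∈ baseDomain L x₀) :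
    0 ≤ density (fun _ => θ) (chartAt (Fin n → ℂ) x₀) z :=
  (hK.isPositive (chart_mem_atlas _ _) hz.1).wedgeDensity_pos.le

theorem topSelfIntersection_refClass (hK : IsKahlerForm θ)
    (hθ : ∀ x₀ x, x ∈ (trivializationAt ℂ L x₀).baseSet →
      HasPotential θ x fun x => Real.log (h.frameNorm x₀ x)) {p c s : ℝ} (hsc : s ≤ c)
    (hP : ∀ x ∈ Icc s c, 0 ≤ (p + x) ^ n * x ^ m) :
    topSelfIntersection (refClass n L m (deRhamClass θ) p c s) =
      (n + m + 1).factorial / (n.factorial * m.factorial) * (∫ x in s..c, (p + x) ^ n * x ^ m) *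
        topSelfIntersection (deRhamClass θ) := by
  obtain ⟨τ, hτ, hτc, hτp⟩ := exists_refForm (m := m) h hθ p c s
  obtain ⟨Q⟩ := exists_coordPartition n L
  have hI : 0 ≤ ∫ x in s..c, (p + x) ^ n * x ^ m := intervalIntegral.integral_nonneg hsc hP
  rw [hτc, topSelfIntersection, topSelfIntersection, intersectionNumber_deRhamClass fun _ => hτ,
    intersectionNumber_deRhamClass fun _ => hK.1, Q.integralWedge_blow fun _ => hτ.1,
    Q.integralWedge_base fun _ => hK.1.1, Finset.mul_sum]
  refine Finset.sum_congr rfl fun k _ => ?_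
  have hsub := Q.domain_subset k
  rw [setIntegral_fibre (Q.measurableSet_domain k)
    (g := density (fun _ => θ) (chartAt (Fin n → ℂ) (Q.centre k)))
    (C := (n + m + 1).factorial / n.factorial / Real.pi ^ (m + 1)) (by positivity)
    (f := fun z => fibreDensity m (fun x => (p + x) ^ n * x ^ m) c s (chartNorm h (Q.centre k) z))
    (K := Real.pi ^ (m + 1) / m.factorial * ∫ x in s..c, (p + x) ^ n * x ^ m)
    (mul_nonneg (by positivity) hI)
    ((continuousOn_density (fun _ => hτ.1) (blowHomeo_mem_atlas (Q.centre k) 0 false)).mono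
      fun u hu => hsub hu)
    ((continuousOn_density (fun _ => hK.1.1) (chart_mem_atlas _ (Q.centre k))).mono
      fun z hz => (hsub hz).1)
    (fun z hz => density_base_nonneg hK (hsub hz))
    (fun z hz w => fibreDensity_nonneg hsc hP (chartNorm_pos h (hsub hz)) w)
    (fun u hu => density_refForm h hθ (hτp _ 0 false) (hsub hu))
    (fun z hz => lintegral_fibre m (by fun_prop) hsc hP (chartNorm_pos h (hsub hz)))]
  have := Real.pi_ne_zero
  field_simp

lemma topSelfIntersection_refClass_nonpos (hK : IsKahlerForm θ)
    (hθ : ∀ x₀ x, x ∈ (trivializationAt ℂ L x₀).baseSet →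
      HasPotential θ x fun x => Real.log (h.frameNorm x₀ x)) {p c s : ℝ} (hsc : c ≤ s)
    (hc : 0 ≤ c) (hp : 0 ≤ p) :
    topSelfIntersection (refClass n L m (deRhamClass θ) p c s) ≤ 0 := by
  obtain ⟨τ, hτ, hτc, hτp⟩ := exists_refForm (m := m) h hθ p c s
  obtain ⟨Q⟩ := exists_coordPartition n L
  rw [hτc, topSelfIntersection, intersectionNumber_deRhamClass fun _ => hτ,
    Q.integralWedge_blow fun _ => hτ.1]
  refine Finset.sum_nonpos fun k _ => ?_
  have hsub := Q.domain_subset k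
  refine setIntegral_nonpos ((Q.measurableSet_domain k).preimage
    (projInl n m).continuous.measurable) fun u hu => ?_
  have hu' := hsub hu
  rw [density_refForm h hθ (hτp _ 0 false) hu']
  refine mul_nonpos_of_nonpos_of_nonneg (mul_nonpos_of_nonneg_of_nonpos (by positivity) ?_)
    (density_base_nonneg hK hu')
  have h1 := lineNorm_pos 0 (u ∘ Sum.inr)
  have h2 := chartNorm_pos h hu'
  rw [fibreDensity]
  set r := ‖(u ∘ Sum.inr) 0‖ ^ 2 * (chartNorm h (Q.centre k) (u ∘ Sum.inl) *
    lineNorm 0 (u ∘ Sum.inr)) with hr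
  have h3 : 0 ≤ r := by positivity
  have h4 : 0 ≤ s + (c - s) * (r / (1 + r)) := by
    have : s + (c - s) * (r / (1 + r)) = (s + c * r) / (1 + r) := by field_simp; ring
    rw [this]
    have := hc.trans hsc
    positivity
  refine mul_nonpos_of_nonpos_of_nonneg (mul_nonpos_of_nonneg_of_nonpos (by positivity)
    (mul_nonpos_of_nonpos_of_nonneg (sub_nonpos.2 hsc) (by positivity))) (by positivity)

end

end KahlerProj

namespace KahlerProj

noncomputable section

/-! ### Intersection numbers are preserved by the blow-down map -/

section BlowDownCoord

variable {n m : ℕ}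

lemma blowDownCoord_inr (u : Fin n ⊕ Fin (m + 1) → ℂ) (k : Fin (m + 1)) :
    blowDownCoord n 0 false u (Sum.inr k) =
      u (Sum.inr 0) * if k = 0 then 1 else u (Sum.inr k) := by
  simp [blowDownCoord, affine, blowPoint, blowLine, Function.update_apply]

lemma injOn_blowDownCoord (A : Set (Fin n → ℂ)) : InjOn (blowDownCoord n (0 : Fin (m + 1)) false)
    ({u | u ∘ Sum.inl ∈ A} ∩ {u | u (Sum.inr 0) ≠ 0}) := by
  rintro u ⟨-, hu⟩ u' - h
  have h0 : u (Sum.inr 0) = u' (Sum.inr 0) := by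
    simpa [blowDownCoord_inr] using congrFun h (Sum.inr 0)
  ext (l | k)
  · exact congrFun h (Sum.inl l)
  · by_cases hk : k = 0
    · rw [hk, h0]
    · have h1 := congrFun h (Sum.inr k)
      simp only [blowDownCoord_inr, if_neg hk, ← h0] at h1
      exact mul_left_cancel₀ hu h1

lemma image_blowDownCoord (A : Set (Fin n → ℂ)) : blowDownCoord n (0 : Fin (m + 1)) false ''
    ({u | u ∘ Sum.inl ∈ A} ∩ {u | u (Sum.inr 0) ≠ 0}) =
    {u | u ∘ Sum.inl ∈ A} ∩ {u | u (Sum.inr 0) ≠ 0} := by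
  ext u
  constructor
  · rintro ⟨u', ⟨h1, h2⟩, rfl⟩
    exact ⟨h1, by simpa [blowDownCoord_inr] using h2⟩
  · rintro ⟨h1, h2⟩
    refine ⟨Sum.elim (u ∘ Sum.inl) fun k => if k = 0 then u (Sum.inr 0) else
      u (Sum.inr k) / u (Sum.inr 0), ⟨h1, by simpa using h2⟩, ?_⟩
    ext (l | k)
    · rfl
    · by_cases hk : k = 0
      · subst hk; simp [blowDownCoord_inr]
      · simpa [blowDownCoord_inr, hk] using mul_div_cancel₀ _ h2

lemma setIntegral_ne_zero (A : Set (Fin n ⊕ Fin (m + 1) → ℂ))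
    (f : (Fin n ⊕ Fin (m + 1) → ℂ) → ℝ) :
    ∫ u in A ∩ {u | u (Sum.inr 0) ≠ 0}, f u = ∫ u in A, f u := by
  refine setIntegral_congr_set ?_
  filter_upwards [compl_mem_ae_iff.2 (volume_hyperplane (Sum.inr 0 : Fin n ⊕ Fin (m + 1)))] with u hu
  exact propext ⟨fun h => h.1, fun h => ⟨h, hu⟩⟩

end BlowDownCoord

variable {n m : ℕ} {M : Type*} [TopologicalSpace M] [ChartedSpace (Fin n → ℂ) M]
  [IsManifold 𝓘(ℂ, Fin n → ℂ) ω M]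
  {L : M → Type*} [∀ x, AddCommGroup (L x)] [∀ x, Module ℂ (L x)]
  [∀ x, TopologicalSpace (L x)] [TopologicalSpace (TotalSpace ℂ L)] [FiberBundle ℂ L]
  [VectorBundle ℂ ℂ L] [ContMDiffVectorBundle ω ℂ L 𝓘(ℂ, Fin n → ℂ)]

lemma contMDiff_real_blowDown : ContMDiff 𝓘(ℝ, Fin n ⊕ Fin (m + 1) → ℂ)
    𝓘(ℝ, Fin n ⊕ Fin (m + 1) → ℂ) ∞ (blowDown : BlowUp n L m → ProjBundle n L m) :=
  fun q => ContMDiffAt.complex_to_real (contMDiff_blowDown q)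

lemma projHomeo_comp_blowDown {x₀ : M} {u : Fin n ⊕ Fin (m + 1) → ℂ}
    (hu : u ∘ Sum.inl ∈ baseDomain L x₀) :
    projHomeo (L := L) x₀ none ∘ blowDown ∘ (blowHomeo x₀ (0 : Fin (m + 1)) false).symm
      =ᶠ[𝓝 u] blowDownCoord n 0 false := by
  filter_upwards [(blowHomeo (L := L) x₀ (0 : Fin (m + 1)) false).open_target.mem_nhds hu]
    with u' hu'
  have := projHomeo_blowDown (i := 0) (b := false) ((blowHomeo (L := L) x₀ (0 : Fin (m + 1)) false).map_target hu')
  rwa [OpenPartialHomeomorph.right_inv _ hu'] at this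

lemma inChart_pullback_blowDown (θ : RealForm (Fin n ⊕ Fin (m + 1)) (ProjBundle n L m) 2) {x₀ : M}
    {u : Fin n ⊕ Fin (m + 1) → ℂ} (hu : u ∘ Sum.inl ∈ baseDomain L x₀) :
    inChart (pullbackForm blowDown θ) (blowHomeo (L := L) x₀ 0 false) u =
      (inChart θ (projHomeo x₀ none) (blowDownCoord n 0 false u)).compContinuousLinearMap
        (fderiv ℝ (blowDownCoord n (0 : Fin (m + 1)) false) u) := by
  have he := projHomeo_comp_blowDown (m := m) hu
  have hs : blowDown ((blowHomeo (L := L) x₀ (0 : Fin (m + 1)) false).symm u) ∈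
      (projHomeo (L := L) x₀ none).source :=
    blowDown_mem_source (i := 0) (b := false)
      ((blowHomeo (L := L) x₀ (0 : Fin (m + 1)) false).map_target hu)
  have hd : MDifferentiableAt 𝓘(ℝ, Fin n ⊕ Fin (m + 1) → ℂ) 𝓘(ℝ, Fin n ⊕ Fin (m + 1) → ℂ)
      (blowDown : BlowUp n L m → ProjBundle n L m)
      ((blowHomeo (L := L) x₀ (0 : Fin (m + 1)) false).symm u) :=
    (contMDiff_real_blowDown _).mdifferentiableAt (by simp)
  have h0 : projHomeo (L := L) x₀ none (blowDown ((blowHomeo (L := L) x₀ (0 : Fin (m + 1))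
      false).symm u)) = blowDownCoord n 0 false u := he.self_of_nhds
  rw [inChart_pullbackForm θ (blowHomeo_mem_atlas x₀ 0 false) (projHomeo_mem_atlas x₀ none) hu
    hd hs, he.fderiv_eq, h0]

lemma density_pullback_blowDown (θ : Fin n ⊕ Fin (m + 1) →
    RealForm (Fin n ⊕ Fin (m + 1)) (ProjBundle n L m) 2) {x₀ : M} {u : Fin n ⊕ Fin (m + 1) → ℂ}
    (hu : u ∘ Sum.inl ∈ baseDomain L x₀) :
    density (fun j => pullbackForm blowDown (θ j)) (blowHomeo (L := L) x₀ 0 false) u =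
      |(fderiv ℝ (blowDownCoord n (0 : Fin (m + 1)) false) u).det| *
        density θ (projHomeo x₀ none) (blowDownCoord n 0 false u) := by
  have h2 : 0 ≤ (fderiv ℝ (blowDownCoord n (0 : Fin (m + 1)) false) u).det := by
    rw [fderiv_real_eq ((contDiffAt_blowDownCoord u).differentiableAt (by simp)),
      det_restrictScalars_eq]
    positivity
  rw [density, funext fun j => inChart_pullback_blowDown (θ j) hu, abs_of_nonneg h2]
  exact wedgeDensity_comp _ _

variable [T2Space M] [CompactSpace M]

lemma integralWedge_pullback_blowDown {θ : Fin n ⊕ Fin (m + 1) →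
    RealForm (Fin n ⊕ Fin (m + 1)) (ProjBundle n L m) 2} (hθ : ∀ j, θ j ∈ closedForms _ _) :
    integralWedge (fun j => pullbackForm (blowDown : BlowUp n L m → ProjBundle n L m) (θ j)) =
      integralWedge θ := by
  obtain ⟨Q⟩ := exists_coordPartition n L
  rw [Q.integralWedge_blow fun j => (pullbackForm_mem_closedForms contMDiff_real_blowDown (hθ j)).1,
    Q.integralWedge_proj fun j => (hθ j).1]
  refine Finset.sum_congr rfl fun k _ => ?_
  have hm : MeasurableSet ({u : Fin n ⊕ Fin (m + 1) → ℂ | u ∘ Sum.inl ∈ Q.domain k} ∩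
      {u | u (Sum.inr 0) ≠ 0}) :=
    ((Q.measurableSet_domain k).preimage (projInl n m).continuous.measurable).inter
      (isOpen_compl_singleton.preimage (continuous_apply _)).measurableSet
  rw [← setIntegral_ne_zero, ← setIntegral_ne_zero _ (density θ _)]
  conv_rhs => rw [← image_blowDownCoord]
  rw [integral_image_eq_integral_abs_det_fderiv_smul volume hm (fun u _ =>
    ((contDiffAt_blowDownCoord u).restrict_scalars ℝ |>.differentiableAt
      (by simp)).hasFDerivAt.hasFDerivWithinAt) (injOn_blowDownCoord _)]
  exact setIntegral_congr_fun hm fun u hu => density_pullback_blowDown _ (Q.domain_subset k hu.1)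

lemma intersectionNumber_pullback_blowDown
    (c : Fin n ⊕ Fin (m + 1) → DeRham2 (Fin n ⊕ Fin (m + 1)) (ProjBundle n L m)) :
    intersectionNumber (fun j => pullbackClass (blowDown : BlowUp n L m → ProjBundle n L m) (c j)) =
      intersectionNumber c := by
  rw [show (fun j => pullbackClass (blowDown : BlowUp n L m → ProjBundle n L m) (c j)) = fun j => deRhamClass
    (pullbackForm blowDown (representative (c j))) from rfl, intersectionNumber_deRhamClass fun j =>
      pullbackForm_mem_closedForms (contMDiff_real_blowDown (n := n) (L := L) (m := m)) (representative_mem _),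
    integralWedge_pullback_blowDown fun j => representative_mem _]
  rfl

lemma jSlope_pullback_blowDown
    (α β : DeRham2 (Fin n ⊕ Fin (m + 1)) (ProjBundle n L m)) :
    jSlope (n := n) (m := m) (pullbackClass (blowDown : BlowUp n L m → ProjBundle n L m) α)
      (pullbackClass (blowDown : BlowUp n L m → ProjBundle n L m) β) =
      jSlope α β := by
  have h' := intersectionNumber_pullback_blowDown (n := n) (L := L) (m := m) fun _ => α
  have h : intersectionNumber (pullbackClass (κ := Fin n ⊕ Fin (m + 1))
      (blowDown : BlowUp n L m → ProjBundle n L m) ∘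
      Function.update (fun _ => α) (Sum.inr 0) β) = _ :=
    intersectionNumber_pullback_blowDown (Function.update (fun _ => α) (Sum.inr 0) β)
  rw [Function.comp_update] at h
  exact congrArg₂ (fun x y : ℝ => (m + n + 1) * x / y) h h'

end

end KahlerProj

namespace KahlerProj

noncomputable section

/-! ### The Kähler classes among the reference classes -/

section Curve

variable {ι κ : Type*} [Fintype ι] [Fintype κ] [DecidableEq κ] [Nonempty κ]
  {Y : Type*} [TopologicalSpace Y] [ChartedSpace (ι → ℂ) Y] [IsManifold 𝓘(ℂ, ι → ℂ) ω Y]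
  {Z : Type*} [TopologicalSpace Z] [ChartedSpace (κ → ℂ) Z] [IsManifold 𝓘(ℂ, κ → ℂ) ω Z]
  [T2Space Z] [CompactSpace Z] [Nonempty Z]

/-- A form cannot be nonpositive along a compact submanifold if its class is Kähler. The
submanifold is given by an immersion which is affine in suitable charts. -/
lemma not_isKahlerClass_of_nonpos {f : Z → Y} {τ : RealForm ι Y 2} (hτ : τ ∈ closedForms ι Y)
    (H : ∀ z, ∃ c ∈ atlas (κ → ℂ) Z, z ∈ c.source ∧ ∃ c' ∈ atlas (ι → ℂ) Y,
      ∃ (D : (κ → ℂ) →L[ℂ] (ι → ℂ)) (a : ι → ℂ), Function.Injective D ∧ D (c z) + a ∈ c'.target ∧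
      (∀ᶠ y in 𝓝 z, f y = c'.symm (D (c y) + a)) ∧
      (∀ v w, inChart τ c' (D (c z) + a) ![Complex.I • v, Complex.I • w] =
        inChart τ c' (D (c z) + a) ![v, w]) ∧
      ∀ v, inChart τ c' (D (c z) + a) ![D v, Complex.I • D v] ≤ 0) :
    ¬ IsKahlerClass (deRhamClass τ) := by
  rintro ⟨τ', hK, hcl⟩
  have hf : ContMDiff 𝓘(ℂ, κ → ℂ) 𝓘(ℂ, ι → ℂ) ω f := by
    intro z
    obtain ⟨c, hc, hz, c', hc', D, a, -, ht, he, -⟩ := H z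
    exact (contMDiffAt_of_charts hc hc' hz (F := fun u => D u + a)
      (D.contDiff.contDiffAt.add contDiffAt_const) ht fun _ _ => rfl).congr_of_eventuallyEq he
  have hfr : ContMDiff 𝓘(ℝ, κ → ℂ) 𝓘(ℝ, ι → ℂ) ∞ f :=
    fun z => ContMDiffAt.complex_to_real (hf z)
  have hd : τ' - τ ∈ closedForms ι Y := (closedForms ι Y).sub_mem hK.1 hτ
  have hex : τ' - τ ∈ exactForms ι Y := (deRhamClass_eq_iff hK.1 hτ).1 hcl
  have hp : IsKahlerForm (pullbackForm (κ := κ) f (τ' - τ)) := by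
    refine isKahlerForm_of_isPositive (pullbackForm_mem_closedForms hfr hd) fun z => ?_
    obtain ⟨c, hc, hz, c', hc', D, a, hD, ht, he, hJ, hn⟩ := H z
    refine ⟨c, hc, hz, ?_⟩
    have hl : c.symm (c z) = z := c.left_inv hz
    have hfz : f (c.symm (c z)) ∈ c'.source := by
      rw [hl, he.self_of_nhds]; exact c'.map_target ht
    have hF : c' ∘ f ∘ c.symm =ᶠ[𝓝 (c z)] fun u => D u + a := by
      have ho : ∀ᶠ u in 𝓝 (c z), D u + a ∈ c'.target :=
        (by fun_prop : ContinuousAt (fun u => D u + a) (c z)).eventually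
          (c'.open_target.mem_nhds ht)
      have he' := c.symm.continuousAt (c.map_source hz)
      rw [ContinuousAt, hl] at he'
      filter_upwards [c.open_target.mem_nhds (c.map_source hz), ho, he'.eventually he]
        with u hu hu' hu''
      simp only [Function.comp_apply]
      rw [hu'', c.right_inv hu, c'.right_inv hu']
    have hF' : HasFDerivAt (fun u => D u + a) (D.restrictScalars ℝ) (c z) :=
      (D.restrictScalars ℝ).hasFDerivAt.add_const a
    have h0 : c' (f (c.symm (c z))) = D (c z) + a := hF.self_of_nhds
    rw [inChart_pullbackForm _ hc hc' (c.map_source hz) ((hfr _).mdifferentiableAt (by simp)) hfz,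
      hF.fderiv_eq, hF'.fderiv, h0]
    have h1 : ∀ v w, inChart (τ' - τ) c' (D (c z) + a) ![v, w] =
        inChart τ' c' (D (c z) + a) ![v, w] - inChart τ c' (D (c z) + a) ![v, w] :=
      fun v w => rfl
    have h2 := hK.isPositive hc' ht
    refine ⟨fun v w => ?_, fun v hv => ?_⟩
    · simp only [two_comp, ContinuousLinearMap.coe_restrictScalars', map_smul, h1, hJ, h2.1]
    · simp only [two_comp, ContinuousLinearMap.coe_restrictScalars', map_smul, h1]
      have h3 := h2.2 (D v) fun h => hv (hD (h.trans (map_zero D).symm))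
      linarith [hn v]
  refine hp.deRhamClass_ne_zero ?_
  rw [deRhamClass, dif_pos hp.1, Submodule.Quotient.mk_eq_zero]
  exact pullbackForm_mem_exactForms hfr hex

end Curve

variable {n m : ℕ} {M : Type*} [TopologicalSpace M] [ChartedSpace (Fin n → ℂ) M]
  [IsManifold 𝓘(ℂ, Fin n → ℂ) ω M]
  {L : M → Type*} [∀ x, AddCommGroup (L x)] [∀ x, Module ℂ (L x)]
  [∀ x, TopologicalSpace (L x)] [TopologicalSpace (TotalSpace ℂ L)] [FiberBundle ℂ L]
  [VectorBundle ℂ ℂ L]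

variable (n) in
/-- The point of the exceptional divisor over `x` given by the line spanned by `Λ`. -/
def excPoint (x : M) (Λ : Fin (m + 1) → L x) (hΛ : Λ ≠ 0) : BlowUp n L m where
  base := x
  point := .mk ℂ _ (one_zero_ne_zero x)
  line := .mk ℂ Λ hΛ
  mem_line := by
    intro v hv
    rw [Projectivization.submodule_mk, Submodule.mem_span_singleton] at hv
    obtain ⟨c, rfl⟩ := hv
    simp

lemma eq_symm_excPoint {x₀ x : M} (hx : x ∈ coordSet n L x₀) (Λ : Fin (m + 1) → L x) (hΛ : Λ ≠ 0)
    {i : Fin (m + 1)} (hi : homL x₀ x Λ i ≠ 0) :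
    excPoint n x Λ hΛ = (blowHomeo x₀ i false).symm (Sum.elim (chartAt (Fin n → ℂ) x₀ x)
      fun k => if k = i then 0 else homL x₀ x Λ k / homL x₀ x Λ i) := by
  obtain ⟨r, hr, h1⟩ := rep_mk (one_zero_ne_zero (L := L) (m := m) x)
  obtain ⟨r', hr', h2⟩ := rep_mk hΛ
  have h3 : hom x₀ x (excPoint n x Λ hΛ).point.rep =
      r • hom x₀ x ((1, 0) : ℂ × (Fin (m + 1) → L x)) := by
    rw [← hom_smul, ← h1]; rfl
  have h4 : homL x₀ x (excPoint n x Λ hΛ).line.rep = r' • homL x₀ x Λ := by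
    rw [← homL_smul, ← h2]; rfl
  have h5 : hom (m := m) x₀ x ((1, 0) : ℂ × (Fin (m + 1) → L x)) (some i) = 0 :=
    map_zero (coord x₀ x)
  have hs : excPoint n x Λ hΛ ∈ (blowHomeo x₀ i false).source := by
    refine mem_blowHomeo_source.2 ⟨hx, ?_⟩
    change BlowDefined i false (hom x₀ x _) (homL x₀ x _)
    rw [h3, h4, blowDefined_smul i false hr hr']
    exact ⟨one_ne_zero, hi⟩
  rw [← (blowHomeo x₀ i false).left_inv hs]
  congr 1
  refine (Sum.elim_comp_inl_inr _).symm.trans (congrArg₂ Sum.elim blowHomeo_inl ?_)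
  rw [blowHomeo_inr]
  change blowCoord i false (hom x₀ x _) (homL x₀ x _) = _
  rw [h3, h4, blowCoord_smul i false hr hr', blowCoord, cond_false, h5, zero_div]
  ext k
  rw [Function.update_apply]

variable [ContMDiffVectorBundle ω ℂ L 𝓘(ℂ, Fin n → ℂ)]
  (h : HermitianMetric (ι := Fin n) L) {θ : RealForm (Fin n) M 2}

lemma momentum_pos (x₀ : M) (i : Fin (m + 1)) (b : Bool) {c s : ℝ} (hs : 0 < s) (hsc : s < c)
    (u : Fin n ⊕ Fin (m + 1) → ℂ) : 0 < momentum h x₀ i b c s u := by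
  obtain ⟨h1, h2⟩ := fibreRatio_mem h x₀ i b u
  cases b <;> simp only [momentum, fibreSign, cond_false, cond_true] <;>
    nlinarith [sub_pos.2 hsc]

/-- The reference form is positive for `0 < s < c`. -/
theorem isKahlerClass_refClass (hK : IsKahlerForm θ)
    (hθ : ∀ x₀ x, x ∈ (trivializationAt ℂ L x₀).baseSet →
      HasPotential θ x fun x => Real.log (h.frameNorm x₀ x)) {c s : ℝ} (hs : 0 < s) (hsc : s < c) :
    IsKahlerClass (refClass n L m (deRhamClass θ) 1 c s) := by
  obtain ⟨τ, hτ, hτc, hτp⟩ := exists_refForm (m := m) h hθ 1 c s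
  refine ⟨τ, isKahlerForm_of_isPositive hτ fun q => ?_, hτc.symm⟩
  obtain ⟨i, b, hq, -⟩ := exists_mem_blowHomeo_source q (mem_coordSet q.base)
  refine ⟨_, blowHomeo_mem_atlas q.base i b, hq, ?_⟩
  have hu := (blowHomeo q.base i b).map_source hq
  refine ⟨HasPotential.inChart_invariant (blowHomeo_mem_atlas _ i b) hu
    (hτp _ i b _ ((blowHomeo q.base i b).map_target hu)), fun v hv => ?_⟩
  rw [refForm_quadratic h hθ (hτp _ i b) hu]
  generalize blowHomeo q.base i b q = u at hu
  have hP := momentum_pos h q.base i b hs hsc u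
  have hV := mul_pos (sub_pos.2 hsc) (verticalCoeff_pos h q.base i b u)
  have hθ' := hK.isPositive (chart_mem_atlas _ q.base) (show u ∘ Sum.inl ∈ _ from hu.1)
  have hF := fubiniStudy_nonneg i (u ∘ Sum.inr) (v ∘ Sum.inr)
  have hπ := Real.pi_pos
  by_cases h1 : v ∘ Sum.inl = 0
  · have h0 : inChart θ (chartAt (Fin n → ℂ) q.base) (u ∘ Sum.inl)
        ![v ∘ Sum.inl, Complex.I • (v ∘ Sum.inl)] = 0 := by
      rw [h1, ← zero_smul ℝ (0 : Fin n → ℂ), two_smul_left, zero_mul]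
    rw [h0, mul_zero, zero_add]
    refine div_pos ?_ hπ
    by_cases h2 : lineVec i (v ∘ Sum.inr) = 0
    · have h3 : v = v (Sum.inr i) • Pi.single (Sum.inr i) 1 := by
        ext (l | k)
        · simpa using congrFun h1 l
        · by_cases hk : k = i
          · subst hk; simp
          · simpa [lineVec, hk] using congrFun h2 k
      have h4 : v (Sum.inr i) ≠ 0 := fun h4 => hv (by rw [h3, h4, zero_smul])
      have h5 : verticalPart h q.base i b u v = v (Sum.inr i) := by
        have : del (logFrame h q.base i) u v = 0 := by
          rw [h3, map_smul, del_logFrame_single h hu, smul_zero]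
        rw [verticalPart, this]; simp
      rw [h5]
      have := norm_pos_iff.2 h4
      positivity
    · have := fubiniStudy_pos i (u ∘ Sum.inr) h2
      positivity
  · have := hθ'.2 _ h1
    have : 0 < 1 + momentum h q.base i b c s u := by linarith
    positivity

/-- The reference form along directions tangent to the exceptional divisor. -/
lemma refForm_excDivisor (hθ : ∀ x₀ x, x ∈ (trivializationAt ℂ L x₀).baseSet →
      HasPotential θ x fun x => Real.log (h.frameNorm x₀ x)) {x₀ : M} {i : Fin (m + 1)} {p c s : ℝ}
    {τ : RealForm (Fin n ⊕ Fin (m + 1)) (BlowUp n L m) 2}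
    (hτ : ∀ q ∈ (blowHomeo (L := L) x₀ i false).source,
        HasPotential τ q fun q => refPotential h x₀ i false p c s (blowHomeo x₀ i false q))
    {u v : Fin n ⊕ Fin (m + 1) → ℂ} (hu : u ∘ Sum.inl ∈ baseDomain L x₀)
    (hui : u (Sum.inr i) = 0) (hvi : v (Sum.inr i) = 0) :
    inChart τ (blowHomeo (L := L) x₀ i false) u ![v, Complex.I • v] =
      (p + s) * inChart θ (chartAt (Fin n → ℂ) x₀) (u ∘ Sum.inl)
        ![v ∘ Sum.inl, Complex.I • (v ∘ Sum.inl)] +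
      s * fubiniStudy i (u ∘ Sum.inr) (v ∘ Sum.inr) / Real.pi := by
  rw [refForm_quadratic h hθ hτ hu]
  simp [momentum, fibreRatio, verticalPart, hui, hvi]

/-- A tangent map into the exceptional divisor. -/
def excTangent {κ : Type*} [Fintype κ] (T : (κ → ℂ) →L[ℂ] (Fin n → ℂ))
    (S : Fin (m + 1) → ((κ → ℂ) →L[ℂ] ℂ)) : (κ → ℂ) →L[ℂ] (Fin n ⊕ Fin (m + 1) → ℂ) :=
  ContinuousLinearMap.pi (Sum.elim (fun l => (ContinuousLinearMap.proj l).comp T) S)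

variable [T2Space M] [CompactSpace M] [Nonempty M]

lemma neg_one_lt_of_isKahlerClass (hn : 0 < n) (hK : IsKahlerForm θ)
    (hθ : ∀ x₀ x, x ∈ (trivializationAt ℂ L x₀).baseSet →
      HasPotential θ x fun x => Real.log (h.frameNorm x₀ x)) {c s : ℝ}
    (hs : IsKahlerClass (refClass n L m (deRhamClass θ) 1 c s)) : -1 < s := by
  obtain ⟨τ, hτ, hτc, hτp⟩ := exists_refForm (m := m) h hθ 1 c s
  rw [hτc] at hs
  by_contra! hle
  have : Nonempty (Fin n) := ⟨⟨0, hn⟩⟩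
  have hΛ : ∀ x : M, (fun k => (Pi.single 0 1 : Fin (m + 1) → ℂ) k • frame x x :
      Fin (m + 1) → L x) ≠ 0 := fun x =>
    unhomL_ne_zero (Λ := Pi.single 0 1) (mem_baseSet_trivializationAt ℂ L x) (by simp)
  let D : (Fin n → ℂ) →L[ℂ] (Fin n ⊕ Fin (m + 1) → ℂ) := excTangent (.id ℂ _) 0
  have hD1 : ∀ v, D v ∘ Sum.inl = v := fun v => rfl
  have hD2 : ∀ v, D v ∘ Sum.inr = 0 := fun v => rfl
  have ht : ∀ x : M, D (chartAt (Fin n → ℂ) x x) + 0 ∈ (blowHomeo (L := L) x 0 false).target :=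
    fun x => by
      rw [add_zero, mem_blowHomeo_target, hD1]
      exact ⟨mem_chart_target _ x, by
        rw [mem_preimage, (chartAt _ x).left_inv (mem_chart_source _ x)]
        exact mem_baseSet_trivializationAt ℂ L x⟩
  refine not_isKahlerClass_of_nonpos (f := fun x : M => excPoint n x _ (hΛ x)) hτ (fun x =>
    ⟨chartAt _ x, chart_mem_atlas _ x, mem_chart_source _ x, blowHomeo x 0 false,
      blowHomeo_mem_atlas x 0 false, D, 0, fun v w hvw => congrArg (· ∘ Sum.inl) hvw, ht x, ?_,
      HasPotential.inChart_invariant (blowHomeo_mem_atlas x 0 false) (ht x)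
        (hτp _ 0 false _ ((blowHomeo x 0 false).map_target (ht x))), fun v => ?_⟩) hs
  · filter_upwards [(isOpen_coordSet x).mem_nhds (mem_coordSet (n := n) (L := L) x)] with y hy
    have hg := transition_ne_zero (mem_baseSet_trivializationAt ℂ L y) hy.2
    rw [eq_symm_excPoint (i := 0) hy _ _ (by rw [homL_unhomL]; simpa using hg), homL_unhomL]
    congr 1
    ext (l | k)
    · exact (add_zero _).symm
    · by_cases hk : k = 0
      · simp [hk, D, excTangent]
      · simp [hk, D, excTangent]
  · have h1 := refForm_excDivisor h hθ (hτp x 0 false) (ht x) (v := D v) (add_zero _) rfl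
    have h2 : lineVec 0 (D v ∘ Sum.inr) = 0 := by
      rw [hD2]; simp [lineVec]
    have h3 : fubiniStudy 0 ((D (chartAt (Fin n → ℂ) x x) + 0) ∘ Sum.inr) (D v ∘ Sum.inr) = 0 := by
      rw [fubiniStudy, h2]; simp
    rw [h1, h3, mul_zero, zero_div, add_zero]
    refine mul_nonpos_of_nonpos_of_nonneg (by linarith) ?_
    have h4 := hK.isPositive (chart_mem_atlas _ x) (ht x).1
    by_cases hv : v = 0
    · subst hv
      have : D 0 ∘ Sum.inl = (0 : ℝ) • (0 : Fin n → ℂ) := by simp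
      rw [this, two_smul_left, zero_mul]
    · exact (h4.2 v hv).le

/-- The projective space of dimension `m + 1`, as a projective bundle over a point. -/
abbrev ProjSpace (m : ℕ) : Type := ProjBundle 0 (Bundle.Trivial (Fin 0 → ℂ) ℂ) m

/-- The homogeneous coordinates on a projective space, renumbered. -/
def projVec {m : ℕ} (p : ProjSpace m) : Fin (m + 2) → ℂ :=
  fun k => hom (0 : Fin 0 → ℂ) p.base p.point.rep (finSuccEquiv (m + 1) k)

lemma pos_of_isKahlerClass {m : ℕ} (hθ : ∀ x₀ x, x ∈ (trivializationAt ℂ L x₀).baseSet →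
      HasPotential θ x fun x => Real.log (h.frameNorm x₀ x)) {c s : ℝ}
    (hs : IsKahlerClass (refClass n L (m + 1) (deRhamClass θ) 1 c s)) : 0 < s := by
  obtain ⟨τ, hτ, hτc, hτp⟩ := exists_refForm (m := m + 1) h hθ 1 c s
  rw [hτc] at hs
  by_contra! hle
  obtain ⟨x⟩ := ‹Nonempty M›
  have hx := mem_coordSet (n := n) (L := L) x
  have h0 : ∀ p : ProjSpace m, p.base ∈ coordSet 0 (Bundle.Trivial (Fin 0 → ℂ) ℂ) 0 := fun p =>
    Subsingleton.elim (0 : Fin 0 → ℂ) p.base ▸ mem_coordSet _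
  have hΛ : ∀ p : ProjSpace m, (fun k => projVec p k • frame x x : Fin (m + 2) → L x) ≠ 0 :=
    fun p => unhomL_ne_zero (Λ := projVec p) hx.2 fun hp => hom_ne_zero (h0 p).2 p.point.rep_nonzero <| by
      ext o
      simpa [projVec] using congrFun hp ((finSuccEquiv (m + 1)).symm o)
  have : Nonempty (ProjSpace m) := ⟨⟨0, .mk ℂ (1, 0) (one_zero_ne_zero _)⟩⟩
  let S : Option (Fin (m + 1)) → Fin (m + 2) → ((Fin 0 ⊕ Fin (m + 1) → ℂ) →L[ℂ] ℂ) := fun o k =>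
    (Equiv.swap none o (finSuccEquiv (m + 1) k)).elim 0 fun j => .proj (Sum.inr j)
  have hS : ∀ o k u, finSuccEquiv (m + 1) k ≠ o →
      S o k u = homogenize o (u ∘ Sum.inr) (finSuccEquiv (m + 1) k) := by
    intro o k u hk
    simp only [S, homogenize]
    rcases hj : Equiv.swap none o (finSuccEquiv (m + 1) k) with _ | j
    · exact absurd (by simpa using congrArg (Equiv.swap none o) hj) hk
    · rfl
  have hS0 : ∀ o u, S o ((finSuccEquiv (m + 1)).symm o) u = 0 := by
    intro o u; simp [S]
  have hSe : ∀ o j u, S o ((finSuccEquiv (m + 1)).symm (Equiv.swap none o (some j))) u =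
      u (Sum.inr j) := by
    intro o j u; simp [S]
  let D := fun o => excTangent (n := n) (m := m + 1) 0 (S o)
  let a : Fin n ⊕ Fin (m + 2) → ℂ := Sum.elim (chartAt (Fin n → ℂ) x x) 0
  have ht : ∀ o u i, D o u + a ∈ (blowHomeo (L := L) x i false).target := fun o u i => by
    have : (D o u + a) ∘ Sum.inl = chartAt (Fin n → ℂ) x x := by
      ext l; simp [D, a, excTangent]
    rw [mem_blowHomeo_target, this]
    exact ⟨mem_chart_target _ x, by
      rw [mem_preimage, (chartAt _ x).left_inv (mem_chart_source _ x)]; exact hx.2⟩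
  refine not_isKahlerClass_of_nonpos (κ := Fin 0 ⊕ Fin (m + 1)) (f := fun p : ProjSpace m => excPoint n x _ (hΛ p)) hτ
    (fun p => ?_) hs
  obtain ⟨o, ho, -⟩ := exists_mem_projHomeo_source p (h0 p)
  refine ⟨projHomeo 0 o, projHomeo_mem_atlas _ o, ho,
    blowHomeo x ((finSuccEquiv (m + 1)).symm o) false, blowHomeo_mem_atlas _ _ _, D o, a,
    fun v w hvw => ?_, ht _ _ _, ?_, HasPotential.inChart_invariant (blowHomeo_mem_atlas _ _ _)
      (ht _ _ _) (hτp _ _ false _ ((blowHomeo x _ false).map_target (ht _ _ _))), fun v => ?_⟩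
  · ext (l | j)
    · exact l.elim0
    · rw [← hSe o j v, ← hSe o j w]
      exact congrFun hvw (Sum.inr _)
  · filter_upwards [(projHomeo 0 o).open_source.mem_nhds ho] with q hq
    have hW := (mem_projHomeo_source.1 hq).2
    have h1 : projVec q ((finSuccEquiv (m + 1)).symm o) ≠ 0 := by simpa [projVec] using hW
    have h2 : homL x x (fun k => projVec q k • frame x x : Fin (m + 2) → L x) = projVec q := by
      rw [homL_unhomL, show transition L x x x = 1 from coord_frame hx.2, one_smul]
    rw [eq_symm_excPoint hx _ _ (by rwa [h2]), h2]
    congr 1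
    ext (l | k)
    · simp [D, a, excTangent]
    · have h3 : (D o (projHomeo 0 o q) + a) (Sum.inr k) = S o k (projHomeo 0 o q) := add_zero _
      rw [h3, Sum.elim_inr]
      by_cases hk : k = (finSuccEquiv (m + 1)).symm o
      · rw [if_pos hk, hk, hS0]
      · rw [if_neg hk, hS _ _ _ fun h => hk (by rw [← h]; simp), projHomeo_inr,
          homogenize_affine _ hW]
        simp [projVec, div_eq_inv_mul]
  · rw [refForm_excDivisor h hθ (i := (finSuccEquiv (m + 1)).symm o) (hτp _ _ false) (ht _ _ 0)
      ((add_zero _).trans (hS0 _ _)) (hS0 _ _)]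
    have h2 : D o v ∘ Sum.inl = (0 : ℝ) • (0 : Fin n → ℂ) := by
      ext l; simp [D, excTangent]
    rw [h2, two_smul_left, zero_mul, mul_zero, zero_add]
    exact div_nonpos_of_nonpos_of_nonneg (mul_nonpos_of_nonpos_of_nonneg hle
      (fubiniStudy_nonneg _ _ _)) Real.pi_pos.le

end

end KahlerProj

namespace KahlerProj

noncomputable section

/-! ### The slopes and the boundary value problem -/

section Slopes

variable {m n k : ℕ} {a b s x : ℝ}

lemma continuous_weight (m n : ℕ) : Continuous fun t : ℝ => (1 + t) ^ n * t ^ m := by fun_prop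

lemma hasDerivAt_integralI_right (m n : ℕ) (s x : ℝ) :
    HasDerivAt (integralI m n s) ((1 + x) ^ n * x ^ m) x :=
  intervalIntegral.integral_hasDerivAt_right ((continuous_weight m n).intervalIntegrable _ _)
    ((continuous_weight m n).stronglyMeasurableAtFilter _ _) (continuous_weight m n).continuousAt

lemma hasDerivAt_integralI_left (m n : ℕ) (s x : ℝ) :
    HasDerivAt (fun s => integralI m n s x) (-((1 + s) ^ n * s ^ m)) s :=
  intervalIntegral.integral_hasDerivAt_left ((continuous_weight m n).intervalIntegrable _ _)
    ((continuous_weight m n).stronglyMeasurableAtFilter _ _) (continuous_weight m n).continuousAt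

/-- The range of parameters for which the reference volume forms are positive. -/
def Admissible (m : ℕ) (a s : ℝ) : Prop := -1 < s ∧ s < a ∧ (0 ≤ s ∨ m = 0)

lemma admissible_of_mem (hs : s ∈ Ico 0 a) : Admissible m a s :=
  ⟨by linarith [hs.1], hs.2, Or.inl hs.1⟩

lemma Admissible.pow_pos (h : Admissible m a s) (hx : s < x) : 0 < x ^ m := by
  rcases h.2.2 with h0 | rfl
  · exact _root_.pow_pos (h0.trans_lt hx) m
  · simp

lemma Admissible.pow_nonneg (h : Admissible m a s) (hx : s ≤ x) : 0 ≤ x ^ m := by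
  rcases h.2.2 with h0 | rfl
  · exact _root_.pow_nonneg (h0.trans hx) m
  · simp

lemma Admissible.weight_pos (h : Admissible m a s) (hx : s < x) : 0 < (1 + x) ^ n * x ^ m :=
  mul_pos (_root_.pow_pos (by linarith [h.1]) n) (h.pow_pos hx)

lemma Admissible.integralI_pos (h : Admissible m a s) (hx : s < x) : 0 < integralI m n s x :=
  intervalIntegral.intervalIntegral_pos_of_pos_on
    ((continuous_weight m n).intervalIntegrable _ _) (fun _ ht => h.weight_pos ht.1) hx

/-- The numerator of `μ_s`. -/
def slopeNum (m n : ℕ) (a b s : ℝ) : ℝ := (1 + a) ^ n * a ^ m * b + n * integralI m (n - 1) s a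

lemma Admissible.slopeNum_pos (h : Admissible m a s) (hb : 0 < b) : 0 < slopeNum m n a b s := by
  have h1 := h.weight_pos (n := n) h.2.1
  have h2 := h.integralI_pos (n := n - 1) h.2.1
  rw [slopeNum]
  positivity

lemma integralI_sub (m n : ℕ) (s t x : ℝ) :
    integralI m n s x = integralI m n s t + integralI m n t x :=
  (intervalIntegral.integral_add_adjacent_intervals
    ((continuous_weight m n).intervalIntegrable _ _)
    ((continuous_weight m n).intervalIntegrable _ _)).symm

/-- The function whose sign determines the monotonicity of `μ_s`. -/
def slopeSign (m n : ℕ) (a b s : ℝ) : ℝ := slopeNum m n a b s * (1 + s) - n * integralI m n s a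

lemma hasDerivAt_slopeSign (s : ℝ) :
    HasDerivAt (slopeSign m (k + 1) a b) (slopeNum m (k + 1) a b s) s := by
  have h1 : HasDerivAt (slopeNum m (k + 1) a b) (((k + 1 : ℕ) : ℝ) * -((1 + s) ^ k * s ^ m)) s :=
    ((hasDerivAt_integralI_left m k s a).const_mul _).const_add _
  have h2 := (h1.mul ((hasDerivAt_id s).const_add 1)).sub
    ((hasDerivAt_integralI_left m (k + 1) s a).const_mul ((k + 1 : ℕ) : ℝ))
  refine h2.congr_deriv ?_
  simp only [id_eq]
  ring

lemma slopeSign_lt (hb : 0 < b) {t : ℝ} (hs : 0 ≤ s) (hst : s < t) (ht : t < a) :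
    slopeSign m (k + 1) a b s < slopeSign m (k + 1) a b t := by
  refine strictMonoOn_of_deriv_pos (convex_Icc s t)
    (fun x _ => (hasDerivAt_slopeSign x).continuousAt.continuousWithinAt) (fun x hx => ?_)
    (left_mem_Icc.2 hst.le) (right_mem_Icc.2 hst.le) hst
  rw [interior_Icc] at hx
  rw [(hasDerivAt_slopeSign x).deriv]
  exact (admissible_of_mem (m := m) (a := a)
    ⟨hs.trans hx.1.le, hx.2.trans ht⟩).slopeNum_pos hb

/-- The primitive `ψ (1 + x)ⁿ xᵐ` of the boundary value problem. -/
def primitive (m k : ℕ) (a b s x : ℝ) : ℝ :=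
  muS m (k + 1) a b s * integralI m (k + 1) s x - ((k + 1 : ℕ) : ℝ) * integralI m k s x

lemma hasDerivAt_primitive (x : ℝ) : HasDerivAt (primitive m k a b s)
    ((1 + x) ^ k * x ^ m * (muS m (k + 1) a b s * (1 + x) - (k + 1 : ℕ))) x := by
  refine (((hasDerivAt_integralI_right m (k + 1) s x).const_mul _).sub
    ((hasDerivAt_integralI_right m k s x).const_mul _)).congr_deriv ?_
  ring

lemma primitive_self : primitive m k a b s s = 0 := by
  simp [primitive, integralI]

lemma muS_eq : muS m (k + 1) a b s = slopeNum m (k + 1) a b s / integralI m (k + 1) s a := rfl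

lemma Admissible.slopeSign_eq (h : Admissible m a s) : slopeSign m (k + 1) a b s =
    integralI m (k + 1) s a * (muS m (k + 1) a b s * (1 + s) - (k + 1 : ℕ)) := by
  have := (h.integralI_pos (n := k + 1) h.2.1).ne'
  rw [muS_eq, slopeSign]
  field_simp

lemma Admissible.primitive_right (h : Admissible m a s) :
    primitive m k a b s a = (1 + a) ^ (k + 1) * a ^ m * b := by
  have := (h.integralI_pos (n := k + 1) h.2.1).ne'
  rw [primitive, muS_eq, div_mul_cancel₀ _ this, slopeNum, Nat.add_sub_cancel]
  ring

/-- A zero of `slopeSign` is the strict minimum of `μ_s`. -/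
lemma muS_lt_of_slopeSign_eq_zero {s₀ : ℝ} (h₀ : s₀ ∈ Ico 0 a)
    (hz : slopeSign m (k + 1) a b s₀ = 0) (h : Admissible m a s) (hne : s ≠ s₀) :
    muS m (k + 1) a b s₀ < muS m (k + 1) a b s := by
  have A₀ := admissible_of_mem (m := m) h₀
  have hp : 0 < 1 + s₀ := by linarith [h₀.1]
  have hD := h.integralI_pos (n := k + 1) h.2.1
  set c := muS m (k + 1) a b s₀ with hc
  have hc1 : c * (1 + s₀) = (k + 1 : ℕ) := by
    rw [A₀.slopeSign_eq] at hz
    linarith [(mul_eq_zero.1 hz).resolve_left (A₀.integralI_pos A₀.2.1).ne']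
  have hc0 : 0 < c := by
    have : (0 : ℝ) < (k + 1 : ℕ) := by positivity
    rw [← hc1] at this
    exact (mul_pos_iff_of_pos_right hp).1 this
  have hN : slopeNum m (k + 1) a b s₀ = c * integralI m (k + 1) s₀ a := by
    rw [hc, muS_eq, div_mul_cancel₀ _ (A₀.integralI_pos A₀.2.1).ne']
  have e1 : ((k + 1 : ℕ) : ℝ) * integralI m k s s₀ - c * integralI m (k + 1) s s₀ =
      c * ∫ t in s..s₀, (1 + t) ^ k * t ^ m * (s₀ - t) := by
    rw [integralI, integralI, ← intervalIntegral.integral_const_mul,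
      ← intervalIntegral.integral_const_mul, ← intervalIntegral.integral_const_mul,
      ← intervalIntegral.integral_sub (Continuous.intervalIntegrable (by fun_prop) _ _)
        (Continuous.intervalIntegrable (by fun_prop) _ _)]
    refine intervalIntegral.integral_congr fun t _ => ?_
    rw [← hc1]
    ring
  have hI : 0 < ∫ t in s..s₀, (1 + t) ^ k * t ^ m * (s₀ - t) := by
    rcases lt_or_gt_of_ne hne with hlt | hgt
    · exact intervalIntegral.intervalIntegral_pos_of_pos_on
        (Continuous.intervalIntegrable (by fun_prop) _ _)
        (fun t ht => mul_pos (h.weight_pos ht.1) (sub_pos.2 ht.2)) hlt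
    · rw [intervalIntegral.integral_symm, ← intervalIntegral.integral_neg]
      exact intervalIntegral.intervalIntegral_pos_of_pos_on
        (Continuous.intervalIntegrable (by fun_prop) _ _)
        (fun t ht => by nlinarith [mul_pos (A₀.weight_pos (n := k) ht.1) (sub_pos.2 ht.1)]) hgt
  rw [muS_eq (s := s), lt_div_iff₀ hD]
  have e2 : slopeNum m (k + 1) a b s = slopeNum m (k + 1) a b s₀ + (k + 1 : ℕ) * integralI m k s s₀ := by
    simp only [slopeNum, Nat.add_sub_cancel]
    rw [integralI_sub m k s s₀ a]
    ring
  rw [e2, hN, integralI_sub m (k + 1) s s₀ a]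
  nlinarith [mul_pos hc0 hI]

lemma exists_solution (ha : 0 < a) (hs : s ∈ Ioo 0 a) (hF : 0 < slopeSign m (k + 1) a b s) :
    ∃ ψ : ℝ → ℝ, SolvesODE m (k + 1) a b s ψ ∧ ∀ x ∈ Ioc s a, 0 < ψ x := by
  have A := admissible_of_mem (m := m) ⟨hs.1.le, hs.2⟩
  have hw : ∀ x, s ≤ x → 0 < (1 + x) ^ (k + 1) * x ^ m := fun x hx => by
    have := hs.1.trans_le hx
    positivity
  have hmu : 0 < muS m (k + 1) a b s * (1 + s) - (k + 1 : ℕ) := by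
    rw [A.slopeSign_eq] at hF
    exact (mul_pos_iff_of_pos_left (A.integralI_pos (n := k + 1) A.2.1)).1 hF
  have hd : ∀ x, s ≤ x → HasDerivAt (fun x => primitive m k a b s x / ((1 + x) ^ (k + 1) * x ^ m))
      (muS m (k + 1) a b s - ((k + 1 : ℕ) : ℝ) / (1 + x) -
        primitive m k a b s x / ((1 + x) ^ (k + 1) * x ^ m) *
        (((k + 1 : ℕ) : ℝ) / (1 + x) + m / x)) x := by
    intro x hx
    have hx0 : 0 < x := hs.1.trans_le hx
    have h1 := (((hasDerivAt_id x).const_add 1).pow (k + 1)).mul ((hasDerivAt_id x).pow m)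
    refine ((hasDerivAt_primitive x).div h1 (hw x hx).ne').congr_deriv ?_
    have h2 : (m : ℝ) * x ^ (m - 1) * 1 = m / x * x ^ m := by
      rcases m with _ | m
      · simp
      · rw [Nat.add_sub_cancel, pow_succ]; field_simp
    simp only [id_eq, Nat.add_sub_cancel, Pi.mul_apply, Pi.pow_apply]
    rw [h2]
    have : (1 + x) ≠ 0 := by positivity
    field_simp
    ring
  refine ⟨_, ⟨fun x hx => (hd x hx.1).continuousAt.continuousWithinAt, ?_, ?_, fun x hx =>
    hd x hx.1.le⟩, fun x hx => div_pos ?_ (hw x hx.1.le)⟩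
  · simp only [primitive_self, zero_div]
  · rw [A.primitive_right, mul_comm, mul_div_assoc, div_self (hw a A.2.1.le).ne', mul_one]
  · have h0 : StrictMonoOn (primitive m k a b s) (Icc s x) := by
      refine strictMonoOn_of_deriv_pos (convex_Icc _ _)
        (fun y _ => (hasDerivAt_primitive y).continuousAt.continuousWithinAt) fun y hy => ?_
      rw [interior_Icc] at hy
      rw [(hasDerivAt_primitive y).deriv]
      refine mul_pos (A.weight_pos hy.1) ?_
      have h3 : 0 < muS m (k + 1) a b s := by
        by_contra! h4
        have : (0 : ℝ) ≤ (k + 1 : ℕ) := by positivity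
        nlinarith [hs.1]
      nlinarith [hy.1]
    have := h0 (left_mem_Icc.2 hx.1.le) (right_mem_Icc.2 hx.1.le) hx.1
    rwa [primitive_self] at this

lemma slopeSign_nonneg_of_solution (hs : s ∈ Ico 0 a) {ψ : ℝ → ℝ}
    (hψ : SolvesODE m (k + 1) a b s ψ) (hpos : ∀ x ∈ Ioc s a, 0 < ψ x) :
    0 ≤ slopeSign m (k + 1) a b s := by
  by_contra! hF
  have A := admissible_of_mem (m := m) hs
  have hmu : muS m (k + 1) a b s * (1 + s) < (k + 1 : ℕ) := by
    rw [A.slopeSign_eq] at hF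
    by_contra! h
    exact absurd hF (not_lt.2 (mul_nonneg (A.integralI_pos A.2.1).le (sub_nonneg.2 h)))
  have hev : ∀ᶠ x in 𝓝 s, muS m (k + 1) a b s * (1 + x) < (k + 1 : ℕ) :=
    ContinuousAt.eventually_lt (by fun_prop) (by fun_prop) hmu
  obtain ⟨ε, hε, hball⟩ := Metric.eventually_nhds_iff.1 hev
  obtain ⟨t, ht1, ht2⟩ : ∃ t, s < t ∧ t < min (s + ε) a :=
    exists_between (lt_min (by linarith) hs.2)
  rw [lt_min_iff] at ht2
  have h1 : StrictAntiOn (fun x => ψ x * ((1 + x) ^ (k + 1) * x ^ m)) (Icc s t) := by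
    refine strictAntiOn_of_deriv_neg (convex_Icc _ _) ?_ fun x hx => ?_
    · exact (hψ.1.mono (Icc_subset_Icc_right ht2.2.le)).mul (by fun_prop)
    · rw [interior_Icc] at hx
      have hx0 : 0 < x := hs.1.trans_lt hx.1
      have h2 := (((hasDerivAt_id x).const_add 1).pow (k + 1)).mul ((hasDerivAt_id x).pow m)
      have h3 : HasDerivAt (fun x => ψ x * ((1 + x) ^ (k + 1) * x ^ m))
          ((1 + x) ^ k * x ^ m * (muS m (k + 1) a b s * (1 + x) - (k + 1 : ℕ))) x := by
        refine ((hψ.2.2.2 x ⟨hx.1, hx.2.trans ht2.2⟩).mul h2).congr_deriv ?_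
        have h4 : (m : ℝ) * x ^ (m - 1) * 1 = m / x * x ^ m := by
          rcases m with _ | m
          · simp
          · rw [Nat.add_sub_cancel, pow_succ]; field_simp
        simp only [id_eq, Nat.add_sub_cancel, Pi.mul_apply, Pi.pow_apply]
        rw [h4]
        have : (1 + x) ≠ 0 := by positivity
        field_simp
        ring
      rw [h3.deriv]
      refine mul_neg_of_pos_of_neg (A.weight_pos hx.1) (sub_neg.2 (hball ?_))
      rw [Real.dist_eq, abs_of_pos (sub_pos.2 hx.1)]
      linarith [hx.2]
  have h2 := h1 (left_mem_Icc.2 ht1.le) (right_mem_Icc.2 ht1.le) ht1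
  simp only [hψ.2.1, zero_mul] at h2
  exact absurd h2 (not_lt.2 (mul_pos (hpos t ⟨ht1, ht2.2.le⟩) (A.weight_pos ht1)).le)

lemma lam_eq (hb : 0 < b) {s₀ : ℝ} (h₀ : s₀ ∈ Ico 0 a)
    (hz : slopeSign m (k + 1) a b s₀ = 0) : lam m (k + 1) a b = s₀ := by
  have ha : 0 < a := h₀.1.trans_lt h₀.2
  have hsub : Ioo s₀ a ⊆ {s | s ∈ Ico 0 a ∧
      ∃ ψ : ℝ → ℝ, SolvesODE m (k + 1) a b s ψ ∧ ∀ x ∈ Ioc s a, 0 < ψ x} := fun s hs =>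
    ⟨⟨h₀.1.trans hs.1.le, hs.2⟩, exists_solution ha ⟨h₀.1.trans_lt hs.1, hs.2⟩
      (hz ▸ slopeSign_lt hb h₀.1 hs.1 hs.2)⟩
  have hlow : ∀ s ∈ {s | s ∈ Ico 0 a ∧
      ∃ ψ : ℝ → ℝ, SolvesODE m (k + 1) a b s ψ ∧ ∀ x ∈ Ioc s a, 0 < ψ x}, s₀ ≤ s := by
    rintro s ⟨hs, ψ, hψ, hpos⟩
    by_contra! hlt
    have h1 := slopeSign_lt (m := m) (k := k) hb hs.1 hlt h₀.2
    rw [hz] at h1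
    exact absurd h1 (not_lt.2 (slopeSign_nonneg_of_solution hs hψ hpos))
  refine le_antisymm ?_ (le_csInf ((nonempty_Ioo.2 h₀.2).mono hsub) hlow)
  rw [← csInf_Ioo h₀.2]
  exact csInf_le_csInf ⟨s₀, hlow⟩ (nonempty_Ioo.2 h₀.2) hsub

lemma exists_slopeSign_eq_zero (ha : 0 < a) (hb : 0 < b) (hmu : muS m (k + 1) a b 0 ≤ (k + 1 : ℕ)) :
    ∃ s₀ ∈ Ico 0 a, slopeSign m (k + 1) a b s₀ = 0 := by
  have A := admissible_of_mem (m := m) (left_mem_Ico.2 ha)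
  have h1 : slopeSign m (k + 1) a b 0 ≤ 0 := by
    rw [A.slopeSign_eq]
    exact mul_nonpos_of_nonneg_of_nonpos (A.integralI_pos ha).le (by linarith)
  have h2 : 0 < slopeSign m (k + 1) a b a := by
    simp only [slopeSign, slopeNum, integralI, intervalIntegral.integral_same]
    simp only [mul_zero, add_zero, sub_zero]
    positivity
  obtain ⟨s₀, hs, hz⟩ := intermediate_value_Icc ha.le
    (f := slopeSign m (k + 1) a b) (fun x _ => (hasDerivAt_slopeSign x).continuousAt.continuousWithinAt)
    ⟨h1, h2.le⟩
  refine ⟨s₀, ⟨hs.1, lt_of_le_of_ne hs.2 ?_⟩, hz⟩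
  rintro rfl
  exact h2.ne' hz

/-- The derivative of the reference volumes. -/
lemma hasDerivAt_volume (m n : ℕ) (a b s : ℝ) :
    HasDerivAt (fun t => ∫ x in s..(a + t * b), (1 + t + x) ^ n * x ^ m) (slopeNum m n a b s) 0 := by
  have e : ∀ t, ∫ x in s..(a + t * b), (1 + t + x) ^ n * x ^ m =
      ∑ j ∈ Finset.range (n + 1), integralI m j s (a + t * b) * (t ^ (n - j) * n.choose j) := by
    intro t
    simp only [integralI, ← intervalIntegral.integral_mul_const]
    rw [← intervalIntegral.integral_finsetSum fun j _ =>
      Continuous.intervalIntegrable (by fun_prop) _ _]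
    refine intervalIntegral.integral_congr fun x _ => ?_
    rw [show 1 + t + x = (1 + x) + t by ring, add_pow, Finset.sum_mul]
    exact Finset.sum_congr rfl fun j _ => by ring
  rw [funext e]
  have h1 : ∀ j, HasDerivAt (fun t : ℝ => integralI m j s (a + t * b) * (t ^ (n - j) * n.choose j))
      ((1 + a) ^ j * a ^ m * b * (0 ^ (n - j) * n.choose j) +
        integralI m j s a * (((n - j : ℕ) : ℝ) * 0 ^ (n - j - 1) * n.choose j)) 0 := by
    intro j
    have h2 : HasDerivAt (fun t : ℝ => a + t * b) b 0 := by
      simpa using ((hasDerivAt_id (0 : ℝ)).mul_const b).const_add a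
    have h3 : HasDerivAt (integralI m j s) ((1 + a) ^ j * a ^ m) (a + 0 * b) := by
      rw [zero_mul, add_zero]; exact hasDerivAt_integralI_right m j s a
    have h4 := (h3.comp 0 h2).mul ((hasDerivAt_pow (n - j) (0 : ℝ)).mul_const (n.choose j : ℝ))
    refine h4.congr_deriv ?_
    simp
  refine (HasDerivAt.fun_sum fun j _ => h1 j).congr_deriv ?_
  rw [Finset.sum_add_distrib, slopeNum]
  congr 1
  · have := add_pow (1 + a) 0 n
    rw [add_zero] at this
    rw [this, Finset.sum_mul, Finset.sum_mul]
    exact Finset.sum_congr rfl fun j _ => by ring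
  · rcases n with _ | n
    · simp
    · rw [Finset.sum_range_succ, Finset.sum_range_succ, Finset.sum_eq_zero]
      · simp [mul_comm]
      · intro j hj
        have : n + 1 - j - 1 ≠ 0 := by have := Finset.mem_range.1 hj; omega
        simp [zero_pow this]

end Slopes

end

end KahlerProj

namespace KahlerProj

noncomputable section

/-! ### Intersection numbers and slopes of the classes `α̃_s` -/

variable {n m : ℕ} {M : Type*} [TopologicalSpace M] [T2Space M] [CompactSpace M] [Nonempty M]
  [ChartedSpace (Fin n → ℂ) M] [IsManifold 𝓘(ℂ, Fin n → ℂ) ω M]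
  {L : M → Type*} [∀ x, AddCommGroup (L x)] [∀ x, Module ℂ (L x)]
  [∀ x, TopologicalSpace (L x)] [TopologicalSpace (TotalSpace ℂ L)] [FiberBundle ℂ L]
  [VectorBundle ℂ ℂ L] [ContMDiffVectorBundle ω ℂ L 𝓘(ℂ, Fin n → ℂ)]

lemma twistedClass_bundleClass (Θ : DeRham2 (Fin n) M) (a s : ℝ) :
    twistedClass (bundleClass n L m Θ a) s = refClass n L m Θ 1 a s := by
  rw [refClass, one_smul]; rfl

lemma twistedClass_zero (α : DeRham2 (Fin n ⊕ Fin (m + 1)) (ProjBundle n L m)) :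
    twistedClass α 0 = pullbackClass blowDown α := by
  rw [twistedClass, zero_smul, sub_zero]

lemma refClass_add_smul (Θ : DeRham2 (Fin n) M) (a b s t : ℝ) :
    refClass n L m Θ 1 a s + t • pullbackClass blowDown (bundleClass n L m Θ b) =
      refClass n L m Θ (1 + t) (a + t * b) s := by
  simp only [refClass, twistedClass, bundleClass]
  rw [← pullbackClass_smul contMDiff_real_blowDown, sub_add_eq_add_sub,
    ← pullbackClass_add contMDiff_real_blowDown]
  congr 2
  module

lemma factorial_div (n m : ℕ) : ((n + m + 1).factorial : ℝ) / (n.factorial * m.factorial) =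
    (m + n + 1) * (m + n).choose n := by
  have h : ((m + n).choose n * m.factorial * n.factorial : ℝ) = (m + n).factorial := by
    exact_mod_cast Nat.add_choose_mul_factorial_mul_factorial m n
  rw [Nat.factorial_succ, add_comm n m]
  push_cast
  rw [← h]
  have h1 : (n.factorial : ℝ) ≠ 0 := by exact_mod_cast n.factorial_ne_zero
  have h2 : (m.factorial : ℝ) ≠ 0 := by exact_mod_cast m.factorial_ne_zero
  field_simp

variable {h : HermitianMetric (ι := Fin n) L} {θ : RealForm (Fin n) M 2} {a b s : ℝ}

lemma topSelfIntersection_twistedClass (hK : IsKahlerForm θ)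
    (hθ : ∀ x₀ x, x ∈ (trivializationAt ℂ L x₀).baseSet →
      HasPotential θ x fun x => Real.log (h.frameNorm x₀ x)) (hs : Admissible m a s) :
    topSelfIntersection (twistedClass (bundleClass n L m (deRhamClass θ) a) s) =
      topSelfIntersection (deRhamClass θ) * (m + n + 1) * (m + n).choose n * integralI m n s a := by
  rw [twistedClass_bundleClass, topSelfIntersection_refClass h hK hθ hs.2.1.le fun x hx =>
    mul_nonneg (pow_nonneg (by linarith [hs.1, hx.1]) n) (hs.pow_nonneg hx.1), factorial_div,
    integralI]
  ring

lemma topIntersection_twistedClass (hK : IsKahlerForm θ)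
    (hθ : ∀ x₀ x, x ∈ (trivializationAt ℂ L x₀).baseSet →
      HasPotential θ x fun x => Real.log (h.frameNorm x₀ x)) (hs : Admissible m a s) :
    topIntersection (Sum.inr 0) (twistedClass (bundleClass n L m (deRhamClass θ) a) s)
      (pullbackClass blowDown (bundleClass n L m (deRhamClass θ) b)) =
      topSelfIntersection (deRhamClass θ) * (m + n).choose n * slopeNum m n a b s := by
  have h1 := hasDerivAt_topSelfIntersection (Sum.inr 0 : Fin n ⊕ Fin (m + 1))
    (refClass n L m (deRhamClass θ) 1 a s)
    (pullbackClass blowDown (bundleClass n L m (deRhamClass θ) b))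
  have h2 : (fun t : ℝ => topSelfIntersection (refClass n L m (deRhamClass θ) 1 a s +
      t • pullbackClass blowDown (bundleClass n L m (deRhamClass θ) b))) =ᶠ[𝓝 0] fun t =>
      (m + n + 1) * (m + n).choose n * (∫ x in s..(a + t * b), (1 + t + x) ^ n * x ^ m) *
        topSelfIntersection (deRhamClass θ) := by
    have e1 : ∀ᶠ t : ℝ in 𝓝 0, s < a + t * b :=
      ContinuousAt.eventually_lt (by fun_prop) (by fun_prop) (by simpa using hs.2.1)
    have e2 : ∀ᶠ t : ℝ in 𝓝 0, 0 < 1 + t + s :=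
      ContinuousAt.eventually_lt (by fun_prop) (by fun_prop) (by linarith [hs.1])
    filter_upwards [e1, e2] with t h1 h2
    rw [refClass_add_smul, topSelfIntersection_refClass h hK hθ h1.le fun x hx =>
      mul_nonneg (pow_nonneg (by linarith [hx.1]) n) (hs.pow_nonneg hx.1), factorial_div]
  have h3 := ((hasDerivAt_volume m n a b s).const_mul
    ((m + n + 1) * (m + n).choose n : ℝ)).mul_const (topSelfIntersection (deRhamClass θ))
  have h4 := h1.unique (h3.congr_of_eventuallyEq h2)
  rw [Fintype.card_sum, Fintype.card_fin, Fintype.card_fin] at h4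
  push_cast at h4
  rw [twistedClass_bundleClass]
  have h5 : (m + n + 1 : ℝ) ≠ 0 := by positivity
  refine mul_left_cancel₀ h5 ?_
  linear_combination h4

lemma jSlope_twistedClass (hK : IsKahlerForm θ)
    (hθ : ∀ x₀ x, x ∈ (trivializationAt ℂ L x₀).baseSet →
      HasPotential θ x fun x => Real.log (h.frameNorm x₀ x)) (hs : Admissible m a s) :
    muS m n a b s = jSlope (twistedClass (bundleClass n L m (deRhamClass θ) a) s)
      (pullbackClass blowDown (bundleClass n L m (deRhamClass θ) b)) := by
  have hd := IsKahlerClass.topSelfIntersection_pos ⟨θ, hK, rfl⟩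
  have hI := hs.integralI_pos (n := n) hs.2.1
  have hc : (0 : ℝ) < (m + n).choose n := by exact_mod_cast Nat.choose_pos (by omega)
  rw [jSlope, topSelfIntersection_twistedClass hK hθ hs, topIntersection_twistedClass hK hθ hs]
  change slopeNum m n a b s / _ = _
  have h5 : (m + n + 1 : ℝ) ≠ 0 := by positivity
  field_simp

lemma admissible_of_isKahlerClass (hn : 0 < n) (ha : 0 < a) (hK : IsKahlerForm θ)
    (hθ : ∀ x₀ x, x ∈ (trivializationAt ℂ L x₀).baseSet →
      HasPotential θ x fun x => Real.log (h.frameNorm x₀ x))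
    (hs : IsKahlerClass (twistedClass (bundleClass n L m (deRhamClass θ) a) s)) :
    Admissible m a s := by
  rw [twistedClass_bundleClass] at hs
  refine ⟨neg_one_lt_of_isKahlerClass h hn hK hθ hs, ?_, ?_⟩
  · by_contra! hle
    have : Nonempty (BlowUp n L m) := ‹Nonempty M›.map fun x => blowPointOf n x x 0 false 0
    exact absurd hs.topSelfIntersection_pos
      (not_lt.2 (topSelfIntersection_refClass_nonpos h hK hθ hle ha.le zero_le_one))
  · rcases m with _ | m
    · exact Or.inr rfl
    · exact Or.inl (pos_of_isKahlerClass h hθ hs).le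

/-- The slopes of the ample classes, when `μ_s` has its minimum at `s₀ ∈ [0, a)`. -/
lemma isGLB_ampleSlopes (hn : 0 < n) (ha : 0 < a) (hK : IsKahlerForm θ)
    (hθ : ∀ x₀ x, x ∈ (trivializationAt ℂ L x₀).baseSet →
      HasPotential θ x fun x => Real.log (h.frameNorm x₀ x)) {s₀ : ℝ} (h₀ : s₀ ∈ Ico 0 a)
    (hmin : ∀ s, Admissible m a s → muS m n a b s₀ ≤ muS m n a b s) :
    (ampleSlopes (bundleClass n L m (deRhamClass θ) a)
      (bundleClass n L m (deRhamClass θ) b)).Nonempty ∧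
    IsGLB (ampleSlopes (bundleClass n L m (deRhamClass θ) a)
      (bundleClass n L m (deRhamClass θ) b)) (muS m n a b s₀) := by
  have hmem : ∀ s, 0 < s → s < a → muS m n a b s ∈ ampleSlopes
      (bundleClass n L m (deRhamClass θ) a) (bundleClass n L m (deRhamClass θ) b) :=
    fun s hs hsa => ⟨s, twistedClass_bundleClass (m := m) (L := L) (deRhamClass θ) a s ▸
      isKahlerClass_refClass h hK hθ hs hsa,
      jSlope_twistedClass hK hθ (admissible_of_mem ⟨hs.le, hsa⟩)⟩
  refine ⟨⟨_, hmem (a / 2) (by linarith) (by linarith)⟩, ?_, fun c hc => ?_⟩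
  · rintro _ ⟨s, hs, rfl⟩
    have A := admissible_of_isKahlerClass hn ha hK hθ hs
    rw [← jSlope_twistedClass hK hθ A]
    exact hmin s A
  · have hcont : ContinuousAt (muS m n a b) s₀ :=
      (((hasDerivAt_integralI_left m (n - 1) s₀ a).continuousAt.const_mul _).const_add _).div
        (hasDerivAt_integralI_left m n s₀ a).continuousAt
        ((admissible_of_mem h₀).integralI_pos h₀.2).ne'
    refine ge_of_tendsto (hcont.tendsto.mono_left (nhdsWithin_le_nhds (s := Ioi s₀))) ?_
    filter_upwards [Ioo_mem_nhdsGT h₀.2] with s hs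
    exact hc (hmem s (h₀.1.trans_lt hs.1) hs.2)

end

end KahlerProj

theorem mainTheorem7 (n m : ℕ)
    {M : Type*} [TopologicalSpace M] [T2Space M] [CompactSpace M] [Nonempty M]
    [ChartedSpace (Fin n → ℂ) M] [IsManifold 𝓘(ℂ, Fin n → ℂ) ω M]
    (L : M → Type*) [∀ x, AddCommGroup (L x)] [∀ x, Module ℂ (L x)]
    [∀ x, TopologicalSpace (L x)] [TopologicalSpace (TotalSpace ℂ L)] [FiberBundle ℂ L]
    [VectorBundle ℂ ℂ L] [ContMDiffVectorBundle ω ℂ L 𝓘(ℂ, Fin n → ℂ)]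
    (hL : IsNegativeLineBundle (Fin n) L)
    (ωM : RealForm (Fin n) M 2) (hωM : IsKahlerForm ωM)
    (hclass : deRhamClass ωM = -chernClass (Fin n) L)
    (a b : ℝ) (ha : 0 < a) (hb : 0 < b)
    (α β : DeRham2 (Fin n ⊕ Fin (m + 1)) (ProjBundle n L m))
    (hα : α = bundleClass n L m (deRhamClass ωM) a)
    (hβ : β = bundleClass n L m (deRhamClass ωM) b) :
    (∀ s ∈ Set.Ico 0 a,
      topSelfIntersection (twistedClass α s) =
        topSelfIntersection (deRhamClass ωM) * (m + n + 1) * (m + n).choose n *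
          integralI m n s a ∧
      topIntersection (Sum.inr 0) (twistedClass α s) (pullbackClass blowDown β) =
        topSelfIntersection (deRhamClass ωM) * (m + n).choose n *
          ((1 + a) ^ n * a ^ m * b + n * integralI m (n - 1) s a) ∧
      0 < topSelfIntersection (twistedClass α s) ∧
      muS m n a b s = jSlope (twistedClass α s) (pullbackClass blowDown β)) ∧
    (0 < topSelfIntersection α ∧ muS m n a b 0 = jSlope α β) ∧
    (muS m n a b 0 ≤ n →
      (ampleSlopes α β).Nonempty ∧ BddBelow (ampleSlopes α β) ∧
      lam m n a b ∈ Set.Ico 0 a ∧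
      (∀ s ∈ Set.Ico 0 a,
        zetaInv α β = jSlope (twistedClass α s) (pullbackClass blowDown β) ↔ s = lam m n a b) ∧
      (muS m n a b 0 = n → lam m n a b = 0)) := by
  obtain ⟨h, θ, hK, hθc, hθ⟩ := hL.exists_form
  rw [hclass, ← hθc] at hα hβ ⊢
  subst hα hβ
  have hd := IsKahlerClass.topSelfIntersection_pos ⟨θ, hK, rfl⟩
  have hc : (0 : ℝ) < (m + n).choose n := by exact_mod_cast Nat.choose_pos (by omega)
  have hpos : ∀ s ∈ Set.Ico 0 a,
      0 < topSelfIntersection (twistedClass (bundleClass n L m (deRhamClass θ) a) s) := by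
    intro s hs
    have A := admissible_of_mem (m := m) hs
    have hI := A.integralI_pos (n := n) A.2.1
    rw [topSelfIntersection_twistedClass hK hθ A]
    positivity
  have h0 : (0 : ℝ) ∈ Set.Ico 0 a := ⟨le_rfl, ha⟩
  refine ⟨fun s hs => ⟨topSelfIntersection_twistedClass hK hθ (admissible_of_mem hs),
    topIntersection_twistedClass hK hθ (admissible_of_mem hs), hpos s hs,
    jSlope_twistedClass hK hθ (admissible_of_mem hs)⟩, ⟨?_, ?_⟩, fun hmu => ?_⟩
  · have h1 := hpos 0 h0
    rwa [twistedClass_zero, topSelfIntersection, intersectionNumber_pullback_blowDown] at h1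
  · rw [jSlope_twistedClass hK hθ (admissible_of_mem h0), twistedClass_zero,
      jSlope_pullback_blowDown]
  · rcases n with _ | k
    · have A := admissible_of_mem (m := m) h0
      have h1 : 0 < muS m 0 a b 0 := div_pos (A.slopeNum_pos hb) (A.integralI_pos ha)
      exact absurd hmu (not_le.2 (by simpa using h1))
    · obtain ⟨s₀, hs₀, hz⟩ := exists_slopeSign_eq_zero ha hb hmu
      have hmin := fun s hs => muS_lt_of_slopeSign_eq_zero (m := m) (k := k) (s := s) hs₀ hz hs
      obtain ⟨hne, hglb⟩ := isGLB_ampleSlopes (b := b) k.succ_pos ha hK hθ hs₀ fun s hs => by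
        rcases eq_or_ne s s₀ with rfl | hss
        · exact le_rfl
        · exact (hmin s hs hss).le
      rw [lam_eq hb hs₀ hz]
      refine ⟨hne, ⟨_, hglb.1⟩, hs₀, fun s hs => ?_, fun heq => ?_⟩
      · rw [zetaInv, hglb.csInf_eq hne, ← jSlope_twistedClass hK hθ (admissible_of_mem hs)]
        refine ⟨fun he => ?_, fun he => by rw [he]⟩
        by_contra hss
        exact (hmin s (admissible_of_mem hs) hss).ne he
      · have h1 : slopeSign m (k + 1) a b 0 = 0 := by
          rw [(admissible_of_mem h0).slopeSign_eq, heq]; ring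
        rw [← lam_eq hb hs₀ hz, lam_eq hb h0 h1]
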